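/- **Setup.** Let $T,\varepsilon>0$. On $N=\mathbb{R}/T\mathbb{Z}\times\mathbb{R}/\mathbb{Z}\times(-\varepsilon,\varepsilon)$ with coordinates $(z,x,y)$ let $\lambda=h(x,y,z)\,(dz-y\,dx)$ be a contact form, where $h>0$ is smooth with $h=1$ and $dh=0$ on $\{y=0\}$ (so $\{y=0\}$ is foliated by the Reeb orbits $x=\mathrm{const}$ of period $T$). Assume that $\{y=0\}$ is a Morse–Bott torus: for each of these orbits, every vector fixed by the linearized time-$T$ Reeb flow is tangent to $\{y=0\}$. On the symplectization $M=\mathbb{R}_a\times N$ use the flat metric $da^2+dz^2+dx^2+dy^2$. A $\lambda$-compatible almost complex structure $J$ is a smooth, $a$-invariant $J$ with $J^2=-1$ that sends $\partial_a$ to the Reeb vector field, preserves $\xi=\ker\lambda\subset TN$, and for which $d\lambda(\cdot,J\cdot)$ is positive and $d\lambda$ is $J$-invariant on $\xi$. Let $f:\mathbb{R}/\mathbb{Z}\to\mathbb{R}$ be a smooth Morse function whose only critical points are a minimum at $0$ and a maximum at $1/2$; let $g:\mathbb{R}\to\mathbb{R}$ be smooth with $g=1$ on $[-\varepsilon',\varepsilon']$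 and $g=0$ outside $[-2\varepsilon',2\varepsilon']$ for some $\varepsilon'>0$ with $2\varepsilon'<\varepsilon$; and for $\delta>0$ let $\lambda_\delta=e^{\delta g(y)f(x)}\lambda$. Let $J$ be $\lambda$-compatible with $J\partial_x=\partial_y$ on $\{y=0\}$, and let $J_\delta$ be $\lambda_\delta$-compatible with $J_\delta|_\xi=J|_\xi$. A gradient trajectory $x'(s)=\delta f'(x(s))$ lifts to the $J_\delta$-holomorphic cylinder $$v_\delta:\mathbb{R}\times\mathbb{R}/T\mathbb{Z}\to M,\qquad v_\delta(s,t)=(a(s),\,t+c,\,x(s),\,0),\qquad a'=e^{\delta f(x)},\ a(0)=0,$$ in the coordinates $(a,z,x,y)$, with $c\in\mathbb{R}$. Let $$D_{J_\delta}\eta=\partial_s\eta+J_\delta(v_\delta)\,\partial_t\eta+(\nabla_\eta J_\delta)(v_\delta)\,\partial_t v_\delta$$ be the linearization of $\bar\partial_{J_\delta}u=\partial_su+J_\delta(u)\partial_tu$ at $v_\delta$ with respect to the flat metric. For $d\in\mathbb{R}$ let $W^{k,p,d}(v_\delta^*TM)$ be the Sobolev space with exponential weight $e^{ds}$, i.e.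 the space of sections $\eta$ with weak derivatives up to order $k$ and finite norm $$\|\eta\|=\Big(\sum_{i+j\le k}\|e^{ds}\,\partial_s^i\partial_t^j\eta\|_{L^p}^p\Big)^{1/p}.$$ **Proposition.** There is $d_0>0$, depending only on the Morse–Bott torus (on $T,\varepsilon,h$), such that for all $f,g,J$ as above, all $1<p<\infty$ and all $d$ with $0<|d|<d_0$ there are $\delta_0>0$ and $C>0$ with the following property. For every $0<\delta<\delta_0$, every $J_\delta$ as above and every lift $v_\delta$ of a gradient trajectory of $\delta f$, $$D_{J_\delta}:W^{2,p,d}(v_\delta^*TM)\longrightarrow W^{1,p,d}(v_\delta^*TM)$$ is a well-defined bounded operator which is Fredholm of index $0$ and an isomorphism, and its two-sided inverse $Q_\delta$ satisfies $\|Q_\delta\|\le C$. -/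

import Mathlib

open MeasureTheory Set
open scoped ENNReal ContDiff

noncomputable section

namespace MorseBottTorus

/-! ### Contact geometry near a Morse-Bott torus

The symplectization of the coordinate neighbourhood is covered by `ℝ⁴` with coordinates
`(a, z, x, y)` (indices `0, 1, 2, 3`); objects on
`ℝ × (ℝ/Tℤ) × (ℝ/ℤ) × (-ε, ε)` are objects on `|y| < ε` that are `T`-periodic in `z` and
`1`-periodic in `x`. The Euclidean inner product of `ℝ⁴` is the metric
`g = da² + dz² + dx² + dy²`. -/

/-- `ℝ⁴` with the flat metric and coordinates `(a, z, x, y)`. -/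
abbrev E4 : Type := EuclideanSpace ℝ (Fin 4)

/-- Coordinate vector fields. -/
def dirA : E4 := EuclideanSpace.single 0 1
/-- The vector `∂_z`. -/
def dirZ : E4 := EuclideanSpace.single 1 1
/-- The vector `∂_x`. -/
def dirX : E4 := EuclideanSpace.single 2 1
/-- The vector `∂_y`. -/
def dirY : E4 := EuclideanSpace.single 3 1

/-- The coordinate neighbourhood `{|y| < ε}`. -/
def nbhd (ε : ℝ) : Set E4 := {q | |q 3| < ε}

/-- The coordinate one-form `dq_i`. -/
def coordForm (i : Fin 4) : E4 →L[ℝ] ℝ := EuclideanSpace.proj i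

/-- The standard contact form `λ₀ = dz - y dx`. -/
def stdForm (q : E4) : E4 →L[ℝ] ℝ := coordForm 1 - q 3 • coordForm 2

/-- The one-form `λ = h(x, y, z) (dz - y dx)`; the argument of `h` is `(x, y, z)`. -/
def contactForm (h : ℝ × ℝ × ℝ → ℝ) (q : E4) : E4 →L[ℝ] ℝ :=
  h (q 2, q 3, q 1) • stdForm q

/-- The perturbed one-form `λ_δ = e^{δ g(y) f(x)} λ`. -/
def perturbedForm (h : ℝ × ℝ × ℝ → ℝ) (f g : ℝ → ℝ) (δ : ℝ) (q : E4) : E4 →L[ℝ] ℝ :=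
  Real.exp (δ * g (q 3) * f (q 2)) • contactForm h q

/-- The exterior derivative of a one-form: `dα(v, w) = (D_v α)(w) - (D_w α)(v)`. -/
def extDer (α : E4 → E4 →L[ℝ] ℝ) (q v w : E4) : ℝ :=
  fderiv ℝ α q v w - fderiv ℝ α q w v

/-- `v` is the value at `q` of the Reeb vector field of the contact form `α` on `Y`
(a vector of the symplectization with no `∂_a` component). -/
def IsReebVector (α : E4 → E4 →L[ℝ] ℝ) (q v : E4) : Prop :=
  v 0 = 0 ∧ α q v = 1 ∧ ∀ w, extDer α q v w = 0

/-- The contact distribution `ξ = ker α ⊆ TY` at `q`, as a subspace of `T(ℝ × Y)`. -/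
def InContactPlane (α : E4 → E4 →L[ℝ] ℝ) (q w : E4) : Prop :=
  w 0 = 0 ∧ α q w = 0

/-- Normal form `λ = h (dz - y dx)` of a Morse-Bott contact form around a Morse-Bott torus
`{y = 0}` foliated by Reeb orbits `{x = const}` of minimal period `T`. The last field is the
Morse-Bott condition: for each Reeb orbit of the torus, a fixed vector of the linearized
time-`T` Reeb flow is tangent to the torus. -/
structure IsMorseBottNormalForm (T ε : ℝ) (h : ℝ × ℝ × ℝ → ℝ) : Prop where
  smooth : ContDiffOn ℝ ∞ h {r | |r.2.1| < ε}
  periodic_x : ∀ x y z, h (x + 1, y, z) = h (x, y, z)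
  periodic_z : ∀ x y z, h (x, y, z + T) = h (x, y, z)
  pos : ∀ x y z, |y| < ε → 0 < h (x, y, z)
  eq_one : ∀ x z, h (x, 0, z) = 1
  deriv_eq_zero : ∀ x z, fderiv ℝ h (x, 0, z) = 0
  morseBott : ∃ R : E4 → E4,
    (∀ q ∈ nbhd ε, IsReebVector (contactForm h) q (R q)) ∧
    ∀ (x : ℝ) (w : ℝ → E4), (∀ t, w t 0 = 0) →
      (∀ t, HasDerivAt w (fderiv ℝ R (t • dirZ + x • dirX) (w t)) t) →
      w T = w 0 → w 0 3 = 0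

/-- `f` is a smooth Morse function on `ℝ/ℤ` whose only critical points are a minimum at `0`
and a maximum at `1/2`. -/
structure IsMorseOnCircle (f : ℝ → ℝ) : Prop where
  smooth : ContDiff ℝ ∞ f
  periodic : ∀ x, f (x + 1) = f x
  critical : ∀ x, deriv f x = 0 ↔ ∃ n : ℤ, x = n ∨ x = n + 1 / 2
  min_nondegenerate : 0 < deriv (deriv f) 0
  max_nondegenerate : deriv (deriv f) (1 / 2) < 0

/-- `g` is a bump function equal to `1` on `[-ε', ε']` and to `0` outside `[-2ε', 2ε']`, for
some `ε'` so small that the latter interval lies in the coordinate neighbourhood. -/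
def IsBump (ε : ℝ) (g : ℝ → ℝ) : Prop :=
  ContDiff ℝ ∞ g ∧ ∃ ε' > 0, 2 * ε' < ε ∧
    (∀ y, |y| ≤ ε' → g y = 1) ∧ ∀ y, 2 * ε' ≤ |y| → g y = 0

/-- `J` is an `α`-compatible almost complex structure on the symplectization of the
coordinate neighbourhood: it is smooth, invariant under translation in `a`, squares to `-1`,
sends `∂_a` to the Reeb vector field of `α`, preserves the contact distribution, and is
compatible there with `dα`. -/
structure IsCompatibleACS (T ε : ℝ) (α : E4 → E4 →L[ℝ] ℝ) (J : E4 → E4 →L[ℝ] E4) :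
    Prop where
  smooth : ContDiffOn ℝ ∞ J (nbhd ε)
  periodic_z : ∀ q ∈ nbhd ε, J (q + T • dirZ) = J q
  periodic_x : ∀ q ∈ nbhd ε, J (q + dirX) = J q
  invariant : ∀ q ∈ nbhd ε, ∀ c : ℝ, J (q + c • dirA) = J q
  sq : ∀ q ∈ nbhd ε, ∀ w, J q (J q w) = -w
  reeb : ∀ q ∈ nbhd ε, IsReebVector α q (J q dirA)
  maps_plane : ∀ q ∈ nbhd ε, ∀ w, InContactPlane α q w → InContactPlane α q (J q w)
  pos : ∀ q ∈ nbhd ε, ∀ w, InContactPlane α q w → w ≠ 0 → 0 < extDer α q w (J q w)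
  symplectic : ∀ q ∈ nbhd ε, ∀ w w', InContactPlane α q w → InContactPlane α q w' →
    extDer α q (J q w) (J q w') = extDer α q w w'

/-- `v(s, t) = (a(s), t + c, x(s), 0)` is the lift of the gradient trajectory `x` of `δ f`:
`x' = δ f'(x)`, `a' = e^{δ f(x)}`, `a(0) = 0`. -/
def IsGradientCylinder (f : ℝ → ℝ) (δ : ℝ) (v : ℝ → ℝ → E4) : Prop :=
  ∃ (a x : ℝ → ℝ) (c : ℝ),
    (∀ s, HasDerivAt a (Real.exp (δ * f (x s))) s) ∧ a 0 = 0 ∧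
    (∀ s, HasDerivAt x (δ * deriv f (x s)) s) ∧
    ∀ s t, v s t = !₂[a s, t + c, x s, 0]

/-! ### Weighted Sobolev spaces of sections of `v^*TM` over the cylinder `ℝ × ℝ/Tℤ`

The bundle `v^*TM` is trivialized by the coordinate vector fields, which are orthonormal and
parallel, so sections are `E4`-valued. Functions on the cylinder are identified
(up to null sets) with functions on the fundamental domain `ℝ × (0, T]`. -/

/-- The area measure `ds dt` on the fundamental domain of the cylinder. -/
def cylMeasure (T : ℝ) : Measure (ℝ × ℝ) := volume.restrict (univ ×ˢ Ioc 0 T)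

/-- The measure `e^{p d s} ds dt`: its `L^p` norm is `‖e^{ds} η‖_{L^p(ds dt)}`. -/
def weightedMeasure (T : ℝ) (p : ℝ≥0∞) (d : ℝ) : Measure (ℝ × ℝ) :=
  (cylMeasure T).withDensity fun q => ENNReal.ofReal (Real.exp (p.toReal * d * q.1))

/-- Smooth functions on the cylinder with compact support. -/
def IsTestFunction (T : ℝ) (ψ : ℝ × ℝ → ℝ) : Prop :=
  ContDiff ℝ ∞ ψ ∧ (∀ s t, ψ (s, t + T) = ψ (s, t)) ∧ ∃ K : ℝ, ∀ s t, K < |s| → ψ (s, t) = 0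

/-- `w` is the weak derivative of `u` on the cylinder in the constant direction `e`. -/
def IsWeakDeriv (T : ℝ) (e : ℝ × ℝ) (u w : ℝ × ℝ → E4) : Prop :=
  ∀ ψ, IsTestFunction T ψ →
    ∫ q, fderiv ℝ ψ q e • u q ∂cylMeasure T = -∫ q, ψ q • w q ∂cylMeasure T

/-- Multi-indices `(i, j)` with `i + j ≤ k`, standing for `∂_s^i ∂_t^j`. -/
abbrev MultiIdx (k : ℕ) : Type := {α : Fin (k + 1) × Fin (k + 1) // (α.1 : ℕ) + α.2 ≤ k}

/-- The multi-index `(i, j)`. -/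
abbrev mkIdx {k : ℕ} (i j : ℕ) (hij : i + j ≤ k) : MultiIdx k :=
  ⟨(⟨i, by omega⟩, ⟨j, by omega⟩), hij⟩

lemma integrable_smul (T : ℝ) (p : ℝ≥0∞) [Fact (1 ≤ p)] (d : ℝ) (φ : ℝ × ℝ → ℝ)
    (hφ : Continuous φ) (K : ℝ) (hK : ∀ s t, K < |s| → φ (s, t) = 0)
    (u : Lp E4 p (weightedMeasure T p d)) :
    Integrable (fun q => φ q • u q) (cylMeasure T) := by
  set c : ℝ := p.toReal * d with hc
  set ρ : ℝ × ℝ → ℝ≥0∞ := fun q => ENNReal.ofReal (Real.exp (c * q.1)) with hρ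
  have hexp : Continuous fun q : ℝ × ℝ => Real.exp (c * q.1) := by fun_prop
  have hρm : Measurable ρ := hexp.measurable.ennreal_ofReal
  have hμ : weightedMeasure T p d = (cylMeasure T).withDensity ρ := rfl
  set A : Set (ℝ × ℝ) := Icc (-K) K ×ˢ Icc 0 T with hA
  have hAc : IsCompact A := isCompact_Icc.prod isCompact_Icc
  have hAm : MeasurableSet A := hAc.measurableSet
  have hcyl : ∀ᵐ q ∂cylMeasure T, q.2 ∈ Icc 0 T := by
    unfold cylMeasure
    filter_upwards [ae_restrict_mem (MeasurableSet.univ.prod measurableSet_Ioc)] with q hq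
    exact Ioc_subset_Icc_self hq.2
  have hfin : weightedMeasure T p d A < ⊤ := by
    obtain ⟨M, hM⟩ := hAc.bddAbove_image hexp.continuousOn
    rw [hμ, withDensity_apply _ hAm]
    calc ∫⁻ q in A, ρ q ∂cylMeasure T ≤ ∫⁻ _ in A, ENNReal.ofReal M ∂cylMeasure T := by
          refine setLIntegral_mono measurable_const fun q hq => ?_
          exact ENNReal.ofReal_le_ofReal (hM (mem_image_of_mem _ hq))
      _ = ENNReal.ofReal M * cylMeasure T A := by simp
      _ < ⊤ := ENNReal.mul_lt_top ENNReal.ofReal_lt_top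
          ((Measure.restrict_apply_le _ _).trans_lt hAc.measure_lt_top)
  have hu : IntegrableOn (fun q => u q) A (weightedMeasure T p d) := by
    have : IsFiniteMeasure ((weightedMeasure T p d).restrict A) :=
      ⟨by rw [Measure.restrict_apply_univ]; exact hfin⟩
    exact ((Lp.memLp u).restrict A).integrable Fact.out
  set θ : ℝ × ℝ → ℝ := fun q => Real.exp (-(c * q.1)) * φ q with hθ
  have hθc : Continuous θ := by fun_prop
  obtain ⟨M, hM⟩ := hAc.exists_bound_of_continuousOn hθc.continuousOn
  have h1 : IntegrableOn (fun q => θ q • u q) A (weightedMeasure T p d) := by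
    refine Integrable.bdd_smul hu M hθc.aestronglyMeasurable ?_
    filter_upwards [ae_restrict_mem hAm] with q hq using hM q hq
  have h2 : Integrable (fun q => θ q • u q) (weightedMeasure T p d) := by
    refine ((integrable_indicator_iff hAm).2 h1).congr ?_
    filter_upwards [(withDensity_absolutelyContinuous (cylMeasure T) ρ).ae_le hcyl] with q hq
    by_cases hqA : q ∈ A
    · rw [indicator_of_mem hqA]
    · have hs : K < |q.1| := by
        by_contra hcon
        exact hqA ⟨abs_le.1 (not_lt.1 hcon), hq⟩
      have h0 : φ q = 0 := hK q.1 q.2 hs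
      rw [indicator_of_notMem hqA]
      simp [hθ, h0]
  replace h2 := (integrable_withDensity_iff_integrable_smul₀' hρm.aemeasurable
    (by simp [hρ])).1 h2
  refine h2.congr (Filter.Eventually.of_forall fun q => ?_)
  simp only [hρ, hθ]
  rw [ENNReal.toReal_ofReal (Real.exp_pos _).le, smul_smul, ← mul_assoc, ← Real.exp_add]
  simp

/-- `η` has components `η_α ∈ L^{p,d}` with `η_{(i+1, j)} = ∂_s η_{(i, j)}` and
`η_{(i, j+1)} = ∂_t η_{(i, j)}` in the weak sense. -/
def IsSobolevFamily (T : ℝ) (p : ℝ≥0∞) [Fact (1 ≤ p)] (k : ℕ) (d : ℝ)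
    (η : PiLp p fun _ : MultiIdx k => Lp E4 p (weightedMeasure T p d)) : Prop :=
  ∀ α β : MultiIdx k,
    ((β.1.1 : ℕ) = α.1.1 + 1 → (β.1.2 : ℕ) = α.1.2 → IsWeakDeriv T (1, 0) (η α) (η β)) ∧
    ((β.1.1 : ℕ) = α.1.1 → (β.1.2 : ℕ) = α.1.2 + 1 → IsWeakDeriv T (0, 1) (η α) (η β))

lemma integrable_test (T : ℝ) (p : ℝ≥0∞) [Fact (1 ≤ p)] (d : ℝ) {ψ : ℝ × ℝ → ℝ}
    (hψ : IsTestFunction T ψ) (u : Lp E4 p (weightedMeasure T p d)) :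
    Integrable (fun q => ψ q • u q) (cylMeasure T) := by
  obtain ⟨h1, -, K, hK⟩ := hψ
  exact integrable_smul T p d ψ h1.continuous K hK u

lemma integrable_fderiv_test (T : ℝ) (p : ℝ≥0∞) [Fact (1 ≤ p)] (d : ℝ) {ψ : ℝ × ℝ → ℝ}
    (hψ : IsTestFunction T ψ) (e : ℝ × ℝ) (u : Lp E4 p (weightedMeasure T p d)) :
    Integrable (fun q => fderiv ℝ ψ q e • u q) (cylMeasure T) := by
  obtain ⟨h1, -, K, hK⟩ := hψ
  refine integrable_smul T p d (fun q => fderiv ℝ ψ q e)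
    ((h1.continuous_fderiv (by simp)).clm_apply continuous_const) K (fun s t hs => ?_) u
  have hopen : IsOpen {q : ℝ × ℝ | K < |q.1|} :=
    isOpen_lt continuous_const (continuous_abs.comp continuous_fst)
  have hev : ψ =ᶠ[nhds (s, t)] fun _ => 0 := by
    filter_upwards [hopen.mem_nhds (show (s, t) ∈ {q : ℝ × ℝ | K < |q.1|} from hs)] with q hq
    exact hK q.1 q.2 hq
  simp [hev.fderiv_eq]

lemma ae_weighted_of {T : ℝ} {p : ℝ≥0∞} {d : ℝ} {P : ℝ × ℝ → Prop}
    (h : ∀ᵐ q ∂weightedMeasure T p d, P q) : ∀ᵐ q ∂cylMeasure T, P q := by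
  have hm : Measurable fun q : ℝ × ℝ =>
      ENNReal.ofReal (Real.exp (p.toReal * d * q.1)) :=
    (Continuous.measurable (by fun_prop)).ennreal_ofReal
  refine (withDensity_absolutelyContinuous' hm.aemeasurable ?_).ae_le h
  exact Filter.Eventually.of_forall fun q => by simp [Real.exp_pos]

lemma IsWeakDeriv.congr {T : ℝ} {e : ℝ × ℝ} {u u' w w' : ℝ × ℝ → E4}
    (h : IsWeakDeriv T e u w) (hu : ∀ᵐ q ∂cylMeasure T, u' q = u q)
    (hw : ∀ᵐ q ∂cylMeasure T, w' q = w q) : IsWeakDeriv T e u' w' := by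
  intro ψ hψ
  have e1 : ∫ q, fderiv ℝ ψ q e • u' q ∂cylMeasure T = ∫ q, fderiv ℝ ψ q e • u q ∂cylMeasure T :=
    integral_congr_ae (hu.mono fun q hq => by simp only [hq])
  have e2 : ∫ q, ψ q • w' q ∂cylMeasure T = ∫ q, ψ q • w q ∂cylMeasure T :=
    integral_congr_ae (hw.mono fun q hq => by simp only [hq])
  rw [e1, e2]
  exact h ψ hψ

lemma IsWeakDeriv.add {T : ℝ} {p : ℝ≥0∞} [Fact (1 ≤ p)] {d : ℝ} {e : ℝ × ℝ}
    {u u' w w' : Lp E4 p (weightedMeasure T p d)}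
    (h : IsWeakDeriv T e u w) (h' : IsWeakDeriv T e u' w') :
    IsWeakDeriv T e (u + u' : Lp E4 p (weightedMeasure T p d))
      (w + w' : Lp E4 p (weightedMeasure T p d)) := by
  have key : IsWeakDeriv T e (fun q => u q + u' q) (fun q => w q + w' q) := by
    intro ψ hψ
    simp only [smul_add]
    rw [integral_add (integrable_fderiv_test T p d hψ e u) (integrable_fderiv_test T p d hψ e u'),
      integral_add (integrable_test T p d hψ w) (integrable_test T p d hψ w'), h ψ hψ, h' ψ hψ,
      neg_add]
  exact key.congr (ae_weighted_of (Lp.coeFn_add u u')) (ae_weighted_of (Lp.coeFn_add w w'))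

lemma IsWeakDeriv.smul {T : ℝ} {p : ℝ≥0∞} [Fact (1 ≤ p)] {d : ℝ} {e : ℝ × ℝ} (c : ℝ)
    {u w : Lp E4 p (weightedMeasure T p d)} (h : IsWeakDeriv T e u w) :
    IsWeakDeriv T e (c • u : Lp E4 p (weightedMeasure T p d))
      (c • w : Lp E4 p (weightedMeasure T p d)) := by
  have key : IsWeakDeriv T e (fun q => c • u q) (fun q => c • w q) := by
    intro ψ hψ
    simp only [smul_comm _ c]
    rw [integral_smul, integral_smul, h ψ hψ, smul_neg]
  exact key.congr (ae_weighted_of (Lp.coeFn_smul c u)) (ae_weighted_of (Lp.coeFn_smul c w))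

lemma IsWeakDeriv.zero {T : ℝ} {p : ℝ≥0∞} [Fact (1 ≤ p)] {d : ℝ} {e : ℝ × ℝ} :
    IsWeakDeriv T e (0 : Lp E4 p (weightedMeasure T p d))
      (0 : Lp E4 p (weightedMeasure T p d)) := by
  have key : IsWeakDeriv T e (fun _ => 0) (fun _ => 0) := by
    intro ψ hψ
    simp
  exact key.congr (ae_weighted_of (Lp.coeFn_zero E4 p (weightedMeasure T p d)))
    (ae_weighted_of (Lp.coeFn_zero E4 p (weightedMeasure T p d)))

/-- The weighted Sobolev space `W^{k,p,d}(v^*TM)` of sections with weight `e^{ds}`: a section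
`η` is recorded together with its weak derivatives `∂_s^i ∂_t^j η`, `i + j ≤ k`, and has norm
`(∑ ‖e^{ds} ∂_s^i ∂_t^j η‖_{L^p}^p)^{1/p}`. -/
def weightedSobolev (T : ℝ) (k : ℕ) (p : ℝ≥0∞) [Fact (1 ≤ p)] (d : ℝ) :
    Submodule ℝ (PiLp p fun _ : MultiIdx k => Lp E4 p (weightedMeasure T p d)) where
  carrier := {η | IsSobolevFamily T p k d η}
  add_mem' h h' := fun α β =>
    ⟨fun h1 h2 => ((h α β).1 h1 h2).add ((h' α β).1 h1 h2),
      fun h1 h2 => ((h α β).2 h1 h2).add ((h' α β).2 h1 h2)⟩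
  zero_mem' := fun _ _ => ⟨fun _ _ => IsWeakDeriv.zero, fun _ _ => IsWeakDeriv.zero⟩
  smul_mem' c _ h := fun α β =>
    ⟨fun h1 h2 => ((h α β).1 h1 h2).smul c, fun h1 h2 => ((h α β).2 h1 h2).smul c⟩

/-- The function on the cylinder underlying the weak derivative `∂_s^i ∂_t^j η`; in particular
`partialDeriv η 0 0` is the section `η` itself. -/
def partialDeriv {T : ℝ} {k : ℕ} {p : ℝ≥0∞} [Fact (1 ≤ p)] {d : ℝ}
    (η : weightedSobolev T k p d) (i j : ℕ) (hij : i + j ≤ k) : ℝ × ℝ → E4 :=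
  (η : PiLp p fun _ : MultiIdx k => Lp E4 p (weightedMeasure T p d)) (mkIdx i j hij)

/-! ### The linearized Cauchy-Riemann operator -/

/-- The Cauchy-Riemann operator `∂̄_J(u) = ∂_s u + J(u) ∂_t u`, viewed as a section of
`u^*TM`. -/
def cauchyRiemann (J : E4 → E4 →L[ℝ] E4) (u : ℝ → ℝ → E4) (s t : ℝ) : E4 :=
  deriv (fun σ => u σ t) s + J (u s t) (deriv (fun τ => u s τ) t)

/-- The linearization of `∂̄_J` along `v` at a point `(s, t)`, applied to the one-jet
`(η, ∂_s η, ∂_t η)` of a section, for the flat metric: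
`D_J η = ∂_s η + J(v) ∂_t η + (∇_η J)(v) ∂_t v`. -/
def linearizedAt (J : E4 → E4 →L[ℝ] E4) (v : ℝ → ℝ → E4) (s t : ℝ) (η ηs ηt : E4) : E4 :=
  ηs + J (v s t) ηt + fderiv ℝ J (v s t) η (deriv (fun τ => v s τ) t)

/-- On smooth sections, `linearizedAt` is the derivative of `∂̄_J(exp_v (r η)) = ∂̄_J(v + r η)`
at `r = 0`. -/
lemma hasDerivAt_cauchyRiemann (J : E4 → E4 →L[ℝ] E4) (v η : ℝ → ℝ → E4) (s t : ℝ)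
    (hJ : DifferentiableAt ℝ J (v s t))
    (hvs : DifferentiableAt ℝ (fun σ => v σ t) s) (hvt : DifferentiableAt ℝ (fun τ => v s τ) t)
    (hηs : DifferentiableAt ℝ (fun σ => η σ t) s)
    (hηt : DifferentiableAt ℝ (fun τ => η s τ) t) :
    HasDerivAt (fun r : ℝ => cauchyRiemann J (fun σ τ => v σ τ + r • η σ τ) s t)
      (linearizedAt J v s t (η s t) (deriv (fun σ => η σ t) s) (deriv (fun τ => η s τ) t)) 0 := by
  have hval : (fun r : ℝ => cauchyRiemann J (fun σ τ => v σ τ + r • η σ τ) s t) =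
      fun r : ℝ => deriv (fun σ => v σ t) s + r • deriv (fun σ => η σ t) s +
        J (v s t + r • η s t) (deriv (fun τ => v s τ) t + r • deriv (fun τ => η s τ) t) := by
    funext r
    simp only [cauchyRiemann]
    have h1 : deriv (fun σ => v σ t + r • η σ t) s =
        deriv (fun σ => v σ t) s + r • deriv (fun σ => η σ t) s :=
      (hvs.hasDerivAt.add (hηs.hasDerivAt.const_smul r)).deriv
    have h2 : deriv (fun τ => v s τ + r • η s τ) t =
        deriv (fun τ => v s τ) t + r • deriv (fun τ => η s τ) t :=
      (hvt.hasDerivAt.add (hηt.hasDerivAt.const_smul r)).deriv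
    rw [h1, h2]
  have hline : ∀ b c : E4, HasDerivAt (fun r : ℝ => b + r • c) c 0 := fun b c => by
    simpa using ((hasDerivAt_id (0 : ℝ)).smul_const c).const_add b
  have hJ' : HasDerivAt (fun r : ℝ => J (v s t + r • η s t))
      (fderiv ℝ J (v s t) (η s t)) 0 := by
    have h0 : HasFDerivAt J (fderiv ℝ J (v s t)) (v s t + (0 : ℝ) • η s t) := by
      simpa using hJ.hasFDerivAt
    exact h0.comp_hasDerivAt (0 : ℝ) (hline (v s t) (η s t))
  rw [hval]
  refine ((hline _ _).add (hJ'.clm_apply (hline _ _))).congr_deriv ?_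
  simp only [linearizedAt, zero_smul, add_zero]
  abel

/-- `D` is the linearized operator `D_J : W^{2,p,d}(v^*TM) → W^{1,p,d}(v^*TM)`. -/
def IsLinearizedOperator {T : ℝ} {p : ℝ≥0∞} [Fact (1 ≤ p)] {d : ℝ}
    (J : E4 → E4 →L[ℝ] E4) (v : ℝ → ℝ → E4)
    (D : weightedSobolev T 2 p d →L[ℝ] weightedSobolev T 1 p d) : Prop :=
  ∀ η, ∀ᵐ q ∂cylMeasure T,
    partialDeriv (D η) 0 0 (by norm_num) q =
      linearizedAt J v q.1 q.2 (partialDeriv η 0 0 (by norm_num) q)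
        (partialDeriv η 1 0 (by norm_num) q) (partialDeriv η 0 1 (by norm_num) q)

/-- The Fredholm index `dim ker D - dim coker D`. -/
def fredholmIndex {E F : Type*} [NormedAddCommGroup E] [NormedSpace ℝ E]
    [NormedAddCommGroup F] [NormedSpace ℝ F] (D : E →L[ℝ] F) : ℤ :=
  (Module.finrank ℝ D.ker : ℤ) - (Module.finrank ℝ (F ⧸ D.range) : ℤ)

end MorseBottTorus

end

open MorseBottTorus

open MeasureTheory Set
open scoped ENNReal ContDiff

noncomputable section

namespace MorseBottTorus

/-! ### A Bellman function -/

/-- The auxiliary quantity `A^P + B^Q`. -/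
def bellW (P Q A B : ℝ) : ℝ := A ^ P + B ^ Q

/-- A Bellman function, in terms of the squared moduli `A` and `B` of its two arguments. -/
def bell (C γ P Q A B : ℝ) : ℝ := A * bellW P Q A B ^ γ + C * B ^ Q

/-- The derivative of `bell` with respect to `A`. -/
def bellA (γ P Q A B : ℝ) : ℝ :=
  bellW P Q A B ^ γ / bellW P Q A B * (bellW P Q A B + (P - 1) * A ^ P)

/-- The derivative of `bell` with respect to `B`. -/
def bellB (C γ P Q A B : ℝ) : ℝ :=
  B ^ Q / B * Q * (γ * A * (bellW P Q A B ^ γ / bellW P Q A B) + C)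

/-- The second derivative of `bell` with respect to `A`. -/
def bellAA (γ P Q A B : ℝ) : ℝ :=
  (P - 1) * (A ^ P / A) * (bellW P Q A B ^ γ / bellW P Q A B) * (1 + P - A ^ P / bellW P Q A B)

/-- The mixed second derivative of `bell`. -/
def bellAB (γ P Q A B : ℝ) : ℝ :=
  γ * Q * (B ^ Q / B) * B ^ Q * (bellW P Q A B ^ γ / bellW P Q A B ^ 2)

/-- The second derivative of `bell` with respect to `B`. -/
def bellBB (C γ P Q A B : ℝ) : ℝ :=
  Q * (B ^ Q / B ^ 2) * (A * γ * (bellW P Q A B ^ γ / bellW P Q A B) *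
    (-(1 - γ) * Q * (B ^ Q / bellW P Q A B) - (1 - Q)) - C * (1 - Q))

section Chain

variable {γ P Q : ℝ} {A B : ℝ → ℝ} {A' B' x : ℝ}

lemma bellW_pos (P Q : ℝ) {a b : ℝ} (ha : 0 < a) (hb : 0 < b) : 0 < bellW P Q a b :=
  add_pos (Real.rpow_pos_of_pos ha _) (Real.rpow_pos_of_pos hb _)

lemma HasDerivAt.rpow_div {f : ℝ → ℝ} {f' : ℝ} (r : ℝ) (hf : HasDerivAt f f' x) (h : 0 < f x) :
    HasDerivAt (fun y => f y ^ r) (r * (f x ^ r / f x) * f') x := by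
  convert hf.rpow_const (p := r) (Or.inl h.ne') using 1
  rw [Real.rpow_sub_one h.ne']
  ring

lemma hasDerivAt_bellW (hA : HasDerivAt A A' x) (hB : HasDerivAt B B' x)
    (ha : 0 < A x) (hb : 0 < B x) :
    HasDerivAt (fun y => bellW P Q (A y) (B y))
      (P * (A x ^ P / A x) * A' + Q * (B x ^ Q / B x) * B') x :=
  (HasDerivAt.rpow_div P hA ha).add (HasDerivAt.rpow_div Q hB hb)

lemma hasDerivAt_bell (C : ℝ) (hP : P * (1 - γ) = 1)
    (hA : HasDerivAt A A' x) (hB : HasDerivAt B B' x) (ha : 0 < A x) (hb : 0 < B x) :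
    HasDerivAt (fun y => bell C γ P Q (A y) (B y))
      (bellA γ P Q (A x) (B x) * A' + bellB C γ P Q (A x) (B x) * B') x := by
  have hW := hasDerivAt_bellW (P := P) (Q := Q) hA hB ha hb
  have hWp := bellW_pos P Q ha hb
  refine ((hA.mul (HasDerivAt.rpow_div γ hW hWp)).add
    ((HasDerivAt.rpow_div Q hB hb).const_mul C)).congr_deriv ?_
  simp only [bellA, bellB]
  set w := bellW P Q (A x) (B x)
  generalize w ^ γ = wg
  generalize A x ^ P = aP
  generalize B x ^ Q = bQ
  field_simp
  linear_combination -(aP * A' * B x) * wg * hP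

lemma hasDerivAt_bellA (hP : P * (1 - γ) = 1)
    (hA : HasDerivAt A A' x) (hB : HasDerivAt B B' x) (ha : 0 < A x) (hb : 0 < B x) :
    HasDerivAt (fun y => bellA γ P Q (A y) (B y))
      (bellAA γ P Q (A x) (B x) * A' + bellAB γ P Q (A x) (B x) * B') x := by
  have hW := hasDerivAt_bellW (P := P) (Q := Q) hA hB ha hb
  have hWp := bellW_pos P Q ha hb
  refine (((HasDerivAt.rpow_div γ hW hWp).div hW hWp.ne').mul
    (hW.add ((HasDerivAt.rpow_div P hA ha).const_mul (P - 1)))).congr_deriv ?_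
  simp only [bellAA, bellAB, Pi.add_apply, Pi.div_apply]
  have hw : bellW P Q (A x) (B x) = A x ^ P + B x ^ Q := rfl
  set w := bellW P Q (A x) (B x)
  generalize w ^ γ = wg
  generalize A x ^ P = aP at *
  generalize B x ^ Q = bQ at *
  obtain rfl : bQ = w - aP := by rw [hw]; ring
  have hP0 : P ≠ 0 := by rintro rfl; simp at hP
  obtain rfl : γ = 1 - 1 / P := by field_simp; linear_combination -hP
  have hw0 : w ≠ 0 := hWp.ne'
  clear_value w
  field_simp
  ring

lemma hasDerivAt_bellB (C : ℝ)
    (hA : HasDerivAt A A' x) (hB : HasDerivAt B B' x) (ha : 0 < A x) (hb : 0 < B x)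
    (hP : P * (1 - γ) = 1) :
    HasDerivAt (fun y => bellB C γ P Q (A y) (B y))
      (bellAB γ P Q (A x) (B x) * A' + bellBB C γ P Q (A x) (B x) * B') x := by
  have hW := hasDerivAt_bellW (P := P) (Q := Q) hA hB ha hb
  have hWp := bellW_pos P Q ha hb
  refine ((((HasDerivAt.rpow_div Q hB hb).div hB hb.ne').mul_const Q).mul
    (((hA.const_mul γ).mul ((HasDerivAt.rpow_div γ hW hWp).div hW hWp.ne')).add_const C)).congr_deriv ?_
  simp only [bellBB, bellAB, Pi.mul_apply, Pi.div_apply]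
  have hw : bellW P Q (A x) (B x) = A x ^ P + B x ^ Q := rfl
  set w := bellW P Q (A x) (B x)
  generalize w ^ γ = wg
  generalize A x ^ P = aP at *
  generalize B x ^ Q = bQ at *
  obtain rfl : bQ = w - aP := by rw [hw]; ring
  have hP0 : P ≠ 0 := by rintro rfl; simp at hP
  obtain rfl : γ = 1 - 1 / P := by field_simp; linear_combination -hP
  have hw0 : w ≠ 0 := hWp.ne'
  clear_value w
  field_simp
  ring

end Chain

/-- Lower bound for the Hessian of the Bellman function along the squared moduli: `α` and `β` are
the derivatives of the squared moduli, `x` and `y` the squared moduli of the derivatives. -/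
lemma bell_hessian {γ P Q C A B α β x y : ℝ} (hγ : 0 ≤ γ) (hγ1 : γ < 1) (hP : P * (1 - γ) = 1)
    (hQ : Q * (1 + γ) = 1) (hC : 25 ≤ 2 * C * Q * (2 * Q - 1)) (hA : 0 < A) (hB : 0 < B)
    (hx : 0 ≤ x) (hy : 0 ≤ y) (hα : α ^ 2 ≤ 4 * A * x) (hβ : β ^ 2 ≤ 4 * B * y) :
    bellW P Q A B ^ γ * x + (bellW P Q A B ^ γ)⁻¹ * y ≤
      2 * bellA γ P Q A B * x + 2 * bellB C γ P Q A B * y + bellAA γ P Q A B * α ^ 2 +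
        2 * bellAB γ P Q A B * (α * β) + bellBB C γ P Q A B * β ^ 2 := by
  have hW := bellW_pos P Q hA hB
  have hP1 : 1 ≤ P := by nlinarith
  have hQ0 : 0 < Q := by nlinarith
  have hQ1 : Q ≤ 1 := by nlinarith
  have hQ2 : 1 < 2 * Q := by nlinarith
  have hC0 : 0 < C := by
    by_contra hcon
    have : C * (Q * (2 * Q - 1)) ≤ 0 :=
      mul_nonpos_of_nonpos_of_nonneg (not_lt.1 hcon) (by nlinarith)
    nlinarith
  have hw : bellW P Q A B = A ^ P + B ^ Q := rfl
  have haP : 0 < A ^ P := Real.rpow_pos_of_pos hA _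
  have hbQ : 0 < B ^ Q := Real.rpow_pos_of_pos hB _
  set w := bellW P Q A B with hwdef
  have hwg : 0 < w ^ γ := Real.rpow_pos_of_pos hW _
  -- the two scale relations
  have h1 : A * (w ^ γ / w) ≤ 1 := by
    have : A ≤ w / w ^ γ := by
      have e1 : w / w ^ γ = w ^ (1 - γ) := by rw [Real.rpow_sub hW, Real.rpow_one]
      have e2 : A = (A ^ P) ^ (1 - γ) := by rw [← Real.rpow_mul hA.le, hP, Real.rpow_one]
      rw [e1]
      nth_rewrite 1 [e2]
      exact Real.rpow_le_rpow haP.le (by rw [hw]; linarith) (by linarith)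
    rw [le_div_iff₀ hwg] at this
    rw [mul_div_assoc', div_le_one hW]
    exact this
  have h2 : 1 ≤ w ^ γ * (B ^ Q / B) := by
    have e2 : B / B ^ Q = (B ^ Q) ^ γ := by
      rw [← Real.rpow_mul hB.le, show Q * γ = 1 - Q by linarith, Real.rpow_sub hB, Real.rpow_one]
    have : B / B ^ Q ≤ w ^ γ := by
      rw [e2]
      exact Real.rpow_le_rpow hbQ.le (by rw [hw]; linarith) hγ
    rw [div_le_iff₀ hbQ] at this
    rw [mul_div_assoc', le_div_iff₀ hB]
    linarith
  simp only [bellA, bellB, bellAA, bellAB, bellBB, ← hwdef]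
  generalize w ^ γ = G at *
  generalize A ^ P = aP at *
  generalize B ^ Q = bQ at *
  clear_value w
  have hGw : 0 < G / w := div_pos hwg hW
  set m := A * (G / w) with hm
  set b := bQ / B with hb
  have hb0 : 0 < b := div_pos hbQ hB
  set ρ := bQ / w with hρ
  have hρ0 : 0 < ρ := div_pos hbQ hW
  have hρ1 : ρ ≤ 1 := (div_le_one hW).2 (by linarith)
  have hm0 : 0 < m := mul_pos hA hGw
  have haw : aP / w ≤ 1 := (div_le_one hW).2 (by linarith)
  have t1 : 2 * G * x ≤ 2 * (G / w * (w + (P - 1) * aP)) * x := by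
    have : G ≤ G / w * (w + (P - 1) * aP) := by
      have e : G / w * (w + (P - 1) * aP) = G + G / w * ((P - 1) * aP) := by field_simp
      rw [e]
      have := mul_nonneg hGw.le (mul_nonneg (sub_nonneg.2 hP1) haP.le)
      linarith
    exact mul_le_mul_of_nonneg_right (by linarith) hx
  have t2 : 2 * (b * Q * C) * y ≤ 2 * (b * Q * (γ * A * (G / w) + C)) * y := by
    have : 0 ≤ b * Q * (γ * m) * y := by positivity
    have e : b * Q * (γ * A * (G / w) + C) = b * Q * (γ * m) + b * Q * C := by rw [hm]; ring
    rw [e]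
    linarith
  have t3 : 0 ≤ (P - 1) * (aP / A) * (G / w) * (1 + P - aP / w) * α ^ 2 := by
    have h1 : 0 ≤ P - 1 := by linarith
    have h2 : 0 ≤ 1 + P - aP / w := by linarith
    positivity
  have t4 : -(G * x + 16 * b * y) ≤ 2 * (γ * Q * b * bQ * (G / w ^ 2)) * (α * β) := by
    set K := γ * Q * b * bQ * (G / w ^ 2) with hK
    have hK2 : A * B * K ^ 2 / G = (γ * Q) ^ 2 * ρ ^ 3 * m * b := by
      rw [hK, hρ, hm, hb]; field_simp
    have hle : A * B * K ^ 2 / G ≤ b := by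
      rw [hK2]
      have i1 : (γ * Q) ^ 2 ≤ 1 := by
        apply pow_le_one₀ (by positivity)
        linarith
      have i2 : ρ ^ 3 ≤ 1 := pow_le_one₀ hρ0.le hρ1
      calc (γ * Q) ^ 2 * ρ ^ 3 * m * b ≤ 1 * 1 * 1 * b := by gcongr
        _ = b := by ring
    have i3 : 0 ≤ G / (4 * A) * (α + 4 * A * K / G * β) ^ 2 := by positivity
    have i4 : G / (4 * A) * (α + 4 * A * K / G * β) ^ 2 =
        G / (4 * A) * α ^ 2 + 2 * K * (α * β) + 4 * A * K ^ 2 / G * β ^ 2 := by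
      field_simp
      ring
    have i5 : G / (4 * A) * α ^ 2 ≤ G * x := by
      calc G / (4 * A) * α ^ 2 ≤ G / (4 * A) * (4 * A * x) := by gcongr
        _ = G * x := by field_simp
    have i6 : 4 * A * K ^ 2 / G * β ^ 2 ≤ 16 * b * y := by
      calc 4 * A * K ^ 2 / G * β ^ 2 ≤ 4 * A * K ^ 2 / G * (4 * B * y) := by gcongr
        _ = 16 * (A * B * K ^ 2 / G) * y := by ring
        _ ≤ 16 * b * y := by gcongr
    linarith
  have t5 : -(8 * b * y + 4 * C * Q * (1 - Q) * b * y) ≤ Q * (bQ / B ^ 2) *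
      (A * γ * (G / w) * (-(1 - γ) * Q * (bQ / w) - (1 - Q)) - C * (1 - Q)) * β ^ 2 := by
    have e : Q * (bQ / B ^ 2) *
      (A * γ * (G / w) * (-(1 - γ) * Q * (bQ / w) - (1 - Q)) - C * (1 - Q)) * β ^ 2 =
      -(Q * b / B * (m * γ * ((1 - γ) * Q * ρ + (1 - Q)) + C * (1 - Q)) * β ^ 2) := by
      rw [hb, hm, hρ]
      field_simp
      ring
    have i0 : 0 ≤ 1 - Q := by linarith
    have i00 : 0 ≤ 1 - γ := by linarith
    have i1 : m * γ * ((1 - γ) * Q * ρ + (1 - Q)) ≤ 1 * 1 * (1 * 1 * 1 + 1) := by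
      gcongr
      · linarith
      · linarith
    have i2 : Q * b / B * (m * γ * ((1 - γ) * Q * ρ + (1 - Q)) + C * (1 - Q)) * β ^ 2 ≤
        Q * b / B * (2 + C * (1 - Q)) * (4 * B * y) := by
      gcongr
      linarith
    have i3 : Q * b / B * (2 + C * (1 - Q)) * (4 * B * y) =
        8 * (Q * (b * y)) + 4 * C * Q * (1 - Q) * b * y := by
      field_simp
      ring
    have i4 : Q * (b * y) ≤ 1 * (b * y) := by gcongr
    rw [e]
    linarith
  have t6 : G⁻¹ * y ≤ b * y := by
    gcongr
    rw [inv_le_iff_one_le_mul₀ hwg]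
    linarith
  have t7 : 25 * (b * y) ≤ 2 * C * Q * (2 * Q - 1) * (b * y) := by gcongr
  linarith

/-! ### Integration over a rectangle -/

/-- Lebesgue measure on the rectangle `(0, S] × (0, T]`. -/
def boxMeasure (S T : ℝ) : Measure (ℝ × ℝ) := volume.restrict (Ioc 0 S ×ˢ Ioc 0 T)

instance (S T : ℝ) : IsFiniteMeasure (boxMeasure S T) := by
  refine ⟨?_⟩
  rw [boxMeasure, Measure.restrict_apply_univ]
  exact (measure_mono (prod_mono Ioc_subset_Icc_self Ioc_subset_Icc_self)).trans_lt
    (isCompact_Icc.prod isCompact_Icc).measure_lt_top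

lemma boxMeasure_eq_prod (S T : ℝ) :
    boxMeasure S T = (volume.restrict (Ioc 0 S)).prod (volume.restrict (Ioc 0 T)) := by
  rw [boxMeasure, Measure.volume_eq_prod, Measure.prod_restrict]

lemma ae_boxMeasure (S T : ℝ) : ∀ᵐ x ∂boxMeasure S T, x ∈ Icc 0 S ×ˢ Icc 0 T := by
  filter_upwards [ae_restrict_mem (measurableSet_Ioc.prod measurableSet_Ioc)] with x hx
  exact prod_mono Ioc_subset_Icc_self Ioc_subset_Icc_self hx

section
variable {E : Type*} [NormedAddCommGroup E] [NormedSpace ℝ E]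

omit [NormedSpace ℝ E] in
lemma _root_.Continuous.integrable_box {F : ℝ × ℝ → E} (hF : Continuous F) (S T : ℝ) :
    Integrable F (boxMeasure S T) := by
  have : IntegrableOn F (Icc 0 S ×ˢ Icc 0 T) :=
    hF.continuousOn.integrableOn_compact (isCompact_Icc.prod isCompact_Icc)
  exact this.mono_set (prod_mono Ioc_subset_Icc_self Ioc_subset_Icc_self)

lemma integral_box_eq {F : ℝ × ℝ → E} (hF : Continuous F) (S T : ℝ) :
    ∫ x, F x ∂boxMeasure S T = ∫ s in Ioc 0 S, ∫ t in Ioc 0 T, F (s, t) := by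
  have := hF.integrable_box S T
  rw [boxMeasure_eq_prod] at this ⊢
  exact integral_prod _ this

lemma integral_box_eq' {F : ℝ × ℝ → E} (hF : Continuous F) (S T : ℝ) :
    ∫ x, F x ∂boxMeasure S T = ∫ t in Ioc 0 T, ∫ s in Ioc 0 S, F (s, t) := by
  have := hF.integrable_box S T
  rw [boxMeasure_eq_prod] at this ⊢
  exact integral_prod_symm _ this

variable [CompleteSpace E]

lemma integral_box_deriv_fst {S T : ℝ} (hS : 0 ≤ S) {F F' : ℝ × ℝ → E} (hF' : Continuous F')
    (h : ∀ s t, HasDerivAt (fun s => F (s, t)) (F' (s, t)) s) (hp : ∀ t, F (S, t) = F (0, t)) :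
    ∫ x, F' x ∂boxMeasure S T = 0 := by
  rw [integral_box_eq' hF']
  refine integral_eq_zero_of_ae (Filter.Eventually.of_forall fun t => ?_)
  simp only [Pi.zero_apply]
  rw [← intervalIntegral.integral_of_le hS,
    intervalIntegral.integral_eq_sub_of_hasDerivAt (fun s _ => h s t)
      ((by fun_prop : Continuous fun s => F' (s, t)).intervalIntegrable _ _), hp, sub_self]

lemma integral_box_deriv_snd {S T : ℝ} (hT : 0 ≤ T) {F F' : ℝ × ℝ → E} (hF' : Continuous F')
    (h : ∀ s t, HasDerivAt (fun t => F (s, t)) (F' (s, t)) t) (hp : ∀ s, F (s, T) = F (s, 0)) :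
    ∫ x, F' x ∂boxMeasure S T = 0 := by
  rw [integral_box_eq hF']
  refine integral_eq_zero_of_ae (Filter.Eventually.of_forall fun s => ?_)
  simp only [Pi.zero_apply]
  rw [← intervalIntegral.integral_of_le hT,
    intervalIntegral.integral_eq_sub_of_hasDerivAt (fun t _ => h s t)
      ((by fun_prop : Continuous fun t => F' (s, t)).intervalIntegrable _ _), hp, sub_self]

end

lemma hasDerivAt_integral_box (S T : ℝ) {F F' : ℝ → ℝ × ℝ → ℝ}
    (h : ∀ τ x, HasDerivAt (fun τ => F τ x) (F' τ x) τ)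
    (hF : Continuous (Function.uncurry F)) (hF' : Continuous (Function.uncurry F')) (τ : ℝ) :
    HasDerivAt (fun τ => ∫ x, F τ x ∂boxMeasure S T) (∫ x, F' τ x ∂boxMeasure S T) τ := by
  obtain ⟨M, hM⟩ := (isCompact_Icc (a := τ - 1) (b := τ + 1)).prod
    ((isCompact_Icc (a := (0 : ℝ)) (b := S)).prod (isCompact_Icc (a := (0 : ℝ)) (b := T)))
    |>.exists_bound_of_continuousOn hF'.continuousOn
  have hc : ∀ τ, Continuous (F τ) := fun τ => hF.comp (by fun_prop : Continuous fun x => (τ, x))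
  have hc' : ∀ τ, Continuous (F' τ) := fun τ => hF'.comp (by fun_prop : Continuous fun x => (τ, x))
  refine (hasDerivAt_integral_of_dominated_loc_of_deriv_le (bound := fun _ => M)
    (Icc_mem_nhds (by linarith : τ - 1 < τ) (by linarith : τ < τ + 1))
    (Filter.Eventually.of_forall fun τ => (hc τ).aestronglyMeasurable)
    ((hc τ).integrable_box S T) (hc' τ).aestronglyMeasurable ?_ (integrable_const _)
    (Filter.Eventually.of_forall fun x τ _ => h τ x)).2
  filter_upwards [ae_boxMeasure S T] with x hx y hy
  exact hM (y, x) ⟨hy, hx⟩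

/-! ### The heat flow on trigonometric polynomials -/

/-- The frequency of the Fourier mode `k` in direction `j` on the torus with periods `S`, `T`. -/
def freq (S T : ℝ) (j : Fin 2) (k : ℤ × ℤ) : ℝ :=
  if j = 0 then 2 * Real.pi * k.1 / S else 2 * Real.pi * k.2 / T

/-- The Laplace eigenvalue of a Fourier mode. -/
def lapEig (S T : ℝ) (k : ℤ × ℤ) : ℝ := freq S T 0 k ^ 2 + freq S T 1 k ^ 2

/-- The heat flow at time `τ` of the trigonometric polynomial with coefficients `c`. -/
def trigFlow (S T : ℝ) (N : Finset (ℤ × ℤ)) (c : ℤ × ℤ → ℂ) (τ : ℝ) (x : ℝ × ℝ) : ℂ :=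
  ∑ k ∈ N, c k * Complex.exp (((-(lapEig S T k * τ) : ℝ) : ℂ) +
    ((freq S T 0 k * x.1 + freq S T 1 k * x.2 : ℝ) : ℂ) * Complex.I)

/-- The coefficients of the derivative in direction `j`. -/
def trigDeriv (S T : ℝ) (j : Fin 2) (c : ℤ × ℤ → ℂ) (k : ℤ × ℤ) : ℂ :=
  freq S T j k * Complex.I * c k

/-- The coefficients of the Laplacian. -/
def trigLap (S T : ℝ) (c : ℤ × ℤ → ℂ) (k : ℤ × ℤ) : ℂ := -lapEig S T k * c k

/-- The line through `x` in direction `j`, with coordinate value `r`. -/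
def setCoord (j : Fin 2) (x : ℝ × ℝ) (r : ℝ) : ℝ × ℝ := if j = 0 then (r, x.2) else (x.1, r)

/-- The coordinate in direction `j`. -/
def getCoord (j : Fin 2) (x : ℝ × ℝ) : ℝ := if j = 0 then x.1 else x.2

section Flow

variable {S T : ℝ} {N : Finset (ℤ × ℤ)} {c d : ℤ × ℤ → ℂ}

@[fun_prop]
lemma continuous_trigFlow : Continuous fun q : ℝ × ℝ × ℝ => trigFlow S T N c q.1 q.2 := by
  unfold trigFlow
  fun_prop

@[fun_prop]
lemma continuous_trigFlow_right (τ : ℝ) : Continuous (trigFlow S T N c τ) := by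
  unfold trigFlow
  fun_prop

lemma trigFlow_add (τ : ℝ) (x : ℝ × ℝ) : trigFlow S T N (fun k => c k + d k) τ x =
    trigFlow S T N c τ x + trigFlow S T N d τ x := by
  simp only [trigFlow, add_mul, Finset.sum_add_distrib]

lemma trigFlow_lap (τ : ℝ) (x : ℝ × ℝ) : trigFlow S T N (trigLap S T c) τ x =
    trigFlow S T N (trigDeriv S T 0 (trigDeriv S T 0 c)) τ x +
      trigFlow S T N (trigDeriv S T 1 (trigDeriv S T 1 c)) τ x := by
  rw [← trigFlow_add]
  congr 1
  ext k
  simp only [trigLap, trigDeriv, lapEig]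
  push_cast
  linear_combination (-(freq S T 0 k : ℂ) ^ 2 - (freq S T 1 k : ℂ) ^ 2) * c k * Complex.I_sq

lemma hasDerivAt_trigFlow_time (τ : ℝ) (x : ℝ × ℝ) :
    HasDerivAt (fun τ => trigFlow S T N c τ x) (trigFlow S T N (trigLap S T c) τ x) τ := by
  unfold trigFlow
  refine HasDerivAt.fun_sum fun k _ => ?_
  have h1 : HasDerivAt (fun τ : ℝ => ((-(lapEig S T k * τ) : ℝ) : ℂ)) (-lapEig S T k : ℂ) τ := by
    have := (((hasDerivAt_id τ).const_mul (lapEig S T k)).neg).ofReal_comp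
    simpa using this
  refine (((h1.add_const _).cexp).const_mul (c k)).congr_deriv ?_
  simp only [trigLap]
  ring

lemma hasDerivAt_trigFlow (j : Fin 2) (τ : ℝ) (x : ℝ × ℝ) :
    HasDerivAt (fun r => trigFlow S T N c τ (setCoord j x r))
      (trigFlow S T N (trigDeriv S T j c) τ x) (getCoord j x) := by
  unfold trigFlow
  refine HasDerivAt.fun_sum fun k _ => ?_
  have h1 : HasDerivAt (fun r : ℝ => ((freq S T 0 k * (setCoord j x r).1 +
      freq S T 1 k * (setCoord j x r).2 : ℝ) : ℂ)) (freq S T j k : ℂ) (getCoord j x) := by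
    fin_cases j
    · have := ((((hasDerivAt_id x.1).const_mul (freq S T 0 k))).add_const
        (freq S T 1 k * x.2)).ofReal_comp
      simpa [setCoord, getCoord] using this
    · have := ((((hasDerivAt_id x.2).const_mul (freq S T 1 k))).const_add
        (freq S T 0 k * x.1)).ofReal_comp
      simpa [setCoord, getCoord] using this
  refine ((((h1.mul_const Complex.I).const_add _).cexp).const_mul (c k)).congr_deriv ?_
  have : setCoord j x (getCoord j x) = x := by fin_cases j <;> simp [setCoord, getCoord]
  simp only [trigDeriv, this]
  ring

lemma trigFlow_periodic_fst (hS : S ≠ 0) (τ : ℝ) (s t : ℝ) :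
    trigFlow S T N c τ (s + S, t) = trigFlow S T N c τ (s, t) := by
  unfold trigFlow
  refine Finset.sum_congr rfl fun k _ => ?_
  congr 1
  rw [Complex.exp_eq_exp_iff_exists_int]
  refine ⟨k.1, ?_⟩
  simp only [freq, if_true, one_ne_zero, if_false]
  push_cast
  have : (S : ℂ) ≠ 0 := by exact_mod_cast hS
  field_simp
  ring

lemma trigFlow_periodic_snd (hT : T ≠ 0) (τ : ℝ) (s t : ℝ) :
    trigFlow S T N c τ (s, t + T) = trigFlow S T N c τ (s, t) := by
  unfold trigFlow
  refine Finset.sum_congr rfl fun k _ => ?_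
  congr 1
  rw [Complex.exp_eq_exp_iff_exists_int]
  refine ⟨k.2, ?_⟩
  simp only [freq, if_true, one_ne_zero, if_false]
  push_cast
  have : (T : ℂ) ≠ 0 := by exact_mod_cast hT
  field_simp
  ring

end Flow

/-- The derivative of a doubly periodic function in a coordinate direction has integral zero. -/
lemma integral_box_deriv {E : Type*} [NormedAddCommGroup E] [NormedSpace ℝ E] [CompleteSpace E]
    {S T : ℝ} (hS : 0 ≤ S) (hT : 0 ≤ T) (j : Fin 2)
    {F F' : ℝ × ℝ → E} (hF' : Continuous F')
    (h : ∀ x, HasDerivAt (fun r => F (setCoord j x r)) (F' x) (getCoord j x))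
    (hp1 : ∀ s t, F (s + S, t) = F (s, t)) (hp2 : ∀ s t, F (s, t + T) = F (s, t)) :
    ∫ x, F' x ∂boxMeasure S T = 0 := by
  fin_cases j
  · exact integral_box_deriv_fst hS hF' (fun s t => h (s, t)) fun t => by
      simpa using hp1 0 t
  · exact integral_box_deriv_snd hT hF' (fun s t => h (s, t)) fun s => by
      simpa using hp2 s 0

lemma integral_trigFlow_mul {S T : ℝ} (hS : 0 < S) (hT : 0 < T) (N : Finset (ℤ × ℤ))
    (c d : ℤ × ℤ → ℂ) (j : Fin 2) (τ τ' : ℝ) :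
    ∫ x, trigFlow S T N (trigDeriv S T j c) τ x * trigFlow S T N d τ' x ∂boxMeasure S T =
      -∫ x, trigFlow S T N c τ x * trigFlow S T N (trigDeriv S T j d) τ' x ∂boxMeasure S T := by
  rw [← add_eq_zero_iff_eq_neg, ← integral_add ((by fun_prop : Continuous _).integrable_box S T)
    ((by fun_prop : Continuous _).integrable_box S T)]
  refine integral_box_deriv hS.le hT.le j
    (F := fun x => trigFlow S T N c τ x * trigFlow S T N d τ' x) (by fun_prop) (fun x => ?_)
    (fun s t => ?_) (fun s t => ?_)
  · have := (hasDerivAt_trigFlow (N := N) (c := c) (S := S) (T := T) j τ x).mul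
      (hasDerivAt_trigFlow (S := S) (T := T) (N := N) (c := d) j τ' x)
    have e : setCoord j x (getCoord j x) = x := by fin_cases j <;> simp [setCoord, getCoord]
    rw [e] at this
    exact this
  · simp only [trigFlow_periodic_fst hS.ne']
  · simp only [trigFlow_periodic_snd hT.ne']

lemma setCoord_getCoord (j : Fin 2) (x : ℝ × ℝ) : setCoord j x (getCoord j x) = x := by
  fin_cases j <;> simp [setCoord, getCoord]

section Cont

variable {X : Type*} [TopologicalSpace X] {γ P Q C : ℝ} {A B : X → ℝ}

lemma continuous_bellW (hA : Continuous A) (hB : Continuous B) (ha : ∀ x, 0 < A x)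
    (hb : ∀ x, 0 < B x) : Continuous fun x => bellW P Q (A x) (B x) :=
  (hA.rpow_const fun x => Or.inl (ha x).ne').add (hB.rpow_const fun x => Or.inl (hb x).ne')

lemma continuous_bell (hA : Continuous A) (hB : Continuous B) (ha : ∀ x, 0 < A x)
    (hb : ∀ x, 0 < B x) : Continuous fun x => bell C γ P Q (A x) (B x) :=
  (hA.mul ((continuous_bellW hA hB ha hb).rpow_const
    fun x => Or.inl (bellW_pos P Q (ha x) (hb x)).ne')).add
    ((hB.rpow_const fun x => Or.inl (hb x).ne').const_mul C)

lemma continuous_bell_derivs (hA : Continuous A) (hB : Continuous B) (ha : ∀ x, 0 < A x)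
    (hb : ∀ x, 0 < B x) :
    (Continuous fun x => bellA γ P Q (A x) (B x)) ∧ (Continuous fun x => bellB C γ P Q (A x) (B x)) ∧
    (Continuous fun x => bellAA γ P Q (A x) (B x)) ∧
    (Continuous fun x => bellAB γ P Q (A x) (B x)) ∧
    (Continuous fun x => bellBB C γ P Q (A x) (B x)) := by
  have hW := continuous_bellW (P := P) (Q := Q) hA hB ha hb
  have hW0 : ∀ x, bellW P Q (A x) (B x) ≠ 0 := fun x => (bellW_pos P Q (ha x) (hb x)).ne'
  have hWg : Continuous fun x => bellW P Q (A x) (B x) ^ γ := hW.rpow_const fun x => Or.inl (hW0 x)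
  have hAP : Continuous fun x => A x ^ P := hA.rpow_const fun x => Or.inl (ha x).ne'
  have hBQ : Continuous fun x => B x ^ Q := hB.rpow_const fun x => Or.inl (hb x).ne'
  have h1 := hWg.div hW hW0
  have hA0 := fun x => (ha x).ne'
  have hB0 := fun x => (hb x).ne'
  refine ⟨?_, ?_, ?_, ?_, ?_⟩
  · exact h1.mul (hW.add (hAP.const_mul _))
  · exact ((hBQ.div hB hB0).mul_const Q).mul (((hA.const_mul γ).mul h1).add_const C)
  · exact (((hAP.div hA hA0).const_mul _).mul h1).mul (continuous_const.sub (hAP.div hW hW0))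
  · exact (((hBQ.div hB hB0).const_mul _).mul hBQ).mul (hWg.div (hW.pow 2) fun x => by
      simpa using hW0 x)
  · exact ((hBQ.div (hB.pow 2) fun x => by simpa using hB0 x).const_mul Q).mul
      ((((hA.mul_const γ).mul h1).mul (((hBQ.div hW hW0).const_mul _).sub continuous_const)).sub continuous_const)

end Cont

section Monotone

variable (S T : ℝ) (N : Finset (ℤ × ℤ)) (c d : ℤ × ℤ → ℂ) (ε C γ P Q : ℝ)

/-- The regularized squared modulus of a trigonometric heat flow. -/
def trigSq (τ : ℝ) (x : ℝ × ℝ) : ℝ := ε + ‖trigFlow S T N c τ x‖ ^ 2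

variable {ε}

lemma trigSq_pos (hε : 0 < ε) (τ : ℝ) (x : ℝ × ℝ) : 0 < trigSq S T N c ε τ x := by
  unfold trigSq
  positivity

@[fun_prop]
lemma continuous_trigSq : Continuous fun q : ℝ × ℝ × ℝ => trigSq S T N c ε q.1 q.2 := by
  unfold trigSq
  fun_prop

@[fun_prop]
lemma continuous_trigSq_right (τ : ℝ) : Continuous (trigSq S T N c ε τ) := by
  unfold trigSq
  fun_prop

lemma hasDerivAt_trigSq_time (τ : ℝ) (x : ℝ × ℝ) :
    HasDerivAt (fun τ => trigSq S T N c ε τ x)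
      (2 * inner ℝ (trigFlow S T N c τ x) (trigFlow S T N (trigLap S T c) τ x)) τ :=
  ((hasDerivAt_trigFlow_time τ x).norm_sq).const_add ε

lemma hasDerivAt_trigSq (j : Fin 2) (τ : ℝ) (x : ℝ × ℝ) :
    HasDerivAt (fun r => trigSq S T N c ε τ (setCoord j x r))
      (2 * inner ℝ (trigFlow S T N c τ x) (trigFlow S T N (trigDeriv S T j c) τ x))
      (getCoord j x) := by
  have := ((hasDerivAt_trigFlow (S := S) (T := T) (N := N) (c := c) j τ x).norm_sq).const_add ε
  rwa [setCoord_getCoord] at this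

lemma hasDerivAt_trigSq_deriv (j : Fin 2) (τ : ℝ) (x : ℝ × ℝ) :
    HasDerivAt (fun r => 2 * inner ℝ (trigFlow S T N c τ (setCoord j x r))
        (trigFlow S T N (trigDeriv S T j c) τ (setCoord j x r)))
      (2 * ‖trigFlow S T N (trigDeriv S T j c) τ x‖ ^ 2 + 2 * inner ℝ (trigFlow S T N c τ x)
        (trigFlow S T N (trigDeriv S T j (trigDeriv S T j c)) τ x)) (getCoord j x) := by
  have := ((hasDerivAt_trigFlow (S := S) (T := T) (N := N) (c := c) j τ x).inner ℝ
    (hasDerivAt_trigFlow (S := S) (T := T) (N := N) (c := trigDeriv S T j c) j τ x)).const_mul 2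
  rw [setCoord_getCoord] at this
  refine this.congr_deriv ?_
  rw [real_inner_self_eq_norm_sq]
  ring

/-- The second derivative of the Bellman functional of two flows in a coordinate direction. -/
def bellSecond (j : Fin 2) (ε : ℝ) (τ : ℝ) (x : ℝ × ℝ) : ℝ :=
  let A := trigSq S T N c ε τ x
  let B := trigSq S T N d ε τ x
  let α := 2 * inner ℝ (trigFlow S T N c τ x) (trigFlow S T N (trigDeriv S T j c) τ x)
  let β := 2 * inner ℝ (trigFlow S T N d τ x) (trigFlow S T N (trigDeriv S T j d) τ x)
  (bellAA γ P Q A B * α + bellAB γ P Q A B * β) * α +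
  bellA γ P Q A B * (2 * ‖trigFlow S T N (trigDeriv S T j c) τ x‖ ^ 2 +
    2 * inner ℝ (trigFlow S T N c τ x)
        (trigFlow S T N (trigDeriv S T j (trigDeriv S T j c)) τ x)) +
  ((bellAB γ P Q A B * α + bellBB C γ P Q A B * β) * β +
  bellB C γ P Q A B * (2 * ‖trigFlow S T N (trigDeriv S T j d) τ x‖ ^ 2 +
    2 * inner ℝ (trigFlow S T N d τ x)
        (trigFlow S T N (trigDeriv S T j (trigDeriv S T j d)) τ x)))

/-- The time derivative of the Bellman functional of two flows. -/
def bellTime (ε : ℝ) (τ : ℝ) (x : ℝ × ℝ) : ℝ :=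
  bellA γ P Q (trigSq S T N c ε τ x) (trigSq S T N d ε τ x) *
    (2 * inner ℝ (trigFlow S T N c τ x) (trigFlow S T N (trigLap S T c) τ x)) +
  bellB C γ P Q (trigSq S T N c ε τ x) (trigSq S T N d ε τ x) *
    (2 * inner ℝ (trigFlow S T N d τ x) (trigFlow S T N (trigLap S T d) τ x))

lemma continuous_bellSecond (hε : 0 < ε) (j : Fin 2) (τ : ℝ) :
    Continuous (bellSecond S T N c d C γ P Q j ε τ) := by
  obtain ⟨h1, h2, h3, h4, h5⟩ := continuous_bell_derivs (γ := γ) (P := P) (Q := Q) (C := C)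
    (continuous_trigSq_right S T N c (ε := ε) τ) (continuous_trigSq_right S T N d (ε := ε) τ)
    (trigSq_pos S T N c hε τ) (trigSq_pos S T N d hε τ)
  unfold bellSecond
  dsimp only
  fun_prop

lemma continuous_bellTime (hε : 0 < ε) :
    Continuous fun q : ℝ × ℝ × ℝ => bellTime S T N c d C γ P Q ε q.1 q.2 := by
  obtain ⟨h1, h2, -⟩ := continuous_bell_derivs (γ := γ) (P := P) (Q := Q) (C := C)
    (continuous_trigSq S T N c (ε := ε)) (continuous_trigSq S T N d (ε := ε))
    (fun q => trigSq_pos S T N c hε q.1 q.2) (fun q => trigSq_pos S T N d hε q.1 q.2)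
  unfold bellTime
  fun_prop

lemma continuous_bell_trigSq (hε : 0 < ε) :
    Continuous fun q : ℝ × ℝ × ℝ =>
      bell C γ P Q (trigSq S T N c ε q.1 q.2) (trigSq S T N d ε q.1 q.2) :=
  continuous_bell (continuous_trigSq S T N c) (continuous_trigSq S T N d)
      (fun q => trigSq_pos S T N c hε q.1 q.2) (fun q => trigSq_pos S T N d hε q.1 q.2)

variable {S T}

lemma integral_bellSecond (hS : 0 < S) (hT : 0 < T) (hε : 0 < ε) (hP : P * (1 - γ) = 1)
    (j : Fin 2) (τ : ℝ) :
    ∫ x, bellSecond S T N c d C γ P Q j ε τ x ∂boxMeasure S T = 0 := by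
  refine integral_box_deriv hS.le hT.le j
    (F := fun x => bellA γ P Q (trigSq S T N c ε τ x) (trigSq S T N d ε τ x) *
      (2 * inner ℝ (trigFlow S T N c τ x) (trigFlow S T N (trigDeriv S T j c) τ x)) +
      bellB C γ P Q (trigSq S T N c ε τ x) (trigSq S T N d ε τ x) *
      (2 * inner ℝ (trigFlow S T N d τ x) (trigFlow S T N (trigDeriv S T j d) τ x)))
    (continuous_bellSecond S T N c d C γ P Q hε j τ) (fun x => ?_) (fun s t => ?_) (fun s t => ?_)
  · have hA := hasDerivAt_trigSq S T N c (ε := ε) j τ x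
    have hB := hasDerivAt_trigSq S T N d (ε := ε) j τ x
    have h1 := hasDerivAt_bellA (γ := γ) (P := P) (Q := Q) hP hA hB
      (trigSq_pos S T N c hε τ _) (trigSq_pos S T N d hε τ _)
    have h2 := hasDerivAt_bellB (γ := γ) (P := P) (Q := Q) C hA hB
      (trigSq_pos S T N c hε τ _) (trigSq_pos S T N d hε τ _) hP
    have := (h1.mul (hasDerivAt_trigSq_deriv S T N c j τ x)).add
      (h2.mul (hasDerivAt_trigSq_deriv S T N d j τ x))
    rw [setCoord_getCoord] at this
    exact this
  · simp only [trigSq, trigFlow_periodic_fst hS.ne']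
  · simp only [trigSq, trigFlow_periodic_snd hT.ne']

variable (S T)

lemma bellSecond_sub_time (hε : 0 < ε) (hγ : 0 ≤ γ) (hγ1 : γ < 1) (hP : P * (1 - γ) = 1)
    (hQ : Q * (1 + γ) = 1) (hC : 25 ≤ 2 * C * Q * (2 * Q - 1)) (i j : Fin 2) (τ : ℝ) (x : ℝ × ℝ) :
    2 * (‖trigFlow S T N (trigDeriv S T i c) τ x‖ * ‖trigFlow S T N (trigDeriv S T j d) τ x‖) ≤
      bellSecond S T N c d C γ P Q 0 ε τ x + bellSecond S T N c d C γ P Q 1 ε τ x -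
        bellTime S T N c d C γ P Q ε τ x := by
  have hA := trigSq_pos S T N c hε τ x
  have hB := trigSq_pos S T N d hε τ x
  have key : ∀ (e : ℤ × ℤ → ℂ) (l : Fin 2),
      (2 * inner ℝ (trigFlow S T N e τ x) (trigFlow S T N (trigDeriv S T l e) τ x)) ^ 2 ≤
        4 * trigSq S T N e ε τ x * ‖trigFlow S T N (trigDeriv S T l e) τ x‖ ^ 2 := by
    intro e l
    have h1 := abs_real_inner_le_norm (trigFlow S T N e τ x)
      (trigFlow S T N (trigDeriv S T l e) τ x)
    have h2 := sq_le_sq' (by linarith [neg_abs_le (inner ℝ (trigFlow S T N e τ x)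
      (trigFlow S T N (trigDeriv S T l e) τ x))]) ((le_abs_self _).trans h1)
    have h3 : 0 ≤ ε * ‖trigFlow S T N (trigDeriv S T l e) τ x‖ ^ 2 := by positivity
    unfold trigSq
    nlinarith
  have hess := fun l : Fin 2 => bell_hessian hγ hγ1 hP hQ hC hA hB (sq_nonneg _) (sq_nonneg _)
    (key c l) (key d l)
  have h0 := hess 0
  have h1 := hess 1
  have hlap : ∀ e : ℤ × ℤ → ℂ, inner ℝ (trigFlow S T N e τ x)
      (trigFlow S T N (trigLap S T e) τ x) =
      inner ℝ (trigFlow S T N e τ x)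
        (trigFlow S T N (trigDeriv S T 0 (trigDeriv S T 0 e)) τ x) +
      inner ℝ (trigFlow S T N e τ x)
        (trigFlow S T N (trigDeriv S T 1 (trigDeriv S T 1 e)) τ x) := by
    intro e
    rw [trigFlow_lap, inner_add_right]
  simp only [bellSecond, bellTime, hlap]
  have hG : 0 < bellW P Q (trigSq S T N c ε τ x) (trigSq S T N d ε τ x) ^ γ :=
    Real.rpow_pos_of_pos (bellW_pos P Q hA hB) _
  generalize bellW P Q (trigSq S T N c ε τ x) (trigSq S T N d ε τ x) ^ γ = G at *
  have hle : ∀ (e : ℤ × ℤ → ℂ) (l : Fin 2), ‖trigFlow S T N (trigDeriv S T l e) τ x‖ ^ 2 ≤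
      ‖trigFlow S T N (trigDeriv S T 0 e) τ x‖ ^ 2 +
        ‖trigFlow S T N (trigDeriv S T 1 e) τ x‖ ^ 2 := by
    intro e l
    fin_cases l
    · exact le_add_of_nonneg_right (sq_nonneg _)
    · exact le_add_of_nonneg_left (sq_nonneg _)
  have hc := mul_le_mul_of_nonneg_left (hle c i) hG.le
  have hd := mul_le_mul_of_nonneg_left (hle d j) (inv_pos.2 hG).le
  have ham : 2 * (‖trigFlow S T N (trigDeriv S T i c) τ x‖ *
      ‖trigFlow S T N (trigDeriv S T j d) τ x‖) ≤
      G * ‖trigFlow S T N (trigDeriv S T i c) τ x‖ ^ 2 +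
        G⁻¹ * ‖trigFlow S T N (trigDeriv S T j d) τ x‖ ^ 2 := by
    generalize ‖trigFlow S T N (trigDeriv S T i c) τ x‖ = a
    generalize ‖trigFlow S T N (trigDeriv S T j d) τ x‖ = b
    have : 0 ≤ G * (a - G⁻¹ * b) ^ 2 := by positivity
    have e : G * (a - G⁻¹ * b) ^ 2 = G * a ^ 2 + G⁻¹ * b ^ 2 - 2 * (a * b) := by
      field_simp
      ring
    linarith
  linarith

variable {S T}

/-- The Bellman functional of two heat flows dissipates the product of their gradients. -/
lemma hasDerivAt_bell_integral (hS : 0 < S) (hT : 0 < T) (hε : 0 < ε) (hγ : 0 ≤ γ) (hγ1 : γ < 1)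
    (hP : P * (1 - γ) = 1) (hQ : Q * (1 + γ) = 1) (hC : 25 ≤ 2 * C * Q * (2 * Q - 1)) (τ : ℝ) :
    ∃ D : ℝ, HasDerivAt (fun τ => ∫ x, bell C γ P Q (trigSq S T N c ε τ x)
        (trigSq S T N d ε τ x) ∂boxMeasure S T) D τ ∧
      ∀ i j : Fin 2, D ≤ -(2 * ∫ x, ‖trigFlow S T N (trigDeriv S T i c) τ x‖ *
        ‖trigFlow S T N (trigDeriv S T j d) τ x‖ ∂boxMeasure S T) := by
  have hct := continuous_bellTime S T N c d C γ P Q hε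
  have hct1 : Continuous (bellTime S T N c d C γ P Q ε τ) :=
    Continuous.comp (g := fun q : ℝ × ℝ × ℝ => bellTime S T N c d C γ P Q ε q.1 q.2)
      (f := fun x => (τ, x)) hct (by fun_prop)
  refine ⟨_, hasDerivAt_integral_box S T (F := fun τ x => bell C γ P Q (trigSq S T N c ε τ x)
    (trigSq S T N d ε τ x)) (F' := bellTime S T N c d C γ P Q ε)
    (fun τ x => hasDerivAt_bell C hP (hasDerivAt_trigSq_time S T N c τ x)
      (hasDerivAt_trigSq_time S T N d τ x) (trigSq_pos S T N c hε τ x) (trigSq_pos S T N d hε τ x))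
    ?_ hct τ, fun i j => ?_⟩
  · exact continuous_bell_trigSq S T N c d C γ P Q hε
  · have hc0 := (continuous_bellSecond S T N c d C γ P Q hε 0 τ).integrable_box S T
    have hc1 := (continuous_bellSecond S T N c d C γ P Q hε 1 τ).integrable_box S T
    have h1 := integral_mono (μ := boxMeasure S T) ((by fun_prop : Continuous fun x =>
      2 * (‖trigFlow S T N (trigDeriv S T i c) τ x‖ *
        ‖trigFlow S T N (trigDeriv S T j d) τ x‖)).integrable_box S T)
      ((hc0.add hc1).sub (hct1.integrable_box S T))
      (fun x => bellSecond_sub_time S T N c d C γ P Q hε hγ hγ1 hP hQ hC i j τ x)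
    have h2 : ∫ x, (bellSecond S T N c d C γ P Q 0 ε τ + bellSecond S T N c d C γ P Q 1 ε τ -
        bellTime S T N c d C γ P Q ε τ) x ∂boxMeasure S T =
        -∫ x, bellTime S T N c d C γ P Q ε τ x ∂boxMeasure S T := by
      rw [integral_sub' (hc0.add hc1) (hct1.integrable_box S T), integral_add' hc0 hc1,
        integral_bellSecond N c d C γ P Q hS hT hε hP, integral_bellSecond N c d C γ P Q hS hT hε hP]
      ring
    rw [integral_const_mul] at h1
    have h3 := h1.trans_eq h2
    linarith

end Monotone

/-! ### Second derivatives of trigonometric polynomials in `L^q` -/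

section Pairing

variable {S T : ℝ} (N : Finset (ℤ × ℤ)) (c e : ℤ × ℤ → ℂ)

lemma trigDeriv_comm (S T : ℝ) (i j : Fin 2) :
    trigLap S T (trigDeriv S T i (trigDeriv S T j e)) =
      trigDeriv S T i (trigDeriv S T j (trigLap S T e)) := by
  ext k
  simp only [trigLap, trigDeriv]
  ring

lemma integral_trigFlow_lap (hS : 0 < S) (hT : 0 < T) (τ : ℝ) :
    ∫ x, trigFlow S T N (trigLap S T c) τ x * trigFlow S T N e τ x ∂boxMeasure S T =
      ∫ x, trigFlow S T N c τ x * trigFlow S T N (trigLap S T e) τ x ∂boxMeasure S T := by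
  simp only [trigFlow_lap, add_mul, mul_add]
  rw [integral_add ((by fun_prop : Continuous _).integrable_box S T)
    ((by fun_prop : Continuous _).integrable_box S T),
    integral_add ((by fun_prop : Continuous _).integrable_box S T)
    ((by fun_prop : Continuous _).integrable_box S T)]
  simp only [integral_trigFlow_mul hS hT, neg_neg]

/-- The pairing of a trigonometric flow with a second derivative of another one. -/
def trigPairing (S T : ℝ) (i j : Fin 2) (τ : ℝ) : ℝ :=
  ∫ x, (trigFlow S T N c τ x * trigFlow S T N (trigDeriv S T i (trigDeriv S T j e)) τ x).re
    ∂boxMeasure S T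

lemma hasDerivAt_trigPairing (hS : 0 < S) (hT : 0 < T) (i j : Fin 2) (τ : ℝ) :
    ∃ D : ℝ, HasDerivAt (trigPairing N c e S T i j) D τ ∧
      |D| ≤ 2 * ∫ x, ‖trigFlow S T N (trigDeriv S T i c) τ x‖ *
        ‖trigFlow S T N (trigDeriv S T j (trigLap S T e)) τ x‖ ∂boxMeasure S T := by
  set d := trigDeriv S T i (trigDeriv S T j e) with hd
  have h1 : ∀ τ x, HasDerivAt (fun τ => (trigFlow S T N c τ x * trigFlow S T N d τ x).re)
      (trigFlow S T N (trigLap S T c) τ x * trigFlow S T N d τ x +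
        trigFlow S T N c τ x * trigFlow S T N (trigLap S T d) τ x).re τ := by
    intro τ x
    exact (Complex.reCLM.hasFDerivAt).comp_hasDerivAt τ
      ((hasDerivAt_trigFlow_time τ x).mul (hasDerivAt_trigFlow_time τ x))
  refine ⟨_, hasDerivAt_integral_box S T h1 ?_ ?_ τ, ?_⟩
  · simp only [Function.uncurry_def]
    fun_prop
  · simp only [Function.uncurry_def]
    fun_prop
  · have e1 : ∫ x, (trigFlow S T N (trigLap S T c) τ x * trigFlow S T N d τ x +
        trigFlow S T N c τ x * trigFlow S T N (trigLap S T d) τ x).re ∂boxMeasure S T =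
        (-(2 * ∫ x, trigFlow S T N (trigDeriv S T i c) τ x *
          trigFlow S T N (trigDeriv S T j (trigLap S T e)) τ x ∂boxMeasure S T)).re := by
      have := integral_re (𝕜 := ℂ) (μ := boxMeasure S T) ((by fun_prop : Continuous fun x =>
        trigFlow S T N (trigLap S T c) τ x * trigFlow S T N d τ x +
        trigFlow S T N c τ x * trigFlow S T N (trigLap S T d) τ x).integrable_box S T)
      refine this.trans ?_
      rw [integral_add ((by fun_prop : Continuous _).integrable_box S T)
        ((by fun_prop : Continuous _).integrable_box S T), integral_trigFlow_lap N c d hS hT, hd,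
        trigDeriv_comm, integral_trigFlow_mul hS hT]
      simp only [RCLike.re_to_complex]
      congr 1
      ring
    rw [e1]
    refine (Complex.abs_re_le_norm _).trans ?_
    rw [norm_neg, norm_mul, Complex.norm_ofNat]
    gcongr
    refine (norm_integral_le_integral_norm _).trans_eq ?_
    simp only [norm_mul]

lemma tendsto_trigFlow_deriv (i j : Fin 2) :
    Filter.Tendsto (fun τ => ∑ k ∈ N, ‖trigDeriv S T i (trigDeriv S T j e) k‖ *
      Real.exp (-(lapEig S T k * τ))) Filter.atTop (nhds 0) := by
  rw [← Finset.sum_const_zero (ι := ℤ × ℤ) (s := N)]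
  refine tendsto_finsetSum _ fun k _ => ?_
  rcases eq_or_ne (lapEig S T k) 0 with h0 | h0
  · have hf : freq S T i k = 0 := by
      have h1 := sq_nonneg (freq S T 0 k)
      have h2 := sq_nonneg (freq S T 1 k)
      unfold lapEig at h0
      have : ∀ l : Fin 2, freq S T l k ^ 2 = 0 := by
        intro l
        fin_cases l
        · simp only [Fin.zero_eta]; linarith
        · simp only [Fin.mk_one]; linarith
      simpa using this i
    simp [trigDeriv, hf]
  · have hpos : 0 < lapEig S T k :=
      lt_of_le_of_ne (add_nonneg (sq_nonneg _) (sq_nonneg _)) h0.symm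
    rw [show (0 : ℝ) = ‖trigDeriv S T i (trigDeriv S T j e) k‖ * 0 by simp]
    refine Filter.Tendsto.const_mul _ (Real.tendsto_exp_atBot.comp ?_)
    exact Filter.tendsto_neg_atTop_atBot.comp (Filter.tendsto_id.const_mul_atTop hpos)

lemma norm_trigFlow_le (τ : ℝ) (x : ℝ × ℝ) :
    ‖trigFlow S T N c τ x‖ ≤ ∑ k ∈ N, ‖c k‖ * Real.exp (-(lapEig S T k * τ)) := by
  refine (norm_sum_le _ _).trans (Finset.sum_le_sum fun k _ => ?_)
  rw [norm_mul, Complex.norm_exp]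
  simp

lemma tendsto_trigPairing (i j : Fin 2) :
    Filter.Tendsto (trigPairing N c e S T i j) Filter.atTop (nhds 0) := by
  set B : ℝ → ℝ := fun τ => (∑ k ∈ N, ‖c k‖) * ∑ k ∈ N, ‖trigDeriv S T i (trigDeriv S T j e) k‖ *
      Real.exp (-(lapEig S T k * τ))
  have hB : Filter.Tendsto (fun τ => B τ * (boxMeasure S T).real univ) Filter.atTop (nhds 0) := by
    have := ((tendsto_trigFlow_deriv (S := S) (T := T) N e i j).const_mul
      (∑ k ∈ N, ‖c k‖)).mul_const ((boxMeasure S T).real univ)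
    simpa using this
  refine squeeze_zero_norm' ?_ hB
  filter_upwards [Filter.eventually_ge_atTop 0] with τ hτ
  refine norm_integral_le_of_norm_le_const (Filter.Eventually.of_forall fun x => ?_)
  refine (Complex.abs_re_le_norm _).trans ?_
  rw [norm_mul]
  refine mul_le_mul ((norm_trigFlow_le N c τ x).trans (Finset.sum_le_sum fun k _ => ?_))
    (norm_trigFlow_le N _ τ x) (norm_nonneg _) (Finset.sum_nonneg fun k _ => norm_nonneg _)
  have : 0 ≤ lapEig S T k * τ := mul_nonneg (add_nonneg (sq_nonneg _) (sq_nonneg _)) hτ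
  exact mul_le_of_le_one_right (norm_nonneg _) (Real.exp_le_one_iff.2 (by linarith))

lemma abs_le_of_dissipation {K M : ℝ → ℝ} (hK : ∀ τ, 0 ≤ K τ)
    (h : ∀ τ, ∃ D D', HasDerivAt K D τ ∧ HasDerivAt M D' τ ∧ |D'| ≤ -D)
    (hM : Filter.Tendsto M Filter.atTop (nhds 0)) : |M 0| ≤ K 0 := by
  have key : ∀ σ : ℝ, |σ| = 1 → 0 ≤ K 0 + σ * M 0 := by
    intro σ hσ
    have hanti : Antitone fun τ => K τ + σ * M τ := by
      choose D D' hD hD' hle using h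
      have hd : ∀ τ, HasDerivAt (fun τ => K τ + σ * M τ) (D τ + σ * D' τ) τ :=
        fun τ => (hD τ).add ((hD' τ).const_mul σ)
      refine antitone_of_deriv_nonpos (fun τ => (hd τ).differentiableAt) fun τ => ?_
      rw [(hd τ).deriv]
      have : σ * D' τ ≤ |D' τ| := by
        refine (le_abs_self _).trans_eq ?_
        rw [abs_mul, hσ, one_mul]
      linarith [hle τ]
    have h2 : Filter.Tendsto (fun τ => σ * M τ) Filter.atTop (nhds 0) := by
      simpa using hM.const_mul σ
    refine le_of_tendsto h2 ?_
    filter_upwards [Filter.eventually_ge_atTop 0] with τ hτ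
    have := hanti hτ
    simp only at this
    linarith [hK τ]
  have h1 := key 1 (by simp)
  have h2 := key (-1) (by simp)
  exact abs_le.2 ⟨by linarith, by linarith⟩

lemma bell_nonneg {C γ P Q A B : ℝ} (hC : 0 ≤ C) (hA : 0 < A) (hB : 0 < B) :
    0 ≤ bell C γ P Q A B := by
  have := (Real.rpow_pos_of_pos (bellW_pos P Q hA hB) γ)
  have h2 := Real.rpow_pos_of_pos hB Q
  unfold bell
  positivity

lemma bell_le {C γ P Q A B : ℝ} (hC : 0 ≤ C) (hA : 0 < A) (hB : 0 < B) (hγ1 : γ < 1)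
    (hP : P * (1 - γ) = 1) : bell C γ P Q A B ≤ (1 + C) * (A ^ P + B ^ Q) := by
  have hW := bellW_pos P Q hA hB
  have haP := Real.rpow_pos_of_pos hA P
  have hbQ := Real.rpow_pos_of_pos hB Q
  have h1 : A ≤ bellW P Q A B ^ (1 - γ) := by
    have e2 : A = (A ^ P) ^ (1 - γ) := by rw [← Real.rpow_mul hA.le, hP, Real.rpow_one]
    nth_rewrite 1 [e2]
    exact Real.rpow_le_rpow haP.le (by unfold bellW; linarith) (by linarith)
  have h2 : A * bellW P Q A B ^ γ ≤ bellW P Q A B := by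
    calc A * bellW P Q A B ^ γ ≤ bellW P Q A B ^ (1 - γ) * bellW P Q A B ^ γ := by gcongr
      _ = bellW P Q A B := by rw [← Real.rpow_add hW]; simp
  unfold bell
  unfold bellW at *
  nlinarith [mul_nonneg hC haP.le]

/-- Continuity of a regularized `L^p` integral in the regularization parameter. -/
lemma tendsto_integral_reg (S T : ℝ) {P : ℝ} (hP : 0 ≤ P) {f : ℝ × ℝ → ℂ} (hf : Continuous f) :
    Filter.Tendsto (fun ε : ℝ => ∫ x, (ε + ‖f x‖ ^ 2) ^ P ∂boxMeasure S T)
      (nhdsWithin 0 (Ioi 0)) (nhds (∫ x, ‖f x‖ ^ (2 * P) ∂boxMeasure S T)) := by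
  have h0 : ∫ x, ‖f x‖ ^ (2 * P) ∂boxMeasure S T = ∫ x, (0 + ‖f x‖ ^ 2) ^ P ∂boxMeasure S T := by
    congr 1
    ext x
    rw [zero_add, Real.rpow_mul (norm_nonneg _)]
    simp
  rw [h0]
  refine tendsto_integral_filter_of_dominated_convergence (fun x => (1 + ‖f x‖ ^ 2) ^ P) ?_ ?_ ?_ ?_
  · exact Filter.Eventually.of_forall fun ε =>
      (Continuous.rpow_const (by fun_prop) fun x => Or.inr hP).aestronglyMeasurable
  · filter_upwards [self_mem_nhdsWithin, mem_nhdsWithin_of_mem_nhds (Iio_mem_nhds one_pos)]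
      with ε hε hε1
    refine Filter.Eventually.of_forall fun x => ?_
    have hε0 : (0 : ℝ) < ε := hε
    have hε2 : ε < 1 := hε1
    rw [Real.norm_of_nonneg (by positivity)]
    gcongr
  · exact (Continuous.rpow_const (by fun_prop) fun x => Or.inr hP).integrable_box S T
  · refine Filter.Eventually.of_forall fun x => ?_
    have : Continuous fun ε : ℝ => (ε + ‖f x‖ ^ 2) ^ P :=
      Continuous.rpow_const (by fun_prop) fun x => Or.inr hP
    exact this.continuousWithinAt

end Pairing

lemma trig_pairing_aux {γ P Q C : ℝ} (hγ : 0 ≤ γ) (hγ1 : γ < 1) (hP : P * (1 - γ) = 1)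
    (hQ : Q * (1 + γ) = 1) (hC0 : 0 ≤ C) (hC : 25 ≤ 2 * C * Q * (2 * Q - 1))
    {S T : ℝ} (hS : 0 < S) (hT : 0 < T) (N : Finset (ℤ × ℤ)) (c d : ℤ × ℤ → ℂ) {M : ℝ → ℝ}
    (i j : Fin 2) (hM : ∀ τ, ∃ D', HasDerivAt M D' τ ∧
      |D'| ≤ 2 * ∫ x, ‖trigFlow S T N (trigDeriv S T i c) τ x‖ *
        ‖trigFlow S T N (trigDeriv S T j d) τ x‖ ∂boxMeasure S T)
    (hM0 : Filter.Tendsto M Filter.atTop (nhds 0)) :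
    |M 0| ≤ (1 + C) * ((∫ x, ‖trigFlow S T N c 0 x‖ ^ (2 * P) ∂boxMeasure S T) +
      ∫ x, ‖trigFlow S T N d 0 x‖ ^ (2 * Q) ∂boxMeasure S T) := by
  have hP0 : 0 ≤ P := by nlinarith
  have hQ0 : 0 ≤ Q := by nlinarith
  have key : ∀ ε : ℝ, 0 < ε → |M 0| ≤ (1 + C) *
      ((∫ x, (ε + ‖trigFlow S T N c 0 x‖ ^ 2) ^ P ∂boxMeasure S T) +
      ∫ x, (ε + ‖trigFlow S T N d 0 x‖ ^ 2) ^ Q ∂boxMeasure S T) := by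
    intro ε hε
    have h1 := abs_le_of_dissipation (K := fun τ => ∫ x, bell C γ P Q (trigSq S T N c ε τ x)
        (trigSq S T N d ε τ x) ∂boxMeasure S T) (M := M)
      (fun τ => integral_nonneg fun x =>
        bell_nonneg hC0 (trigSq_pos S T N c hε τ x) (trigSq_pos S T N d hε τ x))
      (fun τ => by
        obtain ⟨D, hD, hle⟩ := hasDerivAt_bell_integral N c d C γ P Q hS hT hε hγ hγ1 hP hQ hC τ
        obtain ⟨D', hD', hle'⟩ := hM τ
        exact ⟨D, D', hD, hD', by linarith [hle i j]⟩) hM0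
    have hcA : Continuous fun x => (trigSq S T N c ε 0 x) ^ P :=
      Continuous.rpow_const (by fun_prop) fun x => Or.inr hP0
    have hcB : Continuous fun x => (trigSq S T N d ε 0 x) ^ Q :=
      Continuous.rpow_const (by fun_prop) fun x => Or.inr hQ0
    refine h1.trans ?_
    change _ ≤ (1 + C) * ((∫ x, trigSq S T N c ε 0 x ^ P ∂boxMeasure S T) +
      ∫ x, trigSq S T N d ε 0 x ^ Q ∂boxMeasure S T)
    rw [← integral_add (hcA.integrable_box S T) (hcB.integrable_box S T), ← integral_const_mul]
    refine integral_mono (Continuous.integrable_box ?_ S T)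
      (((hcA.add hcB).const_mul (1 + C)).integrable_box S T) fun x => ?_
    · exact continuous_bell (continuous_trigSq_right S T N c 0) (continuous_trigSq_right S T N d 0)
        (trigSq_pos S T N c hε 0) (trigSq_pos S T N d hε 0)
    · exact bell_le hC0 (trigSq_pos S T N c hε 0 x) (trigSq_pos S T N d hε 0 x) hγ1 hP
  have hlim := ((tendsto_integral_reg S T hP0
    (continuous_trigFlow_right (S := S) (T := T) (N := N) (c := c) 0)).add
    (tendsto_integral_reg S T hQ0
    (continuous_trigFlow_right (S := S) (T := T) (N := N) (c := d) 0))).const_mul (1 + C)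
  refine ge_of_tendsto hlim ?_
  filter_upwards [self_mem_nhdsWithin] with ε hε using key ε hε

lemma trig_pairing {p q : ℝ} (hpq : p.HolderConjugate q) : ∃ K : ℝ, 0 < K ∧ ∀ {S T : ℝ}, 0 < S →
    0 < T → ∀ (N : Finset (ℤ × ℤ)) (c e : ℤ × ℤ → ℂ) (i j : Fin 2),
    |∫ x, (trigFlow S T N c 0 x * trigFlow S T N (trigDeriv S T i (trigDeriv S T j e)) 0 x).re
      ∂boxMeasure S T| ≤ K * ((∫ x, ‖trigFlow S T N c 0 x‖ ^ p ∂boxMeasure S T) +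
      ∫ x, ‖trigFlow S T N (trigLap S T e) 0 x‖ ^ q ∂boxMeasure S T) := by
  have h1 := hpq.inv_add_inv_eq_one
  have hp0 := hpq.pos
  have hq0 := hpq.symm.pos
  have hp1 := hpq.lt
  have hq1 := hpq.symm.lt
  have hmul := hpq.mul_eq_add
  have hconst : ∀ r : ℝ, 1 < r → r ≤ 2 →
      25 ≤ 2 * (25 / (r * (r - 1))) * (r / 2) * (2 * (r / 2) - 1) := by
    intro r hr hr2
    have h1 : 0 < r - 1 := by linarith
    have h2 : 0 < r := by linarith
    apply le_of_eq
    field_simp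
  rcases le_total 2 p with h2 | h2
  · have hq2 : q ≤ 2 := by nlinarith
    refine ⟨1 + 25 / (q * (q - 1)), ?_, fun {S T} hS hT N c e i j => ?_⟩
    · have : 0 < q - 1 := by linarith
      positivity
    have hC0 : 0 ≤ 25 / (q * (q - 1)) := by
      have : 0 < q - 1 := by linarith
      positivity
    have := trig_pairing_aux (γ := 1 - 2 / p) (P := p / 2) (Q := q / 2) (C := 25 / (q * (q - 1)))
      (by rw [sub_nonneg, div_le_one hp0]; exact h2) (by have := div_pos two_pos hp0; linarith)
      (by field_simp; ring) (by field_simp; linarith) hC0 (hconst q hq1 hq2) hS hT N c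
      (trigLap S T e) i j
      (fun τ => hasDerivAt_trigPairing N c e hS hT i j τ) (tendsto_trigPairing N c e i j)
    rw [mul_div_cancel₀ _ two_ne_zero, mul_div_cancel₀ _ two_ne_zero] at this
    exact this
  · have hq2 : 2 ≤ q := by nlinarith
    refine ⟨1 + 25 / (p * (p - 1)), ?_, fun {S T} hS hT N c e i j => ?_⟩
    · have : 0 < p - 1 := by linarith
      positivity
    have hC0 : 0 ≤ 25 / (p * (p - 1)) := by
      have : 0 < p - 1 := by linarith
      positivity
    have := trig_pairing_aux (γ := 1 - 2 / q) (P := q / 2) (Q := p / 2) (C := 25 / (p * (p - 1)))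
      (by rw [sub_nonneg, div_le_one hq0]; exact hq2) (by have := div_pos two_pos hq0; linarith)
      (by field_simp; ring) (by field_simp; linarith) hC0 (hconst p hp1 h2) hS hT N
      (trigLap S T e) c j i
      (fun τ => by
        obtain ⟨D, h1, h2⟩ := hasDerivAt_trigPairing N c e hS hT i j τ
        refine ⟨D, h1, h2.trans_eq ?_⟩
        simp only [mul_comm])
      (tendsto_trigPairing N c e i j)
    rw [mul_div_cancel₀ _ two_ne_zero, mul_div_cancel₀ _ two_ne_zero, add_comm (∫ x, _ ∂_)] at this
    exact this

/-! ### Density of trigonometric polynomials and the Calderón–Zygmund estimate on tori -/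

lemma periodic_zsmul {X : Type*} {f : ℝ → X} {c : ℝ} (h : ∀ t, f (t + c) = f t) (n : ℤ) (t : ℝ) :
    f (t + n * c) = f t :=
  (show Function.Periodic f c from h).int_mul n t

/-- Trigonometric polynomials are uniformly dense in continuous doubly periodic functions. -/
lemma exists_trigFlow_near {S T : ℝ} (hS : S ≠ 0) (hT : T ≠ 0) {F : ℝ × ℝ → ℂ} (hF : Continuous F)
    (hp1 : ∀ s t, F (s + S, t) = F (s, t)) (hp2 : ∀ s t, F (s, t + T) = F (s, t)) {ε : ℝ}
    (hε : 0 < ε) : ∃ (N : Finset (ℤ × ℤ)) (c : ℤ × ℤ → ℂ),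
      ∀ x, ‖F x - trigFlow S T N c 0 x‖ < ε := by
  set π : C(Fin 2 → ℝ, UnitAddTorus (Fin 2)) := ⟨Pi.map fun _ => ((↑) : ℝ → UnitAddCircle),
    Continuous.piMap fun _ => continuous_quotient_mk'⟩ with hπ
  have hq : Topology.IsQuotientMap π :=
    (IsOpenQuotientMap.piMap fun _ => QuotientAddGroup.isOpenQuotientMap_mk).isQuotientMap
  set G : C(Fin 2 → ℝ, ℂ) := ⟨fun y => F (S * y 0, T * y 1), by fun_prop⟩ with hG
  have hfac : Function.FactorsThrough G π := by
    intro a b hab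
    have hi : ∀ i, ∃ n : ℤ, b i = a i + n := by
      intro i
      have h1 : ((a i : ℝ) : UnitAddCircle) = (b i : ℝ) := congrFun hab i
      obtain ⟨n, hn⟩ := AddSubgroup.mem_zmultiples_iff.1 (QuotientAddGroup.eq.1 h1)
      exact ⟨n, by simp at hn; linarith⟩
    obtain ⟨n, hn⟩ := hi 0
    obtain ⟨m, hm⟩ := hi 1
    simp only [hG, ContinuousMap.coe_mk, hn, hm]
    have e1 : S * (a 0 + n) = S * a 0 + n * S := by ring
    have e2 : T * (a 1 + m) = T * a 1 + m * T := by ring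
    rw [e1, e2, periodic_zsmul (f := fun t => F (_, t)) (fun t => hp2 _ t) m,
      periodic_zsmul (f := fun s => F (s, _)) (fun s => hp1 s _) n]
  set H : C(UnitAddTorus (Fin 2), ℂ) := hq.lift G hfac with hH
  have hHG : ∀ y, H (π y) = G y := fun y => congrArg (fun f : C(Fin 2 → ℝ, ℂ) => f y)
    (hq.lift_comp G hfac)
  have hmem : H ∈ (Submodule.span ℂ (range <| UnitAddTorus.mFourier (d := Fin 2))).topologicalClosure := by
    rw [UnitAddTorus.span_mFourier_closure_eq_top]
    trivial
  obtain ⟨g, hg, hd⟩ := Metric.mem_closure_iff.1 hmem ε hε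
  obtain ⟨c, hc⟩ := Finsupp.mem_span_range_iff_exists_finsupp.1 hg
  refine ⟨c.support.map (finTwoArrowEquiv ℤ).toEmbedding,
    fun k => c ((finTwoArrowEquiv ℤ).symm k), fun x => ?_⟩
  have hx : F x = H (π ![x.1 / S, x.2 / T]) := by
    rw [hHG]
    simp only [hG, ContinuousMap.coe_mk, Matrix.cons_val_zero, Matrix.cons_val_one]
    rw [mul_div_cancel₀ _ hS, mul_div_cancel₀ _ hT]
  have hgx : trigFlow S T (c.support.map (finTwoArrowEquiv ℤ).toEmbedding)
      (fun k => c ((finTwoArrowEquiv ℤ).symm k)) 0 x = g (π ![x.1 / S, x.2 / T]) := by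
    rw [← hc, Finsupp.sum, trigFlow, Finset.sum_map]
    rw [ContinuousMap.coe_sum, Finset.sum_apply]
    refine Finset.sum_congr rfl fun k _ => ?_
    simp only [Equiv.coe_toEmbedding, Equiv.symm_apply_apply, ContinuousMap.coe_smul,
      Pi.smul_apply, smul_eq_mul]
    congr 1
    simp only [UnitAddTorus.mFourier, ContinuousMap.coe_mk, Fin.prod_univ_two, hπ, Pi.map_apply,
      fourier_coe_apply, Matrix.cons_val_zero, Matrix.cons_val_one, finTwoArrowEquiv_apply,
      ← Complex.exp_add, freq]
    congr 1
    have hS' : (S : ℂ) ≠ 0 := by exact_mod_cast hS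
    have hT' : (T : ℂ) ≠ 0 := by exact_mod_cast hT
    simp
    field_simp
  rw [hx, hgx, ← dist_eq_norm]
  exact (ContinuousMap.dist_apply_le_dist _).trans_lt hd

lemma continuous_dualityMap {p : ℝ} (hp : 1 < p) :
    Continuous fun z : ℂ => (starRingEnd ℂ) z * ((‖z‖ ^ (p - 2) : ℝ) : ℂ) := by
  refine continuous_iff_continuousAt.2 fun z => ?_
  rcases eq_or_ne z 0 with rfl | hz
  · have h : ∀ z : ℂ, ‖(starRingEnd ℂ) z * ((‖z‖ ^ (p - 2) : ℝ) : ℂ)‖ = ‖z‖ ^ (p - 1) := by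
      intro z
      rcases eq_or_ne z 0 with rfl | hz
      · simp [Real.zero_rpow (by linarith : p - 1 ≠ 0)]
      · rw [norm_mul, RCLike.norm_conj, Complex.norm_real, Real.norm_of_nonneg (by positivity)]
        nth_rewrite 1 [← Real.rpow_one ‖z‖]
        rw [← Real.rpow_add (norm_pos_iff.2 hz)]
        ring_nf
    rw [ContinuousAt, map_zero, zero_mul, tendsto_zero_iff_norm_tendsto_zero]
    simp only [h]
    have : Continuous fun z : ℂ => ‖z‖ ^ (p - 1) :=
      continuous_norm.rpow_const fun _ => Or.inr (by linarith)
    have := this.tendsto 0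
    simpa [Real.zero_rpow (by linarith : p - 1 ≠ 0)] using this
  · exact ContinuousAt.mul (by fun_prop) (Complex.continuous_ofReal.continuousAt.comp
      (continuous_norm.continuousAt.rpow_const (Or.inl (norm_ne_zero_iff.2 hz))))

lemma norm_dualityMap {p : ℝ} (hp : 1 < p) (z : ℂ) :
    ‖(starRingEnd ℂ) z * ((‖z‖ ^ (p - 2) : ℝ) : ℂ)‖ = ‖z‖ ^ (p - 1) := by
  rcases eq_or_ne z 0 with rfl | hz
  · simp [Real.zero_rpow (by linarith : p - 1 ≠ 0)]
  · rw [norm_mul, RCLike.norm_conj, Complex.norm_real, Real.norm_of_nonneg (by positivity)]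
    nth_rewrite 1 [← Real.rpow_one ‖z‖]
    rw [← Real.rpow_add (norm_pos_iff.2 hz)]
    ring_nf

lemma dualityMap_mul {p : ℝ} (hp : 1 < p) (z : ℂ) :
    (starRingEnd ℂ) z * ((‖z‖ ^ (p - 2) : ℝ) : ℂ) * z = ((‖z‖ ^ p : ℝ) : ℂ) := by
  rcases eq_or_ne z 0 with rfl | hz
  · simp [Real.zero_rpow (by linarith : p ≠ 0)]
  · have h1 : ‖z‖ ^ p = ‖z‖ ^ 2 * ‖z‖ ^ (p - 2) := by
      rw [← Real.rpow_natCast, ← Real.rpow_add (norm_pos_iff.2 hz)]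
      norm_num
    rw [h1, mul_right_comm, Complex.conj_mul']
    push_cast
    ring

/-- A bound on the pairings with trigonometric polynomials bounds the `L^p` norm. -/
lemma integral_rpow_le_of_pairing {p q : ℝ} (hpq : p.HolderConjugate q) {K : ℝ} (hK : 0 ≤ K) :
    ∃ K' : ℝ, 0 < K' ∧ ∀ {S T : ℝ}, 0 < S → 0 < T → ∀ {F : ℝ × ℝ → ℂ}, Continuous F →
      (∀ s t, F (s + S, t) = F (s, t)) → (∀ s t, F (s, t + T) = F (s, t)) → ∀ X : ℝ,
      (∀ (N : Finset (ℤ × ℤ)) (c : ℤ × ℤ → ℂ), ∫ x, (trigFlow S T N c 0 x * F x).re ∂boxMeasure S T ≤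
        X + K * ∫ x, ‖trigFlow S T N c 0 x‖ ^ q ∂boxMeasure S T) →
      ∫ x, ‖F x‖ ^ p ∂boxMeasure S T ≤ K' * X := by
  have hp1 := hpq.lt
  have hq1 := hpq.symm.lt
  have hpq' : (p - 1) * q = p := hpq.sub_one_mul_conj
  set lam : ℝ := (2 * K + 1)⁻¹ ^ (q - 1)⁻¹ with hlam
  have hlam0 : 0 < lam := by positivity
  have hlamq : K * lam ^ q ≤ lam / 2 := by
    have h1 : lam ^ (q - 1) = (2 * K + 1)⁻¹ := by
      rw [hlam, ← Real.rpow_mul (by positivity), inv_mul_cancel₀ (by linarith), Real.rpow_one]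
    have h2 : lam ^ q = (2 * K + 1)⁻¹ * lam := by
      rw [← h1, ← Real.rpow_add_one hlam0.ne']
      ring_nf
    have h3 : K * (2 * K + 1)⁻¹ ≤ 1 / 2 := by
      rw [mul_inv_le_iff₀ (by positivity)]
      linarith
    rw [h2]
    nlinarith
  refine ⟨2 / lam, by positivity, fun {S T} hS hT {F} hF hp1' hp2' X hX => ?_⟩
  set h : ℝ × ℝ → ℂ := fun x => lam * ((starRingEnd ℂ) (F x) * ((‖F x‖ ^ (p - 2) : ℝ) : ℂ)) with hh
  have hhc : Continuous h := continuous_const.mul ((continuous_dualityMap hp1).comp hF)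
  have hhn : ∀ x, ‖h x‖ = lam * ‖F x‖ ^ (p - 1) := by
    intro x
    rw [hh, norm_mul, norm_dualityMap hp1, Complex.norm_real, Real.norm_of_nonneg hlam0.le]
  have hFp : Continuous fun x => ‖F x‖ ^ p := hF.norm.rpow_const fun _ => Or.inr (by linarith)
  have key : ∀ ε : ℝ, 0 < ε → lam * ∫ x, ‖F x‖ ^ p ∂boxMeasure S T ≤
      ε * (∫ x, ‖F x‖ ∂boxMeasure S T) + (X + K * ∫ x, (‖h x‖ + ε) ^ q ∂boxMeasure S T) := by
    intro ε hε
    obtain ⟨N, c, hc⟩ := exists_trigFlow_near hS.ne' hT.ne' hhc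
      (fun s t => by simp only [hh, hp1']) (fun s t => by simp only [hh, hp2']) hε
    have h1 : ∫ x, (h x * F x).re ∂boxMeasure S T = lam * ∫ x, ‖F x‖ ^ p ∂boxMeasure S T := by
      rw [← integral_const_mul]
      congr 1
      ext x
      rw [hh, mul_assoc, dualityMap_mul hp1, ← Complex.ofReal_mul, Complex.ofReal_re]
    have h2 : ∫ x, (h x * F x).re ∂boxMeasure S T ≤
        ∫ x, (ε * ‖F x‖ + (trigFlow S T N c 0 x * F x).re) ∂boxMeasure S T := by
      refine integral_mono ((by fun_prop : Continuous fun x => (h x * F x).re).integrable_box S T)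
        ((by fun_prop : Continuous fun x =>
          ε * ‖F x‖ + (trigFlow S T N c 0 x * F x).re).integrable_box S T) fun x => ?_
      have e : (h x * F x).re =
          ((h x - trigFlow S T N c 0 x) * F x).re + (trigFlow S T N c 0 x * F x).re := by
        rw [← Complex.add_re]
        ring_nf
      simp only [e]
      gcongr
      refine (Complex.re_le_norm _).trans ?_
      rw [norm_mul]
      gcongr
      exact (hc x).le
    rw [integral_add ((by fun_prop : Continuous _).integrable_box S T)
      ((by fun_prop : Continuous _).integrable_box S T), integral_const_mul] at h2
    have h3 : ∫ x, ‖trigFlow S T N c 0 x‖ ^ q ∂boxMeasure S T ≤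
        ∫ x, (‖h x‖ + ε) ^ q ∂boxMeasure S T := by
      refine integral_mono ((Continuous.rpow_const (by fun_prop) fun x =>
          Or.inr (by linarith)).integrable_box S T)
        ((Continuous.rpow_const (by fun_prop) fun x =>
          Or.inr (by linarith)).integrable_box S T) fun x => ?_
      refine Real.rpow_le_rpow (norm_nonneg _) ?_ (by linarith)
      have := norm_sub_norm_le (trigFlow S T N c 0 x) (h x)
      rw [norm_sub_rev] at this
      linarith [hc x]
    have h4 := hX N c
    have h5 := mul_le_mul_of_nonneg_left h3 hK
    linarith
  have hlim : Filter.Tendsto (fun ε : ℝ => ε * (∫ x, ‖F x‖ ∂boxMeasure S T) +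
      (X + K * ∫ x, (‖h x‖ + ε) ^ q ∂boxMeasure S T)) (nhdsWithin 0 (Ioi 0))
      (nhds (0 * (∫ x, ‖F x‖ ∂boxMeasure S T) +
      (X + K * ∫ x, (‖h x‖ + 0) ^ q ∂boxMeasure S T))) := by
    refine ((tendsto_nhdsWithin_of_tendsto_nhds Filter.tendsto_id).mul_const _).add
      ((Filter.Tendsto.const_mul K ?_).const_add X)
    refine tendsto_integral_filter_of_dominated_convergence (fun x => (‖h x‖ + 1) ^ q) ?_ ?_ ?_ ?_
    · exact Filter.Eventually.of_forall fun ε => (Continuous.rpow_const (by fun_prop)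
        fun x => Or.inr (by linarith)).aestronglyMeasurable
    · filter_upwards [self_mem_nhdsWithin, mem_nhdsWithin_of_mem_nhds (Iio_mem_nhds one_pos)]
        with ε hε hε1
      refine Filter.Eventually.of_forall fun x => ?_
      have hε0 : (0 : ℝ) < ε := hε
      have hε2 : ε < 1 := hε1
      rw [Real.norm_of_nonneg (by positivity)]
      gcongr
    · exact (Continuous.rpow_const (by fun_prop) fun x => Or.inr (by linarith)).integrable_box S T
    · refine Filter.Eventually.of_forall fun x => ?_
      have : Continuous fun ε : ℝ => (‖h x‖ + ε) ^ q :=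
        Continuous.rpow_const (by fun_prop) fun x => Or.inr (by linarith)
      exact this.continuousWithinAt
  have hfin := ge_of_tendsto hlim (by
    filter_upwards [self_mem_nhdsWithin] with ε hε using key ε hε)
  have hhq : ∫ x, (‖h x‖ + 0) ^ q ∂boxMeasure S T =
      lam ^ q * ∫ x, ‖F x‖ ^ p ∂boxMeasure S T := by
    rw [← integral_const_mul]
    congr 1
    ext x
    rw [add_zero, hhn, Real.mul_rpow hlam0.le (by positivity), ← Real.rpow_mul (norm_nonneg _), hpq']
  rw [hhq] at hfin
  have hI : 0 ≤ ∫ x, ‖F x‖ ^ p ∂boxMeasure S T := integral_nonneg fun x => by positivity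
  have := mul_le_mul_of_nonneg_right hlamq hI
  rw [div_mul_eq_mul_div, le_div_iff₀ hlam0]
  linarith

lemma trig_calderon {q : ℝ} (hq : 1 < q) : ∃ K : ℝ, 0 < K ∧ ∀ {S T : ℝ}, 0 < S → 0 < T →
    ∀ (N : Finset (ℤ × ℤ)) (e : ℤ × ℤ → ℂ) (i j : Fin 2),
    ∫ x, ‖trigFlow S T N (trigDeriv S T i (trigDeriv S T j e)) 0 x‖ ^ q ∂boxMeasure S T ≤
      K * ∫ x, ‖trigFlow S T N (trigLap S T e) 0 x‖ ^ q ∂boxMeasure S T := by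
  have hqp := Real.HolderConjugate.conjExponent hq
  obtain ⟨K, hK, h⟩ := trig_pairing hqp.symm
  obtain ⟨K', hK', h'⟩ := integral_rpow_le_of_pairing hqp hK.le
  refine ⟨K' * K, by positivity, fun {S T} hS hT N e i j => ?_⟩
  rw [mul_assoc]
  refine h' hS hT (continuous_trigFlow_right 0) (fun s t => trigFlow_periodic_fst hS.ne' 0 s t)
    (fun s t => trigFlow_periodic_snd hT.ne' 0 s t) _ fun N' c => ?_
  -- pass to a common set of modes
  have ext1 : ∀ (M M' : Finset (ℤ × ℤ)) (c : ℤ × ℤ → ℂ) (x : ℝ × ℝ), M ⊆ M' →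
      trigFlow S T M c 0 x = trigFlow S T M' (fun k => if k ∈ M then c k else 0) 0 x := by
    intro M M' c x hM
    unfold trigFlow
    rw [← Finset.sum_subset hM fun k _ hk => by simp [hk]]
    exact Finset.sum_congr rfl fun k hk => by simp [hk]
  have e1 : ∀ x, trigFlow S T N (trigDeriv S T i (trigDeriv S T j e)) 0 x = trigFlow S T (N ∪ N')
      (trigDeriv S T i (trigDeriv S T j fun k => if k ∈ N then e k else 0)) 0 x := by
    intro x
    rw [ext1 N (N ∪ N') _ x Finset.subset_union_left]
    congr 1
    ext k
    by_cases hk : k ∈ N <;> simp [trigDeriv, hk]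
  have e2 : ∀ x, trigFlow S T N (trigLap S T e) 0 x = trigFlow S T (N ∪ N')
      (trigLap S T fun k => if k ∈ N then e k else 0) 0 x := by
    intro x
    rw [ext1 N (N ∪ N') _ x Finset.subset_union_left]
    congr 1
    ext k
    by_cases hk : k ∈ N <;> simp [trigLap, hk]
  have := h hS hT (N ∪ N') (fun k => if k ∈ N' then c k else 0) (fun k => if k ∈ N then e k else 0)
    i j
  simp only [← e1, ← e2, ← ext1 N' (N ∪ N') c _ Finset.subset_union_right] at this
  linarith [le_abs_self (∫ x, (trigFlow S T N' c 0 x *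
    trigFlow S T N (trigDeriv S T i (trigDeriv S T j e)) 0 x).re ∂boxMeasure S T)]

/-- The average of a trigonometric polynomial is controlled by its `L^q` norm. -/
lemma integral_norm_rpow_sub_const_le {S T : ℝ} (hS : 0 < S) (hT : 0 < T) {q : ℝ} (hq : 1 < q)
    {g h : ℝ × ℝ → ℂ} (hg : Continuous g) (hh : Continuous h) (m : ℂ) (hgm : ∀ x, g x = h x + m)
    (h0 : ∫ x, h x ∂boxMeasure S T = 0) :
    ∫ x, ‖h x‖ ^ q ∂boxMeasure S T ≤ 2 ^ q * ∫ x, ‖g x‖ ^ q ∂boxMeasure S T := by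
  have hq0 : 0 ≤ q := by linarith
  have hne : NeZero (boxMeasure S T) := by
    refine ⟨fun h => ?_⟩
    have h1 : boxMeasure S T univ = 0 := by rw [h]; simp
    rw [boxMeasure, Measure.restrict_apply_univ, Measure.volume_eq_prod, Measure.prod_prod] at h1
    simp [not_le.2 hS, not_le.2 hT] at h1
  have harea : 0 < (boxMeasure S T).real univ :=
    measureReal_univ_pos (μ := boxMeasure S T)
  have hgq : Continuous fun x => ‖g x‖ ^ q := hg.norm.rpow_const fun _ => Or.inr hq0
  have hhq : Continuous fun x => ‖h x‖ ^ q := hh.norm.rpow_const fun _ => Or.inr hq0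
  have hm : (boxMeasure S T).real univ * ‖m‖ ^ q ≤ ∫ x, ‖g x‖ ^ q ∂boxMeasure S T := by
    have h1 : ∫ x, g x ∂boxMeasure S T = (boxMeasure S T).real univ • m := by
      simp only [hgm]
      rw [integral_add (hh.integrable_box S T) (integrable_const _), h0, zero_add, integral_const]
    have h2 : ‖m‖ ≤ ⨍ x, ‖g x‖ ∂boxMeasure S T := by
      have := norm_integral_le_integral_norm (μ := boxMeasure S T) g
      rw [h1, norm_smul, Real.norm_of_nonneg harea.le] at this
      rw [average_eq, smul_eq_mul, inv_mul_eq_div, le_div_iff₀ harea]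
      linarith
    have h3 := (convexOn_rpow hq.le).map_average_le (μ := boxMeasure S T) (f := fun x => ‖g x‖)
      (Real.continuous_rpow_const hq0).continuousOn isClosed_Ici
      (Filter.Eventually.of_forall fun x => norm_nonneg (g x)) (hg.norm.integrable_box S T)
      (hgq.integrable_box S T)
    have h4 : ‖m‖ ^ q ≤ ⨍ x, ‖g x‖ ^ q ∂boxMeasure S T :=
      (Real.rpow_le_rpow (norm_nonneg _) h2 hq0).trans h3
    rw [average_eq, smul_eq_mul, inv_mul_eq_div, le_div_iff₀ harea] at h4
    linarith
  have hpt : ∀ x, ‖h x‖ ^ q ≤ 2 ^ (q - 1) * (‖g x‖ ^ q + ‖m‖ ^ q) := by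
    intro x
    have h1 : ‖h x‖ ≤ ‖g x‖ + ‖m‖ := by
      have : h x = g x - m := by rw [hgm]; ring
      rw [this]
      exact norm_sub_le _ _
    have h2 := NNReal.rpow_add_le_mul_rpow_add_rpow ‖g x‖₊ ‖m‖₊ hq.le
    exact (Real.rpow_le_rpow (norm_nonneg _) h1 hq0).trans (by exact_mod_cast h2)
  calc ∫ x, ‖h x‖ ^ q ∂boxMeasure S T
      ≤ ∫ x, 2 ^ (q - 1) * (‖g x‖ ^ q + ‖m‖ ^ q) ∂boxMeasure S T :=
        integral_mono (hhq.integrable_box S T)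
          (((hgq.add continuous_const).const_mul _).integrable_box S T) hpt
    _ = 2 ^ (q - 1) * ((∫ x, ‖g x‖ ^ q ∂boxMeasure S T) +
          (boxMeasure S T).real univ * ‖m‖ ^ q) := by
        rw [integral_const_mul, integral_add (hgq.integrable_box S T) (integrable_const _),
          integral_const, smul_eq_mul]
    _ ≤ 2 ^ (q - 1) * (2 * ∫ x, ‖g x‖ ^ q ∂boxMeasure S T) := by
        gcongr
        linarith
    _ = 2 ^ q * ∫ x, ‖g x‖ ^ q ∂boxMeasure S T := by
        rw [← mul_assoc, ← Real.rpow_add_one two_ne_zero]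
        ring_nf

lemma integral_mul_trigFlow {S T : ℝ} (hS : 0 < S) (hT : 0 < T) {η η' : ℝ × ℝ → ℂ} (j : Fin 2)
    (hη : Continuous η) (hη' : Continuous η')
    (hd : ∀ x, HasDerivAt (fun r => η (setCoord j x r)) (η' x) (getCoord j x))
    (hp1 : ∀ s t, η (s + S, t) = η (s, t)) (hp2 : ∀ s t, η (s, t + T) = η (s, t))
    (N : Finset (ℤ × ℤ)) (c : ℤ × ℤ → ℂ) :
    ∫ x, η' x * trigFlow S T N c 0 x ∂boxMeasure S T =
      -∫ x, η x * trigFlow S T N (trigDeriv S T j c) 0 x ∂boxMeasure S T := by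
  rw [← add_eq_zero_iff_eq_neg, ← integral_add ((by fun_prop : Continuous _).integrable_box S T)
    ((by fun_prop : Continuous _).integrable_box S T)]
  refine integral_box_deriv hS.le hT.le j
    (F := fun x => η x * trigFlow S T N c 0 x) (by fun_prop) (fun x => ?_)
    (fun s t => ?_) (fun s t => ?_)
  · have := (hd x).mul (hasDerivAt_trigFlow (S := S) (T := T) (N := N) (c := c) j 0 x)
    rw [setCoord_getCoord] at this
    exact this
  · simp only [trigFlow_periodic_fst hS.ne', hp1]
  · simp only [trigFlow_periodic_snd hT.ne', hp2]

/-- The Calderón–Zygmund estimate for the Cauchy–Riemann operator on a torus, with a constant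
independent of the periods. -/
lemma torus_dbar {p : ℝ} (hp : 1 < p) : ∃ K : ℝ, 0 < K ∧ ∀ {S T : ℝ}, 0 < S → 0 < T →
    ∀ (η : ℝ × ℝ → ℂ) (ηd : Fin 2 → ℝ × ℝ → ℂ), Continuous η → (∀ j, Continuous (ηd j)) →
    (∀ j x, HasDerivAt (fun r => η (setCoord j x r)) (ηd j x) (getCoord j x)) →
    (∀ s t, η (s + S, t) = η (s, t)) → (∀ s t, η (s, t + T) = η (s, t)) →
    (∀ j s t, ηd j (s + S, t) = ηd j (s, t)) → (∀ j s t, ηd j (s, t + T) = ηd j (s, t)) →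
    ∀ j, ∫ x, ‖ηd j x‖ ^ p ∂boxMeasure S T ≤
      K * ∫ x, ‖ηd 0 x + Complex.I * ηd 1 x‖ ^ p ∂boxMeasure S T := by
  have hpq := Real.HolderConjugate.conjExponent hp
  set q := p.conjExponent
  have hq := hpq.symm.lt
  obtain ⟨K, hK, hcal⟩ := trig_calderon hq
  obtain ⟨K', hK', hdual⟩ := integral_rpow_le_of_pairing hpq
    (show 0 ≤ 2 ^ q * K * 2 ^ q by positivity)
  refine ⟨K', hK', fun {S T} hS hT η ηd hη hηd hd hp1 hp2 hdp1 hdp2 j => ?_⟩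
  refine hdual hS hT (hηd j) (hdp1 j) (hdp2 j) _ fun N c => ?_
  have hη0 := hηd 0
  have hη1 := hηd 1
  have hηj := hηd j
  -- solve the Poisson equation modulo constants
  set e : ℤ × ℤ → ℂ := fun k => if lapEig S T k = 0 then 0 else -c k / lapEig S T k with he
  set c₀ : ℤ × ℤ → ℂ := fun k => if lapEig S T k = 0 then c k else 0 with hc₀
  set m : ℂ := ∑ k ∈ N, c₀ k with hm
  have hgm : ∀ x, trigFlow S T N c 0 x = trigFlow S T N (trigLap S T e) 0 x + m := by
    intro x
    have h1 : c = fun k => trigLap S T e k + c₀ k := by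
      ext k
      by_cases hk : lapEig S T k = 0
      · simp [trigLap, he, hc₀, hk]
      · have : (lapEig S T k : ℂ) ≠ 0 := by exact_mod_cast hk
        simp only [trigLap, he, hc₀, hk, if_false, add_zero]
        field_simp
    have h2 : trigFlow S T N c₀ 0 x = m := by
      refine Finset.sum_congr rfl fun k _ => ?_
      by_cases hk : lapEig S T k = 0
      · have hk2 := hk
        unfold lapEig at hk2
        have i0 := sq_nonneg (freq S T 0 k)
        have i1 := sq_nonneg (freq S T 1 k)
        have j0 : freq S T 0 k = 0 := by
          have : freq S T 0 k ^ 2 = 0 := by linarith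
          simpa using this
        have j1 : freq S T 1 k = 0 := by
          have : freq S T 1 k ^ 2 = 0 := by linarith
          simpa using this
        simp [j0, j1]
      · simp [hc₀, hk]
    conv_lhs => rw [h1]
    rw [trigFlow_add, h2]
  set b : ℤ × ℤ → ℂ := trigDeriv S T j e with hb
  set ξ : ℝ × ℝ → ℂ := fun x => trigFlow S T N (trigDeriv S T 0 b) 0 x -
    Complex.I * trigFlow S T N (trigDeriv S T 1 b) 0 x with hξ
  have hξc : Continuous ξ := by fun_prop
  have hmean : ∀ j, ∫ x, ηd j x ∂boxMeasure S T = 0 := fun j =>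
    integral_box_deriv hS.le hT.le j (hηd j) (hd j) hp1 hp2
  have hI : ∀ i l, ∫ x, ηd i x * trigFlow S T N (trigDeriv S T l b) 0 x ∂boxMeasure S T =
      -∫ x, η x * trigFlow S T N (trigDeriv S T i (trigDeriv S T l b)) 0 x ∂boxMeasure S T :=
    fun i l => integral_mul_trigFlow hS hT i hη (hηd i) (hd i) hp1 hp2 N _
  have hint : ∀ {F : ℝ × ℝ → ℂ}, Continuous F → Integrable F (boxMeasure S T) :=
    fun hF => hF.integrable_box S T
  have hpair : ∫ x, trigFlow S T N c 0 x * ηd j x ∂boxMeasure S T =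
      ∫ x, (ηd 0 x + Complex.I * ηd 1 x) * ξ x ∂boxMeasure S T := by
    have h1 : ∫ x, trigFlow S T N c 0 x * ηd j x ∂boxMeasure S T =
        ∫ x, ηd j x * trigFlow S T N (trigLap S T e) 0 x ∂boxMeasure S T := by
      have : ∀ x, trigFlow S T N c 0 x * ηd j x =
          ηd j x * trigFlow S T N (trigLap S T e) 0 x + m * ηd j x := by
        intro x
        rw [hgm]
        ring
      simp only [this]
      rw [integral_add (hint (by fun_prop)) (hint (by fun_prop)), integral_const_mul, hmean,
        mul_zero, add_zero]
    have h2 : trigDeriv S T j (trigLap S T e) = trigLap S T b := by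
      ext k
      simp only [hb, trigDeriv, trigLap]
      ring
    rw [h1, integral_mul_trigFlow hS hT j hη (hηd j) (hd j) hp1 hp2 N, h2]
    simp only [trigFlow_lap, mul_add]
    rw [integral_add (hint (by fun_prop)) (hint (by fun_prop)), neg_add, ← hI, ← hI]
    have h3 : ∀ x, (ηd 0 x + Complex.I * ηd 1 x) * ξ x =
        (ηd 0 x * trigFlow S T N (trigDeriv S T 0 b) 0 x +
          ηd 1 x * trigFlow S T N (trigDeriv S T 1 b) 0 x) +
        Complex.I * (ηd 1 x * trigFlow S T N (trigDeriv S T 0 b) 0 x -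
          ηd 0 x * trigFlow S T N (trigDeriv S T 1 b) 0 x) := by
      intro x
      simp only [hξ]
      linear_combination (-ηd 1 x * trigFlow S T N (trigDeriv S T 1 b) 0 x) * Complex.I_sq
    have h4 : trigDeriv S T 1 (trigDeriv S T 0 b) = trigDeriv S T 0 (trigDeriv S T 1 b) := by
      ext k
      simp only [trigDeriv]
      ring
    simp only [h3]
    rw [integral_add (hint (by fun_prop)) (hint (by fun_prop)),
      integral_add (hint (by fun_prop)) (hint (by fun_prop)), integral_const_mul,
      integral_sub (hint (by fun_prop)) (hint (by fun_prop)), hI 1 0, hI 0 1, h4, sub_self,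
      mul_zero, add_zero]
  have hrpow : ∀ {F : ℝ × ℝ → ℂ} {r : ℝ}, 0 ≤ r → Continuous F →
      Integrable (fun x => ‖F x‖ ^ r) (boxMeasure S T) :=
    fun hr hF => (hF.norm.rpow_const fun _ => Or.inr hr).integrable_box S T
  have hp0 : 0 ≤ p := by linarith
  have hq0 : 0 ≤ q := by linarith
  have hre : ∫ x, (trigFlow S T N c 0 x * ηd j x).re ∂boxMeasure S T =
      (∫ x, trigFlow S T N c 0 x * ηd j x ∂boxMeasure S T).re :=
    integral_re (𝕜 := ℂ)
      (hint (by fun_prop : Continuous fun x => trigFlow S T N c 0 x * ηd j x))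
  rw [hre, hpair]
  have hξq : ∫ x, ‖ξ x‖ ^ q ∂boxMeasure S T ≤
      2 ^ q * K * ∫ x, ‖trigFlow S T N (trigLap S T e) 0 x‖ ^ q ∂boxMeasure S T := by
    have hpt : ∀ x, ‖ξ x‖ ^ q ≤ 2 ^ (q - 1) * (‖trigFlow S T N (trigDeriv S T 0 b) 0 x‖ ^ q +
        ‖trigFlow S T N (trigDeriv S T 1 b) 0 x‖ ^ q) := by
      intro x
      have h1 : ‖ξ x‖ ≤ ‖trigFlow S T N (trigDeriv S T 0 b) 0 x‖ +
          ‖trigFlow S T N (trigDeriv S T 1 b) 0 x‖ := by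
        refine (norm_sub_le _ _).trans_eq ?_
        rw [norm_mul, Complex.norm_I, one_mul]
      have h2 := NNReal.rpow_add_le_mul_rpow_add_rpow ‖trigFlow S T N (trigDeriv S T 0 b) 0 x‖₊
        ‖trigFlow S T N (trigDeriv S T 1 b) 0 x‖₊ hq.le
      exact (Real.rpow_le_rpow (norm_nonneg _) h1 hq0).trans (by exact_mod_cast h2)
    have h3 := integral_mono (hrpow hq0 hξc) (((hrpow hq0 (continuous_trigFlow_right 0)).add
      (hrpow hq0 (continuous_trigFlow_right 0))).const_mul (2 ^ (q - 1))) hpt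
    refine h3.trans ?_
    rw [integral_const_mul]
    simp only [Pi.add_apply]
    rw [integral_add (hrpow hq0 (continuous_trigFlow_right 0))
      (hrpow hq0 (continuous_trigFlow_right 0))]
    have h4 := hcal hS hT N e 0 j
    have h5 := hcal hS hT N e 1 j
    have h6 : (2 : ℝ) ^ q = 2 ^ (q - 1) * 2 := by
      rw [← Real.rpow_add_one two_ne_zero]
      ring_nf
    rw [h6]
    have h7 : (0 : ℝ) < 2 ^ (q - 1) := by positivity
    nlinarith
  have hlap0 : ∫ x, trigFlow S T N (trigLap S T e) 0 x ∂boxMeasure S T = 0 := by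
    simp only [trigFlow_lap]
    rw [integral_add (hint (by fun_prop)) (hint (by fun_prop))]
    have : ∀ (d : ℤ × ℤ → ℂ) (l : Fin 2),
        ∫ x, trigFlow S T N (trigDeriv S T l d) 0 x ∂boxMeasure S T = 0 := fun d l =>
      integral_box_deriv hS.le hT.le l (continuous_trigFlow_right 0)
        (fun x => hasDerivAt_trigFlow l 0 x) (fun s t => trigFlow_periodic_fst hS.ne' 0 s t)
        (fun s t => trigFlow_periodic_snd hT.ne' 0 s t)
    rw [this, this, add_zero]
  have hg := integral_norm_rpow_sub_const_le hS hT hq (continuous_trigFlow_right 0)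
    (continuous_trigFlow_right 0) m hgm hlap0
  calc (∫ x, (ηd 0 x + Complex.I * ηd 1 x) * ξ x ∂boxMeasure S T).re
      ≤ ∫ x, ‖(ηd 0 x + Complex.I * ηd 1 x) * ξ x‖ ∂boxMeasure S T :=
        (Complex.re_le_norm _).trans (norm_integral_le_integral_norm _)
    _ ≤ ∫ x, (‖ηd 0 x + Complex.I * ηd 1 x‖ ^ p + ‖ξ x‖ ^ q) ∂boxMeasure S T := by
        refine integral_mono (hint (by fun_prop)).norm ((hrpow hp0 (by fun_prop)).add
          (hrpow hq0 hξc)) fun x => ?_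
        simp only [norm_mul]
        refine (Real.young_inequality_of_nonneg (norm_nonneg _) (norm_nonneg _) hpq).trans ?_
        gcongr
        · exact div_le_self (by positivity) hp.le
        · exact div_le_self (by positivity) hq.le
    _ = (∫ x, ‖ηd 0 x + Complex.I * ηd 1 x‖ ^ p ∂boxMeasure S T) +
          ∫ x, ‖ξ x‖ ^ q ∂boxMeasure S T :=
        integral_add (hrpow hp0 (by fun_prop)) (hrpow hq0 hξc)
    _ ≤ _ := by
        have h1 : 0 ≤ 2 ^ q * K := by positivity
        have := hξq.trans (mul_le_mul_of_nonneg_left hg h1)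
        rw [← mul_assoc] at this
        linarith

/-! ### Periodization -/

section Periodize

variable {X E : Type*} [NormedAddCommGroup X] [NormedSpace ℝ X]
  [NormedAddCommGroup E] [NormedSpace ℝ E]

/-- The `L`-periodic function in the first variable that agrees with `g` on `(b, b + L]`. -/
def periodize {L : ℝ} (hL : 0 < L) (b : ℝ) (g : ℝ × X → E) (y : ℝ × X) : E :=
  g (toIocMod hL b y.1, y.2)

omit [NormedSpace ℝ X] [NormedAddCommGroup X] [NormedSpace ℝ E] [NormedAddCommGroup E] in
lemma periodize_add {L : ℝ} (hL : 0 < L) (b : ℝ) (g : ℝ × X → E) (r : ℝ) (x : X) :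
    periodize hL b g (r + L, x) = periodize hL b g (r, x) := by
  simp [periodize]

omit [NormedSpace ℝ X] [NormedAddCommGroup X] [NormedSpace ℝ E] in
lemma periodize_eq {L b ρ : ℝ} (hL : 0 < L) {g : ℝ × X → E} (hρ : 2 * ρ ≤ L)
    (h1 : ∀ r x, r ≤ b + ρ → g (r, x) = 0) (h2 : ∀ r x, b + L - ρ ≤ r → g (r, x) = 0)
    (n : ℤ) {r : ℝ} {x : X} (hr1 : b - ρ < r - n * L) (hr2 : r - n * L < b + L + ρ) :
    periodize hL b g (r, x) = g (r - n * L, x) := by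
  unfold periodize
  by_cases hb : r - n * L ≤ b
  · have : toIocMod hL b r = r - n * L + L := by
      rw [toIocMod_eq_iff]
      refine ⟨⟨by linarith, by linarith⟩, n - 1, ?_⟩
      simp only [zsmul_eq_mul]
      push_cast
      ring
    rw [this, h2 _ _ (by linarith), h1 _ _ (by linarith)]
  · by_cases hb' : r - n * L ≤ b + L
    · have : toIocMod hL b r = r - n * L := by
        rw [toIocMod_eq_iff]
        exact ⟨⟨by linarith, by linarith⟩, n, by simp⟩
      rw [this]
    · have : toIocMod hL b r = r - n * L - L := by
        rw [toIocMod_eq_iff]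
        refine ⟨⟨by linarith, by linarith⟩, n + 1, ?_⟩
        simp only [zsmul_eq_mul]
        push_cast
        ring
      rw [this, h1 _ _ (by linarith), h2 _ _ (by linarith)]

lemma contDiff_periodize {L b ρ : ℝ} (hL : 0 < L) {g : ℝ × X → E} (hρ0 : 0 < ρ) (hρ : 2 * ρ ≤ L)
    (h1 : ∀ r x, r ≤ b + ρ → g (r, x) = 0) (h2 : ∀ r x, b + L - ρ ≤ r → g (r, x) = 0)
    {m : WithTop ℕ∞} (hg : ContDiff ℝ m g) : ContDiff ℝ m (periodize hL b g) := by
  rw [contDiff_iff_contDiffAt]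
  rintro ⟨r₀, x₀⟩
  set n := toIocDiv hL b r₀ with hn
  have hmem := sub_toIocDiv_zsmul_mem_Ioc hL b r₀
  rw [← hn, zsmul_eq_mul] at hmem
  have hev : periodize hL b g =ᶠ[nhds (r₀, x₀)] fun y => g (y.1 - n * L, y.2) := by
    have : {y : ℝ × X | |y.1 - r₀| < ρ} ∈ nhds (r₀, x₀) :=
      (isOpen_lt (by fun_prop) continuous_const).mem_nhds (by simpa using hρ0)
    filter_upwards [this] with y hy
    have hy' := abs_lt.1 hy
    exact periodize_eq hL hρ h1 h2 n (by linarith [hmem.1]) (by linarith [hmem.2])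
  refine ContDiffAt.congr_of_eventuallyEq ?_ hev
  exact (hg.comp (by fun_prop)).contDiffAt

end Periodize

/-- The Calderón–Zygmund estimate for the Cauchy–Riemann operator on the cylinder. -/
lemma cylinder_dbar {p : ℝ} (hp : 1 < p) : ∃ K : ℝ, 0 < K ∧ ∀ {T : ℝ}, 0 < T →
    ∀ (η : ℝ × ℝ → ℂ), ContDiff ℝ 1 η → (∀ s t, η (s, t + T) = η (s, t)) →
    ∀ R : ℝ, (∀ s t, R < |s| → η (s, t) = 0) → ∀ e : ℝ × ℝ, e = (1, 0) ∨ e = (0, 1) →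
    ∫ x, ‖fderiv ℝ η x e‖ ^ p ∂cylMeasure T ≤
      K * ∫ x, ‖fderiv ℝ η x (1, 0) + Complex.I * fderiv ℝ η x (0, 1)‖ ^ p ∂cylMeasure T := by
  obtain ⟨K, hK, h⟩ := torus_dbar hp
  refine ⟨K, hK, fun {T} hT η hη hper R hR e he => ?_⟩
  wlog hR0 : 0 < R generalizing R
  · exact this 1 (fun s t hs => hR s t (by linarith)) one_pos
  set S : ℝ := 2 * R + 2 with hS
  have hS0 : 0 < S := by positivity
  -- translate the support into the interior of a fundamental domain
  set g : ℝ × ℝ → ℂ := fun y => η (y.1 - (R + 1), y.2) with hg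
  have hgc : ContDiff ℝ 1 g := hη.comp (by fun_prop)
  have hg1 : ∀ r x, r ≤ 0 + (1 / 2 : ℝ) → g (r, x) = 0 := fun r x hr =>
    hR _ _ (by rw [lt_abs]; right; simp only; linarith)
  have hg2 : ∀ r x, 0 + S - (1 / 2 : ℝ) ≤ r → g (r, x) = 0 := fun r x hr =>
    hR _ _ (by rw [lt_abs]; left; simp only; linarith)
  have hρ : 2 * (1 / 2 : ℝ) ≤ S := by linarith
  set G := periodize hS0 0 g with hG
  have hGc : ContDiff ℝ 1 G := contDiff_periodize hS0 (by norm_num) hρ hg1 hg2 hgc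
  have hGp1 : ∀ s t, G (s + S, t) = G (s, t) := fun s t => periodize_add hS0 0 g s t
  have hGp2 : ∀ s t, G (s, t + T) = G (s, t) := fun s t => by
    simp only [hG, periodize, hg, hper]
  have hGd1 : ∀ s t, fderiv ℝ G (s + S, t) = fderiv ℝ G (s, t) := fun s t => by
    have := fderiv_comp_add_right (𝕜 := ℝ) (f := G) (x := (s, t)) (S, (0 : ℝ))
    simp only [Prod.mk_add_mk, add_zero] at this
    rw [← this]
    congr 1
    ext y
    rw [show y + (S, (0 : ℝ)) = (y.1 + S, y.2) by ext <;> simp]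
    exact hGp1 y.1 y.2
  have hGd2 : ∀ s t, fderiv ℝ G (s, t + T) = fderiv ℝ G (s, t) := fun s t => by
    have := fderiv_comp_add_right (𝕜 := ℝ) (f := G) (x := (s, t)) ((0 : ℝ), T)
    simp only [Prod.mk_add_mk, add_zero] at this
    rw [← this]
    congr 1
    ext y
    rw [show y + ((0 : ℝ), T) = (y.1, y.2 + T) by ext <;> simp]
    exact hGp2 y.1 y.2
  have hcf : Continuous (fderiv ℝ G) := hGc.continuous_fderiv (by simp)
  set v : Fin 2 → ℝ × ℝ := fun j => if j = 0 then (1, 0) else (0, 1) with hv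
  have hmain := h hS0 hT G (fun j x => fderiv ℝ G x (v j)) hGc.continuous
    (fun j => hcf.clm_apply continuous_const) (fun j x => ?_) hGp1 hGp2
    (fun j s t => by simp only [hGd1]) (fun j s t => by simp only [hGd2])
  -- transfer the integrals
  · have htrans : ∀ Φ : (ℝ × ℝ →L[ℝ] ℂ) → ℝ, Φ 0 = 0 →
        ∫ x, Φ (fderiv ℝ G x) ∂boxMeasure S T = ∫ x, Φ (fderiv ℝ η x) ∂cylMeasure T := by
      intro Φ hΦ0
      have e1 : ∫ x, Φ (fderiv ℝ G x) ∂boxMeasure S T =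
          ∫ x, Φ (fderiv ℝ η (x - (R + 1, 0))) ∂boxMeasure S T := by
        refine setIntegral_congr_fun (measurableSet_Ioc.prod measurableSet_Ioc) fun x hx => ?_
        congr 1
        have hev : G =ᶠ[nhds x] fun y => η (y - (R + 1, 0)) := by
          have : {y : ℝ × ℝ | 0 - 1 / 2 < y.1 ∧ y.1 < 0 + S + 1 / 2} ∈ nhds x := by
            refine ((isOpen_lt continuous_const continuous_fst).inter
              (isOpen_lt continuous_fst continuous_const)).mem_nhds ?_
            have := hx.1.1
            have := hx.1.2
            constructor <;> simp only [mem_ofPred_eq] <;> linarith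
          filter_upwards [this] with y hy
          have := periodize_eq hS0 hρ hg1 hg2 0 (r := y.1) (x := y.2) (by simpa using hy.1)
            (by simpa using hy.2)
          rw [show y = (y.1, y.2) from rfl, hG, this]
          rw [hg, show y - (R + 1, (0 : ℝ)) = (y.1 - (R + 1), y.2) by ext <;> simp]
          simp
        rw [hev.fderiv_eq, fderiv_comp_sub]
      rw [e1]
      have e2 : ∫ x, Φ (fderiv ℝ η (x - (R + 1, 0))) ∂boxMeasure S T =
          ∫ x in Ioc (-(R + 1)) (R + 1) ×ˢ Ioc 0 T, Φ (fderiv ℝ η x) := by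
        have hmp := measurePreserving_sub_right (volume : Measure (ℝ × ℝ)) (R + 1, (0 : ℝ))
        have := hmp.setIntegral_preimage_emb
          (measurableEmbedding_subRight (R + 1, (0 : ℝ))) (fun x => Φ (fderiv ℝ η x))
          (Ioc (-(R + 1)) (R + 1) ×ˢ Ioc 0 T)
        rw [← this, boxMeasure]
        congr 2
        ext x
        simp only [mem_prod, mem_Ioc, mem_preimage, Prod.fst_sub, Prod.snd_sub, hS]
        constructor <;> rintro ⟨⟨h1, h2⟩, h3, h4⟩ <;>
          exact ⟨⟨by linarith, by linarith⟩, by linarith, by linarith⟩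
      rw [e2, cylMeasure]
      refine (setIntegral_eq_of_subset_of_forall_sdiff_eq_zero
        (MeasurableSet.univ.prod measurableSet_Ioc)
        (prod_mono (subset_univ _) subset_rfl) fun x hx => ?_).symm
      have hx1 : R < |x.1| := by
        by_contra hcon
        have := abs_le.1 (not_lt.1 hcon)
        exact hx.2 ⟨⟨by linarith, by linarith⟩, hx.1.2⟩
      have hev : η =ᶠ[nhds x] fun _ => 0 := by
        have : {y : ℝ × ℝ | R < |y.1|} ∈ nhds x :=
          (isOpen_lt continuous_const (by fun_prop)).mem_nhds hx1
        filter_upwards [this] with y hy using hR y.1 y.2 hy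
      rw [hev.fderiv_eq]
      simp [hΦ0]
    have hp0 : p ≠ 0 := by linarith
    have t1 := htrans (fun L => ‖L e‖ ^ p) (by simp [Real.zero_rpow hp0])
    have t2 := htrans (fun L => ‖L (1, 0) + Complex.I * L (0, 1)‖ ^ p)
      (by simp [Real.zero_rpow hp0])
    rw [← t1, ← t2]
    rcases he with rfl | rfl
    · simpa [hv] using hmain 0
    · simpa [hv] using hmain 1
  · have hd : HasFDerivAt G (fderiv ℝ G x) (setCoord j x (getCoord j x)) := by
      rw [setCoord_getCoord]
      exact (hGc.differentiable (by simp) x).hasFDerivAt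
    have hl : HasDerivAt (fun r => setCoord j x r) (v j) (getCoord j x) := by
      fin_cases j
      · exact (hasDerivAt_id x.1).prodMk (hasDerivAt_const x.1 x.2)
      · exact (hasDerivAt_const x.2 x.1).prodMk (hasDerivAt_id x.2)
    exact hd.comp_hasDerivAt _ hl

/-! ### Smooth maps on the cylinder -/

section CylMaps

variable {F G : Type*} [NormedAddCommGroup F] [NormedSpace ℝ F]
  [NormedAddCommGroup G] [NormedSpace ℝ G] {T : ℝ}

/-- The derivative of `φ` in the constant direction `e`. -/
def pd (e : ℝ × ℝ) (φ : ℝ × ℝ → F) (q : ℝ × ℝ) : F := fderiv ℝ φ q e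

/-- Smooth maps on the cylinder. -/
structure IsCylMap (T : ℝ) (φ : ℝ × ℝ → F) : Prop where
  smooth : ContDiff ℝ ∞ φ
  periodic : ∀ s t, φ (s, t + T) = φ (s, t)

/-- Smooth maps on the cylinder with compact support. -/
structure IsTestMap (T : ℝ) (φ : ℝ × ℝ → F) : Prop extends IsCylMap T φ where
  supp : ∃ K : ℝ, ∀ s t, K < |s| → φ (s, t) = 0

lemma IsTestFunction.isTestMap {ψ : ℝ × ℝ → ℝ} (h : IsTestFunction T ψ) : IsTestMap T ψ :=
  ⟨⟨h.1, h.2.1⟩, h.2.2⟩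

lemma IsTestMap.isTestFunction {ψ : ℝ × ℝ → ℝ} (h : IsTestMap T ψ) : IsTestFunction T ψ :=
  ⟨h.smooth, h.periodic, h.supp⟩

lemma IsTestMap.of_zero {φ : ℝ × ℝ → F} {ψ : ℝ × ℝ → G} (hφ : IsTestMap T φ) (hψ : IsCylMap T ψ)
    (h : ∀ q, φ q = 0 → ψ q = 0) : IsTestMap T ψ :=
  ⟨hψ, hφ.supp.imp fun _ hK s t hs => h _ (hK s t hs)⟩

lemma IsCylMap.fderiv_periodic {φ : ℝ × ℝ → F} (h : IsCylMap T φ) (s t : ℝ) :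
    fderiv ℝ φ (s, t + T) = fderiv ℝ φ (s, t) := by
  have := fderiv_comp_add_right (𝕜 := ℝ) (f := φ) (x := (s, t)) ((0 : ℝ), T)
  simp only [Prod.mk_add_mk, add_zero] at this
  rw [← this]
  congr 1
  ext y
  rw [show y + ((0 : ℝ), T) = (y.1, y.2 + T) by ext <;> simp]
  exact h.periodic y.1 y.2

lemma IsCylMap.pd {φ : ℝ × ℝ → F} (h : IsCylMap T φ) (e : ℝ × ℝ) : IsCylMap T (pd e φ) :=
  ⟨(h.smooth.fderiv_right (m := ∞) (by simp)).clm_apply contDiff_const,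
    fun s t => by simp only [MorseBottTorus.pd, h.fderiv_periodic]⟩

lemma IsCylMap.continuous {φ : ℝ × ℝ → F} (h : IsCylMap T φ) : Continuous φ := h.smooth.continuous

lemma IsCylMap.differentiable {φ : ℝ × ℝ → F} (h : IsCylMap T φ) : Differentiable ℝ φ :=
  h.smooth.differentiable (by simp)

lemma IsCylMap.differentiableAt {φ : ℝ × ℝ → F} (h : IsCylMap T φ) {q : ℝ × ℝ} :
    DifferentiableAt ℝ φ q := h.differentiable q

lemma pd_eq_zero {φ : ℝ × ℝ → F} {K : ℝ} (hK : ∀ s t, K < |s| → φ (s, t) = 0) (e : ℝ × ℝ)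
    (s t : ℝ) (hs : K < |s|) : pd e φ (s, t) = 0 := by
  have hopen : IsOpen {q : ℝ × ℝ | K < |q.1|} :=
    isOpen_lt continuous_const (continuous_abs.comp continuous_fst)
  have hev : φ =ᶠ[nhds (s, t)] fun _ => 0 := by
    filter_upwards [hopen.mem_nhds (show (s, t) ∈ {q : ℝ × ℝ | K < |q.1|} from hs)] with q hq
    exact hK q.1 q.2 hq
  simp [pd, hev.fderiv_eq]

lemma IsTestMap.pd {φ : ℝ × ℝ → F} (h : IsTestMap T φ) (e : ℝ × ℝ) : IsTestMap T (pd e φ) :=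
  ⟨h.toIsCylMap.pd e, h.supp.imp fun _ hK => pd_eq_zero hK e⟩

lemma IsCylMap.comp {φ : ℝ × ℝ → F} (h : IsCylMap T φ) {g : F → G} (hg : ContDiff ℝ ∞ g) :
    IsCylMap T fun q => g (φ q) :=
  ⟨hg.comp h.smooth, fun s t => by rw [h.periodic]⟩

lemma IsCylMap.add {φ ψ : ℝ × ℝ → F} (h : IsCylMap T φ) (h' : IsCylMap T ψ) :
    IsCylMap T fun q => φ q + ψ q :=
  ⟨h.smooth.add h'.smooth, fun s t => by rw [h.periodic, h'.periodic]⟩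

lemma IsCylMap.neg {φ : ℝ × ℝ → F} (h : IsCylMap T φ) : IsCylMap T fun q => -φ q :=
  ⟨h.smooth.neg, fun s t => by rw [h.periodic]⟩

lemma IsCylMap.smul {c : ℝ × ℝ → ℝ} {φ : ℝ × ℝ → F} (h : IsCylMap T c) (h' : IsCylMap T φ) :
    IsCylMap T fun q => c q • φ q :=
  ⟨h.smooth.smul h'.smooth, fun s t => by rw [h.periodic, h'.periodic]⟩

lemma isCylMap_const (v : F) : IsCylMap T fun _ => v := ⟨contDiff_const, fun _ _ => rfl⟩

lemma isCylMap_fst {w : ℝ → F} (hw : ContDiff ℝ ∞ w) : IsCylMap T fun q => w q.1 :=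
  ⟨hw.comp contDiff_fst, fun _ _ => rfl⟩

lemma IsTestMap.comp {φ : ℝ × ℝ → F} (h : IsTestMap T φ) {g : F → G} (hg : ContDiff ℝ ∞ g)
    (h0 : g 0 = 0) : IsTestMap T fun q => g (φ q) :=
  h.of_zero (h.toIsCylMap.comp hg) fun q hq => by rw [hq, h0]

lemma IsTestMap.add {φ ψ : ℝ × ℝ → F} (h : IsTestMap T φ) (h' : IsTestMap T ψ) :
    IsTestMap T fun q => φ q + ψ q := by
  obtain ⟨K, hK⟩ := h.supp
  obtain ⟨K', hK'⟩ := h'.supp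
  refine ⟨h.toIsCylMap.add h'.toIsCylMap, max K K', fun s t hs => ?_⟩
  rw [hK s t ((le_max_left _ _).trans_lt hs), hK' s t ((le_max_right _ _).trans_lt hs), add_zero]

lemma IsTestMap.const_smul {φ : ℝ × ℝ → F} (h : IsTestMap T φ) (c : ℝ) :
    IsTestMap T fun q => c • φ q :=
  h.of_zero ((isCylMap_const c).smul h.toIsCylMap) fun q hq => by rw [hq, smul_zero]

lemma IsTestMap.smul {c : ℝ × ℝ → ℝ} {φ : ℝ × ℝ → F} (h : IsCylMap T c) (h' : IsTestMap T φ) :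
    IsTestMap T fun q => c q • φ q :=
  h'.of_zero (h.smul h'.toIsCylMap) fun q hq => by rw [hq, smul_zero]

lemma IsTestMap.smul_const {ψ : ℝ × ℝ → ℝ} (h : IsTestMap T ψ) (v : F) :
    IsTestMap T fun q => ψ q • v :=
  h.of_zero (h.toIsCylMap.smul (isCylMap_const v)) fun q hq => by rw [hq, zero_smul]

lemma IsTestMap.neg {φ : ℝ × ℝ → F} (h : IsTestMap T φ) : IsTestMap T fun q => -φ q :=
  h.of_zero h.toIsCylMap.neg fun q hq => by rw [hq, neg_zero]

lemma IsTestMap.sub {φ ψ : ℝ × ℝ → F} (h : IsTestMap T φ) (h' : IsTestMap T ψ) :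
    IsTestMap T fun q => φ q - ψ q := by
  simpa only [sub_eq_add_neg] using h.add h'.neg

lemma IsCylMap.translate {φ : ℝ × ℝ → F} (h : IsCylMap T φ) (r : ℝ × ℝ) :
    IsCylMap T fun q => φ (q - r) := by
  refine ⟨h.smooth.comp (by fun_prop), fun s t => ?_⟩
  have := h.periodic (s - r.1) (t - r.2)
  rwa [show t - r.2 + T = t + T - r.2 by ring] at this

lemma IsTestMap.translate {φ : ℝ × ℝ → F} (h : IsTestMap T φ) (r : ℝ × ℝ) :
    IsTestMap T fun q => φ (q - r) := by
  obtain ⟨K, hK⟩ := h.supp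
  refine ⟨h.toIsCylMap.translate r, K + |r.1|, fun s t hs => hK _ _ ?_⟩
  have := abs_sub_abs_le_abs_sub s r.1
  linarith

lemma pd_translate (φ : ℝ × ℝ → F) (e r : ℝ × ℝ) :
    pd e (fun q => φ (q - r)) = fun q => pd e φ (q - r) := by
  ext q
  simp only [pd, fderiv_comp_sub]

lemma pd_add {φ ψ : ℝ × ℝ → F} (h : IsCylMap T φ) (h' : IsCylMap T ψ) (e : ℝ × ℝ) :
    pd e (fun q => φ q + ψ q) = fun q => pd e φ q + pd e ψ q := by
  ext q
  simp only [pd, fderiv_fun_add h.differentiableAt h'.differentiableAt]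
  rfl

lemma pd_const_smul {φ : ℝ × ℝ → F} (h : IsCylMap T φ) (c : ℝ) (e : ℝ × ℝ) :
    pd e (fun q => c • φ q) = fun q => c • pd e φ q := by
  ext q
  simp only [pd, fderiv_fun_const_smul h.differentiableAt]
  rfl

lemma pd_sub {φ ψ : ℝ × ℝ → F} (h : IsCylMap T φ) (h' : IsCylMap T ψ) (e : ℝ × ℝ) :
    pd e (fun q => φ q - ψ q) = fun q => pd e φ q - pd e ψ q := by
  ext q
  simp only [pd, fderiv_fun_sub h.differentiableAt h'.differentiableAt]
  rfl

lemma pd_smul {c : ℝ × ℝ → ℝ} {φ : ℝ × ℝ → F} (h : IsCylMap T c) (h' : IsCylMap T φ)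
    (e : ℝ × ℝ) : pd e (fun q => c q • φ q) = fun q => c q • pd e φ q + pd e c q • φ q := by
  ext q
  simp [pd, fderiv_fun_smul h.differentiableAt h'.differentiableAt]

lemma pd_clm {φ : ℝ × ℝ → F} (h : IsCylMap T φ) (L : F →L[ℝ] G) (e : ℝ × ℝ) :
    pd e (fun q => L (φ q)) = fun q => L (pd e φ q) := by
  ext q
  exact congrArg (fun M : ℝ × ℝ →L[ℝ] G => M e)
    (L.hasFDerivAt.comp q h.differentiableAt.hasFDerivAt).fderiv

lemma pd_comm {φ : ℝ × ℝ → F} (h : IsCylMap T φ) (e e' : ℝ × ℝ) :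
    pd e (pd e' φ) = pd e' (pd e φ) := by
  have hd : Differentiable ℝ (fderiv ℝ φ) :=
    (h.smooth.fderiv_right (m := ∞) (by simp)).differentiable (by simp)
  have key : ∀ a b q, pd a (pd b φ) q = fderiv ℝ (fderiv ℝ φ) q a b := fun a b q => by
    change fderiv ℝ (fun q => fderiv ℝ φ q b) q a = _
    rw [fderiv_clm_apply (hd q) (differentiableAt_const b)]
    simp
  ext q
  rw [key, key]
  exact (h.smooth.contDiffAt.isSymmSndFDerivAt
    (by simp only [minSmoothness_of_isRCLikeNormedField]; exact WithTop.coe_le_coe.2 le_top)).eq e e'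

lemma hasDerivAt_pd_fst {φ : ℝ × ℝ → F} (h : IsCylMap T φ) (s t : ℝ) :
    HasDerivAt (fun s => φ (s, t)) (pd (1, 0) φ (s, t)) s := by
  have h1 : HasDerivAt (fun s : ℝ => (s, t)) ((1 : ℝ), (0 : ℝ)) s :=
    (hasDerivAt_id s).prodMk (hasDerivAt_const s t)
  exact (h.differentiable (s, t)).hasFDerivAt.comp_hasDerivAt s h1

lemma hasDerivAt_pd_snd {φ : ℝ × ℝ → F} (h : IsCylMap T φ) (s t : ℝ) :
    HasDerivAt (fun t => φ (s, t)) (pd (0, 1) φ (s, t)) t := by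
  have h1 : HasDerivAt (fun t : ℝ => (s, t)) ((0 : ℝ), (1 : ℝ)) t :=
    (hasDerivAt_const t s).prodMk (hasDerivAt_id t)
  exact (h.differentiable (s, t)).hasFDerivAt.comp_hasDerivAt t h1

lemma pd_fst {w : ℝ → F} {w' : F} {q : ℝ × ℝ} (hw : HasDerivAt w w' q.1) (e : ℝ × ℝ) :
    pd e (fun q => w q.1) q = e.1 • w' := by
  have := hw.hasFDerivAt.comp q (hasFDerivAt_fst (𝕜 := ℝ) (p := q))
  exact (congrArg (fun M : ℝ × ℝ →L[ℝ] F => M e) this.fderiv).trans (by simp)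

/-! ### Integration over the cylinder -/

lemma cylMeasure_eq_prod (T : ℝ) :
    cylMeasure T = (volume : Measure ℝ).prod (volume.restrict (Ioc 0 T)) := by
  rw [cylMeasure, Measure.volume_eq_prod, ← Measure.prod_restrict, Measure.restrict_univ]

instance (T : ℝ) : IsLocallyFiniteMeasure (cylMeasure T) := by
  rw [cylMeasure]; infer_instance

instance (T : ℝ) (p : ℝ≥0∞) (d : ℝ) : IsLocallyFiniteMeasure (weightedMeasure T p d) :=
  IsLocallyFiniteMeasure.withDensity_ofReal (by fun_prop)

lemma ae_cylMeasure (T : ℝ) : ∀ᵐ q ∂cylMeasure T, q.2 ∈ Ioc 0 T := by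
  unfold cylMeasure
  filter_upwards [ae_restrict_mem (MeasurableSet.univ.prod measurableSet_Ioc)] with q hq
  exact hq.2

lemma weightedMeasure_absolutelyContinuous (T : ℝ) (p : ℝ≥0∞) (d : ℝ) :
    weightedMeasure T p d ≪ cylMeasure T := withDensity_absolutelyContinuous _ _

omit [NormedSpace ℝ F] in
lemma memLp_of_supp {μ : Measure (ℝ × ℝ)} [IsLocallyFiniteMeasure μ] (hμ : μ ≪ cylMeasure T)
    {φ : ℝ × ℝ → F} (hc : Continuous φ) (hK : ∃ K : ℝ, ∀ s t, K < |s| → φ (s, t) = 0)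
    (p : ℝ≥0∞) : MemLp φ p μ := by
  obtain ⟨K, hK⟩ := hK
  set A : Set (ℝ × ℝ) := Icc (-K) K ×ˢ Icc 0 T with hA
  have hAc : IsCompact A := isCompact_Icc.prod isCompact_Icc
  have hfin : IsFiniteMeasure (μ.restrict A) :=
    ⟨by rw [Measure.restrict_apply_univ]; exact hAc.measure_lt_top⟩
  obtain ⟨M, hM⟩ := hAc.exists_bound_of_continuousOn hc.continuousOn
  have h1 : MemLp φ p (μ.restrict A) := by
    refine MemLp.of_bound hc.aestronglyMeasurable M ?_
    filter_upwards [ae_restrict_mem hAc.measurableSet] with q hq using hM q hq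
  refine ((memLp_indicator_iff_restrict hAc.measurableSet).2 h1).ae_eq ?_
  filter_upwards [hμ.ae_le (ae_cylMeasure T)] with q hq
  by_cases hqA : q ∈ A
  · rw [indicator_of_mem hqA]
  · rw [indicator_of_notMem hqA, hK q.1 q.2]
    by_contra hcon
    exact hqA ⟨abs_le.1 (not_lt.1 hcon), Ioc_subset_Icc_self hq⟩

omit [NormedSpace ℝ F] in
lemma integrable_of_supp {φ : ℝ × ℝ → F} (hc : Continuous φ)
    (hK : ∃ K : ℝ, ∀ s t, K < |s| → φ (s, t) = 0) : Integrable φ (cylMeasure T) :=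
  memLp_one_iff_integrable.1 (memLp_of_supp Measure.AbsolutelyContinuous.rfl hc hK 1)

lemma IsTestMap.integrable {φ : ℝ × ℝ → F} (h : IsTestMap T φ) : Integrable φ (cylMeasure T) :=
  integrable_of_supp h.continuous h.supp

lemma IsTestMap.memLp {φ : ℝ × ℝ → F} (h : IsTestMap T φ) (p : ℝ≥0∞) : MemLp φ p (cylMeasure T) :=
  memLp_of_supp Measure.AbsolutelyContinuous.rfl h.continuous h.supp p

lemma IsTestMap.memLp_weighted {φ : ℝ × ℝ → F} (h : IsTestMap T φ) (p : ℝ≥0∞) (d : ℝ) :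
    MemLp φ p (weightedMeasure T p d) :=
  memLp_of_supp (weightedMeasure_absolutelyContinuous T p d) h.continuous h.supp p

lemma eLpNorm_weighted (T : ℝ) {p : ℝ≥0∞} (hp0 : p ≠ 0) (hp : p ≠ ⊤) (d : ℝ) (φ : ℝ × ℝ → F) :
    eLpNorm φ p (weightedMeasure T p d) =
      eLpNorm (fun q => Real.exp (d * q.1) • φ q) p (cylMeasure T) := by
  have hpr : 0 < p.toReal := ENNReal.toReal_pos hp0 hp
  rw [eLpNorm_eq_lintegral_rpow_enorm_toReal hp0 hp, eLpNorm_eq_lintegral_rpow_enorm_toReal hp0 hp,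
    weightedMeasure, lintegral_withDensity_eq_lintegral_mul_non_measurable _
      (Continuous.measurable (by fun_prop)).ennreal_ofReal (Filter.Eventually.of_forall fun _ =>
        ENNReal.ofReal_lt_top)]
  congr 1
  refine lintegral_congr fun q => ?_
  simp only [Pi.mul_apply, enorm_smul]
  rw [ENNReal.mul_rpow_of_nonneg _ _ hpr.le, Real.enorm_eq_ofReal (Real.exp_pos _).le,
    ENNReal.ofReal_rpow_of_pos (Real.exp_pos _), ← Real.exp_mul]
  congr 3
  ring

lemma integral_pd_fst [CompleteSpace F] {φ : ℝ × ℝ → F} (h : IsTestMap T φ) :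
    ∫ q, pd (1, 0) φ q ∂cylMeasure T = 0 := by
  have hi := (h.pd (1, 0)).integrable
  rw [cylMeasure_eq_prod] at hi ⊢
  rw [integral_prod_symm _ hi]
  refine integral_eq_zero_of_ae (Filter.Eventually.of_forall fun t => ?_)
  have hs : ∀ {ψ : ℝ × ℝ → F}, IsTestMap T ψ → Integrable fun s => ψ (s, t) := by
    intro ψ hψ
    obtain ⟨K, hK⟩ := hψ.supp
    refine Continuous.integrable_of_hasCompactSupport (by have := hψ.continuous; fun_prop) ?_
    refine HasCompactSupport.intro (isCompact_Icc (a := -K) (b := K)) fun s hs => hK _ _ ?_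
    by_contra hcon
    exact hs (abs_le.1 (not_lt.1 hcon))
  exact integral_eq_zero_of_hasDerivAt_of_integrable
    (fun s => hasDerivAt_pd_fst h.toIsCylMap s t) (hs (h.pd (1, 0))) (hs h)

lemma integral_pd_snd [CompleteSpace F] (hT : 0 ≤ T) {φ : ℝ × ℝ → F} (h : IsTestMap T φ) :
    ∫ q, pd (0, 1) φ q ∂cylMeasure T = 0 := by
  have hi := (h.pd (0, 1)).integrable
  have hc := (h.pd (0, 1)).continuous
  rw [cylMeasure_eq_prod] at hi ⊢
  rw [integral_prod _ hi]
  refine integral_eq_zero_of_ae (Filter.Eventually.of_forall fun s => ?_)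
  have hp := h.periodic s 0
  rw [zero_add] at hp
  simp only [Pi.zero_apply]
  rw [← intervalIntegral.integral_of_le hT, intervalIntegral.integral_eq_sub_of_hasDerivAt
    (fun t _ => hasDerivAt_pd_snd h.toIsCylMap s t)
    ((by fun_prop : Continuous fun t => pd (0, 1) φ (s, t)).intervalIntegrable _ _), hp, sub_self]

lemma integral_pd [CompleteSpace F] (hT : 0 ≤ T) {φ : ℝ × ℝ → F} (h : IsTestMap T φ)
    (e : ℝ × ℝ) : ∫ q, pd e φ q ∂cylMeasure T = 0 := by
  have : pd e φ = fun q => e.1 • pd (1, 0) φ q + e.2 • pd (0, 1) φ q := by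
    ext q
    simp only [pd, ← map_smul, ← map_add]
    congr 1
    ext <;> simp
  simp only [this]
  rw [integral_add ((h.pd _).const_smul _).integrable ((h.pd _).const_smul _).integrable,
    integral_smul, integral_smul, integral_pd_fst h, integral_pd_snd hT h]
  simp

lemma IsCylMap.isWeakDeriv (hT : 0 ≤ T) {φ : ℝ × ℝ → E4} (h : IsCylMap T φ) (e : ℝ × ℝ) :
    IsWeakDeriv T e φ (MorseBottTorus.pd e φ) := by
  intro ψ hψ
  have hψ' := hψ.isTestMap
  have h1 : IsTestMap T fun q => ψ q • φ q :=
    hψ'.of_zero (hψ'.toIsCylMap.smul h) fun q hq => by rw [hq, zero_smul]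
  have h2 := integral_pd hT h1 e
  rw [pd_smul hψ'.toIsCylMap h, integral_add] at h2
  · rw [add_comm] at h2
    exact eq_neg_of_add_eq_zero_left h2
  · exact (hψ'.of_zero (hψ'.toIsCylMap.smul (h.pd e))
      fun q hq => by rw [hq, zero_smul]).integrable
  · exact ((hψ'.pd e).of_zero ((hψ'.pd e).toIsCylMap.smul h)
      fun q hq => by rw [hq, zero_smul]).integrable

end CylMaps

/-! ### The spectral gap of the asymptotic operator on a circle -/

lemma sq_integral_le {T : ℝ} (hT : 0 < T) {f : ℝ → ℝ} (hf : Continuous f) :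
    (∫ t in (0 : ℝ)..T, f t) ^ 2 ≤ T * ∫ t in (0 : ℝ)..T, f t ^ 2 := by
  set I := ∫ t in (0 : ℝ)..T, f t with hI
  have h0 : 0 ≤ ∫ t in (0 : ℝ)..T, (f t - I / T) ^ 2 :=
    intervalIntegral.integral_nonneg hT.le fun t _ => sq_nonneg _
  have h1 : ∫ t in (0 : ℝ)..T, (f t - I / T) ^ 2 =
      (∫ t in (0 : ℝ)..T, f t ^ 2) - 2 * (I / T) * I + (I / T) ^ 2 * T := by
    have e : ∀ t, (f t - I / T) ^ 2 = f t ^ 2 - 2 * (I / T) * f t + (I / T) ^ 2 := fun t => by ring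
    simp only [e]
    have i1 : ∀ g : ℝ → ℝ, Continuous g → IntervalIntegrable g volume 0 T :=
      fun g hg => hg.intervalIntegrable _ _
    rw [intervalIntegral.integral_add (i1 _ (by fun_prop)) (i1 _ (by fun_prop)),
      intervalIntegral.integral_sub (i1 _ (by fun_prop)) (i1 _ (by fun_prop)),
      intervalIntegral.integral_const_mul, intervalIntegral.integral_const, ← hI]
    simp [mul_comm]
  rw [h1] at h0
  have h2 : 2 * (I / T) * I - (I / T) ^ 2 * T = I ^ 2 / T := by field_simp; ring
  have h3 : I ^ 2 / T ≤ ∫ t in (0 : ℝ)..T, f t ^ 2 := by linarith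
  rw [div_le_iff₀ hT] at h3
  linarith

lemma poincare_circle {T : ℝ} (hT : 0 < T) {u u' : ℝ → ℝ} (hu : ∀ t, HasDerivAt u (u' t) t)
    (hu' : Continuous u') (h0 : ∫ t in (0 : ℝ)..T, u t = 0) :
    ∫ t in (0 : ℝ)..T, u t ^ 2 ≤ T ^ 2 * ∫ t in (0 : ℝ)..T, u' t ^ 2 := by
  have huc : Continuous u := continuous_iff_continuousAt.2 fun t => (hu t).continuousAt
  obtain ⟨t₀, ht₀, hz⟩ : ∃ t₀ ∈ Icc 0 T, u t₀ = 0 := by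
    by_contra! hne
    have hsign : (∀ t ∈ Icc 0 T, 0 < u t) ∨ ∀ t ∈ Icc 0 T, u t < 0 := by
      rcases lt_or_gt_of_ne (hne 0 ⟨le_rfl, hT.le⟩) with h | h
      · refine Or.inr fun t ht => ?_
        by_contra! hc
        obtain ⟨r, hr, hr0⟩ := intermediate_value_Icc ht.1 huc.continuousOn ⟨h.le, hc⟩
        exact hne r ⟨hr.1, hr.2.trans ht.2⟩ hr0
      · refine Or.inl fun t ht => ?_
        by_contra! hc
        obtain ⟨r, hr, hr0⟩ := intermediate_value_Icc' ht.1 huc.continuousOn ⟨hc, h.le⟩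
        exact hne r ⟨hr.1, hr.2.trans ht.2⟩ hr0
    rcases hsign with h | h
    · have := intervalIntegral.intervalIntegral_pos_of_pos_on (huc.intervalIntegrable 0 T)
        (fun t ht => h t (Ioo_subset_Icc_self ht)) hT
      linarith
    · have := intervalIntegral.intervalIntegral_pos_of_pos_on (huc.neg.intervalIntegrable 0 T)
        (fun t ht => by simpa using h t (Ioo_subset_Icc_self ht)) hT
      simp only [Pi.neg_apply, intervalIntegral.integral_neg] at this
      linarith
  have hbd : ∀ t ∈ Icc 0 T, u t ^ 2 ≤ T * ∫ t in (0 : ℝ)..T, u' t ^ 2 := by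
    intro t ht
    have h1 : u t = ∫ r in t₀..t, u' r := by
      rw [intervalIntegral.integral_eq_sub_of_hasDerivAt (fun r _ => hu r)
        (hu'.intervalIntegrable _ _), hz, sub_zero]
    have h2 : |u t| ≤ ∫ r in (0 : ℝ)..T, |u' r| := by
      rw [h1, intervalIntegral.integral_of_le hT.le]
      refine (intervalIntegral.norm_integral_le_integral_norm_uIoc (f := u') (μ := volume)).trans ?_
      simp only [Real.norm_eq_abs]
      refine setIntegral_mono_set (hu'.abs.integrableOn_Ioc)
        (Filter.Eventually.of_forall fun r => abs_nonneg _) ?_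
      refine Filter.Eventually.of_forall fun r hr => ?_
      have hr' : min t₀ t < r ∧ r ≤ max t₀ t := hr
      exact ⟨(le_min ht₀.1 ht.1).trans_lt hr'.1, hr'.2.trans (max_le ht₀.2 ht.2)⟩
    have h3 := sq_integral_le hT hu'.abs
    simp only [sq_abs] at h3
    rw [← sq_abs]
    exact (pow_le_pow_left₀ (abs_nonneg _) h2 2).trans h3
  calc ∫ t in (0 : ℝ)..T, u t ^ 2 ≤ ∫ t in (0 : ℝ)..T, T * ∫ t in (0 : ℝ)..T, u' t ^ 2 :=
        intervalIntegral.integral_mono_on hT.le ((huc.pow 2).intervalIntegrable _ _)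
          (continuous_const.intervalIntegrable _ _) hbd
    _ = _ := by simp; ring

/-- The constant in the Poincaré inequality for the asymptotic operator of a Morse-Bott orbit. -/
def gapConst (T κ M : ℝ) : ℝ :=
  3 * T ^ 2 + (1 + 2 * T ^ 2 * M ^ 2) * (T ^ 2 + 2 * T ^ 2 / κ ^ 2 + 2 * T ^ 4 * M ^ 2 / κ ^ 2)

lemma integral_eq_zero_of_periodic {T : ℝ} {u u' : ℝ → ℝ} (hu : ∀ t, HasDerivAt u (u' t) t)
    (hu' : Continuous u') (hp : u T = u 0) : ∫ t in (0 : ℝ)..T, u' t = 0 := by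
  rw [intervalIntegral.integral_eq_sub_of_hasDerivAt (fun r _ => hu r)
    (hu'.intervalIntegrable _ _), hp, sub_self]

lemma gap_planar {T κ M : ℝ} (hT : 0 < T) (hκ : 0 < κ) {k : ℝ → ℝ} (hk : Continuous k)
    (hM : ∀ t, |k t| ≤ M) (hκk : κ ≤ |∫ t in (0 : ℝ)..T, k t|) {x x' y y' : ℝ → ℝ}
    (hx : ∀ t, HasDerivAt x (x' t) t) (hx' : Continuous x') (hxp : x T = x 0)
    (hx0 : ∫ t in (0 : ℝ)..T, x t = 0)
    (hy : ∀ t, HasDerivAt y (y' t) t) (hy' : Continuous y') :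
    (∫ t in (0 : ℝ)..T, x t ^ 2) + (∫ t in (0 : ℝ)..T, y t ^ 2) ≤ gapConst T κ M *
      ((∫ t in (0 : ℝ)..T, y' t ^ 2) + ∫ t in (0 : ℝ)..T, (x' t - k t * y t) ^ 2) := by
  have hyc : Continuous y := continuous_iff_continuousAt.2 fun t => (hy t).continuousAt
  have ii : ∀ g : ℝ → ℝ, Continuous g → IntervalIntegrable g volume 0 T :=
    fun g hg => hg.intervalIntegrable _ _
  set Y := ∫ t in (0 : ℝ)..T, y' t ^ 2 with hY
  set X := ∫ t in (0 : ℝ)..T, (x' t - k t * y t) ^ 2 with hX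
  have hY0 : 0 ≤ Y := intervalIntegral.integral_nonneg hT.le fun t _ => sq_nonneg _
  have hX0 : 0 ≤ X := intervalIntegral.integral_nonneg hT.le fun t _ => sq_nonneg _
  set m := (∫ t in (0 : ℝ)..T, y t) / T with hm
  have hy1 : ∫ t in (0 : ℝ)..T, (y t - m) = 0 := by
    rw [intervalIntegral.integral_sub (ii _ hyc) (ii _ continuous_const)]
    simp [hm]
    field_simp
    simp
  have hP : ∫ t in (0 : ℝ)..T, (y t - m) ^ 2 ≤ T ^ 2 * Y :=
    poincare_circle hT (fun t => (hy t).sub_const m) hy' hy1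
  have hsplit : ∫ t in (0 : ℝ)..T, y t ^ 2 = (∫ t in (0 : ℝ)..T, (y t - m) ^ 2) + T * m ^ 2 := by
    have e : ∀ t, y t ^ 2 = (y t - m) ^ 2 + 2 * m * (y t - m) + m ^ 2 := fun t => by ring
    simp only [e]
    rw [intervalIntegral.integral_add (ii _ (by fun_prop)) (ii _ (by fun_prop)),
      intervalIntegral.integral_add (ii _ (by fun_prop)) (ii _ (by fun_prop)),
      intervalIntegral.integral_const_mul, hy1]
    simp
  have hmean : κ ^ 2 * m ^ 2 ≤ 2 * T * X + 2 * T ^ 3 * M ^ 2 * Y := by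
    have e : (∫ t in (0 : ℝ)..T, k t) * m =
        -(∫ t in (0 : ℝ)..T, (x' t - k t * y t)) - ∫ t in (0 : ℝ)..T, k t * (y t - m) := by
      have e0 : ∫ t in (0 : ℝ)..T, ((x' t - k t * y t) + k t * (y t - m) + k t * m) = 0 := by
        refine Eq.trans ?_ (integral_eq_zero_of_periodic hx hx' hxp)
        congr 1
        ext t
        ring
      rw [intervalIntegral.integral_add (ii _ (by fun_prop)) (ii _ (by fun_prop)),
        intervalIntegral.integral_add (ii _ (by fun_prop)) (ii _ (by fun_prop)),
        intervalIntegral.integral_mul_const] at e0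
      linarith
    have h1 := sq_integral_le hT (f := fun t => x' t - k t * y t) (by fun_prop)
    have h2 := sq_integral_le hT (f := fun t => k t * (y t - m)) (by fun_prop)
    have h3 : ∫ t in (0 : ℝ)..T, (k t * (y t - m)) ^ 2 ≤ M ^ 2 * (T ^ 2 * Y) := by
      refine le_trans ?_ (mul_le_mul_of_nonneg_left hP (sq_nonneg M))
      rw [← intervalIntegral.integral_const_mul]
      refine intervalIntegral.integral_mono_on hT.le (ii _ (by fun_prop)) (ii _ (by fun_prop))
        fun t _ => ?_
      rw [mul_pow]
      exact mul_le_mul_of_nonneg_right (sq_le_sq' (by linarith [neg_abs_le (k t), hM t])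
        ((le_abs_self _).trans (hM t))) (sq_nonneg _)
    have h4 : κ ^ 2 * m ^ 2 ≤ ((∫ t in (0 : ℝ)..T, k t) * m) ^ 2 := by
      rw [mul_pow, ← sq_abs (∫ t in (0 : ℝ)..T, k t)]
      gcongr
    have h5 := mul_le_mul_of_nonneg_left h3 hT.le
    rw [e] at h4
    linarith [sq_nonneg ((∫ t in (0 : ℝ)..T, (x' t - k t * y t)) -
      ∫ t in (0 : ℝ)..T, k t * (y t - m))]
  have hm2 : m ^ 2 ≤ (2 * T * X + 2 * T ^ 3 * M ^ 2 * Y) / κ ^ 2 := by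
    rw [le_div_iff₀ (by positivity)]; linarith
  set W := ∫ t in (0 : ℝ)..T, y t ^ 2 with hW
  have hWle : W ≤ (T ^ 2 + 2 * T ^ 2 / κ ^ 2 + 2 * T ^ 4 * M ^ 2 / κ ^ 2) * (Y + X) := by
    have h1 := mul_le_mul_of_nonneg_left hm2 hT.le
    have h2 : T * ((2 * T * X + 2 * T ^ 3 * M ^ 2 * Y) / κ ^ 2) =
      2 * T ^ 2 / κ ^ 2 * X + 2 * T ^ 4 * M ^ 2 / κ ^ 2 * Y := by ring
    have h3 : 0 ≤ 2 * T ^ 2 / κ ^ 2 * Y := by positivity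
    have h4 : 0 ≤ 2 * T ^ 4 * M ^ 2 / κ ^ 2 * X := by positivity
    have h5 : 0 ≤ T ^ 2 * X := by positivity
    linarith
  have hXx : ∫ t in (0 : ℝ)..T, x' t ^ 2 ≤ 2 * X + 2 * M ^ 2 * W := by
    rw [hX, hW, ← intervalIntegral.integral_const_mul, ← intervalIntegral.integral_const_mul,
      ← intervalIntegral.integral_add (ii _ (by fun_prop)) (ii _ (by fun_prop))]
    refine intervalIntegral.integral_mono_on hT.le (ii _ (by fun_prop)) (ii _ (by fun_prop))
      fun t _ => ?_
    have : (k t * y t) ^ 2 ≤ M ^ 2 * y t ^ 2 := by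
      rw [mul_pow]
      exact mul_le_mul_of_nonneg_right (sq_le_sq' (by linarith [neg_abs_le (k t), hM t])
        ((le_abs_self _).trans (hM t))) (sq_nonneg _)
    linarith [sq_nonneg (x' t - k t * y t - k t * y t)]
  have hxx := poincare_circle hT hx hx' hx0
  have hT2 := mul_le_mul_of_nonneg_left hXx (sq_nonneg T)
  have hWW := mul_le_mul_of_nonneg_left hWle (show 0 ≤ 1 + 2 * T ^ 2 * M ^ 2 by positivity)
  unfold gapConst
  have h6 : 0 ≤ T ^ 2 * Y := by positivity
  have h7 : 0 ≤ T ^ 2 * X := by positivity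
  linarith

/-- Subtracting the mean of a component orthogonal to the range. -/
lemma integral_sub_mean {T : ℝ} (hT : 0 < T) {u f : ℝ → ℝ} (hu : Continuous u) (hf : Continuous f)
    (h0 : ∫ t in (0 : ℝ)..T, f t = 0) (d : ℝ) : ∃ m : ℝ,
    (∫ t in (0 : ℝ)..T, (u t - m) = 0) ∧
    (∫ t in (0 : ℝ)..T, u t ^ 2 = (∫ t in (0 : ℝ)..T, (u t - m) ^ 2) + T * m ^ 2) ∧
    (∫ t in (0 : ℝ)..T, (f t - d * u t) ^ 2 =
      (∫ t in (0 : ℝ)..T, (f t - d * (u t - m)) ^ 2) + d ^ 2 * (T * m ^ 2)) := by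
  have ii : ∀ g : ℝ → ℝ, Continuous g → IntervalIntegrable g volume 0 T :=
    fun g hg => hg.intervalIntegrable _ _
  refine ⟨(∫ t in (0 : ℝ)..T, u t) / T, ?_⟩
  set m := (∫ t in (0 : ℝ)..T, u t) / T with hm
  have h1 : ∫ t in (0 : ℝ)..T, (u t - m) = 0 := by
    rw [intervalIntegral.integral_sub (ii _ hu) (ii _ continuous_const)]
    simp [hm]
    field_simp
    simp
  refine ⟨h1, ?_, ?_⟩
  · have e : ∀ t, u t ^ 2 = (u t - m) ^ 2 + 2 * m * (u t - m) + m ^ 2 := fun t => by ring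
    simp only [e]
    rw [intervalIntegral.integral_add (ii _ (by fun_prop)) (ii _ (by fun_prop)),
      intervalIntegral.integral_add (ii _ (by fun_prop)) (ii _ (by fun_prop)),
      intervalIntegral.integral_const_mul, h1]
    simp
  · have e : ∀ t, (f t - d * u t) ^ 2 = (f t - d * (u t - m)) ^ 2 + (-2 * d * m) * f t +
        2 * d ^ 2 * m * (u t - m) + d ^ 2 * m ^ 2 := fun t => by ring
    simp only [e]
    rw [intervalIntegral.integral_add (ii _ (by fun_prop)) (ii _ (by fun_prop)),
      intervalIntegral.integral_add (ii _ (by fun_prop)) (ii _ (by fun_prop)),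
      intervalIntegral.integral_add (ii _ (by fun_prop)) (ii _ (by fun_prop)),
      intervalIntegral.integral_const_mul, intervalIntegral.integral_const_mul, h1, h0]
    simp

/-- The operator `(a, z, x, y) ↦ (-z', a', -y', x' - k y) - d (a, z, x, y)` is bounded below by
`|d|` when `d` is small. -/
lemma circle_gap {T κ M d : ℝ} (hT : 0 < T) (hκ : 0 < κ) (hd : 4 * gapConst T κ M * d ^ 2 ≤ 1)
    {k : ℝ → ℝ} (hk : Continuous k)
    (hM : ∀ t, |k t| ≤ M) (hκk : κ ≤ |∫ t in (0 : ℝ)..T, k t|) {u u' : Fin 4 → ℝ → ℝ}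
    (hu : ∀ i t, HasDerivAt (u i) (u' i t) t) (hu' : ∀ i, Continuous (u' i))
    (hp : ∀ i, u i T = u i 0) :
    d ^ 2 * ∫ t in (0 : ℝ)..T, (u 0 t ^ 2 + u 1 t ^ 2 + u 2 t ^ 2 + u 3 t ^ 2) ≤
      ∫ t in (0 : ℝ)..T, ((-u' 1 t - d * u 0 t) ^ 2 + (u' 0 t - d * u 1 t) ^ 2 +
        (-u' 3 t - d * u 2 t) ^ 2 + (u' 2 t - k t * u 3 t - d * u 3 t) ^ 2) := by
  have ii : ∀ g : ℝ → ℝ, Continuous g → IntervalIntegrable g volume 0 T :=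
    fun g hg => hg.intervalIntegrable _ _
  have huc : ∀ i, Continuous (u i) :=
    fun i => continuous_iff_continuousAt.2 fun t => (hu i t).continuousAt
  have c0 := huc 0; have c1 := huc 1; have c2 := huc 2; have c3 := huc 3
  have c0' := hu' 0; have c1' := hu' 1; have c2' := hu' 2; have c3' := hu' 3
  have z : ∀ i, ∫ t in (0 : ℝ)..T, u' i t = 0 :=
    fun i => integral_eq_zero_of_periodic (hu i) (hu' i) (hp i)
  have zn : ∀ i, ∫ t in (0 : ℝ)..T, -u' i t = 0 := fun i => by
    rw [intervalIntegral.integral_neg, z, neg_zero]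
  obtain ⟨m0, a1, a2, a3⟩ := integral_sub_mean hT (f := fun t => -u' 1 t) c0 c1'.neg (zn 1) d
  obtain ⟨m1, b1, b2, b3⟩ := integral_sub_mean hT c1 c0' (z 0) d
  obtain ⟨m2, e1, e2, e3⟩ := integral_sub_mean hT (f := fun t => -u' 3 t) c2 c3'.neg (zn 3) d
  have half : ∀ {f v : ℝ → ℝ}, Continuous f → Continuous v →
      (∫ t in (0 : ℝ)..T, f t ^ 2) / 2 - d ^ 2 * (∫ t in (0 : ℝ)..T, v t ^ 2) ≤
        ∫ t in (0 : ℝ)..T, (f t - d * v t) ^ 2 := by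
    intro f v hf hv
    rw [← intervalIntegral.integral_div, ← intervalIntegral.integral_const_mul,
      ← intervalIntegral.integral_sub (ii _ (by fun_prop)) (ii _ (by fun_prop))]
    refine intervalIntegral.integral_mono_on hT.le (ii _ (by fun_prop)) (ii _ (by fun_prop))
      fun t _ => ?_
    linarith [sq_nonneg (f t - 2 * (d * v t))]
  have ha := half (f := fun t => -u' 1 t) (v := fun t => u 0 t - m0) (by fun_prop) (by fun_prop)
  have hb := half (f := u' 0) (v := fun t => u 1 t - m1) (by fun_prop) (by fun_prop)
  have he := half (f := fun t => -u' 3 t) (v := fun t => u 2 t - m2) (by fun_prop) (by fun_prop)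
  have hg := half (f := fun t => u' 2 t - k t * u 3 t) (by fun_prop) c3
  have p0 := poincare_circle hT (fun t => (hu 0 t).sub_const m0) c0' a1
  have p1 := poincare_circle hT (fun t => (hu 1 t).sub_const m1) c1' b1
  have p2 := gap_planar hT hκ hk hM hκk (fun t => (hu 2 t).sub_const m2) c2'
    (by rw [hp 2]) e1 (hu 3) c3'
  have hTg : T ^ 2 ≤ gapConst T κ M := by
    unfold gapConst
    have : 0 ≤ (1 + 2 * T ^ 2 * M ^ 2) *
      (T ^ 2 + 2 * T ^ 2 / κ ^ 2 + 2 * T ^ 4 * M ^ 2 / κ ^ 2) := by positivity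
    linarith [sq_nonneg T]
  have scale : ∀ {A Z : ℝ}, 0 ≤ Z → A ≤ gapConst T κ M * Z → d ^ 2 * A ≤ Z / 4 := by
    intro A Z hZ hA
    have h1 := mul_le_mul_of_nonneg_left hA (sq_nonneg d)
    have h2 := mul_le_mul_of_nonneg_right hd hZ
    linarith
  have sqn : ∀ f : ℝ → ℝ, 0 ≤ ∫ t in (0 : ℝ)..T, f t ^ 2 :=
    fun f => intervalIntegral.integral_nonneg hT.le fun t _ => sq_nonneg _
  have s0 := scale (sqn (u' 0)) (p0.trans (mul_le_mul_of_nonneg_right hTg (sqn _)))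
  have s1 := scale (sqn (u' 1)) (p1.trans (mul_le_mul_of_nonneg_right hTg (sqn _)))
  have s2 := scale (add_nonneg (sqn _) (sqn _)) p2
  simp only [neg_sq] at ha he
  rw [intervalIntegral.integral_add (ii _ (by fun_prop)) (ii _ (by fun_prop)),
    intervalIntegral.integral_add (ii _ (by fun_prop)) (ii _ (by fun_prop)),
    intervalIntegral.integral_add (ii _ (by fun_prop)) (ii _ (by fun_prop)),
    intervalIntegral.integral_add (ii _ (by fun_prop)) (ii _ (by fun_prop)),
    intervalIntegral.integral_add (ii _ (by fun_prop)) (ii _ (by fun_prop)),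
    intervalIntegral.integral_add (ii _ (by fun_prop)) (ii _ (by fun_prop)),
    a2, b2, e2, a3, b3, e3]
  linarith

/-! ### The weighted energy estimate -/

/-- The complex structure `∂_a ↦ ∂_z`, `∂_x ↦ ∂_y` on `ℝ⁴`. -/
def stdJ : E4 →L[ℝ] E4 :=
  (coordForm 0).smulRight dirZ - (coordForm 1).smulRight dirA + (coordForm 2).smulRight dirY -
    (coordForm 3).smulRight dirX

/-- The projection to the `y`-axis. -/
def projY : E4 →L[ℝ] E4 := (coordForm 3).smulRight dirY

@[simp] lemma coordForm_apply (i : Fin 4) (w : E4) : coordForm i w = w i := rfl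

@[simp] lemma stdJ_zero (w : E4) : stdJ w 0 = -w 1 := by
  simp [stdJ, dirA, dirZ, dirX, dirY]

@[simp] lemma stdJ_one (w : E4) : stdJ w 1 = w 0 := by
  simp [stdJ, dirA, dirZ, dirX, dirY]

@[simp] lemma stdJ_two (w : E4) : stdJ w 2 = -w 3 := by
  simp [stdJ, dirA, dirZ, dirX, dirY]

@[simp] lemma stdJ_three (w : E4) : stdJ w 3 = w 2 := by
  simp [stdJ, dirA, dirZ, dirX, dirY]

@[simp] lemma projY_zero (w : E4) : projY w 0 = 0 := by simp [projY, dirY]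
@[simp] lemma projY_one (w : E4) : projY w 1 = 0 := by simp [projY, dirY]
@[simp] lemma projY_two (w : E4) : projY w 2 = 0 := by simp [projY, dirY]
@[simp] lemma projY_three (w : E4) : projY w 3 = w 3 := by simp [projY, dirY]

lemma inner_E4 (v w : E4) : inner ℝ v w = v 0 * w 0 + v 1 * w 1 + v 2 * w 2 + v 3 * w 3 := by
  simp [PiLp.inner_apply, Fin.sum_univ_four, mul_comm]

lemma norm_sq_E4 (v : E4) : ‖v‖ ^ 2 = v 0 ^ 2 + v 1 ^ 2 + v 2 ^ 2 + v 3 ^ 2 := by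
  rw [← real_inner_self_eq_norm_sq, inner_E4]; ring

/-- The zeroth and `∂_t` terms of the conjugated model operator. -/
def sliceOp (k : ℝ × ℝ → ℝ) (d : ℝ) (ζ : ℝ × ℝ → E4) (q : ℝ × ℝ) : E4 :=
  stdJ (pd (0, 1) ζ q) - k q • projY (ζ q) - d • ζ q

/-- The model operator `∂_s + J₀ ∂_t - k π_y - d`. -/
def modelOp (k : ℝ × ℝ → ℝ) (d : ℝ) (ζ : ℝ × ℝ → E4) (q : ℝ × ℝ) : E4 :=
  pd (1, 0) ζ q + sliceOp k d ζ q

section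
variable {T d : ℝ} {k : ℝ × ℝ → ℝ} {ζ : ℝ × ℝ → E4}

lemma IsTestMap.sliceOp (hk : IsCylMap T k) (hζ : IsTestMap T ζ) (d : ℝ) :
    IsTestMap T (sliceOp k d ζ) :=
  (((hζ.pd (0, 1)).comp stdJ.contDiff (map_zero _)).sub
    (IsTestMap.smul hk (hζ.comp projY.contDiff (map_zero _)))).sub (hζ.const_smul d)

lemma IsTestMap.modelOp (hk : IsCylMap T k) (hζ : IsTestMap T ζ) (d : ℝ) :
    IsTestMap T (modelOp k d ζ) :=
  (hζ.pd (1, 0)).add (hζ.sliceOp hk d)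

lemma pd_inner {φ ψ : ℝ × ℝ → E4} (h : IsCylMap T φ) (h' : IsCylMap T ψ) (e : ℝ × ℝ) :
    pd e (fun q => inner ℝ (φ q) (ψ q)) =
      fun q => inner ℝ (φ q) (pd e ψ q) + inner ℝ (pd e φ q) (ψ q) := by
  ext q
  exact fderiv_inner_apply ℝ h.differentiableAt h'.differentiableAt e

lemma pd_sliceOp (hk : IsCylMap T k) (hζ : IsTestMap T ζ) (e : ℝ × ℝ) :
    pd e (sliceOp k d ζ) = fun q => sliceOp k d (pd e ζ) q - pd e k q • projY (ζ q) := by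
  have h1 := (hζ.pd (0, 1)).comp stdJ.contDiff (map_zero _)
  have h2 := hζ.comp projY.contDiff (map_zero _)
  have h3 := IsTestMap.smul hk h2
  change pd e (fun q => stdJ (pd (0, 1) ζ q) - k q • projY (ζ q) - d • ζ q) = _
  rw [pd_sub (h1.sub h3).toIsCylMap (hζ.const_smul d).toIsCylMap,
    pd_sub h1.toIsCylMap h3.toIsCylMap, pd_const_smul hζ.toIsCylMap,
    pd_clm (hζ.pd (0, 1)).toIsCylMap, pd_smul hk h2.toIsCylMap, pd_clm hζ.toIsCylMap,
    pd_comm hζ.toIsCylMap]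
  ext q
  simp only [sliceOp]
  abel_nf

/-- The pairing of test maps with a weight depending on `s` only. -/
lemma isTestMap_weight_inner {w : ℝ → ℝ} (hw : ContDiff ℝ ∞ w) {φ ψ : ℝ × ℝ → E4}
    (hφ : IsTestMap T φ) (hψ : IsTestMap T ψ) :
    IsTestMap T fun q => w q.1 * inner ℝ (φ q) (ψ q) := by
  refine hφ.of_zero ⟨((hw.comp contDiff_fst).mul (hφ.smooth.inner ℝ hψ.smooth)), ?_⟩ ?_
  · intro s t; simp only [hφ.periodic, hψ.periodic]
  · intro q hq; simp [hq]

lemma isTestMap_weight_norm {w : ℝ → ℝ} (hw : ContDiff ℝ ∞ w) {φ : ℝ × ℝ → E4}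
    (hφ : IsTestMap T φ) : IsTestMap T fun q => w q.1 * ‖φ q‖ ^ 2 := by
  simpa only [real_inner_self_eq_norm_sq] using isTestMap_weight_inner hw hφ hφ

/-- The hypotheses on the coefficient `k` of the model operator. -/
structure IsModelCoeff (T κ M δ : ℝ) (k : ℝ × ℝ → ℝ) : Prop extends IsCylMap T k where
  bound : ∀ q, |k q| ≤ M
  bound_pd : ∀ q e, e = ((1 : ℝ), (0 : ℝ)) ∨ e = (0, 1) → |pd e k q| ≤ M
  slow : ∀ q, |pd (1, 0) k q| ≤ δ
  mean : ∀ s, κ ≤ |∫ t in (0 : ℝ)..T, k (s, t)|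

lemma weighted_slice {κ M δ : ℝ} (hT : 0 < T) (hκ : 0 < κ)
    (hd : 4 * gapConst T κ M * d ^ 2 ≤ 1) (hk : IsModelCoeff T κ M δ k) (hζ : IsTestMap T ζ)
    {w : ℝ → ℝ} (hw : ContDiff ℝ ∞ w) (hw0 : ∀ s, 0 ≤ w s) :
    d ^ 2 * ∫ q, w q.1 * ‖ζ q‖ ^ 2 ∂cylMeasure T ≤
      ∫ q, w q.1 * ‖sliceOp k d ζ q‖ ^ 2 ∂cylMeasure T := by
  have i1 := (isTestMap_weight_norm hw hζ).integrable
  have i2 := (isTestMap_weight_norm hw (hζ.sliceOp hk.toIsCylMap d)).integrable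
  rw [cylMeasure_eq_prod] at i1 i2 ⊢
  rw [integral_prod _ i1, integral_prod _ i2, ← integral_const_mul]
  refine integral_mono (i1.integral_prod_left.const_mul _) i2.integral_prod_left fun s => ?_
  simp only
  rw [integral_const_mul, integral_const_mul, mul_left_comm]
  refine mul_le_mul_of_nonneg_left ?_ (hw0 s)
  rw [← intervalIntegral.integral_of_le hT.le, ← intervalIntegral.integral_of_le hT.le]
  have hcoord : ∀ i t, HasDerivAt (fun t => ζ (s, t) i) (pd (0, 1) ζ (s, t) i) t := fun i t =>
    (coordForm i).hasFDerivAt.comp_hasDerivAt t (hasDerivAt_pd_snd hζ.toIsCylMap s t)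
  have hc' := (hζ.pd (0, 1)).continuous
  have := circle_gap (u := fun i t => ζ (s, t) i) (u' := fun i t => pd (0, 1) ζ (s, t) i)
    hT hκ hd (k := fun t => k (s, t)) (by have := hk.continuous; fun_prop)
    (fun t => hk.bound _) (hk.mean s) hcoord (fun i => by fun_prop)
    (fun i => by simpa using congrArg (fun v : E4 => v i) (hζ.periodic s 0))
  simp only [norm_sq_E4]
  simpa [sliceOp] using this

lemma weighted_energy {κ M : ℝ} (hT : 0 < T) (hκ : 0 < κ)
    (hd : 4 * gapConst T κ M * d ^ 2 ≤ 1) (hk : IsModelCoeff T κ M (d ^ 2 / 4) k)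
    (hζ : IsTestMap T ζ) {w w' : ℝ → ℝ} (hw : ContDiff ℝ ∞ w) (hw0 : ∀ s, 0 ≤ w s)
    (hw' : ∀ s, HasDerivAt w (w' s) s) (hww : ∀ s, |w' s| ≤ |d| / 2 * w s) :
    d ^ 2 * ∫ q, w q.1 * ‖ζ q‖ ^ 2 ∂cylMeasure T ≤
      4 * ∫ q, w q.1 * ‖modelOp k d ζ q‖ ^ 2 ∂cylMeasure T := by
  have hslice := weighted_slice hT hκ hd hk hζ hw hw0
  have hL := hζ.sliceOp hk.toIsCylMap d
  have hf := hζ.modelOp hk.toIsCylMap d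
  have hJ : IsTestMap T fun q => stdJ (pd (1, 0) ζ q) :=
    (hζ.pd (1, 0)).comp stdJ.contDiff (map_zero _)
  have h1 := isTestMap_weight_inner hw hζ hL
  have h2 := isTestMap_weight_inner hw hζ hJ
  have hwc : IsCylMap T fun q : ℝ × ℝ => w q.1 := isCylMap_fst hw
  have d1 : pd (1, 0) (fun q => w q.1 * inner ℝ (ζ q) (sliceOp k d ζ q)) = fun q =>
      w q.1 * (inner ℝ (ζ q) (sliceOp k d (pd (1, 0) ζ) q - pd (1, 0) k q • projY (ζ q)) +
        inner ℝ (pd (1, 0) ζ q) (sliceOp k d ζ q)) + w' q.1 * inner ℝ (ζ q) (sliceOp k d ζ q) := by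
    have := pd_smul hwc (φ := fun q => inner ℝ (ζ q) (sliceOp k d ζ q))
      ⟨hζ.smooth.inner ℝ hL.smooth, fun s t => by simp only [hζ.periodic, hL.periodic]⟩ (1, 0)
    simp only [smul_eq_mul] at this
    rw [this, pd_inner hζ.toIsCylMap hL.toIsCylMap, pd_sliceOp hk.toIsCylMap hζ]
    ext q
    rw [pd_fst (hw' q.1)]
    simp
  have d2 : pd (0, 1) (fun q => w q.1 * inner ℝ (ζ q) (stdJ (pd (1, 0) ζ q))) = fun q =>
      w q.1 * (inner ℝ (ζ q) (stdJ (pd (0, 1) (pd (1, 0) ζ) q)) +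
        inner ℝ (pd (0, 1) ζ q) (stdJ (pd (1, 0) ζ q))) := by
    have := pd_smul hwc (φ := fun q => inner ℝ (ζ q) (stdJ (pd (1, 0) ζ q)))
      ⟨hζ.smooth.inner ℝ hJ.smooth, fun s t => by simp only [hζ.periodic, hJ.periodic]⟩ (0, 1)
    simp only [smul_eq_mul] at this
    rw [this, pd_inner hζ.toIsCylMap hJ.toIsCylMap, pd_clm (hζ.pd (1, 0)).toIsCylMap]
    ext q
    rw [pd_fst (hw' q.1)]
    simp
  have z1 := integral_pd hT.le h1 (1, 0)
  have z2 := integral_pd hT.le h2 (0, 1)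
  have I1 := (h1.pd (1, 0)).integrable
  have I2 := (h2.pd (0, 1)).integrable
  have iL := (isTestMap_weight_norm hw hL).integrable
  have if' := (isTestMap_weight_norm hw hf).integrable
  have iζ := (isTestMap_weight_norm hw hζ).integrable
  have key : ∀ q, w q.1 * ‖sliceOp k d ζ q‖ ^ 2 ≤ 2 * (w q.1 * ‖modelOp k d ζ q‖ ^ 2) +
      3 / 8 * d ^ 2 * (w q.1 * ‖ζ q‖ ^ 2) -
      (pd (1, 0) (fun q => w q.1 * inner ℝ (ζ q) (sliceOp k d ζ q)) q -
        pd (0, 1) (fun q => w q.1 * inner ℝ (ζ q) (stdJ (pd (1, 0) ζ q))) q) := by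
    intro q
    have e : pd (1, 0) (fun q => w q.1 * inner ℝ (ζ q) (sliceOp k d ζ q)) q -
        pd (0, 1) (fun q => w q.1 * inner ℝ (ζ q) (stdJ (pd (1, 0) ζ q))) q =
        w' q.1 * inner ℝ (ζ q) (sliceOp k d ζ q) +
        2 * w q.1 * inner ℝ (modelOp k d ζ q) (sliceOp k d ζ q) -
        2 * w q.1 * ‖sliceOp k d ζ q‖ ^ 2 - w q.1 * pd (1, 0) k q * ζ q 3 ^ 2 := by
      rw [d1, d2, ← real_inner_self_eq_norm_sq (sliceOp k d ζ q)]
      simp only [modelOp, inner_E4, sliceOp, PiLp.add_apply, PiLp.sub_apply, PiLp.smul_apply,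
        smul_eq_mul, stdJ_zero, stdJ_one, stdJ_two, stdJ_three, projY_zero, projY_one, projY_two,
        projY_three]
      ring
    rw [e]
    set L := sliceOp k d ζ q with hLdef
    set f := modelOp k d ζ q with hfdef
    have b1 : |w' q.1 * inner ℝ (ζ q) L| ≤ w q.1 * (d ^ 2 / 8 * ‖ζ q‖ ^ 2 + 1 / 2 * ‖L‖ ^ 2) := by
      rw [abs_mul]
      have c1 : |w' q.1| * |inner ℝ (ζ q) L| ≤ (|d| / 2 * w q.1) * (‖ζ q‖ * ‖L‖) :=
        mul_le_mul (hww _) (abs_real_inner_le_norm _ _) (abs_nonneg _)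
          (mul_nonneg (by positivity) (hw0 _))
      have c2 : |d| / 2 * (‖ζ q‖ * ‖L‖) ≤ d ^ 2 / 8 * ‖ζ q‖ ^ 2 + 1 / 2 * ‖L‖ ^ 2 := by
        rw [← sq_abs d]
        nlinarith [sq_nonneg (|d| * ‖ζ q‖ / 2 - ‖L‖)]
      have c3 := mul_le_mul_of_nonneg_left c2 (hw0 q.1)
      linarith
    have b2 : w q.1 * (2 * inner ℝ f L) ≤ w q.1 * (2 * ‖f‖ ^ 2 + 1 / 2 * ‖L‖ ^ 2) := by
      refine mul_le_mul_of_nonneg_left ?_ (hw0 q.1)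
      nlinarith [real_inner_le_norm f L, sq_nonneg (2 * ‖f‖ - ‖L‖)]
    have b3 : w q.1 * (|pd (1, 0) k q| * ζ q 3 ^ 2) ≤ w q.1 * (d ^ 2 / 4 * ‖ζ q‖ ^ 2) := by
      refine mul_le_mul_of_nonneg_left ?_ (hw0 q.1)
      refine mul_le_mul (hk.slow q) ?_ (sq_nonneg _) (by positivity)
      rw [norm_sq_E4]
      nlinarith [sq_nonneg (ζ q 0), sq_nonneg (ζ q 1), sq_nonneg (ζ q 2)]
    have b4 : w q.1 * (-pd (1, 0) k q * ζ q 3 ^ 2) ≤ w q.1 * (|pd (1, 0) k q| * ζ q 3 ^ 2) :=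
      mul_le_mul_of_nonneg_left (mul_le_mul_of_nonneg_right (neg_le_abs _) (sq_nonneg _)) (hw0 _)
    have b5 := le_abs_self (w' q.1 * inner ℝ (ζ q) L)
    linarith
  have i3 : Integrable (fun q => 2 * (w q.1 * ‖modelOp k d ζ q‖ ^ 2) +
      3 / 8 * d ^ 2 * (w q.1 * ‖ζ q‖ ^ 2)) (cylMeasure T) :=
    (if'.const_mul 2).add (iζ.const_mul (3 / 8 * d ^ 2))
  have i4 : Integrable (fun q => pd (1, 0) (fun q => w q.1 * inner ℝ (ζ q) (sliceOp k d ζ q)) q -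
      pd (0, 1) (fun q => w q.1 * inner ℝ (ζ q) (stdJ (pd (1, 0) ζ q))) q) (cylMeasure T) :=
    I1.sub I2
  have hint := integral_mono iL (i3.sub i4) key
  rw [integral_sub' i3 i4, integral_add (if'.const_mul 2) (iζ.const_mul _), integral_sub I1 I2,
    z1, z2, integral_const_mul, integral_const_mul] at hint
  have hf0 : 0 ≤ ∫ q, w q.1 * ‖modelOp k d ζ q‖ ^ 2 ∂cylMeasure T :=
    integral_nonneg fun q => mul_nonneg (hw0 _) (sq_nonneg _)
  linarith

end

/-! ### Integral inequalities on the cylinder -/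

lemma rpow_lintegral_le {X : Type*} [MeasurableSpace X] (ν : Measure X) {p : ℝ} (hp : 1 ≤ p)
    {g : X → ℝ≥0∞} (hg : AEMeasurable g ν) :
    (∫⁻ x, g x ∂ν) ^ p ≤ ν univ ^ (p - 1) * ∫⁻ x, g x ^ p ∂ν := by
  rcases hp.eq_or_lt with rfl | hp1
  · simp
  have hpq := Real.HolderConjugate.conjExponent hp1
  have h := ENNReal.lintegral_mul_le_Lp_mul_Lq ν hpq hg (aemeasurable_const (b := (1 : ℝ≥0∞)))
  simp only [Pi.mul_apply, mul_one, ENNReal.one_rpow, lintegral_one] at h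
  refine (ENNReal.rpow_le_rpow h (by linarith)).trans_eq ?_
  rw [ENNReal.mul_rpow_of_nonneg _ _ (by linarith), ← ENNReal.rpow_mul, ← ENNReal.rpow_mul,
    one_div_mul_cancel (by linarith), ENNReal.rpow_one, mul_comm]
  congr 2
  have := hpq.sub_one_mul_conj
  rw [one_div, inv_mul_eq_div, div_eq_iff hpq.symm.ne_zero]
  exact this.symm

/-- A map on the plane that is periodic in the second variable. -/
def IsPeriodicMap {X : Type*} (T : ℝ) (g : ℝ × ℝ → X) : Prop := ∀ s t, g (s, t + T) = g (s, t)

lemma lintegral_cyl_add {T : ℝ} (hT : 0 < T) {g : ℝ × ℝ → ℝ≥0∞} (hg : Measurable g)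
    (hp : IsPeriodicMap T g) (a : ℝ × ℝ) :
    ∫⁻ q, g (q + a) ∂cylMeasure T = ∫⁻ q, g q ∂cylMeasure T := by
  rw [cylMeasure_eq_prod, lintegral_prod _ (Measurable.aemeasurable (by fun_prop)),
    lintegral_prod _ hg.aemeasurable]
  have h1 : ∀ s, ∫⁻ t in Ioc 0 T, g ((s, t) + a) = ∫⁻ t in Ioc 0 T, g (s + a.1, t) := by
    intro s
    have : ∫⁻ t in Ioc 0 T, g ((s, t) + a) = ∫⁻ t in Ioc a.2 (a.2 + T), g (s + a.1, t) := by
      rw [← lintegral_indicator measurableSet_Ioc, ← lintegral_indicator measurableSet_Ioc,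
        ← lintegral_add_right_eq_self
          (fun t => (Ioc a.2 (a.2 + T)).indicator (fun t => g (s + a.1, t)) t) a.2]
      refine lintegral_congr fun t => ?_
      by_cases ht : t ∈ Ioc 0 T
      · have h2 : t + a.2 ∈ Ioc a.2 (a.2 + T) := ⟨by linarith [ht.1], by linarith [ht.2]⟩
        rw [indicator_of_mem ht, indicator_of_mem h2]
        rfl
      · have h2 : t + a.2 ∉ Ioc a.2 (a.2 + T) := fun h =>
          ht ⟨by linarith [h.1], by linarith [h.2]⟩
        rw [indicator_of_notMem ht, indicator_of_notMem h2]
    rw [this]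
    have : VAddInvariantMeasure (AddSubgroup.zmultiples T) ℝ volume :=
      ⟨fun c s _ => measure_preimage_add _ _ _⟩
    have h0 := isAddFundamentalDomain_Ioc hT 0
    rw [zero_add] at h0
    refine IsAddFundamentalDomain.setLIntegral_eq (G := AddSubgroup.zmultiples T)
      (isAddFundamentalDomain_Ioc hT a.2) h0 (fun t => g (s + a.1, t)) ?_
    have : Function.Periodic (fun t => g (s + a.1, t)) T := fun t => hp _ _
    exact this.map_vadd_zmultiples
  simp only [h1]
  exact lintegral_add_right_eq_self (fun s => ∫⁻ t in Ioc 0 T, g (s, t)) a.1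

instance (T : ℝ) : SFinite (cylMeasure T) := by rw [cylMeasure]; infer_instance

/-- Young's inequality for averages of translates. -/
lemma lintegral_young {T : ℝ} (hT : 0 < T) {X : Type*} [MeasurableSpace X] (ν : Measure X)
    [SFinite ν] {Φ : X → ℝ × ℝ} (hΦ : Measurable Φ) {p : ℝ} (hp : 1 ≤ p) {g : ℝ × ℝ → ℝ≥0∞}
    (hg : Measurable g) (hper : IsPeriodicMap T g) :
    ∫⁻ q, (∫⁻ x, g (q + Φ x) ∂ν) ^ p ∂cylMeasure T ≤
      ν univ ^ p * ∫⁻ q, g q ^ p ∂cylMeasure T := by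
  calc ∫⁻ q, (∫⁻ x, g (q + Φ x) ∂ν) ^ p ∂cylMeasure T
      ≤ ∫⁻ q, ν univ ^ (p - 1) * ∫⁻ x, g (q + Φ x) ^ p ∂ν ∂cylMeasure T :=
        lintegral_mono fun q => rpow_lintegral_le ν hp (by fun_prop)
    _ = ν univ ^ (p - 1) * ∫⁻ q, ∫⁻ x, g (q + Φ x) ^ p ∂ν ∂cylMeasure T := by
        refine lintegral_const_mul _ ?_
        exact Measurable.lintegral_prod_right' (f := fun z : (ℝ × ℝ) × X => g (z.1 + Φ z.2) ^ p)
          (by fun_prop)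
    _ = ν univ ^ (p - 1) * ∫⁻ x, ∫⁻ q, g (q + Φ x) ^ p ∂cylMeasure T ∂ν := by
        congr 1
        exact lintegral_lintegral_swap
          (f := fun q x => g (q + Φ x) ^ p) (Measurable.aemeasurable (by fun_prop))
    _ = ν univ ^ (p - 1) * ∫⁻ _, (∫⁻ q, g q ^ p ∂cylMeasure T) ∂ν := by
        congr 1
        refine lintegral_congr fun x => ?_
        exact lintegral_cyl_add hT (g := fun q => g q ^ p) (by fun_prop)
          (fun s t => by simp only [hper s t]) (Φ x)
    _ = _ := by
        rw [lintegral_const, mul_comm (lintegral _ _), ← mul_assoc]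
        congr 1
        nth_rewrite 2 [← ENNReal.rpow_one (ν univ)]
        rw [← ENNReal.rpow_add_of_nonneg _ _ (by linarith) zero_le_one, sub_add_cancel]

/-- The weight `(1 + (ε s)²)⁻¹`. -/
def cauchyWeight (ε s : ℝ) : ℝ := (1 + (ε * s) ^ 2)⁻¹

lemma cauchyWeight_pos (ε s : ℝ) : 0 < cauchyWeight ε s := by unfold cauchyWeight; positivity

lemma contDiff_cauchyWeight (ε : ℝ) : ContDiff ℝ ∞ (cauchyWeight ε) := by
  unfold cauchyWeight
  exact ContDiff.inv (by fun_prop) fun s => by positivity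

lemma hasDerivAt_cauchyWeight (ε s : ℝ) :
    HasDerivAt (cauchyWeight ε) (-(2 * ε ^ 2 * s) / (1 + (ε * s) ^ 2) ^ 2) s := by
  unfold cauchyWeight
  have h : HasDerivAt (fun s : ℝ => 1 + (ε * s) ^ 2) (2 * ε ^ 2 * s) s := by
    refine ((((hasDerivAt_id s).const_mul ε).pow 2).const_add 1).congr_deriv ?_
    simp; ring
  exact h.fun_inv (by positivity)

lemma abs_deriv_cauchyWeight_le {ε : ℝ} (hε : 0 ≤ ε) (s : ℝ) :
    |-(2 * ε ^ 2 * s) / (1 + (ε * s) ^ 2) ^ 2| ≤ ε * cauchyWeight ε s := by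
  unfold cauchyWeight
  rw [abs_div, abs_of_nonneg (by positivity : (0 : ℝ) ≤ (1 + (ε * s) ^ 2) ^ 2), abs_neg,
    div_le_iff₀ (by positivity)]
  have e : ε * (1 + (ε * s) ^ 2)⁻¹ * (1 + (ε * s) ^ 2) ^ 2 = ε * (1 + (ε * s) ^ 2) := by
    field_simp
  rw [e, abs_mul, abs_of_nonneg (by positivity : (0 : ℝ) ≤ 2 * ε ^ 2)]
  have h2 : 2 * (ε * |s|) ≤ 1 + (ε * s) ^ 2 := by
    have : (ε * s) ^ 2 = (ε * |s|) ^ 2 := by rw [mul_pow, mul_pow, sq_abs]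
    rw [this]
    nlinarith [sq_nonneg (ε * |s| - 1)]
  calc 2 * ε ^ 2 * |s| = ε * (2 * (ε * |s|)) := by ring
    _ ≤ _ := mul_le_mul_of_nonneg_left h2 hε

lemma lintegral_cauchyWeight_lt_top {T ε : ℝ} (hε : ε ≠ 0) :
    ∫⁻ q, ENNReal.ofReal (cauchyWeight ε q.1) ∂cylMeasure T < ⊤ := by
  have hi : Integrable (cauchyWeight ε) := by
    have := integrable_inv_one_add_sq.comp_mul_left' hε
    exact this
  have hm : Measurable (cauchyWeight ε) := (contDiff_cauchyWeight ε).continuous.measurable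
  rw [cylMeasure_eq_prod, lintegral_prod _ (Measurable.aemeasurable (by fun_prop))]
  simp only [lintegral_const, Measure.restrict_apply_univ]
  rw [lintegral_mul_const _ (by fun_prop)]
  refine ENNReal.mul_lt_top ?_ measure_Ioc_lt_top
  have := hi.hasFiniteIntegral
  rw [hasFiniteIntegral_iff_ofReal
    (Filter.Eventually.of_forall fun s => (cauchyWeight_pos ε s).le)] at this
  exact this

section Box

variable {T : ℝ} {ζ : ℝ × ℝ → E4}

/-- The size of the gradient. -/
def gradSize (ζ : ℝ × ℝ → E4) (q : ℝ × ℝ) : ℝ := ‖pd (1, 0) ζ q‖ + ‖pd (0, 1) ζ q‖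

lemma continuous_gradSize (h : IsCylMap T ζ) : Continuous (gradSize ζ) := by
  have h1 := (h.pd (1, 0)).continuous
  have h2 := (h.pd (0, 1)).continuous
  unfold gradSize
  fun_prop

lemma norm_fderiv_le_gradSize (q v : ℝ × ℝ) {r : ℝ} (h1 : |v.1| ≤ r) (h2 : |v.2| ≤ r) :
    ‖fderiv ℝ ζ q v‖ ≤ r * gradSize ζ q := by
  have : fderiv ℝ ζ q v = v.1 • pd (1, 0) ζ q + v.2 • pd (0, 1) ζ q := by
    simp only [pd, ← map_smul, ← map_add]
    congr 1
    ext <;> simp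
  rw [this, gradSize, mul_add]
  refine (norm_add_le _ _).trans (add_le_add ?_ ?_) <;>
  · rw [norm_smul]; gcongr; simpa

lemma enorm_le_path (h : IsCylMap T ζ) (q v : ℝ × ℝ) {r : ℝ} (hr : 0 ≤ r)
    (h1 : |v.1| ≤ r) (h2 : |v.2| ≤ r) :
    ‖ζ q‖ₑ ≤ ‖ζ (q + v)‖ₑ + ENNReal.ofReal r *
      ∫⁻ θ in Ioc (0 : ℝ) 1, ENNReal.ofReal (gradSize ζ (q + θ • v)) := by
  have hgc := continuous_gradSize h
  have hd : ∀ θ : ℝ, HasDerivAt (fun θ : ℝ => ζ (q + θ • v)) (fderiv ℝ ζ (q + θ • v) v) θ := by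
    intro θ
    have : HasDerivAt (fun θ : ℝ => q + θ • v) v θ := by
      simpa using ((hasDerivAt_id θ).smul_const v).const_add q
    exact (h.differentiable _).hasFDerivAt.comp_hasDerivAt θ this
  have hcf : Continuous fun θ : ℝ => fderiv ℝ ζ (q + θ • v) v := by
    have := h.smooth.continuous_fderiv (by simp)
    fun_prop
  have hftc := intervalIntegral.integral_eq_sub_of_hasDerivAt (fun θ _ => hd θ)
    (hcf.intervalIntegrable 0 1)
  simp only [one_smul, zero_smul, add_zero] at hftc
  rw [intervalIntegral.integral_of_le zero_le_one] at hftc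
  have h3 : ζ q = ζ (q + v) - ∫ θ in Ioc (0 : ℝ) 1, fderiv ℝ ζ (q + θ • v) v := by
    rw [hftc]; abel
  calc ‖ζ q‖ₑ ≤ ‖ζ (q + v)‖ₑ + ‖∫ θ in Ioc (0 : ℝ) 1, fderiv ℝ ζ (q + θ • v) v‖ₑ := by
        nth_rewrite 1 [h3]; exact enorm_sub_le
    _ ≤ _ := by
        gcongr
        refine (enorm_integral_le_lintegral_enorm _).trans ?_
        rw [← lintegral_const_mul _ (by fun_prop)]
        refine lintegral_mono fun θ => ?_
        rw [← ENNReal.ofReal_mul hr, ← ofReal_norm]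
        exact ENNReal.ofReal_le_ofReal (norm_fderiv_le_gradSize _ _ h1 h2)

/-- Averaging over a square: the mean value part and the gradient part. -/
lemma enorm_le_box (h : IsCylMap T ζ) {r : ℝ} (hr : 0 < r) (q : ℝ × ℝ) :
    ENNReal.ofReal r ^ 2 * ‖ζ q‖ₑ ≤ (∫⁻ v, ‖ζ (q + v)‖ₑ ∂boxMeasure r r) +
      ENNReal.ofReal r * ∫⁻ x, ENNReal.ofReal (gradSize ζ (q + x.1 • x.2))
        ∂((volume.restrict (Ioc (0 : ℝ) 1)).prod (boxMeasure r r)) := by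
  have hgc := continuous_gradSize h
  have hc := h.continuous
  have hm : Measurable fun v => ‖ζ (q + v)‖ₑ := (Continuous.measurable (by fun_prop))
  have hvol : boxMeasure r r univ = ENNReal.ofReal r ^ 2 := by
    rw [boxMeasure_eq_prod, Measure.prod_apply MeasurableSet.univ]
    simp [sq]
  rw [lintegral_prod_symm _ (Measurable.aemeasurable (by fun_prop)),
    ← lintegral_const_mul' _ _ ENNReal.ofReal_ne_top, ← lintegral_add_left hm, mul_comm,
    ← hvol, ← lintegral_const]
  refine lintegral_mono_ae ?_
  filter_upwards [ae_boxMeasure r r] with v hv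
  refine enorm_le_path h q v hr.le ?_ ?_
  · rw [abs_of_nonneg hv.1.1]; exact hv.1.2
  · rw [abs_of_nonneg hv.2.1]; exact hv.2.2

end Box

/-! ### The first-order `L^p` estimate for `p ≥ 2` -/

/-- The `L^p` norm to the power `p`. -/
def powNorm {F : Type*} [NormedAddCommGroup F] (T p : ℝ) (φ : ℝ × ℝ → F) : ℝ≥0∞ :=
  ∫⁻ q, ‖φ q‖ₑ ^ p ∂cylMeasure T

section
variable {F : Type*} [NormedAddCommGroup F] {T p : ℝ}

lemma powNorm_mono {G : Type*} [NormedAddCommGroup G] {φ : ℝ × ℝ → F} {ψ : ℝ × ℝ → G}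
    (hp : 0 ≤ p) (h : ∀ q, ‖φ q‖ ≤ ‖ψ q‖) : powNorm T p φ ≤ powNorm T p ψ :=
  lintegral_mono fun q => ENNReal.rpow_le_rpow (enorm_le_iff_norm_le.2 (h q)) hp

lemma powNorm_add_le (hp : 1 ≤ p) {φ ψ : ℝ × ℝ → F} (hφ : Continuous φ) :
    powNorm T p (fun q => φ q + ψ q) ≤ 2 ^ (p - 1) * (powNorm T p φ + powNorm T p ψ) := by
  unfold powNorm
  rw [← lintegral_add_left (Continuous.measurable (by fun_prop) |>.pow_const _),
    ← lintegral_const_mul' _ _ (by finiteness)]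
  refine lintegral_mono fun q => ?_
  exact (ENNReal.rpow_le_rpow (enorm_add_le _ _) (by linarith)).trans
    (ENNReal.rpow_add_le_mul_rpow_add_rpow _ _ hp)

lemma powNorm_const_smul [NormedSpace ℝ F] (hp : 0 ≤ p) (c : ℝ) (φ : ℝ × ℝ → F) :
    powNorm T p (fun q => c • φ q) = ‖c‖ₑ ^ p * powNorm T p φ := by
  unfold powNorm
  rw [← lintegral_const_mul' _ _ (by finiteness)]
  refine lintegral_congr fun q => ?_
  rw [enorm_smul, ENNReal.mul_rpow_of_nonneg _ _ hp]

lemma powNorm_lt_top [NormedSpace ℝ F] (hp : 0 < p) {φ : ℝ × ℝ → F} (hφ : IsTestMap T φ) :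
    powNorm T p φ < ⊤ := by
  have := (hφ.memLp (ENNReal.ofReal p)).eLpNorm_lt_top
  rw [eLpNorm_lt_top_iff_lintegral_rpow_enorm_lt_top (by simpa using hp) (by simp),
    ENNReal.toReal_ofReal hp.le] at this
  exact this

lemma powNorm_eq_ofReal [NormedSpace ℝ F] (hp : 0 < p) {φ : ℝ × ℝ → F} (hφ : IsTestMap T φ) :
    powNorm T p φ = ENNReal.ofReal (∫ q, ‖φ q‖ ^ p ∂cylMeasure T) := by
  have hc := hφ.continuous
  have hi : Integrable (fun q => ‖φ q‖ ^ p) (cylMeasure T) := by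
    refine integrable_of_supp ((hc.norm).rpow_const fun _ => Or.inr hp.le) ?_
    exact hφ.supp.imp fun K hK s t hs => by rw [hK s t hs, norm_zero, Real.zero_rpow hp.ne']
  rw [ofReal_integral_eq_lintegral_ofReal hi (Filter.Eventually.of_forall fun q => by positivity)]
  refine lintegral_congr fun q => ?_
  rw [← ofReal_norm, ENNReal.ofReal_rpow_of_nonneg (norm_nonneg _) hp.le]

end

/-- The first complex coordinate `a + i z`. -/
def complexFst : E4 →L[ℝ] ℂ :=
  (coordForm 0).smulRight (1 : ℂ) + (coordForm 1).smulRight Complex.I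

/-- The second complex coordinate `x + i y`. -/
def complexSnd : E4 →L[ℝ] ℂ :=
  (coordForm 2).smulRight (1 : ℂ) + (coordForm 3).smulRight Complex.I

lemma complexFst_stdJ (v : E4) : complexFst (stdJ v) = Complex.I * complexFst v := by
  apply Complex.ext <;> simp [complexFst]

lemma complexSnd_stdJ (v : E4) : complexSnd (stdJ v) = Complex.I * complexSnd v := by
  apply Complex.ext <;> simp [complexSnd]

lemma norm_sq_complex (v : E4) : ‖v‖ ^ 2 = ‖complexFst v‖ ^ 2 + ‖complexSnd v‖ ^ 2 := by
  rw [norm_sq_E4, ← Complex.normSq_eq_norm_sq, ← Complex.normSq_eq_norm_sq]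
  simp [complexFst, complexSnd, Complex.normSq_apply]
  ring

lemma norm_complexFst_le (v : E4) : ‖complexFst v‖ ≤ ‖v‖ := by
  nlinarith [norm_sq_complex v, norm_nonneg v, norm_nonneg (complexFst v),
    sq_nonneg ‖complexSnd v‖]

lemma norm_complexSnd_le (v : E4) : ‖complexSnd v‖ ≤ ‖v‖ := by
  nlinarith [norm_sq_complex v, norm_nonneg v, norm_nonneg (complexSnd v),
    sq_nonneg ‖complexFst v‖]

lemma norm_le_complex (v : E4) : ‖v‖ ≤ ‖complexFst v‖ + ‖complexSnd v‖ := by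
  nlinarith [norm_sq_complex v, norm_nonneg v, norm_nonneg (complexSnd v),
    norm_nonneg (complexFst v)]

/-- The Cauchy-Riemann operator with the standard complex structure. -/
def stdDbar (ζ : ℝ × ℝ → E4) (q : ℝ × ℝ) : E4 := pd (1, 0) ζ q + stdJ (pd (0, 1) ζ q)

lemma IsTestMap.stdDbar {T : ℝ} {ζ : ℝ × ℝ → E4} (hζ : IsTestMap T ζ) : IsTestMap T (stdDbar ζ) :=
  (hζ.pd (1, 0)).add ((hζ.pd (0, 1)).comp stdJ.contDiff (map_zero _))

lemma powNorm_pd_le_stdDbar {p : ℝ} (hp : 1 < p) : ∃ K : ℝ≥0∞, K ≠ ⊤ ∧ ∀ {T : ℝ}, 0 < T →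
    ∀ ζ : ℝ × ℝ → E4, IsTestMap T ζ → ∀ e : ℝ × ℝ, e = (1, 0) ∨ e = (0, 1) →
    powNorm T p (pd e ζ) ≤ K * powNorm T p (stdDbar ζ) := by
  obtain ⟨K, hK, h⟩ := cylinder_dbar hp
  refine ⟨2 ^ (p - 1) * (2 * ENNReal.ofReal K), by finiteness, fun {T} hT ζ hζ e he => ?_⟩
  have hp0 : 0 < p := by linarith
  have main : ∀ c : E4 →L[ℝ] ℂ, (∀ v, c (stdJ v) = Complex.I * c v) → (∀ v, ‖c v‖ ≤ ‖v‖) →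
      powNorm T p (fun q => c (pd e ζ q)) ≤ ENNReal.ofReal K * powNorm T p (stdDbar ζ) := by
    intro c hcJ hc
    have hcζ : IsTestMap T fun q => c (ζ q) := hζ.comp c.contDiff (map_zero _)
    have hcd : IsTestMap T fun q => c (stdDbar ζ q) := hζ.stdDbar.comp c.contDiff (map_zero _)
    obtain ⟨R, hR⟩ := hcζ.supp
    have h1 := h hT (fun q => c (ζ q)) (hcζ.smooth.of_le (by simp)) hcζ.periodic R hR e he
    have e1 : ∀ e' q, fderiv ℝ (fun q => c (ζ q)) q e' = c (pd e' ζ q) := fun e' q =>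
      congrFun (pd_clm hζ.toIsCylMap c e') q
    simp only [e1, ← hcJ, ← map_add] at h1
    refine le_trans ?_ (mul_le_mul_right (powNorm_mono (φ := fun q => c (stdDbar ζ q)) hp0.le
      fun q => hc _) _)
    rw [powNorm_eq_ofReal hp0 ((hζ.pd e).comp c.contDiff (map_zero _)), powNorm_eq_ofReal hp0 hcd,
      ← ENNReal.ofReal_mul hK.le]
    exact ENNReal.ofReal_le_ofReal h1
  have m1 := main complexFst complexFst_stdJ norm_complexFst_le
  have m2 := main complexSnd complexSnd_stdJ norm_complexSnd_le
  have hcc : ∀ c : E4 →L[ℝ] ℂ, Continuous fun q => c (pd e ζ q) := fun c =>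
    c.continuous.comp (hζ.pd e).continuous
  calc powNorm T p (pd e ζ)
      ≤ powNorm T p (fun q => ‖complexFst (pd e ζ q)‖ + ‖complexSnd (pd e ζ q)‖) :=
        powNorm_mono hp0.le fun q => (norm_le_complex _).trans (Real.le_norm_self _)
    _ ≤ 2 ^ (p - 1) * (powNorm T p (fun q => ‖complexFst (pd e ζ q)‖) +
          powNorm T p (fun q => ‖complexSnd (pd e ζ q)‖)) :=
        powNorm_add_le hp.le (hcc _).norm
    _ ≤ 2 ^ (p - 1) * (ENNReal.ofReal K * powNorm T p (stdDbar ζ) +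
          ENNReal.ofReal K * powNorm T p (stdDbar ζ)) := by
        gcongr
        · simpa [powNorm] using m1
        · simpa [powNorm] using m2
    _ = _ := by ring

/-- The gradient is controlled by the model operator and the zeroth order term. -/
lemma powNorm_pd_le_modelOp {p : ℝ} (hp : 1 < p) (M d : ℝ) : ∃ K : ℝ≥0∞, K ≠ ⊤ ∧
    ∀ {T : ℝ}, 0 < T → ∀ k, IsCylMap T k → (∀ q, |k q| ≤ M) →
    ∀ ζ : ℝ × ℝ → E4, IsTestMap T ζ → ∀ e : ℝ × ℝ, e = (1, 0) ∨ e = (0, 1) →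
    powNorm T p (pd e ζ) ≤ K * (powNorm T p (modelOp k d ζ) + powNorm T p ζ) := by
  obtain ⟨K, hK, h⟩ := powNorm_pd_le_stdDbar hp
  refine ⟨K * (2 ^ (p - 1) * (1 + ‖M + |d|‖ₑ ^ p)), by finiteness,
    fun {T} hT k hk hM ζ hζ e he => (h hT ζ hζ e he).trans ?_⟩
  have e1 : stdDbar ζ = fun q => modelOp k d ζ q + (k q • projY (ζ q) + d • ζ q) := by
    ext1 q; simp only [stdDbar, modelOp, sliceOp]; abel
  rw [mul_assoc]
  gcongr
  rw [e1]
  refine (powNorm_add_le hp.le (hζ.modelOp hk d).continuous).trans ?_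
  rw [mul_assoc]
  gcongr
  have h2 : powNorm T p (fun q => k q • projY (ζ q) + d • ζ q) ≤
      ‖M + |d|‖ₑ ^ p * powNorm T p ζ := by
    rw [← powNorm_const_smul (by linarith)]
    refine powNorm_mono (by linarith) fun q => ?_
    have hM0 : 0 ≤ M := (abs_nonneg _).trans (hM 0)
    have h3 : ‖projY (ζ q)‖ ≤ ‖ζ q‖ := by
      rw [← sq_le_sq₀ (norm_nonneg _) (norm_nonneg _), norm_sq_E4, norm_sq_E4]
      simp only [projY_zero, projY_one, projY_two, projY_three]
      nlinarith [sq_nonneg (ζ q 0), sq_nonneg (ζ q 1), sq_nonneg (ζ q 2)]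
    rw [norm_smul, Real.norm_of_nonneg (by positivity), add_mul]
    refine (norm_add_le _ _).trans (add_le_add ?_ ?_)
    · rw [norm_smul]
      exact mul_le_mul (hM q) h3 (norm_nonneg _) hM0
    · rw [norm_smul, Real.norm_eq_abs]
  calc powNorm T p (modelOp k d ζ) + powNorm T p (fun q => k q • projY (ζ q) + d • ζ q)
      ≤ powNorm T p (modelOp k d ζ) + ‖M + |d|‖ₑ ^ p * powNorm T p ζ := by gcongr
    _ ≤ _ := by
        rw [add_mul, mul_add, one_mul, one_mul, mul_add]
        calc _ ≤ powNorm T p (modelOp k d ζ) + ‖M + |d|‖ₑ ^ p * powNorm T p ζ +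
              (powNorm T p ζ + ‖M + |d|‖ₑ ^ p * powNorm T p (modelOp k d ζ)) := le_self_add
          _ = _ := by ring

section
variable {T κ M d : ℝ}

lemma lintegral_weight_translate (hT : 0 < T) {w : ℝ → ℝ} (hw : Measurable w) {G : ℝ × ℝ → ℝ≥0∞}
    (hG : Measurable G) (hp : IsPeriodicMap T G) (q : ℝ × ℝ) :
    ∫⁻ v, ENNReal.ofReal (w v.1) * G (q + v) ∂cylMeasure T =
      ∫⁻ x, ENNReal.ofReal (w (x.1 - q.1)) * G x ∂cylMeasure T := by
  rw [← lintegral_cyl_add hT (g := fun x => ENNReal.ofReal (w (x.1 - q.1)) * G x) (by fun_prop)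
    (fun s t => by simp only [hp s t]) q]
  refine lintegral_congr fun v => ?_
  rw [add_comm q v]
  simp

/-- The energy estimate with the weight centred at `q`. -/
lemma lintegral_energy (hT : 0 < T) (hκ : 0 < κ) (hd0 : d ≠ 0)
    (hd : 4 * gapConst T κ M * d ^ 2 ≤ 1) {k : ℝ × ℝ → ℝ}
    (hk : IsModelCoeff T κ M (d ^ 2 / 4) k) {ζ : ℝ × ℝ → E4} (hζ : IsTestMap T ζ) (q : ℝ × ℝ) :
    ∫⁻ v, ENNReal.ofReal (cauchyWeight (|d| / 2) v.1) * ‖ζ (q + v)‖ₑ ^ (2 : ℝ) ∂cylMeasure T ≤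
      ENNReal.ofReal (4 / d ^ 2) * ∫⁻ v, ENNReal.ofReal (cauchyWeight (|d| / 2) v.1) *
        ‖modelOp k d ζ (q + v)‖ₑ ^ (2 : ℝ) ∂cylMeasure T := by
  have hwc := contDiff_cauchyWeight (|d| / 2)
  have hwm := hwc.continuous.measurable
  have hw : ContDiff ℝ ∞ fun s => cauchyWeight (|d| / 2) (s - q.1) :=
    (contDiff_cauchyWeight (|d| / 2)).comp (contDiff_id.sub contDiff_const)
  have conv : ∀ φ : ℝ × ℝ → E4, IsTestMap T φ →
      ∫⁻ v, ENNReal.ofReal (cauchyWeight (|d| / 2) v.1) * ‖φ (q + v)‖ₑ ^ (2 : ℝ) ∂cylMeasure T =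
      ENNReal.ofReal (∫ x, cauchyWeight (|d| / 2) (x.1 - q.1) * ‖φ x‖ ^ 2 ∂cylMeasure T) := by
    intro φ hφ
    rw [lintegral_weight_translate hT hwm (G := fun x => ‖φ x‖ₑ ^ (2 : ℝ))
      ((Continuous.measurable (by have := hφ.continuous; fun_prop)).pow_const _)
      (fun s t => by simp only [hφ.periodic]) q,
      ofReal_integral_eq_lintegral_ofReal (isTestMap_weight_norm hw hφ).integrable
        (Filter.Eventually.of_forall fun x => mul_nonneg (cauchyWeight_pos _ _).le (sq_nonneg _))]
    refine lintegral_congr fun x => ?_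
    rw [ENNReal.ofReal_mul (cauchyWeight_pos _ _).le, ← ofReal_norm,
      ENNReal.ofReal_rpow_of_nonneg (norm_nonneg _) (by norm_num)]
    norm_num
  rw [conv _ hζ, conv _ (hζ.modelOp hk.toIsCylMap d), ← ENNReal.ofReal_mul (by positivity)]
  refine ENNReal.ofReal_le_ofReal ?_
  have h := weighted_energy hT hκ hd hk hζ hw (fun s => (cauchyWeight_pos _ _).le)
    (fun s => (hasDerivAt_cauchyWeight (|d| / 2) (s - q.1)).comp_sub_const s q.1)
    (fun s => abs_deriv_cauchyWeight_le (by positivity) _)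
  rw [div_mul_eq_mul_div, le_div_iff₀ (by positivity), mul_comm]
  exact h

/-- The mean value part of the box inequality. -/
lemma lintegral_box_mean (hT : 0 < T) (hκ : 0 < κ) (hd0 : d ≠ 0)
    (hd : 4 * gapConst T κ M * d ^ 2 ≤ 1) {p r : ℝ} (hp : 2 ≤ p) (hr1 : r ≤ 1)
    (hrT : r ≤ T) : ∃ C : ℝ≥0∞, C ≠ ⊤ ∧ ∀ k, IsModelCoeff T κ M (d ^ 2 / 4) k →
    ∀ ζ : ℝ × ℝ → E4, IsTestMap T ζ →
    ∫⁻ q, (∫⁻ v, ‖ζ (q + v)‖ₑ ∂boxMeasure r r) ^ p ∂cylMeasure T ≤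
      C * powNorm T p (modelOp k d ζ) := by
  set ε := |d| / 2 with hε
  have hε0 : 0 < ε := by positivity
  set ν := (cylMeasure T).withDensity fun v => ENNReal.ofReal (cauchyWeight ε v.1) with hν
  have hwm : Measurable (cauchyWeight ε) := (contDiff_cauchyWeight ε).continuous.measurable
  have hρm : Measurable fun v : ℝ × ℝ => ENNReal.ofReal (cauchyWeight ε v.1) := by fun_prop
  have hνfin : ν univ ≠ ⊤ := by
    rw [hν, withDensity_apply _ MeasurableSet.univ, Measure.restrict_univ]
    exact (lintegral_cauchyWeight_lt_top hε0.ne').ne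
  set A : ℝ≥0∞ := boxMeasure r r univ ^ (2 - 1 : ℝ) *
    (ENNReal.ofReal (1 + ε ^ 2) * ENNReal.ofReal (4 / d ^ 2)) with hA
  have hAfin : A ≠ ⊤ := by
    have := measure_ne_top (boxMeasure r r) univ
    rw [hA]; finiteness
  refine ⟨A ^ (p / 2) * ν univ ^ (p / 2), ?_, fun k hk ζ hζ => ?_⟩
  · have : 0 ≤ p / 2 := by linarith
    finiteness
  have hf := hζ.modelOp hk.toIsCylMap d
  have hζc := hζ.continuous
  have hfc := hf.continuous
  have hGm : Measurable fun x => ‖modelOp k d ζ x‖ₑ ^ (2 : ℝ) :=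
    (Continuous.measurable (by fun_prop)).pow_const _
  have hptw : ∀ q, (∫⁻ v, ‖ζ (q + v)‖ₑ ∂boxMeasure r r) ^ (2 : ℝ) ≤
      A * ∫⁻ v, ‖modelOp k d ζ (q + v)‖ₑ ^ (2 : ℝ) ∂ν := by
    intro q
    have hm1 : Measurable fun v => ‖ζ (q + v)‖ₑ := Continuous.measurable (by fun_prop)
    refine (rpow_lintegral_le _ one_le_two hm1.aemeasurable).trans ?_
    rw [hA, mul_assoc]
    gcongr
    have hsub : ∫⁻ v, ‖ζ (q + v)‖ₑ ^ (2 : ℝ) ∂boxMeasure r r ≤ ENNReal.ofReal (1 + ε ^ 2) *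
        ∫⁻ v, ENNReal.ofReal (cauchyWeight ε v.1) * ‖ζ (q + v)‖ₑ ^ (2 : ℝ) ∂cylMeasure T := by
      rw [← lintegral_const_mul' _ _ ENNReal.ofReal_ne_top]
      calc ∫⁻ v, ‖ζ (q + v)‖ₑ ^ (2 : ℝ) ∂boxMeasure r r
          ≤ ∫⁻ v, ENNReal.ofReal (1 + ε ^ 2) * (ENNReal.ofReal (cauchyWeight ε v.1) *
              ‖ζ (q + v)‖ₑ ^ (2 : ℝ)) ∂boxMeasure r r := by
            refine lintegral_mono_ae ?_
            filter_upwards [ae_boxMeasure r r] with v hv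
            rw [← mul_assoc, ← ENNReal.ofReal_mul (by positivity)]
            refine le_mul_of_one_le_left zero_le ?_
            rw [ENNReal.one_le_ofReal]
            unfold cauchyWeight
            rw [← div_eq_mul_inv, one_le_div (by positivity), mul_pow]
            have : v.1 ^ 2 ≤ 1 := pow_le_one₀ hv.1.1 (hv.1.2.trans hr1)
            nlinarith [sq_nonneg ε]
        _ ≤ _ := lintegral_mono' (Measure.restrict_mono
            (prod_mono (subset_univ _) (Ioc_subset_Ioc_right hrT)) le_rfl) le_rfl
    refine hsub.trans ?_
    rw [mul_assoc]
    gcongr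
    refine (lintegral_energy hT hκ hd0 hd hk hζ q).trans_eq ?_
    rw [hν, lintegral_withDensity_eq_lintegral_mul _ hρm
      (g := fun v => ‖modelOp k d ζ (q + v)‖ₑ ^ (2 : ℝ)) (hGm.comp (measurable_const_add q))]
    rfl
  calc ∫⁻ q, (∫⁻ v, ‖ζ (q + v)‖ₑ ∂boxMeasure r r) ^ p ∂cylMeasure T
      ≤ ∫⁻ q, A ^ (p / 2) * (∫⁻ v, ‖modelOp k d ζ (q + v)‖ₑ ^ (2 : ℝ) ∂ν) ^ (p / 2)
          ∂cylMeasure T := by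
        refine lintegral_mono fun q => ?_
        rw [← ENNReal.mul_rpow_of_nonneg _ _ (by linarith)]
        refine le_trans (le_of_eq ?_) (ENNReal.rpow_le_rpow (hptw q) (by linarith))
        rw [← ENNReal.rpow_mul]
        congr 1
        ring
    _ = A ^ (p / 2) * ∫⁻ q, (∫⁻ v, ‖modelOp k d ζ (q + v)‖ₑ ^ (2 : ℝ) ∂ν) ^ (p / 2)
          ∂cylMeasure T := lintegral_const_mul' _ _ (by
        have : 0 ≤ p / 2 := by linarith
        finiteness)
    _ ≤ A ^ (p / 2) * (ν univ ^ (p / 2) *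
          ∫⁻ q, (‖modelOp k d ζ q‖ₑ ^ (2 : ℝ)) ^ (p / 2) ∂cylMeasure T) := by
        gcongr
        exact lintegral_young hT ν (Φ := id) measurable_id (by linarith) hGm
          fun s t => by simp only [hf.periodic]
    _ = _ := by
        rw [mul_assoc, powNorm]
        congr 3
        ext q
        rw [← ENNReal.rpow_mul]
        congr 1
        ring

/-- The a priori estimate for the model operator in `L^p`, `p ≥ 2`. -/
lemma powNorm_le_modelOp_of_two_le (hT : 0 < T) (hκ : 0 < κ) (hd0 : d ≠ 0)
    (hd : 4 * gapConst T κ M * d ^ 2 ≤ 1) {p : ℝ} (hp : 2 ≤ p) :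
    ∃ C : ℝ≥0∞, C ≠ ⊤ ∧ ∀ k, IsModelCoeff T κ M (d ^ 2 / 4) k →
    ∀ ζ : ℝ × ℝ → E4, IsTestMap T ζ → powNorm T p ζ ≤ C * powNorm T p (modelOp k d ζ) := by
  have hp1 : 1 < p := by linarith
  have hp0 : 0 < p := by linarith
  obtain ⟨K, hK, hgrad⟩ := powNorm_pd_le_modelOp hp1 M d
  -- the gradient part carries the factor `B r ^ p`
  set B : ℝ≥0∞ := 2 ^ (p - 1) * (2 ^ (p - 1) * (2 * K)) with hB
  have hBfin : B ≠ ⊤ := by rw [hB]; finiteness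
  obtain ⟨r, hr0, hr1, hrT, hrB⟩ : ∃ r : ℝ, 0 < r ∧ r ≤ 1 ∧ r ≤ T ∧
      B * ENNReal.ofReal r ^ p ≤ 1 / 2 := by
    have hlim : Filter.Tendsto (fun r : ℝ => B * ENNReal.ofReal r ^ p) (nhdsWithin 0 (Ioi 0))
        (nhds (B * ENNReal.ofReal 0 ^ p)) := by
      refine ENNReal.Tendsto.const_mul ?_ (Or.inr hBfin)
      exact ((ENNReal.continuous_rpow_const.tendsto _).comp
        (ENNReal.continuous_ofReal.tendsto 0)).mono_left nhdsWithin_le_nhds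
    rw [ENNReal.ofReal_zero, ENNReal.zero_rpow_of_pos hp0, mul_zero] at hlim
    have h1 := hlim.eventually (ge_mem_nhds (show (0 : ℝ≥0∞) < 1 / 2 by simp))
    have h2 : ∀ᶠ r : ℝ in nhdsWithin 0 (Ioi 0), r < min 1 T :=
      nhdsWithin_le_nhds (gt_mem_nhds (lt_min one_pos hT))
    obtain ⟨r, ⟨hr, hr'⟩, hr0⟩ := ((h1.and h2).and self_mem_nhdsWithin).exists
    exact ⟨r, hr0, hr'.le.trans (min_le_left _ _), hr'.le.trans (min_le_right _ _), hr⟩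
  obtain ⟨C, hC, hmean⟩ := lintegral_box_mean hT hκ hd0 hd hp hr1 hrT
  set ρ := ENNReal.ofReal r with hρ
  have hρ0 : ρ ≠ 0 := by simpa [hρ] using hr0
  have hρt : ρ ≠ ⊤ := ENNReal.ofReal_ne_top
  have hρp0 : (ρ ^ 2) ^ p ≠ 0 := by simp [hρ0, hp0.le]
  have hρpt : (ρ ^ 2) ^ p ≠ ⊤ := by finiteness
  refine ⟨2 * (((ρ ^ 2) ^ p)⁻¹ * (2 ^ (p - 1) * C) + 1 / 2), by finiteness, fun k hk ζ hζ => ?_⟩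
  set I := powNorm T p ζ with hI
  set Jf := powNorm T p (modelOp k d ζ) with hJf
  have hIfin : I ≠ ⊤ := (powNorm_lt_top hp0 hζ).ne
  set ν := ((volume.restrict (Ioc (0 : ℝ) 1)).prod (boxMeasure r r)) with hν
  have hνu : ν univ = ρ ^ 2 := by
    rw [hν, boxMeasure_eq_prod, ← univ_prod_univ, Measure.prod_prod, ← univ_prod_univ,
      Measure.prod_prod]
    simp [sq, hρ]
  have hgc := continuous_gradSize hζ.toIsCylMap
  have hgper : IsPeriodicMap T fun q => ENNReal.ofReal (gradSize ζ q) := fun s t => by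
    simp only [gradSize, (hζ.pd _).periodic]
  have hG : ∫⁻ q, ENNReal.ofReal (gradSize ζ q) ^ p ∂cylMeasure T ≤
      2 ^ (p - 1) * (2 * K) * (Jf + I) := by
    have e : ∀ q, ENNReal.ofReal (gradSize ζ q) ^ p =
        ‖‖pd (1, 0) ζ q‖ + ‖pd (0, 1) ζ q‖‖ₑ ^ p := fun q => by
      rw [Real.enorm_eq_ofReal (by positivity), gradSize]
    simp only [e]
    refine (powNorm_add_le (φ := fun q => ‖pd (1, 0) ζ q‖) hp1.le
      (hζ.pd (1, 0)).continuous.norm).trans ?_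
    rw [mul_assoc]
    gcongr
    have n : ∀ e, powNorm T p (fun q => ‖pd e ζ q‖) = powNorm T p (pd e ζ) := fun e => by
      simp [powNorm]
    rw [n, n, mul_assoc, two_mul]
    exact add_le_add (hgrad hT k hk.toIsCylMap hk.bound ζ hζ _ (Or.inl rfl))
      (hgrad hT k hk.toIsCylMap hk.bound ζ hζ _ (Or.inr rfl))
  have hY : ∫⁻ q, (∫⁻ x, ENNReal.ofReal (gradSize ζ (q + x.1 • x.2)) ∂ν) ^ p ∂cylMeasure T ≤
      (ρ ^ 2) ^ p * ∫⁻ q, ENNReal.ofReal (gradSize ζ q) ^ p ∂cylMeasure T := by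
    rw [← hνu]
    exact lintegral_young hT ν (Φ := fun x : ℝ × ℝ × ℝ => x.1 • x.2) (by fun_prop) hp1.le
      (g := fun q => ENNReal.ofReal (gradSize ζ q)) (by fun_prop) hgper
  have hmA : Measurable fun q => ∫⁻ v, ‖ζ (q + v)‖ₑ ∂boxMeasure r r := by
    refine Measurable.lintegral_prod_right' (f := fun z : (ℝ × ℝ) × (ℝ × ℝ) => ‖ζ (z.1 + z.2)‖ₑ) ?_
    have := hζ.continuous
    exact Continuous.measurable (by fun_prop)
  have h1 : (ρ ^ 2) ^ p * I ≤ 2 ^ (p - 1) * (C * Jf + ρ ^ p * ((ρ ^ 2) ^ p *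
      (2 ^ (p - 1) * (2 * K) * (Jf + I)))) := by
    calc (ρ ^ 2) ^ p * I = ∫⁻ q, (ρ ^ 2 * ‖ζ q‖ₑ) ^ p ∂cylMeasure T := by
          rw [hI, powNorm, ← lintegral_const_mul' _ _ hρpt]
          refine lintegral_congr fun q => ?_
          rw [ENNReal.mul_rpow_of_nonneg _ _ hp0.le]
      _ ≤ ∫⁻ q, 2 ^ (p - 1) * ((∫⁻ v, ‖ζ (q + v)‖ₑ ∂boxMeasure r r) ^ p +
            (ρ * ∫⁻ x, ENNReal.ofReal (gradSize ζ (q + x.1 • x.2)) ∂ν) ^ p) ∂cylMeasure T :=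
          lintegral_mono fun q => (ENNReal.rpow_le_rpow (enorm_le_box hζ.toIsCylMap hr0 q)
            hp0.le).trans (ENNReal.rpow_add_le_mul_rpow_add_rpow _ _ hp1.le)
      _ = 2 ^ (p - 1) * ((∫⁻ q, (∫⁻ v, ‖ζ (q + v)‖ₑ ∂boxMeasure r r) ^ p ∂cylMeasure T) +
            ρ ^ p * ∫⁻ q, (∫⁻ x, ENNReal.ofReal (gradSize ζ (q + x.1 • x.2)) ∂ν) ^ p
              ∂cylMeasure T) := by
          rw [lintegral_const_mul' _ _ (by finiteness),
            lintegral_add_left (hmA.pow_const _), ← lintegral_const_mul' _ _ (by finiteness)]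
          simp only [ENNReal.mul_rpow_of_nonneg _ _ hp0.le]
      _ ≤ _ := by
          gcongr
          · exact hmean k hk ζ hζ
          · exact hY.trans (by gcongr)
  have h2 : I ≤ (((ρ ^ 2) ^ p)⁻¹ * (2 ^ (p - 1) * C) + 1 / 2) * Jf + I / 2 := by
    have h3 : I = ((ρ ^ 2) ^ p)⁻¹ * ((ρ ^ 2) ^ p * I) := by
      rw [← mul_assoc, ENNReal.inv_mul_cancel hρp0 hρpt, one_mul]
    calc I ≤ ((ρ ^ 2) ^ p)⁻¹ * (2 ^ (p - 1) * (C * Jf + ρ ^ p * ((ρ ^ 2) ^ p *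
          (2 ^ (p - 1) * (2 * K) * (Jf + I))))) := by
          nth_rewrite 1 [h3]; gcongr
      _ = ((ρ ^ 2) ^ p)⁻¹ * (2 ^ (p - 1) * C) * Jf +
          (((ρ ^ 2) ^ p)⁻¹ * (ρ ^ 2) ^ p) * (B * ρ ^ p * (Jf + I)) := by rw [hB]; ring
      _ ≤ ((ρ ^ 2) ^ p)⁻¹ * (2 ^ (p - 1) * C) * Jf + 1 * (1 / 2 * (Jf + I)) := by
          rw [ENNReal.inv_mul_cancel hρp0 hρpt]; gcongr
      _ = _ := by rw [one_mul, mul_add, add_mul, div_eq_mul_inv I, mul_comm I, one_div]; ring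
  have h4 : I / 2 ≤ (((ρ ^ 2) ^ p)⁻¹ * (2 ^ (p - 1) * C) + 1 / 2) * Jf := by
    have h5 : I / 2 ≠ ⊤ := by finiteness
    rw [← ENNReal.add_halves I] at h2
    nth_rewrite 3 [← ENNReal.add_halves I] at h2
    exact (ENNReal.add_le_add_iff_right h5).1 (by simpa [ENNReal.add_halves] using h2)
  calc I = 2 * (I / 2) := by rw [ENNReal.mul_div_cancel (by simp) (by simp)]
    _ ≤ 2 * ((((ρ ^ 2) ^ p)⁻¹ * (2 ^ (p - 1) * C) + 1 / 2) * Jf) := by gcongr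
    _ = _ := by ring

end

/-! ### Operators between weighted Sobolev spaces -/

/-- The Lebesgue space of sections with exponential weight. -/
abbrev WeightedLp (T : ℝ) (p : ℝ≥0∞) (d : ℝ) := Lp E4 p (weightedMeasure T p d)

/-- The space of test maps. -/
def testSpace (T : ℝ) : Submodule ℝ (ℝ × ℝ → E4) where
  carrier := {φ | IsTestMap T φ}
  add_mem' h h' := h.add h'
  zero_mem' := ⟨isCylMap_const 0, 0, fun _ _ _ => rfl⟩
  smul_mem' c _ h := h.const_smul c

section Iter
variable {F : Type*} [NormedAddCommGroup F] [NormedSpace ℝ F] {T : ℝ}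

/-- The iterated derivative `∂_s^i ∂_t^j`. -/
def pdIter (i j : ℕ) (φ : ℝ × ℝ → F) : ℝ × ℝ → F := (pd (1, 0))^[i] ((pd (0, 1))^[j] φ)

lemma IsCylMap.iterate_pd {φ : ℝ × ℝ → F} (h : IsCylMap T φ) (e : ℝ × ℝ) (i : ℕ) :
    IsCylMap T ((MorseBottTorus.pd e)^[i] φ) := by
  induction i with
  | zero => exact h
  | succ i ih => rw [Function.iterate_succ_apply']; exact ih.pd e

lemma IsTestMap.iterate_pd {φ : ℝ × ℝ → F} (h : IsTestMap T φ) (e : ℝ × ℝ) (i : ℕ) :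
    IsTestMap T ((MorseBottTorus.pd e)^[i] φ) := by
  induction i with
  | zero => exact h
  | succ i ih => rw [Function.iterate_succ_apply']; exact ih.pd e

lemma IsTestMap.pdIter {φ : ℝ × ℝ → F} (h : IsTestMap T φ) (i j : ℕ) :
    IsTestMap T (pdIter i j φ) := (h.iterate_pd _ j).iterate_pd _ i

lemma pd_iterate_comm {φ : ℝ × ℝ → F} (h : IsCylMap T φ) (e e' : ℝ × ℝ) (i : ℕ) :
    pd e ((pd e')^[i] φ) = (pd e')^[i] (pd e φ) := by
  induction i with
  | zero => rfl
  | succ i ih =>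
    rw [Function.iterate_succ_apply', Function.iterate_succ_apply', pd_comm (h.iterate_pd e' i), ih]

lemma pd_fst_pdIter (φ : ℝ × ℝ → F) (i j : ℕ) :
    pd (1, 0) (pdIter i j φ) = pdIter (i + 1) j φ := by
  rw [pdIter, pdIter, Function.iterate_succ_apply']

lemma pd_snd_pdIter {φ : ℝ × ℝ → F} (h : IsCylMap T φ) (i j : ℕ) :
    pd (0, 1) (pdIter i j φ) = pdIter i (j + 1) φ := by
  rw [pdIter, pdIter, Function.iterate_succ_apply', pd_iterate_comm (h.iterate_pd _ j)]

lemma pdIter_add {φ ψ : ℝ × ℝ → F} (h : IsCylMap T φ) (h' : IsCylMap T ψ) (i j : ℕ) :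
    pdIter i j (fun q => φ q + ψ q) = fun q => pdIter i j φ q + pdIter i j ψ q := by
  have key : ∀ (e : ℝ × ℝ) (i : ℕ) {φ ψ : ℝ × ℝ → F}, IsCylMap T φ → IsCylMap T ψ →
      (pd e)^[i] (fun q => φ q + ψ q) = fun q => (pd e)^[i] φ q + (pd e)^[i] ψ q := by
    intro e i
    induction i with
    | zero => intros; rfl
    | succ i ih =>
      intro φ ψ h h'
      rw [Function.iterate_succ_apply, pd_add h h', ih (h.pd e) (h'.pd e)]
      simp only [Function.iterate_succ_apply]
  rw [pdIter, key _ _ h h', key _ _ (h.iterate_pd _ _) (h'.iterate_pd _ _)]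
  rfl

lemma pdIter_const_smul {φ : ℝ × ℝ → F} (h : IsCylMap T φ) (c : ℝ) (i j : ℕ) :
    pdIter i j (fun q => c • φ q) = fun q => c • pdIter i j φ q := by
  have key : ∀ (e : ℝ × ℝ) (i : ℕ) {φ : ℝ × ℝ → F}, IsCylMap T φ →
      (pd e)^[i] (fun q => c • φ q) = fun q => c • (pd e)^[i] φ q := by
    intro e i
    induction i with
    | zero => intros; rfl
    | succ i ih =>
      intro φ h
      rw [Function.iterate_succ_apply, pd_const_smul h, ih (h.pd e)]
      simp only [Function.iterate_succ_apply]
  rw [pdIter, key _ _ h, key _ _ (h.iterate_pd _ _)]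
  rfl

end Iter

section Sobolev
variable {T : ℝ} {p : ℝ≥0∞} [Fact (1 ≤ p)] {d : ℝ} {k : ℕ}

/-- The component `∂_s^i ∂_t^j η` of a Sobolev section. -/
def sobolevComp (α : MultiIdx k) : weightedSobolev T k p d →L[ℝ] WeightedLp T p d :=
  (PiLp.proj p (fun _ : MultiIdx k => WeightedLp T p d) α).comp (weightedSobolev T k p d).subtypeL

lemma norm_sobolevComp_le (α : MultiIdx k) (η : weightedSobolev T k p d) :
    ‖sobolevComp α η‖ ≤ ‖η‖ :=
  PiLp.norm_apply_le (η : PiLp p fun _ : MultiIdx k => WeightedLp T p d) α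

lemma sobolev_ext {η η' : weightedSobolev T k p d} (h : ∀ α, sobolevComp α η = sobolevComp α η') :
    η = η' := by
  apply Subtype.ext
  ext1 α
  exact h α

lemma isWeakDeriv_fst (η : weightedSobolev T k p d) (α β : MultiIdx k)
    (h1 : (β.1.1 : ℕ) = α.1.1 + 1) (h2 : (β.1.2 : ℕ) = α.1.2) :
    IsWeakDeriv T (1, 0) (sobolevComp α η) (sobolevComp β η) := (η.2 α β).1 h1 h2

lemma isWeakDeriv_snd (η : weightedSobolev T k p d) (α β : MultiIdx k)
    (h1 : (β.1.1 : ℕ) = α.1.1) (h2 : (β.1.2 : ℕ) = α.1.2 + 1) :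
    IsWeakDeriv T (0, 1) (sobolevComp α η) (sobolevComp β η) := (η.2 α β).2 h1 h2

/-- The comparison constant between the `ℓ^p` norm and the maximum norm. -/
def piLpConst (T : ℝ) (p : ℝ≥0∞) [Fact (1 ≤ p)] (d : ℝ) (k : ℕ) : ℝ :=
  ‖((PiLp.continuousLinearEquiv p ℝ fun _ : MultiIdx k => WeightedLp T p d).symm :
    (MultiIdx k → WeightedLp T p d) →L[ℝ] PiLp p fun _ : MultiIdx k => WeightedLp T p d)‖

lemma piLpConst_nonneg : 0 ≤ piLpConst T p d k := norm_nonneg _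

lemma norm_sobolev_le {b : ℝ} (hb : 0 ≤ b) (η : weightedSobolev T k p d)
    (h : ∀ α, ‖sobolevComp α η‖ ≤ b) : ‖η‖ ≤ piLpConst T p d k * b := by
  have h1 := ((PiLp.continuousLinearEquiv p ℝ fun _ : MultiIdx k => WeightedLp T p d).symm :
    (MultiIdx k → WeightedLp T p d) →L[ℝ] PiLp p fun _ : MultiIdx k => WeightedLp T p d).le_opNorm
    (fun α => sobolevComp α η)
  refine le_trans h1 (mul_le_mul_of_nonneg_left ?_ (norm_nonneg _))
  exact (pi_norm_le_iff_of_nonneg hb).2 h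

/-- An operator into a Sobolev space from its components. -/
lemma exists_sobolevOp {E : Type*} [NormedAddCommGroup E] [NormedSpace ℝ E]
    (L : MultiIdx k → E →L[ℝ] WeightedLp T p d)
    (h1 : ∀ x, ∀ α β : MultiIdx k, (β.1.1 : ℕ) = α.1.1 + 1 → (β.1.2 : ℕ) = α.1.2 →
      IsWeakDeriv T (1, 0) (L α x) (L β x))
    (h2 : ∀ x, ∀ α β : MultiIdx k, (β.1.1 : ℕ) = α.1.1 → (β.1.2 : ℕ) = α.1.2 + 1 →
      IsWeakDeriv T (0, 1) (L α x) (L β x)) {b : ℝ} (hb : 0 ≤ b) (hL : ∀ α, ‖L α‖ ≤ b) :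
    ∃ A : E →L[ℝ] weightedSobolev T k p d, (∀ x α, sobolevComp α (A x) = L α x) ∧
      ‖A‖ ≤ piLpConst T p d k * b := by
  set A : E →L[ℝ] weightedSobolev T k p d :=
    (((PiLp.continuousLinearEquiv p ℝ fun _ : MultiIdx k => WeightedLp T p d).symm :
      (MultiIdx k → WeightedLp T p d) →L[ℝ] PiLp p fun _ : MultiIdx k => WeightedLp T p d).comp
      (ContinuousLinearMap.pi L)).codRestrict (weightedSobolev T k p d)
      (fun x α β => ⟨h1 x α β, h2 x α β⟩) with hA
  have hAα : ∀ x α, sobolevComp α (A x) = L α x := fun x α => rfl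
  refine ⟨A, hAα, ContinuousLinearMap.opNorm_le_bound _ (mul_nonneg piLpConst_nonneg hb)
    fun x => ?_⟩
  rw [mul_assoc]
  refine norm_sobolev_le (by positivity) _ fun α => ?_
  rw [hAα]
  exact (L α).le_of_opNorm_le (hL α) x

/-- The derivative `∂_s^a ∂_t^b` from `W²` to `W¹`. -/
lemma exists_shiftOp (T : ℝ) (p : ℝ≥0∞) [Fact (1 ≤ p)] (d : ℝ) (a b : ℕ) (hab : a + b ≤ 1) :
    ∃ A : weightedSobolev T 2 p d →L[ℝ] weightedSobolev T 1 p d,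
      (∀ η (α : MultiIdx 1), sobolevComp α (A η) =
        sobolevComp (mkIdx (k := 2) (α.1.1 + a) (α.1.2 + b) (by have := α.2; omega)) η) ∧
      ‖A‖ ≤ piLpConst T p d 1 * 1 := by
  refine exists_sobolevOp (E := weightedSobolev T 2 p d) (T := T) (p := p) (d := d)
    (fun α : MultiIdx 1 =>
    sobolevComp (mkIdx (k := 2) (α.1.1 + a) (α.1.2 + b) (by have := α.2; omega)))
    (fun η α β h1 h2 => ?_) (fun η α β h1 h2 => ?_) zero_le_one fun α => ?_
  · exact isWeakDeriv_fst η _ _ (by simp only; omega) (by simp only; omega)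
  · exact isWeakDeriv_snd η _ _ (by simp only; omega) (by simp only; omega)
  · exact ContinuousLinearMap.opNorm_le_bound _ zero_le_one fun η => by
      rw [one_mul]; exact norm_sobolevComp_le _ _

/-- Multiplication by a bounded continuous matrix function. -/
lemma exists_mulLp {c : ℝ × ℝ → E4 →L[ℝ] E4} (hc : Continuous c) {B : ℝ} (hB : ∀ q, ‖c q‖ ≤ B) :
    ∃ A : WeightedLp T p d →L[ℝ] WeightedLp T p d,
      (∀ u, ∀ᵐ q ∂weightedMeasure T p d, A u q = c q (u q)) ∧ ‖A‖ ≤ B := by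
  have hB0 : 0 ≤ B := (norm_nonneg _).trans (hB 0)
  have hm : ∀ u : WeightedLp T p d, MemLp (fun q => c q (u q)) p (weightedMeasure T p d) := by
    intro u
    refine (Lp.memLp u).of_le_mul (c := B) ?_ (Filter.Eventually.of_forall fun q => ?_)
    · have : Continuous fun z : (E4 →L[ℝ] E4) × E4 => z.1 z.2 := by fun_prop
      exact this.comp_aestronglyMeasurable
        (hc.aestronglyMeasurable.prodMk (Lp.aestronglyMeasurable u))
    · exact (c q).le_of_opNorm_le (hB q) _
  set A₀ : WeightedLp T p d →ₗ[ℝ] WeightedLp T p d :=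
    { toFun := fun u => (hm u).toLp
      map_add' := fun u v => by
        apply Lp.ext
        filter_upwards [(hm (u + v)).coeFn_toLp, (hm u).coeFn_toLp, (hm v).coeFn_toLp,
          Lp.coeFn_add u v, Lp.coeFn_add (hm u).toLp (hm v).toLp] with q h1 h2 h3 h4 h5
        rw [h1, h5, Pi.add_apply, h2, h3, h4, Pi.add_apply, map_add]
      map_smul' := fun r u => by
        apply Lp.ext
        filter_upwards [(hm (r • u)).coeFn_toLp, (hm u).coeFn_toLp, Lp.coeFn_smul r u,
          Lp.coeFn_smul r (hm u).toLp] with q h1 h2 h3 h4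
        rw [RingHom.id_apply, h1, h4, Pi.smul_apply, h2, h3, Pi.smul_apply, map_smul] } with hA₀
  have hA₀q : ∀ u, ∀ᵐ q ∂weightedMeasure T p d, A₀ u q = c q (u q) := fun u => (hm u).coeFn_toLp
  refine ⟨A₀.mkContinuous B fun u => ?_, hA₀q, LinearMap.mkContinuous_norm_le _ hB0 _⟩
  refine Lp.norm_le_mul_norm_of_ae_le_mul ?_
  filter_upwards [hA₀q u] with q hq
  rw [hq]
  exact (c q).le_of_opNorm_le (hB q) _

lemma partialDeriv_eq (η : weightedSobolev T k p d) (i j : ℕ) (hij : i + j ≤ k) :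
    partialDeriv η i j hij = sobolevComp (mkIdx i j hij) η := rfl

lemma exists_toSobolev (hT : 0 ≤ T) (k : ℕ) (p : ℝ≥0∞) [Fact (1 ≤ p)] (d : ℝ) :
    ∃ ι : testSpace T →ₗ[ℝ] weightedSobolev T k p d, ∀ (φ : testSpace T) (α : MultiIdx k),
      sobolevComp α (ι φ) = ((IsTestMap.pdIter φ.2 α.1.1 α.1.2).memLp_weighted p d).toLp := by
  have hmem : ∀ φ : testSpace T, (WithLp.toLp p fun α : MultiIdx k =>
      ((IsTestMap.pdIter φ.2 α.1.1 α.1.2).memLp_weighted p d).toLp) ∈ weightedSobolev T k p d := by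
    intro φ α β
    have hα := (IsTestMap.pdIter φ.2 α.1.1 α.1.2)
    have hβ := (IsTestMap.pdIter φ.2 β.1.1 β.1.2)
    refine ⟨fun h1 h2 => ?_, fun h1 h2 => ?_⟩
    · refine (hα.isWeakDeriv hT (1, 0)).congr (ae_weighted_of (hα.memLp_weighted p d).coeFn_toLp) ?_
      rw [pd_fst_pdIter, ← h1, ← h2]
      exact ae_weighted_of (hβ.memLp_weighted p d).coeFn_toLp
    · refine (hα.isWeakDeriv hT (0, 1)).congr (ae_weighted_of (hα.memLp_weighted p d).coeFn_toLp) ?_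
      rw [pd_snd_pdIter (IsTestMap.toIsCylMap φ.2), ← h1, ← h2]
      exact ae_weighted_of (hβ.memLp_weighted p d).coeFn_toLp
  refine ⟨{ toFun := fun φ => ⟨_, hmem φ⟩, map_add' := fun φ ψ => ?_, map_smul' := fun c φ => ?_ },
    fun φ α => rfl⟩
  · apply Subtype.ext
    ext1 α
    have hm := fun φ : testSpace T => (IsTestMap.pdIter φ.2 α.1.1 α.1.2).memLp_weighted p d
    change (hm (φ + ψ)).toLp = (hm φ).toLp + (hm ψ).toLp
    rw [← MemLp.toLp_add]
    congr 1
    exact pdIter_add (IsTestMap.toIsCylMap φ.2) (IsTestMap.toIsCylMap ψ.2) _ _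
  · apply Subtype.ext
    ext1 α
    have hm := fun φ : testSpace T => (IsTestMap.pdIter φ.2 α.1.1 α.1.2).memLp_weighted p d
    change (hm (c • φ)).toLp = c • (hm φ).toLp
    rw [← MemLp.toLp_const_smul]
    congr 1
    exact pdIter_const_smul (IsTestMap.toIsCylMap φ.2) c _ _

/-- The inclusion of test maps in the Sobolev space. -/
def toSobolev (hT : 0 ≤ T) (k : ℕ) (p : ℝ≥0∞) [Fact (1 ≤ p)] (d : ℝ) :
    testSpace T →ₗ[ℝ] weightedSobolev T k p d := (exists_toSobolev hT k p d).choose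

lemma sobolevComp_toSobolev (hT : 0 ≤ T) (φ : testSpace T) (α : MultiIdx k) :
    sobolevComp α (toSobolev hT k p d φ) =
      ((IsTestMap.pdIter φ.2 α.1.1 α.1.2).memLp_weighted p d).toLp :=
  (exists_toSobolev hT k p d).choose_spec φ α

lemma toSobolev_ae (hT : 0 ≤ T) (φ : testSpace T) (α : MultiIdx k) :
    ∀ᵐ q ∂weightedMeasure T p d, sobolevComp α (toSobolev hT k p d φ) q =
      pdIter α.1.1 α.1.2 φ.1 q := by
  rw [sobolevComp_toSobolev]
  exact MemLp.coeFn_toLp _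

attribute [irreducible] sobolevComp

end Sobolev

section Sobolev
variable {T : ℝ} {p : ℝ≥0∞} [Fact (1 ≤ p)] {d : ℝ} {k : ℕ}

/-- Pairing with functional-valued test maps. -/
lemma pairing_eq_sum (u : WeightedLp T p d) {Ψ : ℝ × ℝ → E4 →L[ℝ] ℝ} (hΨ : IsTestMap T Ψ) :
    Integrable (fun q => Ψ q (u q)) (cylMeasure T) ∧
    ∫ q, Ψ q (u q) ∂cylMeasure T =
      ∑ i : Fin 4, coordForm i (∫ q, Ψ q (EuclideanSpace.single i 1) • u q ∂cylMeasure T) := by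
  have hi : ∀ i : Fin 4, IsTestMap T fun q => Ψ q (EuclideanSpace.single i 1) := fun i =>
    hΨ.comp (ContinuousLinearMap.apply ℝ ℝ (EuclideanSpace.single i (1 : ℝ) : E4)).contDiff rfl
  have hint : ∀ i : Fin 4, Integrable (fun q => Ψ q (EuclideanSpace.single i 1) • u q)
      (cylMeasure T) := fun i => integrable_test T p d (hi i).isTestFunction u
  have e : ∀ q, Ψ q (u q) =
      ∑ i : Fin 4, coordForm i (Ψ q (EuclideanSpace.single i 1) • u q) := by
    intro q
    have hu : u q = ∑ i : Fin 4, u q i • (EuclideanSpace.single i (1 : ℝ) : E4) := by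
      ext j
      fin_cases j <;> simp [Fin.sum_univ_four]
    nth_rewrite 1 [hu]
    rw [map_sum]
    refine Finset.sum_congr rfl fun i _ => ?_
    rw [map_smul, map_smul, coordForm_apply, smul_eq_mul, smul_eq_mul, mul_comm]
  simp only [e]
  refine ⟨integrable_finsetSum _ fun i _ => (coordForm i).integrable_comp (hint i), ?_⟩
  rw [integral_finsetSum _ fun i _ => (coordForm i).integrable_comp (hint i)]
  exact Finset.sum_congr rfl fun i _ => (coordForm i).integral_comp_comm (hint i)

lemma IsWeakDeriv.pairing {e : ℝ × ℝ} {u w : WeightedLp T p d} (h : IsWeakDeriv T e u w)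
    {Ψ : ℝ × ℝ → E4 →L[ℝ] ℝ} (hΨ : IsTestMap T Ψ) :
    ∫ q, pd e Ψ q (u q) ∂cylMeasure T = -∫ q, Ψ q (w q) ∂cylMeasure T := by
  rw [(pairing_eq_sum u (hΨ.pd e)).2, (pairing_eq_sum w hΨ).2, ← Finset.sum_neg_distrib]
  refine Finset.sum_congr rfl fun i _ => ?_
  have hi : IsTestMap T fun q => Ψ q (EuclideanSpace.single i 1) :=
    hΨ.comp (ContinuousLinearMap.apply ℝ ℝ (EuclideanSpace.single i (1 : ℝ) : E4)).contDiff rfl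
  have h1 := h _ hi.isTestFunction
  have h2 : ∀ q, fderiv ℝ (fun q => Ψ q (EuclideanSpace.single i 1)) q e =
      pd e Ψ q (EuclideanSpace.single i 1) := fun q =>
    congrFun (pd_clm hΨ.toIsCylMap
      (ContinuousLinearMap.apply ℝ ℝ (EuclideanSpace.single i (1 : ℝ) : E4)) e) q
  simp only [h2] at h1
  rw [h1, map_neg]

lemma IsWeakDeriv.of_pairing {e : ℝ × ℝ} {u w : WeightedLp T p d}
    (h : ∀ Ψ : ℝ × ℝ → E4 →L[ℝ] ℝ, IsTestMap T Ψ →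
      ∫ q, pd e Ψ q (u q) ∂cylMeasure T = -∫ q, Ψ q (w q) ∂cylMeasure T) :
    IsWeakDeriv T e u w := by
  intro ψ hψ
  have hψ' := hψ.isTestMap
  ext i
  have h1 := h _ (hψ'.smul_const (coordForm i))
  have h2 : pd e (fun q => ψ q • coordForm i) = fun q => pd e ψ q • coordForm i := by
    rw [pd_smul hψ'.toIsCylMap (isCylMap_const _)]
    ext1 q
    simp [pd]
  rw [h2] at h1
  have c1 := (coordForm i).integral_comp_comm (integrable_fderiv_test T p d hψ e u)
  have c2 := (coordForm i).integral_comp_comm (integrable_test T p d hψ w)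
  have h3 : coordForm i (∫ q, fderiv ℝ ψ q e • u q ∂cylMeasure T) =
      coordForm i (-∫ q, ψ q • w q ∂cylMeasure T) := by
    rw [map_neg, ← c1, ← c2]
    exact h1
  exact h3

/-- The product rule for weak derivatives. -/
lemma IsWeakDeriv.mul {e : ℝ × ℝ} {u w cu cw cu' : WeightedLp T p d} (h : IsWeakDeriv T e u w)
    {c : ℝ × ℝ → E4 →L[ℝ] E4} (hc : IsCylMap T c)
    (h1 : ∀ᵐ q ∂weightedMeasure T p d, cu q = c q (u q))
    (h2 : ∀ᵐ q ∂weightedMeasure T p d, cw q = c q (w q))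
    (h3 : ∀ᵐ q ∂weightedMeasure T p d, cu' q = MorseBottTorus.pd e c q (u q)) :
    IsWeakDeriv T e cu (cw + cu' : WeightedLp T p d) := by
  refine IsWeakDeriv.of_pairing fun Ψ hΨ => ?_
  have comp_test : ∀ {Ψ : ℝ × ℝ → E4 →L[ℝ] ℝ} {c : ℝ × ℝ → E4 →L[ℝ] E4}, IsTestMap T Ψ →
      IsCylMap T c → IsTestMap T fun q => (Ψ q).comp (c q) := fun hΨ hc =>
    hΨ.of_zero ⟨hΨ.smooth.clm_comp hc.smooth, fun s t => by rw [hΨ.periodic, hc.periodic]⟩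
      fun q hq => by rw [hq]; simp
  have hΨc := comp_test hΨ hc
  have hd : MorseBottTorus.pd e (fun q => (Ψ q).comp (c q)) = fun q =>
      (Ψ q).comp (MorseBottTorus.pd e c q) + (MorseBottTorus.pd e Ψ q).comp (c q) := by
    ext1 q
    have := (hΨ.toIsCylMap.differentiableAt (q := q)).hasFDerivAt.clm_comp
      (hc.differentiableAt (q := q)).hasFDerivAt
    rw [MorseBottTorus.pd, this.fderiv]
    rfl
  have k1 := h.pairing hΨc
  rw [hd] at k1
  simp only [_root_.add_apply, ContinuousLinearMap.comp_apply] at k1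
  have i1 := (pairing_eq_sum u (comp_test hΨ (hc.pd e))).1
  have i2 := (pairing_eq_sum u (comp_test (hΨ.pd e) hc)).1
  have i3 := (pairing_eq_sum w hΨc).1
  simp only [ContinuousLinearMap.comp_apply] at i1 i2 i3
  rw [integral_add i1 i2] at k1
  have l1 : ∫ q, MorseBottTorus.pd e Ψ q (cu q) ∂cylMeasure T =
      ∫ q, MorseBottTorus.pd e Ψ q (c q (u q)) ∂cylMeasure T :=
    integral_congr_ae ((ae_weighted_of h1).mono fun q hq => by simp only [hq])
  have l2 : ∫ q, Ψ q ((cw + cu' : WeightedLp T p d) q) ∂cylMeasure T =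
      ∫ q, (Ψ q (c q (w q)) + Ψ q (MorseBottTorus.pd e c q (u q))) ∂cylMeasure T := by
    refine integral_congr_ae ?_
    filter_upwards [ae_weighted_of h2, ae_weighted_of h3, ae_weighted_of (Lp.coeFn_add cw cu')]
      with q a1 a2 a3
    rw [a3, Pi.add_apply, map_add, a1, a2]
  rw [l1, l2, integral_add i3 i1]
  linarith

/-- `c` is a smooth matrix function on the cylinder, bounded by `B` with its first derivatives. -/
structure IsCoeff (T B : ℝ) (c : ℝ × ℝ → E4 →L[ℝ] E4) : Prop extends IsCylMap T c where
  bound : ∀ q, ‖c q‖ ≤ B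
  bound_pd : ∀ q e, e = ((1 : ℝ), (0 : ℝ)) ∨ e = (0, 1) → ‖MorseBottTorus.pd e c q‖ ≤ B

lemma multiIdx_fst {α β : MultiIdx 1} (h1 : (β.1.1 : ℕ) = α.1.1 + 1) (h2 : (β.1.2 : ℕ) = α.1.2) :
    α = mkIdx 0 0 (by norm_num) ∧ β = mkIdx 1 0 (by norm_num) := by
  have hα := α.2
  have hβ := β.2
  constructor <;> ext <;> simp only <;> omega

lemma multiIdx_snd {α β : MultiIdx 1} (h1 : (β.1.1 : ℕ) = α.1.1) (h2 : (β.1.2 : ℕ) = α.1.2 + 1) :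
    α = mkIdx 0 0 (by norm_num) ∧ β = mkIdx 0 1 (by norm_num) := by
  have hα := α.2
  have hβ := β.2
  constructor <;> ext <;> simp only <;> omega

set_option maxHeartbeats 1000000 in
/-- Multiplication by a matrix function on `W¹`. -/
lemma exists_mulOp {B : ℝ} {c : ℝ × ℝ → E4 →L[ℝ] E4} (hc : IsCoeff T B c) :
    ∃ A : weightedSobolev T 1 p d →L[ℝ] weightedSobolev T 1 p d,
      (∀ η, ∀ᵐ q ∂weightedMeasure T p d, sobolevComp (mkIdx 0 0 (by norm_num)) (A η) q =
        c q (sobolevComp (mkIdx 0 0 (by norm_num)) η q)) ∧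
      (∀ η, ∀ᵐ q ∂weightedMeasure T p d, sobolevComp (mkIdx 1 0 (by norm_num)) (A η) q =
        c q (sobolevComp (mkIdx 1 0 (by norm_num)) η q) +
          pd (1, 0) c q (sobolevComp (mkIdx 0 0 (by norm_num)) η q)) ∧
      (∀ η, ∀ᵐ q ∂weightedMeasure T p d, sobolevComp (mkIdx 0 1 (by norm_num)) (A η) q =
        c q (sobolevComp (mkIdx 0 1 (by norm_num)) η q) +
          pd (0, 1) c q (sobolevComp (mkIdx 0 0 (by norm_num)) η q)) ∧
      ‖A‖ ≤ piLpConst T p d 1 * (2 * B) := by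
  have hB0 : 0 ≤ B := (norm_nonneg _).trans (hc.bound 0)
  obtain ⟨A₀, hA₀, hA₀n⟩ := exists_mulLp (p := p) (T := T) (d := d) hc.continuous hc.bound
  obtain ⟨A₁, hA₁, hA₁n⟩ := exists_mulLp (p := p) (T := T) (d := d) (hc.pd (1, 0)).continuous
    fun q => hc.bound_pd q _ (Or.inl rfl)
  obtain ⟨A₂, hA₂, hA₂n⟩ := exists_mulLp (p := p) (T := T) (d := d) (hc.pd (0, 1)).continuous
    fun q => hc.bound_pd q _ (Or.inr rfl)
  obtain ⟨R, hR0, hR1, hR2, hRn⟩ : ∃ R : MultiIdx 1 → WeightedLp T p d →L[ℝ] WeightedLp T p d,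
      R (mkIdx 0 0 (by norm_num)) = 0 ∧ R (mkIdx 1 0 (by norm_num)) = A₁ ∧
      R (mkIdx 0 1 (by norm_num)) = A₂ ∧ ∀ α, ‖R α‖ ≤ B := by
    refine ⟨fun α => if (α.1.1 : ℕ) = 1 then A₁ else if (α.1.2 : ℕ) = 1 then A₂ else 0,
      rfl, rfl, rfl, fun α => ?_⟩
    simp only
    split_ifs
    · exact hA₁n
    · exact hA₂n
    · rw [norm_zero]; exact hB0
  obtain ⟨L, hL⟩ : ∃ L : MultiIdx 1 → weightedSobolev T 1 p d →L[ℝ] WeightedLp T p d,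
      ∀ α η, L α η = A₀ (sobolevComp α η) +
        R α (sobolevComp (mkIdx 0 0 (by norm_num)) η) :=
    ⟨fun α => A₀.comp (sobolevComp α) + (R α).comp (sobolevComp (mkIdx 0 0 (by norm_num))),
      fun α η => rfl⟩
  have hL0 : ∀ η, L (mkIdx 0 0 (by norm_num)) η =
      A₀ (sobolevComp (mkIdx 0 0 (by norm_num)) η) := fun η => by
    rw [hL, hR0, zero_apply, add_zero]
  have hL1 : ∀ η, L (mkIdx 1 0 (by norm_num)) η =
      A₀ (sobolevComp (mkIdx 1 0 (by norm_num)) η) +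
        A₁ (sobolevComp (mkIdx 0 0 (by norm_num)) η) := fun η => by rw [hL, hR1]
  have hL2 : ∀ η, L (mkIdx 0 1 (by norm_num)) η =
      A₀ (sobolevComp (mkIdx 0 1 (by norm_num)) η) +
        A₂ (sobolevComp (mkIdx 0 0 (by norm_num)) η) := fun η => by rw [hL, hR2]
  have hw1 : ∀ η, ∀ α β : MultiIdx 1, (β.1.1 : ℕ) = α.1.1 + 1 → (β.1.2 : ℕ) = α.1.2 →
      IsWeakDeriv T (1, 0) (L α η) (L β η) := by
    intro η α β h1 h2
    obtain ⟨hα, hβ⟩ := multiIdx_fst h1 h2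
    rw [hα, hβ, hL0, hL1]
    exact (isWeakDeriv_fst η (mkIdx 0 0 (by norm_num)) (mkIdx 1 0 (by norm_num)) rfl rfl).mul
      hc.toIsCylMap (hA₀ _) (hA₀ _) (hA₁ _)
  have hw2 : ∀ η, ∀ α β : MultiIdx 1, (β.1.1 : ℕ) = α.1.1 → (β.1.2 : ℕ) = α.1.2 + 1 →
      IsWeakDeriv T (0, 1) (L α η) (L β η) := by
    intro η α β h1 h2
    obtain ⟨hα, hβ⟩ := multiIdx_snd h1 h2
    rw [hα, hβ, hL0, hL2]
    exact (isWeakDeriv_snd η (mkIdx 0 0 (by norm_num)) (mkIdx 0 1 (by norm_num)) rfl rfl).mul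
      hc.toIsCylMap (hA₀ _) (hA₀ _) (hA₂ _)
  have hLn : ∀ α, ‖L α‖ ≤ 2 * B := by
    intro α
    refine ContinuousLinearMap.opNorm_le_bound _ (by positivity) fun η => ?_
    rw [hL]
    refine (norm_add_le _ _).trans ?_
    have b1 := (A₀.le_of_opNorm_le hA₀n (sobolevComp α η)).trans
      (mul_le_mul_of_nonneg_left (norm_sobolevComp_le α η) hB0)
    have b2 := ((R α).le_of_opNorm_le (hRn α) (sobolevComp (mkIdx 0 0 (by norm_num)) η)).trans
      (mul_le_mul_of_nonneg_left (norm_sobolevComp_le _ η) hB0)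
    linarith
  obtain ⟨A, hA, hAn⟩ := exists_sobolevOp L hw1 hw2 (by positivity) hLn
  refine ⟨A, fun η => ?_, fun η => ?_, fun η => ?_, hAn⟩
  · rw [hA, hL0]
    exact hA₀ (sobolevComp (mkIdx 0 0 (by norm_num)) η)
  · rw [hA, hL1]
    filter_upwards [hA₀ (sobolevComp (mkIdx 1 0 (by norm_num)) η),
      hA₁ (sobolevComp (mkIdx 0 0 (by norm_num)) η), Lp.coeFn_add
        (A₀ (sobolevComp (mkIdx 1 0 (by norm_num)) η))
        (A₁ (sobolevComp (mkIdx 0 0 (by norm_num)) η))] with q a1 a2 a3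
    rw [a3, Pi.add_apply, a1, a2]
  · rw [hA, hL2]
    filter_upwards [hA₀ (sobolevComp (mkIdx 0 1 (by norm_num)) η),
      hA₂ (sobolevComp (mkIdx 0 0 (by norm_num)) η), Lp.coeFn_add
        (A₀ (sobolevComp (mkIdx 0 1 (by norm_num)) η))
        (A₂ (sobolevComp (mkIdx 0 0 (by norm_num)) η))] with q a1 a2 a3
    rw [a3, Pi.add_apply, a1, a2]

end Sobolev

/-! ### Density of test maps -/

section Density
variable {F : Type*} [NormedAddCommGroup F] [NormedSpace ℝ F] {T : ℝ}

/-- Extension by periodicity of a map supported inside the fundamental domain. -/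
lemma exists_testMap_eq (hT : 0 < T) {g : ℝ × ℝ → F} (hg : ContDiff ℝ ∞ g) {ρ : ℝ} (hρ : 0 < ρ)
    (h1 : ∀ s t, t ≤ ρ → g (s, t) = 0) (h2 : ∀ s t, T - ρ ≤ t → g (s, t) = 0)
    (hK : ∃ K : ℝ, ∀ s t, K < |s| → g (s, t) = 0) :
    ∃ ψ : ℝ × ℝ → F, IsTestMap T ψ ∧ ∀ q : ℝ × ℝ, q.2 ∈ Ioc 0 T → ψ q = g q := by
  set ρ' := min ρ (T / 2)
  have hρ' : 0 < ρ' := lt_min hρ (by positivity)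
  have hρT : 2 * ρ' ≤ T := by linarith [min_le_right ρ (T / 2)]
  set g' : ℝ × ℝ → F := fun y => g (y.2, y.1) with hg'
  have hs := contDiff_periodize hT (b := 0) (g := g') hρ' hρT
    (fun r x hr => h1 _ _ (by linarith [min_le_left ρ (T / 2)]))
    (fun r x hr => h2 _ _ (by linarith [min_le_left ρ (T / 2)])) (m := ∞) (hg.comp (by fun_prop))
  refine ⟨fun q => periodize hT 0 g' (q.2, q.1), ⟨⟨hs.comp (by fun_prop), fun s t =>
    periodize_add hT 0 g' t s⟩, ?_⟩, fun q hq => ?_⟩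
  · exact hK.imp fun K hK s t hs => hK _ _ hs
  · have : toIocMod hT 0 q.2 = q.2 := (toIocMod_eq_self hT).2 (by simpa using hq)
    simp only [periodize, this, hg']

/-- A cutoff in the fundamental domain. -/
def slabCutoff (T : ℝ) (n : ℕ) (t : ℝ) : ℝ :=
  Real.smoothTransition (n * t - 1) * Real.smoothTransition (n * (T - t) - 1)

lemma contDiff_slabCutoff (T : ℝ) (n : ℕ) : ContDiff ℝ ∞ (slabCutoff T n) :=
  (Real.smoothTransition.contDiff.comp (by fun_prop)).mul
    (Real.smoothTransition.contDiff.comp (by fun_prop))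

lemma slabCutoff_mem (T : ℝ) (n : ℕ) (t : ℝ) : 0 ≤ slabCutoff T n t ∧ slabCutoff T n t ≤ 1 :=
  ⟨mul_nonneg (Real.smoothTransition.nonneg _) (Real.smoothTransition.nonneg _),
    mul_le_one₀ (Real.smoothTransition.le_one _) (Real.smoothTransition.nonneg _)
      (Real.smoothTransition.le_one _)⟩

lemma slabCutoff_eventually {t : ℝ} (ht : t ∈ Ioo 0 T) :
    ∀ᶠ n : ℕ in Filter.atTop, slabCutoff T n t = 1 := by
  have h1 := tendsto_natCast_atTop_atTop.atTop_mul_const ht.1 |>.eventually_ge_atTop (2 : ℝ)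
  have h2 := tendsto_natCast_atTop_atTop.atTop_mul_const (sub_pos.2 ht.2)
    |>.eventually_ge_atTop (2 : ℝ)
  filter_upwards [h1, h2] with n a1 a2
  rw [slabCutoff, Real.smoothTransition.one_of_one_le (by linarith),
    Real.smoothTransition.one_of_one_le (by linarith), one_mul]

lemma ae_mem_Ioo (T : ℝ) : ∀ᵐ q ∂cylMeasure T, q.2 ∈ Ioo 0 T := by
  have h1 : ∀ᵐ q : ℝ × ℝ ∂cylMeasure T, q.2 ≠ T := by
    refine ae_restrict_of_ae ?_
    have : (univ : Set ℝ) ×ˢ {T} = {q : ℝ × ℝ | ¬ q.2 ≠ T} := by ext; simp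
    rw [ae_iff, ← this, Measure.volume_eq_prod, Measure.prod_prod]
    simp
  filter_upwards [ae_cylMeasure T, h1] with q a1 a2
  exact ⟨a1.1, lt_of_le_of_ne a1.2 a2⟩

lemma exists_testMap_eLpNorm_le (hT : 0 < T) {p : ℝ≥0∞} (hp : p ≠ ⊤) (hp1 : 1 ≤ p)
    {f : ℝ × ℝ → E4} (hf : MemLp f p (cylMeasure T)) {ε : ℝ} (hε : 0 < ε) :
    ∃ φ : ℝ × ℝ → E4, IsTestMap T φ ∧
      eLpNorm (fun q => f q - φ q) p (cylMeasure T) ≤ ENNReal.ofReal ε := by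
  obtain ⟨g, hgK, hgc, hg⟩ := hf.exist_eLpNorm_sub_le hp hp1 (half_pos hε)
  have hK : ∃ K : ℝ, ∀ s t, K < |s| → g (s, t) = 0 := by
    obtain ⟨K, hK⟩ := hgK.isCompact.isBounded.exists_norm_le
    refine ⟨K, fun s t hs => image_eq_zero_of_notMem_tsupport fun hmem => ?_⟩
    have := (norm_fst_le (s, t)).trans (hK _ hmem)
    rw [Real.norm_eq_abs] at this
    linarith
  have hgm : MemLp g p (cylMeasure T) := hgc.continuous.memLp_of_hasCompactSupport hgK
  have hp0 : p ≠ 0 := (zero_lt_one.trans_le hp1).ne'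
  have hpr : 0 < p.toReal := ENNReal.toReal_pos hp0 hp
  have hsc : ∀ n, ContDiff ℝ ∞ fun q : ℝ × ℝ => slabCutoff T n q.2 := fun n =>
    (contDiff_slabCutoff T n).comp contDiff_snd
  have hlim : Filter.Tendsto (fun n : ℕ => ∫⁻ q, ‖g q - slabCutoff T n q.2 • g q‖ₑ ^ p.toReal
      ∂cylMeasure T) Filter.atTop (nhds (∫⁻ _, 0 ∂cylMeasure T)) := by
    refine tendsto_lintegral_of_dominated_convergence (fun q => ‖g q‖ₑ ^ p.toReal)
      (fun n => ?_) (fun n => Filter.Eventually.of_forall fun q => ?_) ?_ ?_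
    · have h1 := (hsc n).continuous
      have h2 := hgc.continuous
      exact (Continuous.measurable (by fun_prop)).pow_const _
    · refine ENNReal.rpow_le_rpow (enorm_le_iff_norm_le.2 ?_) hpr.le
      have := slabCutoff_mem T n q.2
      rw [show g q - slabCutoff T n q.2 • g q = (1 - slabCutoff T n q.2) • g q by
        rw [sub_smul, one_smul], norm_smul, Real.norm_eq_abs, abs_of_nonneg (by linarith)]
      exact mul_le_of_le_one_left (norm_nonneg _) (by linarith)
    · exact (lintegral_rpow_enorm_lt_top_of_eLpNorm_lt_top hp0 hp hgm.2).ne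
    · filter_upwards [ae_mem_Ioo T] with q hq
      refine tendsto_const_nhds.congr' ?_
      filter_upwards [slabCutoff_eventually hq] with n hn
      rw [hn, one_smul, sub_self, enorm_zero, ENNReal.zero_rpow_of_pos hpr]
  rw [lintegral_zero] at hlim
  have hεp : (0 : ℝ≥0∞) < ENNReal.ofReal (ε / 2) ^ p.toReal :=
    ENNReal.rpow_pos (by simpa using hε) ENNReal.ofReal_ne_top
  obtain ⟨n, hn, hn1⟩ := ((hlim.eventually (gt_mem_nhds hεp)).and
    (Filter.eventually_gt_atTop 0)).exists
  have hn0 : (0 : ℝ) < n := Nat.cast_pos.2 hn1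
  obtain ⟨φ, hφ, hφg⟩ := exists_testMap_eq hT (g := fun q => slabCutoff T n q.2 • g q)
    ((hsc n).smul hgc) (ρ := 1 / n) (by positivity)
    (fun s t ht => by
      simp only [slabCutoff]
      rw [Real.smoothTransition.zero_of_nonpos, zero_mul, zero_smul]
      rw [le_div_iff₀ hn0] at ht; linarith)
    (fun s t ht => by
      simp only [slabCutoff]
      rw [Real.smoothTransition.zero_of_nonpos (x := n * (T - t) - 1), mul_zero, zero_smul]
      have : T - t ≤ 1 / n := by linarith
      rw [le_div_iff₀ hn0] at this; linarith)
    (hK.imp fun K hK s t hs => by simp only [hK s t hs, smul_zero])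
  refine ⟨φ, hφ, ?_⟩
  have e1 : eLpNorm (fun q => g q - φ q) p (cylMeasure T) ≤ ENNReal.ofReal (ε / 2) := by
    rw [eLpNorm_congr_ae (g := fun q => g q - slabCutoff T n q.2 • g q)
      ((ae_cylMeasure T).mono fun q hq => by simp only [hφg q hq]),
      eLpNorm_eq_lintegral_rpow_enorm_toReal hp0 hp]
    calc _ ≤ (ENNReal.ofReal (ε / 2) ^ p.toReal) ^ (1 / p.toReal) :=
          ENNReal.rpow_le_rpow hn.le (by positivity)
      _ = _ := by rw [← ENNReal.rpow_mul, mul_one_div_cancel hpr.ne', ENNReal.rpow_one]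
  have e2 : (fun q => f q - φ q) = (f - g) + fun q => g q - φ q := by ext1 q; simp
  rw [e2]
  refine (eLpNorm_add_le (hf.1.sub hgm.1) (hgm.1.sub hφ.continuous.aestronglyMeasurable)
    hp1).trans ?_
  calc _ ≤ ENNReal.ofReal (ε / 2) + ENNReal.ofReal (ε / 2) := add_le_add hg e1
    _ = ENNReal.ofReal ε := by rw [← ENNReal.ofReal_add (by positivity) (by positivity), add_halves]

/-- The fundamental lemma of the calculus of variations on the cylinder. -/
lemma ae_eq_zero_of_testFunctions (hT : 0 < T) {u : ℝ × ℝ → E4}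
    (hu : LocallyIntegrable u (cylMeasure T))
    (h : ∀ ψ, IsTestFunction T ψ → ∫ q, ψ q • u q ∂cylMeasure T = 0) :
    ∀ᵐ q ∂cylMeasure T, u q = 0 := by
  have hU : IsOpen {q : ℝ × ℝ | q.2 ∈ Ioo 0 T} := isOpen_Ioo.preimage continuous_snd
  have := hU.ae_eq_zero_of_integral_contDiff_smul_eq_zero (μ := cylMeasure T)
    (hu.locallyIntegrableOn _) fun g hg hgK hgU => ?_
  · filter_upwards [this, ae_mem_Ioo T] with q h1 h2 using h1 h2
  · obtain ⟨ρ, hρ, h1, h2⟩ : ∃ ρ : ℝ, 0 < ρ ∧ (∀ q ∈ tsupport g, ρ < q.2) ∧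
        ∀ q ∈ tsupport g, q.2 < T - ρ := by
      rcases (tsupport g).eq_empty_or_nonempty with h0 | h0
      · exact ⟨1, one_pos, by simp [h0], by simp [h0]⟩
      obtain ⟨a, ha, ha'⟩ := hgK.isCompact.exists_isMinOn h0 continuous_snd.continuousOn
      obtain ⟨b, hb, hb'⟩ := hgK.isCompact.exists_isMaxOn h0 continuous_snd.continuousOn
      have a1 := hgU ha
      have b1 := hgU hb
      refine ⟨min a.2 (T - b.2) / 2, half_pos (lt_min a1.1 (sub_pos.2 b1.2)), fun q hq => ?_,
        fun q hq => ?_⟩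
      · have := isMinOn_iff.1 ha' q hq
        linarith [min_le_left a.2 (T - b.2), a1.1, half_lt_self a1.1]
      · have := isMaxOn_iff.1 hb' q hq
        have b2 := b1.2
        linarith [min_le_right a.2 (T - b.2), half_lt_self (sub_pos.2 b2)]
    obtain ⟨K, hK⟩ := hgK.isCompact.isBounded.exists_norm_le
    obtain ⟨ψ, hψ, hψg⟩ := exists_testMap_eq hT hg hρ
      (fun s t ht => image_eq_zero_of_notMem_tsupport fun hm => (h1 _ hm).not_ge ht)
      (fun s t ht => image_eq_zero_of_notMem_tsupport fun hm => (h2 _ hm).not_ge ht)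
      ⟨K, fun s t hs => image_eq_zero_of_notMem_tsupport fun hmem => by
        have := (norm_fst_le (s, t)).trans (hK _ hmem)
        rw [Real.norm_eq_abs] at this
        linarith⟩
    rw [← h ψ hψ.isTestFunction]
    refine integral_congr_ae ?_
    filter_upwards [ae_cylMeasure T] with q hq
    simp only [hψg q hq]

/-- Hölder's inequality for the pairing of sections. -/
lemma abs_integral_inner_le {μ : Measure (ℝ × ℝ)} {p q : ℝ≥0∞} [ENNReal.HolderConjugate p q]
    {φ u : ℝ × ℝ → E4} (hφ : MemLp φ q μ) (hu : MemLp u p μ) :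
    Integrable (fun x => inner ℝ (φ x) (u x)) μ ∧
    |∫ x, inner ℝ (φ x) (u x) ∂μ| ≤ (eLpNorm φ q μ).toReal * (eLpNorm u p μ).toReal := by
  have h1 : eLpNorm (fun x => inner ℝ (φ x) (u x)) 1 μ ≤
      1 * eLpNorm φ q μ * eLpNorm u p μ :=
    have : ENNReal.HolderTriple q p 1 := ENNReal.HolderTriple.symm
    eLpNorm_le_eLpNorm_mul_eLpNorm_of_nnnorm (p := q) (q := p) (r := 1) hφ.1 hu.1
      (fun x y => inner ℝ x y) 1
      (Filter.Eventually.of_forall fun x => by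
        rw [one_mul]
        exact nnnorm_inner_le_nnnorm _ _)
  rw [one_mul] at h1
  have hm : AEStronglyMeasurable (fun x => inner ℝ (φ x) (u x)) μ := hφ.1.inner hu.1
  have htop : eLpNorm φ q μ * eLpNorm u p μ ≠ ⊤ := ENNReal.mul_ne_top hφ.2.ne hu.2.ne
  have hint : Integrable (fun x => inner ℝ (φ x) (u x)) μ :=
    memLp_one_iff_integrable.1 ⟨hm, h1.trans_lt htop.lt_top⟩
  refine ⟨hint, ?_⟩
  rw [← ENNReal.toReal_mul, ← Real.norm_eq_abs]
  refine (norm_integral_le_lintegral_norm _).trans ?_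
  refine ENNReal.toReal_mono htop ?_
  rw [eLpNorm_one_eq_lintegral_enorm] at h1
  simpa only [ofReal_norm] using h1

end Density

/-! ### Bounded solutions of the model equation vanish -/

section Liouville
variable {T d κ M : ℝ} {k : ℝ × ℝ → ℝ} {ζ : ℝ × ℝ → E4}

/-- A cutoff in the `s` direction. -/
def radialCutoff (R s : ℝ) : ℝ := Real.smoothTransition (2 - (R⁻¹ * s) ^ 2)

lemma contDiff_radialCutoff (R : ℝ) : ContDiff ℝ ∞ (radialCutoff R) :=
  Real.smoothTransition.contDiff.comp (by fun_prop)

lemma radialCutoff_eq_one {R s : ℝ} (hR : 0 < R) (hs : |s| ≤ R) : radialCutoff R s = 1 := by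
  refine Real.smoothTransition.one_of_one_le ?_
  have : |R⁻¹ * s| ≤ 1 := by
    rw [abs_mul, abs_of_pos (inv_pos.2 hR), inv_mul_le_iff₀ hR, mul_one]; exact hs
  have := (sq_le_one_iff_abs_le_one _).2 this
  linarith

lemma radialCutoff_eq_zero {R s : ℝ} (hR : 0 < R) (hs : 2 * R < |s|) : radialCutoff R s = 0 := by
  refine Real.smoothTransition.zero_of_nonpos ?_
  have : 2 ≤ |R⁻¹ * s| := by
    rw [abs_mul, abs_of_pos (inv_pos.2 hR), le_inv_mul_iff₀ hR]; linarith
  have h2 : 2 ^ 2 ≤ (R⁻¹ * s) ^ 2 := by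
    rw [← sq_abs (R⁻¹ * s)]; gcongr
  linarith

lemma exists_radialCutoff_deriv : ∃ c : ℝ, 0 ≤ c ∧ ∀ R : ℝ, 0 < R → ∀ s,
    |deriv (radialCutoff R) s| ≤ c * R⁻¹ := by
  have hc : Continuous (deriv (radialCutoff 1)) :=
    (contDiff_radialCutoff 1).continuous_deriv (by simp)
  have hK : HasCompactSupport (deriv (radialCutoff 1)) := by
    refine HasCompactSupport.deriv (HasCompactSupport.intro (isCompact_Icc (a := -2) (b := 2))
      fun s hs => radialCutoff_eq_zero one_pos ?_)
    rw [mul_one]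
    by_contra hcon
    exact hs (abs_le.1 (not_lt.1 hcon))
  obtain ⟨c, hc'⟩ := hK.exists_bound_of_continuous hc
  refine ⟨c, (norm_nonneg _).trans (hc' 0), fun R hR s => ?_⟩
  have e : radialCutoff R = fun s => radialCutoff 1 (R⁻¹ * s) := by
    ext s; simp [radialCutoff]
  rw [e, deriv_comp_mul_left, smul_eq_mul, abs_mul, abs_of_pos (inv_pos.2 hR), mul_comm]
  exact mul_le_mul_of_nonneg_right (hc' _) (inv_pos.2 hR).le

lemma modelOp_cutoff (hζ : IsCylMap T ζ) {χ : ℝ → ℝ} (hχ : ContDiff ℝ ∞ χ) (d : ℝ) (q : ℝ × ℝ) :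
    modelOp k d (fun q => χ q.1 • ζ q) q = χ q.1 • modelOp k d ζ q + deriv χ q.1 • ζ q := by
  have hd : HasDerivAt χ (deriv χ q.1) q.1 :=
    (hχ.differentiable (by simp) q.1).hasDerivAt
  simp only [modelOp, sliceOp]
  rw [pd_smul (isCylMap_fst hχ) hζ, pd_smul (isCylMap_fst hχ) hζ]
  simp only
  rw [pd_fst hd, pd_fst hd]
  simp only [one_smul, zero_smul, add_zero, map_smul, smul_add, smul_sub]
  rw [smul_comm (k q) (χ q.1), smul_comm d (χ q.1)]
  abel

set_option maxHeartbeats 400000 in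
lemma eq_zero_of_bounded (hT : 0 < T) (hκ : 0 < κ) (hd0 : d ≠ 0)
    (hd : 4 * gapConst T κ M * d ^ 2 ≤ 1) (hk : IsModelCoeff T κ M (d ^ 2 / 4) k)
    (hζ : IsCylMap T ζ) {B : ℝ} (hB : ∀ q, ‖ζ q‖ ≤ B)
    (h0 : ∀ q, modelOp k d ζ q = 0) (q : ℝ × ℝ) : ζ q = 0 := by
  obtain ⟨c, hc0, hc⟩ := exists_radialCutoff_deriv
  set w := cauchyWeight (|d| / 2) with hw
  have hwc := contDiff_cauchyWeight (|d| / 2)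
  have hw0 : ∀ s, 0 ≤ w s := fun s => (cauchyWeight_pos _ s).le
  have hwi : Integrable (fun q : ℝ × ℝ => w q.1) (cylMeasure T) := by
    refine ⟨(hwc.continuous.comp continuous_fst).aestronglyMeasurable, ?_⟩
    have := lintegral_cauchyWeight_lt_top (T := T) (ε := |d| / 2) (by positivity)
    rw [hasFiniteIntegral_iff_ofReal (Filter.Eventually.of_forall fun q => hw0 _)]
    exact this
  have hB0 : 0 ≤ B := (norm_nonneg _).trans (hB 0)
  have htest : ∀ R : ℝ, 0 < R → IsTestMap T fun q => radialCutoff R q.1 • ζ q := fun R hR =>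
    ⟨(isCylMap_fst (contDiff_radialCutoff R)).smul hζ, 2 * R, fun s t hs => by
      simp only [radialCutoff_eq_zero hR hs, zero_smul]⟩
  set W := ∫ q, w q.1 ∂cylMeasure T with hW
  have energy : ∀ R : ℝ, 0 < R → d ^ 2 * ∫ q, w q.1 * ‖radialCutoff R q.1 • ζ q‖ ^ 2 ∂cylMeasure T ≤
      4 * ((c * B) ^ 2 * W) * (R⁻¹) ^ 2 := by
    intro R hR
    refine (weighted_energy hT hκ hd hk (htest R hR) hwc hw0 (hasDerivAt_cauchyWeight _)
      (abs_deriv_cauchyWeight_le (by positivity))).trans ?_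
    rw [mul_assoc]
    refine mul_le_mul_of_nonneg_left ?_ (by norm_num)
    have hm := (htest R hR).modelOp hk.toIsCylMap d
    calc _ ≤ ∫ q, (c * R⁻¹ * B) ^ 2 * w q.1 ∂cylMeasure T := by
          refine integral_mono (isTestMap_weight_norm hwc hm).integrable (hwi.const_mul _) fun q => ?_
          simp only
          rw [modelOp_cutoff hζ (contDiff_radialCutoff R), h0, smul_zero, zero_add, norm_smul,
            mul_comm]
          refine mul_le_mul_of_nonneg_right ?_ (hw0 _)
          have := hc R hR q.1
          have hRi := inv_pos.2 hR
          exact pow_le_pow_left₀ (by positivity)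
            (mul_le_mul this (hB q) (norm_nonneg _) (by positivity)) 2
      _ = _ := by rw [integral_const_mul]; ring
  have hzero : ∀ R : ℝ, 0 < R → ∫ q, w q.1 * ‖radialCutoff R q.1 • ζ q‖ ^ 2 ∂cylMeasure T = 0 := by
    intro R hR
    have hint := (isTestMap_weight_norm hwc (htest R hR)).integrable
    refine le_antisymm ?_ (integral_nonneg fun q => mul_nonneg (hw0 _) (sq_nonneg _))
    have hlim : Filter.Tendsto (fun r : ℝ => 4 * ((c * B) ^ 2 * W) * (r⁻¹) ^ 2) Filter.atTop
        (nhds (4 * ((c * B) ^ 2 * W) * 0 ^ 2)) :=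
      (tendsto_inv_atTop_zero.pow 2).const_mul _
    have : d ^ 2 * ∫ q, w q.1 * ‖radialCutoff R q.1 • ζ q‖ ^ 2 ∂cylMeasure T ≤
        4 * ((c * B) ^ 2 * W) * 0 ^ 2 := by
      refine ge_of_tendsto hlim ?_
      filter_upwards [Filter.eventually_ge_atTop (2 * R)] with r hr
      have hr0 : 0 < r := by linarith
      refine le_trans (mul_le_mul_of_nonneg_left ?_ (sq_nonneg d)) (energy r hr0)
      refine integral_mono hint (isTestMap_weight_norm hwc (htest r hr0)).integrable fun q => ?_
      refine mul_le_mul_of_nonneg_left ?_ (hw0 _)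
      by_cases hq : |q.1| ≤ 2 * R
      · rw [radialCutoff_eq_one hr0 (hq.trans hr), one_smul, norm_smul]
        refine pow_le_pow_left₀ (by positivity) (mul_le_of_le_one_left (norm_nonneg _) ?_) 2
        rw [Real.norm_eq_abs, radialCutoff, abs_of_nonneg (Real.smoothTransition.nonneg _)]
        exact Real.smoothTransition.le_one _
      · rw [radialCutoff_eq_zero hR (not_le.1 hq), zero_smul, norm_zero, zero_pow two_ne_zero]
        exact sq_nonneg _
    have hd2 : 0 < d ^ 2 := by positivity
    refine le_of_mul_le_mul_left (this.trans_eq ?_) hd2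
    rw [zero_pow two_ne_zero, mul_zero, mul_zero]
  have hae : ∀ R : ℝ, 0 < R → EqOn (fun q => radialCutoff R q.1 • ζ q) (fun _ => 0)
      (univ ×ˢ Ioc 0 T) := by
    intro R hR
    have hint := (isTestMap_weight_norm hwc (htest R hR)).integrable
    have hnn : 0 ≤ fun q : ℝ × ℝ => cauchyWeight (|d| / 2) q.1 * ‖radialCutoff R q.1 • ζ q‖ ^ 2 :=
      fun q => mul_nonneg (hw0 q.1) (sq_nonneg _)
    have h1 := (integral_eq_zero_iff_of_nonneg hnn hint).1 (hzero R hR)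
    refine Measure.eqOn_of_ae_eq (μ := volume) ?_ (htest R hR).continuous.continuousOn
      continuousOn_const ?_
    · change _ =ᵐ[cylMeasure T] _
      filter_upwards [h1] with q hq
      have h2 : w q.1 * ‖radialCutoff R q.1 • ζ q‖ ^ 2 = 0 := hq
      have h3 := (mul_eq_zero.1 h2).resolve_left (cauchyWeight_pos _ _).ne'
      exact norm_eq_zero.1 (pow_eq_zero_iff (by norm_num) |>.1 h3)
    · rw [interior_prod_eq, closure_prod_eq, interior_univ, closure_univ, interior_Ioc,
        closure_Ioo hT.ne]
      exact prod_mono subset_rfl Ioc_subset_Icc_self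
  have hIoc : ∀ s, ∀ t ∈ Ioc 0 T, ζ (s, t) = 0 := by
    intro s t ht
    have := hae (|s| + 1) (by positivity) (show (s, t) ∈ univ ×ˢ Ioc 0 T from ⟨trivial, ht⟩)
    simp only at this
    rwa [radialCutoff_eq_one (by positivity) (by linarith), one_smul] at this
  have hper : Function.Periodic (fun t => ζ (q.1, t)) T := fun t => hζ.periodic q.1 t
  obtain ⟨t, ht, he⟩ := hper.exists_mem_Ioc hT q.2 0
  rw [zero_add] at ht
  exact he.trans (hIoc q.1 t ht)

end Liouville

/-! ### Density of the range of the model operator with constant coefficient -/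

section Functional
variable {T : ℝ}

/-- The class of a test map in the Lebesgue space. -/
def testLp (T : ℝ) (p : ℝ≥0∞) : testSpace T →ₗ[ℝ] Lp E4 p (cylMeasure T) where
  toFun φ := (IsTestMap.memLp φ.2 p).toLp
  map_add' φ ψ := (IsTestMap.memLp φ.2 p).toLp_add (IsTestMap.memLp ψ.2 p)
  map_smul' c φ := (IsTestMap.memLp φ.2 p).toLp_const_smul c

lemma norm_testLp {p : ℝ≥0∞} (φ : testSpace T) :
    ‖testLp T p φ‖ = (eLpNorm φ.1 p (cylMeasure T)).toReal :=
  Lp.norm_toLp _ (IsTestMap.memLp φ.2 p)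

lemma denseRange_testLp (hT : 0 < T) {p : ℝ≥0∞} [hp1 : Fact (1 ≤ p)] (hp : p ≠ ⊤) :
    DenseRange (testLp T p) := by
  intro f
  rw [Metric.mem_closure_iff]
  intro ε hε
  obtain ⟨φ, hφ, h⟩ := exists_testMap_eLpNorm_le hT hp hp1.out (Lp.memLp f) (half_pos hε)
  refine ⟨_, ⟨⟨φ, hφ⟩, rfl⟩, ?_⟩
  rw [dist_eq_norm, Lp.norm_def]
  have : eLpNorm (f - testLp T p ⟨φ, hφ⟩ : Lp E4 p (cylMeasure T)) p (cylMeasure T) =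
      eLpNorm (fun q => f q - φ q) p (cylMeasure T) := by
    refine eLpNorm_congr_ae ?_
    filter_upwards [Lp.coeFn_sub f (testLp T p ⟨φ, hφ⟩), (hφ.memLp p).coeFn_toLp] with q h1 h2
    rw [h1, Pi.sub_apply]
    exact congrArg _ h2
  rw [this]
  refine (ENNReal.toReal_mono ENNReal.ofReal_ne_top h).trans_lt ?_
  rw [ENNReal.toReal_ofReal (by positivity)]
  linarith

section Bound
variable {F : Type*} [NormedAddCommGroup F] [NormedSpace ℝ F]

lemma IsTestMap.exists_bound (hT : 0 < T) {φ : ℝ × ℝ → F} (h : IsTestMap T φ) :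
    ∃ B : ℝ, 0 ≤ B ∧ ∀ q, ‖φ q‖ ≤ B := by
  obtain ⟨K, hK⟩ := h.supp
  obtain ⟨B, hB⟩ := (isCompact_Icc.prod isCompact_Icc : IsCompact (Icc (-K) K ×ˢ Icc 0 T))
    |>.exists_bound_of_continuousOn h.continuous.continuousOn
  refine ⟨max B 0, le_max_right _ _, fun q => ?_⟩
  have hper : Function.Periodic (fun t => φ (q.1, t)) T := fun t => h.periodic q.1 t
  obtain ⟨t, ht, he⟩ := hper.exists_mem_Ioc hT q.2 0
  rw [zero_add] at ht
  have he' : φ q = φ (q.1, t) := he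
  rw [he']
  by_cases hs : |q.1| ≤ K
  · exact (hB (q.1, t) ⟨abs_le.1 hs, Ioc_subset_Icc_self ht⟩).trans (le_max_left _ _)
  · simp only [hK _ _ (not_le.1 hs), norm_zero]
    exact le_max_right _ _

lemma IsTestMap.fderiv_map {φ : ℝ × ℝ → F} (h : IsTestMap T φ) : IsTestMap T (fderiv ℝ φ) := by
  obtain ⟨K, hK⟩ := h.supp
  refine ⟨⟨h.smooth.fderiv_right (m := ∞) (by simp), h.fderiv_periodic⟩, K, fun s t hs => ?_⟩
  exact ContinuousLinearMap.ext fun e => pd_eq_zero hK e s t hs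

lemma IsTestMap.taylor (hT : 0 < T) {φ : ℝ × ℝ → F} (h : IsTestMap T φ) :
    ∃ B : ℝ, 0 ≤ B ∧ ∀ q v, ‖φ (q - v) - φ q + MorseBottTorus.pd v φ q‖ ≤ B * ‖v‖ ^ 2 := by
  obtain ⟨B, hB0, hB⟩ := h.fderiv_map.fderiv_map.exists_bound hT
  refine ⟨B, hB0, fun q v => ?_⟩
  have hlip : ∀ x, ‖fderiv ℝ φ x - fderiv ℝ φ q‖ ≤ B * ‖x - q‖ := fun x =>
    convex_univ.norm_image_sub_le_of_norm_fderiv_le (𝕜 := ℝ)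
      (fun y _ => h.fderiv_map.toIsCylMap.differentiableAt) (fun y _ => hB y) trivial trivial
  have := (convex_segment q (q - v)).norm_image_sub_le_of_norm_hasFDerivWithin_le' (𝕜 := ℝ)
    (f := φ) (f' := fderiv ℝ φ) (φ := fderiv ℝ φ q) (C := B * ‖v‖)
    (fun x _ => h.toIsCylMap.differentiableAt.hasFDerivAt.hasFDerivWithinAt)
    (fun x hx => (hlip x).trans (mul_le_mul_of_nonneg_left ?_ hB0))
    (left_mem_segment ℝ _ _) (right_mem_segment ℝ _ _)
  · rw [sub_sub_cancel_left, map_neg, norm_neg, sub_neg_eq_add] at this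
    rw [sq, ← mul_assoc]
    exact this
  · have := norm_sub_le_of_mem_segment hx
    rwa [sub_sub_cancel_left, norm_neg] at this

lemma eLpNorm_translate (hT : 0 < T) {p : ℝ≥0∞} (hp0 : p ≠ 0) (hp : p ≠ ⊤) {φ : ℝ × ℝ → F}
    (h : IsCylMap T φ) (r : ℝ × ℝ) :
    eLpNorm (fun q => φ (q - r)) p (cylMeasure T) = eLpNorm φ p (cylMeasure T) := by
  rw [eLpNorm_eq_lintegral_rpow_enorm_toReal hp0 hp, eLpNorm_eq_lintegral_rpow_enorm_toReal hp0 hp]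
  congr 1
  have hc := h.continuous
  have := lintegral_cyl_add hT (g := fun q => ‖φ q‖ₑ ^ p.toReal)
    ((Continuous.measurable (by fun_prop)).pow_const _)
    (fun s t => by simp only [h.periodic]) (-r)
  simpa only [← sub_eq_add_neg] using this

omit [NormedSpace ℝ F] in
lemma eLpNorm_le_of_bound_supp {p : ℝ≥0∞} {φ : ℝ × ℝ → F} {B K : ℝ}
    (hB : ∀ q, ‖φ q‖ ≤ B) (hK : ∀ s t, K < |s| → φ (s, t) = 0) :
    eLpNorm φ p (cylMeasure T) ≤
      ENNReal.ofReal B * cylMeasure T (Icc (-K) K ×ˢ Icc 0 T) ^ (p.toReal⁻¹) := by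
  have hA : MeasurableSet (Icc (-K) K ×ˢ Icc 0 T : Set (ℝ × ℝ)) :=
    measurableSet_Icc.prod measurableSet_Icc
  have e : φ =ᵐ[cylMeasure T] (Icc (-K) K ×ˢ Icc 0 T).indicator φ := by
    filter_upwards [ae_cylMeasure T] with q hq
    by_cases hqA : q ∈ Icc (-K) K ×ˢ Icc 0 T
    · rw [indicator_of_mem hqA]
    · rw [indicator_of_notMem hqA, hK q.1 q.2]
      by_contra hcon
      exact hqA ⟨abs_le.1 (not_lt.1 hcon), Ioc_subset_Icc_self hq⟩
  rw [eLpNorm_congr_ae e, eLpNorm_indicator_eq_eLpNorm_restrict hA]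
  refine (eLpNorm_le_of_ae_bound (Filter.Eventually.of_forall hB)).trans_eq ?_
  rw [Measure.restrict_apply_univ, mul_comm]

end Bound

variable {p : ℝ≥0∞} [Fact (1 ≤ p)]

/-- The pairing of a functional with the translates of a test function. -/
def translatePairing (Γ : testSpace T →ₗ[ℝ] ℝ) (ψ : ℝ × ℝ → ℝ) (hψ : IsTestMap T ψ)
    (q : ℝ × ℝ) : E4 :=
  ∑ i : Fin 4, Γ ⟨fun x => ψ (x - q) • EuclideanSpace.single i 1,
    (hψ.translate q).smul_const _⟩ • (EuclideanSpace.single i (1 : ℝ) : E4)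

lemma translatePairing_apply (Γ : testSpace T →ₗ[ℝ] ℝ) {ψ : ℝ × ℝ → ℝ} (hψ : IsTestMap T ψ)
    (q : ℝ × ℝ) (i : Fin 4) : translatePairing Γ ψ hψ q i =
      Γ ⟨fun x => ψ (x - q) • EuclideanSpace.single i 1, (hψ.translate q).smul_const _⟩ := by
  simp [translatePairing, Fin.sum_univ_four]
  fin_cases i <;> simp

lemma inner_translatePairing (Γ : testSpace T →ₗ[ℝ] ℝ) {ψ : ℝ × ℝ → ℝ} (hψ : IsTestMap T ψ)
    (q : ℝ × ℝ) (v : E4) : inner ℝ (translatePairing Γ ψ hψ q) v =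
      Γ ⟨fun x => ψ (x - q) • v, (hψ.translate q).smul_const _⟩ := by
  have : (⟨fun x => ψ (x - q) • v, (hψ.translate q).smul_const _⟩ : testSpace T) =
      ∑ i : Fin 4, v i • ⟨fun x => ψ (x - q) • EuclideanSpace.single i 1,
        (hψ.translate q).smul_const _⟩ := by
    apply Subtype.ext
    ext x j
    rw [Fin.sum_univ_four]
    fin_cases j <;> simp [mul_comm]
  rw [this, map_sum, inner_E4, Fin.sum_univ_four]
  simp only [map_smul, smul_eq_mul, translatePairing_apply]
  ring

lemma pd_eq_add {F : Type*} [NormedAddCommGroup F] [NormedSpace ℝ F] (v : ℝ × ℝ)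
    (φ : ℝ × ℝ → F) (q : ℝ × ℝ) : pd v φ q = v.1 • pd (1, 0) φ q + v.2 • pd (0, 1) φ q := by
  simp only [pd, ← map_smul, ← map_add]
  congr 1
  ext <;> simp

lemma norm_translatePairing_le (hT : 0 < T) (hp : p ≠ ⊤) {Γ : testSpace T →ₗ[ℝ] ℝ} {C : ℝ}
    (hΓ : ∀ φ, |Γ φ| ≤ C * (eLpNorm φ.1 p (cylMeasure T)).toReal) {ψ : ℝ × ℝ → ℝ}
    (hψ : IsTestMap T ψ) (q : ℝ × ℝ) :
    ‖translatePairing Γ ψ hψ q‖ ≤ C * (eLpNorm ψ p (cylMeasure T)).toReal := by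
  have hp0 : p ≠ 0 := (zero_lt_one.trans_le (Fact.out : 1 ≤ p)).ne'
  set X := translatePairing Γ ψ hψ q with hX
  rcases (norm_nonneg X).eq_or_lt with h0 | h0
  · rw [← h0]
    exact (abs_nonneg _).trans ((hΓ ⟨fun x => ψ x • dirX, hψ.smul_const _⟩).trans_eq (by
      have : eLpNorm (fun x => ψ x • dirX) p (cylMeasure T) = eLpNorm ψ p (cylMeasure T) := by
        refine eLpNorm_congr_norm_ae (Filter.Eventually.of_forall fun x => ?_)
        simp [norm_smul, dirX]
      rw [this]))
  have h1 := hΓ ⟨fun x => ψ (x - q) • X, (hψ.translate q).smul_const _⟩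
  rw [← inner_translatePairing Γ hψ q X, ← hX, real_inner_self_eq_norm_sq] at h1
  have h2 : eLpNorm (fun x => ψ (x - q) • X) p (cylMeasure T) =
      ‖X‖ₑ * eLpNorm ψ p (cylMeasure T) := by
    rw [eLpNorm_translate hT hp0 hp (φ := fun x => ψ x • X) (hψ.smul_const X).toIsCylMap q,
      ← enorm_norm X, ← eLpNorm_const_smul]
    refine eLpNorm_congr_norm_ae (Filter.Eventually.of_forall fun x => ?_)
    simp [norm_smul, mul_comm]
  simp only at h1
  rw [h2, ENNReal.toReal_mul, toReal_enorm, abs_of_nonneg (by positivity)] at h1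
  refine le_of_mul_le_mul_left ?_ h0
  linarith

lemma hasFDerivAt_translatePairing (hT : 0 < T) (hp : p ≠ ⊤) {Γ : testSpace T →ₗ[ℝ] ℝ} {C : ℝ}
    (hC : 0 ≤ C) (hΓ : ∀ φ, |Γ φ| ≤ C * (eLpNorm φ.1 p (cylMeasure T)).toReal) {ψ : ℝ × ℝ → ℝ}
    (hψ : IsTestMap T ψ) (q : ℝ × ℝ) :
    HasFDerivAt (translatePairing Γ ψ hψ)
      (-((ContinuousLinearMap.fst ℝ ℝ ℝ).smulRight (translatePairing Γ _ (hψ.pd (1, 0)) q) +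
        (ContinuousLinearMap.snd ℝ ℝ ℝ).smulRight (translatePairing Γ _ (hψ.pd (0, 1)) q))) q := by
  obtain ⟨B, hB0, hB⟩ := hψ.taylor hT
  obtain ⟨K, hK⟩ := hψ.supp
  have hθ : ∀ v : ℝ × ℝ, IsTestMap T fun x => ψ (x - v) - ψ x + pd v ψ x := fun v =>
    ((hψ.translate v).sub hψ).add (hψ.pd v)
  set m := cylMeasure T (Icc (-(K + 1)) (K + 1) ×ˢ Icc 0 T) ^ (p.toReal⁻¹) with hm
  have hmt : m ≠ ⊤ := ENNReal.rpow_ne_top_of_nonneg (by positivity)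
    (isCompact_Icc.prod isCompact_Icc).measure_lt_top.ne
  have hsmall : ∀ v : ℝ × ℝ, ‖v‖ ≤ 1 →
      (eLpNorm (fun x => ψ (x - v) - ψ x + pd v ψ x) p (cylMeasure T)).toReal ≤
        B * ‖v‖ ^ 2 * m.toReal := by
    intro v hv
    have := eLpNorm_le_of_bound_supp (T := T) (p := p) (fun x => hB x v) (K := K + 1)
      (fun s t hs => by
        have hv1 : |v.1| ≤ 1 := (norm_fst_le v).trans hv
        rw [hK s t (by linarith), pd_eq_zero hK v s t (by linarith)]
        have : ψ ((s, t) - v) = 0 := hK _ _ (by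
          have := abs_sub_abs_le_abs_sub s v.1
          linarith)
        rw [this]; simp)
    refine (ENNReal.toReal_mono (ENNReal.mul_ne_top ENNReal.ofReal_ne_top hmt) this).trans_eq ?_
    rw [ENNReal.toReal_mul, ENNReal.toReal_ofReal (by positivity)]
  have hlin : ∀ v : ℝ × ℝ, translatePairing Γ ψ hψ (q + v) - translatePairing Γ ψ hψ q -
      (-((ContinuousLinearMap.fst ℝ ℝ ℝ).smulRight (translatePairing Γ _ (hψ.pd (1, 0)) q) +
        (ContinuousLinearMap.snd ℝ ℝ ℝ).smulRight (translatePairing Γ _ (hψ.pd (0, 1)) q))) v =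
      translatePairing Γ _ (hθ v) q := by
    intro v
    refine ext_inner_right ℝ fun w => ?_
    have e : (⟨fun x => (ψ (x - q - v) - ψ (x - q) + pd v ψ (x - q)) • w,
        ((hθ v).translate q).smul_const _⟩ : testSpace T) =
        ⟨fun x => ψ (x - (q + v)) • w, (hψ.translate _).smul_const _⟩ -
        ⟨fun x => ψ (x - q) • w, (hψ.translate _).smul_const _⟩ +
        (v.1 • ⟨fun x => pd (1, 0) ψ (x - q) • w, ((hψ.pd _).translate _).smul_const _⟩ +
        v.2 • ⟨fun x => pd (0, 1) ψ (x - q) • w, ((hψ.pd _).translate _).smul_const _⟩) := by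
      apply Subtype.ext
      ext1 x
      simp only [Submodule.coe_add, Submodule.coe_sub, Submodule.coe_smul, Pi.add_apply,
        Pi.sub_apply, Pi.smul_apply]
      rw [pd_eq_add v, ← sub_sub]
      module
    rw [inner_translatePairing Γ (hθ v) q w, e]
    simp only [map_add, map_sub, map_smul, inner_translatePairing, neg_apply, _root_.add_apply,
      ContinuousLinearMap.smulRight_apply, inner_sub_left, inner_neg_left, inner_add_left,
      inner_smul_left, ContinuousLinearMap.coe_fst', ContinuousLinearMap.coe_snd', smul_eq_mul,
      RCLike.conj_to_real]
    ring
  rw [hasFDerivAt_iff_isLittleO_nhds_zero]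
  refine Asymptotics.IsBigO.trans_isLittleO ?_
    (Asymptotics.isLittleO_norm_pow_id (E' := ℝ × ℝ) (n := 2) one_lt_two)
  refine Asymptotics.IsBigO.of_bound (C * (B * m.toReal)) ?_
  filter_upwards [Metric.closedBall_mem_nhds (0 : ℝ × ℝ) one_pos] with v hv
  rw [mem_closedBall_zero_iff] at hv
  rw [hlin v, norm_pow, norm_norm]
  refine (norm_translatePairing_le hT hp hΓ (hθ v) q).trans ?_
  calc _ ≤ C * (B * ‖v‖ ^ 2 * m.toReal) := mul_le_mul_of_nonneg_left (hsmall v hv) hC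
    _ = _ := by ring

lemma contDiff_translatePairing (hT : 0 < T) (hp : p ≠ ⊤) {Γ : testSpace T →ₗ[ℝ] ℝ} {C : ℝ}
    (hC : 0 ≤ C) (hΓ : ∀ φ, |Γ φ| ≤ C * (eLpNorm φ.1 p (cylMeasure T)).toReal) {ψ : ℝ × ℝ → ℝ}
    (hψ : IsTestMap T ψ) : ContDiff ℝ ∞ (translatePairing Γ ψ hψ) := by
  rw [contDiff_infty]
  intro n
  induction n generalizing ψ with
  | zero =>
    rw [Nat.cast_zero, contDiff_zero, continuous_iff_continuousAt]
    exact fun q => (hasFDerivAt_translatePairing hT hp hC hΓ hψ q).continuousAt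
  | succ n ih =>
    refine (contDiff_succ_iff_hasFDerivAt (n := n)).2 ⟨_, ?_, fun q =>
      hasFDerivAt_translatePairing hT hp hC hΓ hψ q⟩
    exact ((contDiff_const.smulRight (ih (hψ.pd (1, 0)))).add
      (contDiff_const.smulRight (ih (hψ.pd (0, 1))))).neg

end Functional

section DenseRange
variable {T d κ M : ℝ} {p : ℝ≥0∞} [Fact (1 ≤ p)]

lemma modelOp_add {k : ℝ × ℝ → ℝ} {φ ψ : ℝ × ℝ → E4} (hφ : IsCylMap T φ) (hψ : IsCylMap T ψ) :
    modelOp k d (fun q => φ q + ψ q) = fun q => modelOp k d φ q + modelOp k d ψ q := by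
  ext1 q
  simp only [modelOp, sliceOp, pd_add hφ hψ, map_add, smul_add]
  abel

lemma modelOp_const_smul {k : ℝ × ℝ → ℝ} {φ : ℝ × ℝ → E4} (hφ : IsCylMap T φ) (c : ℝ) :
    modelOp k d (fun q => c • φ q) = fun q => c • modelOp k d φ q := by
  ext1 q
  simp only [modelOp, sliceOp, pd_const_smul hφ, map_smul, smul_add, smul_sub]
  rw [smul_comm (k q) c, smul_comm d c]

/-- The model operator on the space of test maps. -/
def modelLin {k : ℝ × ℝ → ℝ} (hk : IsCylMap T k) (d : ℝ) : testSpace T →ₗ[ℝ] testSpace T where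
  toFun φ := ⟨modelOp k d φ.1, IsTestMap.modelOp hk φ.2 d⟩
  map_add' φ ψ := Subtype.ext (modelOp_add (IsTestMap.toIsCylMap φ.2) (IsTestMap.toIsCylMap ψ.2))
  map_smul' c φ := Subtype.ext (modelOp_const_smul (IsTestMap.toIsCylMap φ.2) c)

lemma functional_eq_zero (hT : 0 < T) (hκ : 0 < κ) (hd0 : d ≠ 0)
    (hd : 4 * gapConst T κ M * d ^ 2 ≤ 1) {m : ℝ}
    (hm : IsModelCoeff T κ M (d ^ 2 / 4) fun _ => m) (hp : p ≠ ⊤)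
    {Γ : testSpace T →ₗ[ℝ] ℝ} {C : ℝ} (hC : 0 ≤ C)
    (hΓ : ∀ φ, |Γ φ| ≤ C * (eLpNorm φ.1 p (cylMeasure T)).toReal)
    (h0 : ∀ φ, Γ (modelLin hm.toIsCylMap d φ) = 0) (φ : testSpace T) : Γ φ = 0 := by
  have hscal : ∀ (ψ : ℝ × ℝ → ℝ) (hψ : IsTestMap T ψ), translatePairing Γ ψ hψ 0 = 0 := by
    intro ψ hψ
    set G := translatePairing Γ ψ hψ with hG
    set G₁ := translatePairing Γ _ (hψ.pd (1, 0)) with hG₁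
    set G₂ := translatePairing Γ _ (hψ.pd (0, 1)) with hG₂
    have hGd : ∀ q, HasFDerivAt G (-((ContinuousLinearMap.fst ℝ ℝ ℝ).smulRight (G₁ q) +
        (ContinuousLinearMap.snd ℝ ℝ ℝ).smulRight (G₂ q))) q := fun q =>
      hasFDerivAt_translatePairing hT hp hC hΓ hψ q
    have hGc : IsCylMap T G := by
      refine ⟨contDiff_translatePairing hT hp hC hΓ hψ, fun s t => ?_⟩
      refine ext_inner_right ℝ fun w => ?_
      rw [hG, inner_translatePairing, inner_translatePairing]
      congr 2
      ext1 x
      have := hψ.periodic (x.1 - s) (x.2 - (t + T))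
      rw [show x.2 - (t + T) + T = x.2 - t by ring] at this
      change ψ (x.1 - s, x.2 - (t + T)) • w = ψ (x.1 - s, x.2 - t) • w
      rw [this]
    have hpde : ∀ q, G₁ q - stdJ (G₂ q) - m • projY (G q) - d • G q = 0 := by
      intro q
      refine ext_inner_right ℝ fun w => ?_
      have h1 := h0 ⟨fun x => ψ (x - q) • w, (hψ.translate q).smul_const _⟩
      have e : modelLin hm.toIsCylMap d ⟨fun x => ψ (x - q) • w, (hψ.translate q).smul_const _⟩ =
          ⟨fun x => pd (1, 0) ψ (x - q) • w, ((hψ.pd _).translate q).smul_const _⟩ +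
          ⟨fun x => pd (0, 1) ψ (x - q) • stdJ w, ((hψ.pd _).translate q).smul_const _⟩ -
          ⟨fun x => ψ (x - q) • (m • projY w + d • w), (hψ.translate q).smul_const _⟩ := by
        apply Subtype.ext
        ext1 x
        have hpd : ∀ e, pd e (fun x => ψ (x - q) • w) = fun x => pd e ψ (x - q) • w := fun e => by
          rw [pd_smul (hψ.translate q).toIsCylMap (isCylMap_const w), pd_translate]
          ext1 x
          simp [pd]
        simp only [modelLin, LinearMap.coe_mk, AddHom.coe_mk, modelOp, sliceOp, hpd,
          Submodule.coe_add, Submodule.coe_sub, Pi.add_apply, Pi.sub_apply, map_smul]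
        module
      rw [e, map_sub, map_add, ← inner_translatePairing Γ (hψ.pd (1, 0)),
        ← inner_translatePairing Γ (hψ.pd (0, 1)), ← inner_translatePairing Γ hψ] at h1
      rw [inner_zero_left, ← h1]
      simp only [inner_E4, PiLp.add_apply, PiLp.sub_apply, PiLp.smul_apply, smul_eq_mul, stdJ_zero,
        stdJ_one, stdJ_two, stdJ_three, projY_zero, projY_one, projY_two, projY_three]
      ring
    set ζ : ℝ × ℝ → E4 := fun q => G (-q.1, q.2) with hζ
    have hζc : IsCylMap T ζ := ⟨hGc.smooth.comp (by fun_prop), fun s t => hGc.periodic _ _⟩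
    have hζd : ∀ q v, pd v ζ q = v.1 • G₁ (-q.1, q.2) - v.2 • G₂ (-q.1, q.2) := by
      intro q v
      have hl : HasFDerivAt (fun q : ℝ × ℝ => (-q.1, q.2))
          ((-ContinuousLinearMap.fst ℝ ℝ ℝ).prod (ContinuousLinearMap.snd ℝ ℝ ℝ)) q :=
        (hasFDerivAt_fst.neg).prodMk hasFDerivAt_snd
      have := (hGd (-q.1, q.2)).comp q hl
      rw [pd, hζ]
      rw [show (fun q : ℝ × ℝ => G (-q.1, q.2)) = G ∘ fun q : ℝ × ℝ => (-q.1, q.2) from rfl,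
        this.fderiv]
      simp [sub_eq_add_neg, add_comm]
    have hz := eq_zero_of_bounded hT hκ hd0 hd hm hζc
      (fun q => norm_translatePairing_le hT hp hΓ hψ _) (fun q => by
        have := hpde (-q.1, q.2)
        simp only [modelOp, sliceOp, hζd, one_smul, zero_smul, sub_zero, zero_sub, map_neg]
        rw [← this]
        abel) (0, 0)
    simp only [hζ, neg_zero] at hz
    exact hz
  have hφ : IsTestMap T φ.1 := φ.2
  have hi : ∀ i : Fin 4, IsTestMap T fun q => φ.1 q i := fun i =>
    hφ.comp (coordForm i).contDiff (map_zero _)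
  have hi' : ∀ i : Fin 4, Γ ⟨fun q => φ.1 q i • EuclideanSpace.single i (1 : ℝ),
      (hi i).smul_const _⟩ = 0 := by
    intro i
    have := translatePairing_apply Γ (hi i) 0 i
    rw [hscal] at this
    simpa using this.symm
  have e : φ = ∑ i : Fin 4, ⟨fun q => φ.1 q i • EuclideanSpace.single i (1 : ℝ),
      (hi i).smul_const _⟩ := by
    apply Subtype.ext
    ext x j
    rw [Fin.sum_univ_four]
    fin_cases j <;> simp
  rw [e, map_sum]
  exact Finset.sum_eq_zero fun i _ => hi' i

/-- A subspace is dense if every functional vanishing on it vanishes. -/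
lemma dense_of_functional {E : Type*} [NormedAddCommGroup E] [NormedSpace ℝ E]
    (S : Submodule ℝ E) (h : ∀ ℓ : E →L[ℝ] ℝ, (∀ x ∈ S, ℓ x = 0) → ℓ = 0) :
    Dense (S : Set E) := by
  intro x
  by_contra hx
  obtain ⟨f, u, hf, hu⟩ := geometric_hahn_banach_closed_point
    (S.topologicalClosure).convex S.isClosed_topologicalClosure (x := x) hx
  have h0 : ∀ y ∈ S, f y = 0 := by
    intro y hy
    by_contra hne
    have := hf (((u / f y) : ℝ) • y) (S.le_topologicalClosure (S.smul_mem _ hy))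
    rw [map_smul, smul_eq_mul, div_mul_cancel₀ _ hne] at this
    exact lt_irrefl _ this
  have hu0 := hf 0 (zero_mem _)
  rw [h f h0] at hu hu0
  simp at hu hu0
  linarith

lemma denseRange_model_const (hT : 0 < T) (hκ : 0 < κ) (hd0 : d ≠ 0)
    (hd : 4 * gapConst T κ M * d ^ 2 ≤ 1) {m : ℝ}
    (hm : IsModelCoeff T κ M (d ^ 2 / 4) fun _ => m) (hp : p ≠ ⊤) :
    DenseRange ((testLp T p).comp (modelLin hm.toIsCylMap d)) := by
  have := dense_of_functional (LinearMap.range ((testLp T p).comp (modelLin hm.toIsCylMap d)))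
    fun ℓ hℓ => ?_
  · rwa [LinearMap.coe_range] at this
  · have h1 : ∀ φ, ℓ (testLp T p φ) = 0 :=
      functional_eq_zero hT hκ hd0 hd hm hp (Γ := ℓ.toLinearMap.comp (testLp T p)) (norm_nonneg ℓ)
        (fun φ => by
          have := ℓ.le_opNorm (testLp T p φ)
          rwa [norm_testLp] at this)
        (fun φ => hℓ _ ⟨φ, rfl⟩)
    ext1 f
    exact congrFun ((denseRange_testLp hT hp).equalizer ℓ.continuous continuous_zero
      (funext h1)) f

/-- Density of the range of a linear map is stable under relatively small perturbations. -/
lemma denseRange_of_close {V E : Type*} [AddCommGroup V] [Module ℝ V] [NormedAddCommGroup E]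
    [NormedSpace ℝ E] {A B : V →ₗ[ℝ] E} (hA : DenseRange A) {r : ℝ} (hr0 : 0 ≤ r) (hr : r < 1)
    (h : ∀ x, ‖B x - A x‖ ≤ r * ‖A x‖) : DenseRange B := by
  by_contra hB
  set S := (LinearMap.range B).topologicalClosure with hS
  have hne : ∃ x, x ∉ S := by
    by_contra hcon
    push Not at hcon
    exact hB fun x => by
      have := hcon x
      rwa [hS, ← SetLike.mem_coe, Submodule.topologicalClosure_coe, LinearMap.coe_range] at this
  obtain ⟨ρ, hρ1, hρ2⟩ := exists_between hr
  obtain ⟨x, hx, hxS⟩ := riesz_lemma (F := S) (Submodule.isClosed_topologicalClosure _) hne hρ2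
  have hx0 : 0 < ‖x‖ := norm_pos_iff.2 fun h0 => hx (h0 ▸ zero_mem _)
  set ε := (ρ - r) * ‖x‖ / 4 with hε
  have hε0 : 0 < ε := by have := sub_pos.2 hρ1; positivity
  obtain ⟨_, ⟨y, rfl⟩, hy⟩ := Metric.mem_closure_iff.1 (hA x) ε hε0
  rw [dist_eq_norm] at hy
  have h1 := hxS (B y) (Submodule.le_topologicalClosure _ ⟨y, rfl⟩)
  have h2 : ‖x - B y‖ ≤ ‖x - A y‖ + ‖B y - A y‖ := by
    rw [show x - B y = (x - A y) - (B y - A y) by abel]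
    exact norm_sub_le _ _
  have h3 : ‖A y‖ ≤ ‖x‖ + ‖x - A y‖ := by
    have := norm_sub_le x (x - A y)
    rwa [sub_sub_cancel] at this
  have h4 := h y
  have h5 : r * ‖A y‖ ≤ r * (‖x‖ + ε) := by gcongr; linarith
  have h6 : r * ε ≤ ε := mul_le_of_le_one_left hε0.le hr.le
  have h7 : (ρ - r) * ‖x‖ = 4 * ε := by rw [hε]; ring
  nlinarith

end DenseRange

section APriori
variable {T d κ M : ℝ} {p : ℝ≥0∞} [Fact (1 ≤ p)]

/-- The a priori estimate for the conjugated model operators. -/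
def APrioriBound (T κ M d : ℝ) (p : ℝ≥0∞) : Prop :=
  ∃ C : ℝ, 0 ≤ C ∧ ∀ (k : ℝ × ℝ → ℝ) (_ : IsModelCoeff T κ M (d ^ 2 / 4) k) (φ : ℝ × ℝ → E4),
    IsTestMap T φ → (eLpNorm φ p (cylMeasure T)).toReal ≤
      C * (eLpNorm (modelOp k d φ) p (cylMeasure T)).toReal

lemma eLpNorm_eq_powNorm {F : Type*} [NormedAddCommGroup F] {p : ℝ≥0∞} (hp0 : p ≠ 0) (hp : p ≠ ⊤)
    (φ : ℝ × ℝ → F) : eLpNorm φ p (cylMeasure T) = powNorm T p.toReal φ ^ (1 / p.toReal) :=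
  eLpNorm_eq_lintegral_rpow_enorm_toReal hp0 hp

lemma aPrioriBound_of_two_le (hT : 0 < T) (hκ : 0 < κ) (hd0 : d ≠ 0)
    (hd : 4 * gapConst T κ M * d ^ 2 ≤ 1) {p : ℝ≥0∞} (hp2 : 2 ≤ p) (hp : p ≠ ⊤) :
    APrioriBound T κ M d p := by
  have hpr : 2 ≤ p.toReal := by
    have := ENNReal.toReal_mono hp hp2
    simpa using this
  have hp0 : p ≠ 0 := (two_pos.trans_le hp2).ne'
  obtain ⟨C, hC, h⟩ := powNorm_le_modelOp_of_two_le hT hκ hd0 hd hpr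
  refine ⟨(C ^ (1 / p.toReal)).toReal, ENNReal.toReal_nonneg, fun k hk φ hφ => ?_⟩
  rw [← ENNReal.toReal_mul]
  refine ENNReal.toReal_mono (ENNReal.mul_ne_top (by finiteness)
    ((hφ.modelOp hk.toIsCylMap d).memLp p).2.ne) ?_
  rw [eLpNorm_eq_powNorm hp0 hp, eLpNorm_eq_powNorm hp0 hp,
    ← ENNReal.mul_rpow_of_nonneg _ _ (by positivity)]
  exact ENNReal.rpow_le_rpow (h k hk φ hφ) (by positivity)

lemma IsModelCoeff.exists_sign {δ : ℝ} {k : ℝ × ℝ → ℝ} (hκ : 0 < κ)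
    (hk : IsModelCoeff T κ M δ k) : ∃ σ : ℝ, (σ = 1 ∨ σ = -1) ∧
      ∀ s, κ ≤ σ * ∫ t in (0 : ℝ)..T, k (s, t) := by
  have hc : Continuous fun s => ∫ t in (0 : ℝ)..T, k (s, t) :=
    intervalIntegral.continuous_parametric_intervalIntegral_of_continuous'
      (by have := hk.continuous; exact this) 0 T
  have hne : ∀ s, (∫ t in (0 : ℝ)..T, k (s, t)) ≠ 0 := fun s h0 => by
    have := hk.mean s
    rw [h0, abs_zero] at this
    linarith
  by_cases hpos : ∀ s, 0 < ∫ t in (0 : ℝ)..T, k (s, t)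
  · refine ⟨1, Or.inl rfl, fun s => ?_⟩
    have := hk.mean s
    rwa [abs_of_pos (hpos s), ← one_mul (∫ t in (0 : ℝ)..T, k (s, t))] at this
  · push Not at hpos
    obtain ⟨a, ha⟩ := hpos
    refine ⟨-1, Or.inr rfl, fun s => ?_⟩
    have hneg : (∫ t in (0 : ℝ)..T, k (s, t)) ≤ 0 := by
      by_contra hcon
      obtain ⟨r, -, hr⟩ := intermediate_value_uIcc hc.continuousOn
        (show (0 : ℝ) ∈ uIcc (∫ t in (0 : ℝ)..T, k (a, t)) (∫ t in (0 : ℝ)..T, k (s, t)) from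
          ⟨(min_le_left _ _).trans ha, (not_le.1 hcon).le.trans (le_max_right _ _)⟩)
      exact hne r hr
    have := hk.mean s
    rw [abs_of_nonpos hneg] at this
    linarith

lemma IsModelCoeff.homotopy {δ : ℝ} {k : ℝ × ℝ → ℝ} (hT : 0 < T) (hκ : 0 < κ)
    (hk : IsModelCoeff T κ M δ k) : ∃ m : ℝ, |m| ≤ M ∧ ∀ τ : ℝ, 0 ≤ τ → τ ≤ 1 →
      IsModelCoeff T κ M δ fun q => (1 - τ) * m + τ * k q := by
  obtain ⟨σ, hσ, h⟩ := hk.exists_sign hκ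
  have hσ1 : |σ| = 1 := by rcases hσ with rfl | rfl <;> simp
  have hσ2 : σ * σ = 1 := by rcases hσ with rfl | rfl <;> simp
  have hM0 : 0 ≤ M := (abs_nonneg _).trans (hk.bound 0)
  have hmean : κ ≤ M * T := by
    refine (hk.mean 0).trans ?_
    have := intervalIntegral.norm_integral_le_of_norm_le_const (a := (0 : ℝ)) (b := T)
      (f := fun t => k (0, t)) (C := M) fun t _ => hk.bound _
    rwa [sub_zero, abs_of_pos hT] at this
  have hm : |σ * κ / T| ≤ M := by
    rw [abs_div, abs_mul, hσ1, one_mul, abs_of_pos hκ, abs_of_pos hT, div_le_iff₀ hT]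
    exact hmean
  refine ⟨σ * κ / T, hm, fun τ h0 h1 => ?_⟩
  have hsm : IsCylMap T fun q => τ * k q :=
    (isCylMap_const τ).smul hk.toIsCylMap
  have hcyl : IsCylMap T fun q => (1 - τ) * (σ * κ / T) + τ * k q := (isCylMap_const _).add hsm
  have hpd : ∀ e q, pd e (fun q => (1 - τ) * (σ * κ / T) + τ * k q) q = τ * pd e k q := by
    intro e q
    have h1 := congrFun (pd_add (isCylMap_const ((1 - τ) * (σ * κ / T))) hsm e) q
    have h2 := congrFun (pd_const_smul hk.toIsCylMap τ e) q
    simp only [smul_eq_mul] at h2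
    rw [h1, h2]
    simp [pd]
  refine ⟨hcyl, fun q => ?_, fun q e he => ?_, fun q => ?_, fun s => ?_⟩
  · refine (abs_add_le _ _).trans ?_
    rw [abs_mul, abs_mul, abs_of_nonneg h0, abs_of_nonneg (sub_nonneg.2 h1)]
    nlinarith [hk.bound q, sub_nonneg.2 h1]
  · rw [hpd, abs_mul, abs_of_nonneg h0]
    exact (mul_le_of_le_one_left (abs_nonneg _) h1).trans (hk.bound_pd q e he)
  · rw [hpd, abs_mul, abs_of_nonneg h0]
    exact (mul_le_of_le_one_left (abs_nonneg _) h1).trans (hk.slow q)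
  · have hci : IntervalIntegrable (fun t => τ * k (s, t)) volume 0 T :=
      (Continuous.intervalIntegrable (by have := hk.continuous; fun_prop) _ _)
    rw [intervalIntegral.integral_add intervalIntegrable_const hci,
      intervalIntegral.integral_const, intervalIntegral.integral_const_mul, smul_eq_mul, sub_zero]
    set I := ∫ t in (0 : ℝ)..T, k (s, t) with hI
    have e1 : σ * (T * ((1 - τ) * (σ * κ / T)) + τ * I) ≤
        |T * ((1 - τ) * (σ * κ / T)) + τ * I| :=
      (le_abs_self _).trans_eq (by rw [abs_mul, hσ1, one_mul])
    refine le_trans ?_ e1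
    rw [mul_add, show σ * (T * ((1 - τ) * (σ * κ / T))) = σ * σ * ((1 - τ) * κ) by field_simp,
      hσ2]
    have := mul_le_mul_of_nonneg_left (h s) h0
    linarith

lemma modelOp_sub_modelOp (k k' : ℝ × ℝ → ℝ) (φ : ℝ × ℝ → E4) (q : ℝ × ℝ) :
    modelOp k' d φ q - modelOp k d φ q = (k q - k' q) • projY (φ q) := by
  simp only [modelOp, sliceOp, sub_smul]
  abel

lemma norm_projY_le (w : E4) : ‖projY w‖ ≤ ‖w‖ := by
  refine (pow_le_pow_iff_left₀ (norm_nonneg _) (norm_nonneg _) two_ne_zero).1 ?_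
  rw [norm_sq_E4, norm_sq_E4]
  simp
  nlinarith [sq_nonneg (w 0), sq_nonneg (w 1), sq_nonneg (w 2)]

/-- The range of the model operator on test maps is dense. -/
lemma APrioriBound.denseRange (hT : 0 < T) (hκ : 0 < κ) (hd0 : d ≠ 0)
    (hd : 4 * gapConst T κ M * d ^ 2 ≤ 1) (hp : p ≠ ⊤) (hap : APrioriBound T κ M d p)
    {k : ℝ × ℝ → ℝ} (hk : IsModelCoeff T κ M (d ^ 2 / 4) k) :
    DenseRange ((testLp T p).comp (modelLin hk.toIsCylMap d)) := by
  obtain ⟨C, hC, hap⟩ := hap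
  obtain ⟨m, hm, hhom⟩ := hk.homotopy hT hκ
  have hM0 : 0 ≤ M := (abs_nonneg _).trans (hk.bound 0)
  obtain ⟨N, hN⟩ := exists_nat_gt (2 * M * C)
  have hN0 : (0 : ℝ) < N := lt_of_le_of_lt (by positivity) hN
  have key : ∀ j : ℕ, ∀ hj : j ≤ N, ∀ k' : ℝ × ℝ → ℝ, ∀ hk' : IsModelCoeff T κ M (d ^ 2 / 4) k',
      (k' = fun q => (1 - (j / N : ℝ)) * m + (j / N : ℝ) * k q) →
      DenseRange ((testLp T p).comp (modelLin hk'.toIsCylMap d)) := by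
    intro j
    induction j with
    | zero =>
      intro hj k' hk' e
      have e' : k' = fun _ => m := by rw [e]; simp
      subst e'
      exact denseRange_model_const hT hκ hd0 hd hk' hp
    | succ j ih =>
      intro hj k' hk' e
      have hjN : (j : ℝ) / N ≤ 1 := by
        rw [div_le_one hN0]; exact_mod_cast (Nat.le_succ j).trans hj
      have hA := ih ((Nat.le_succ j).trans hj) _ (hhom (j / N) (by positivity) hjN) rfl
      refine denseRange_of_close hA (r := 2 * M * C / N) (by positivity)
        (by rw [div_lt_one hN0]; exact hN) fun φ => ?_
      have h1 := hap _ (hhom (j / N) (by positivity) hjN) φ.1 φ.2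
      have h2 : ‖(testLp T p) (modelLin hk'.toIsCylMap d φ) - (testLp T p)
          (modelLin (hhom (j / N) (by positivity) hjN).toIsCylMap d φ)‖ ≤
          2 * M / N * ‖testLp T p φ‖ := by
        rw [← map_sub]
        refine Lp.norm_le_mul_norm_of_ae_le_mul ?_
        filter_upwards [MemLp.coeFn_toLp (IsTestMap.memLp (modelLin hk'.toIsCylMap d φ -
          modelLin (hhom (j / N) (by positivity) hjN).toIsCylMap d φ).2 p),
          MemLp.coeFn_toLp (IsTestMap.memLp φ.2 p)] with q a1 a2
        refine (congrArg norm a1).trans_le (le_trans ?_ (congrArg (2 * M / N * ‖·‖) a2).ge)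
        change ‖modelOp k' d φ.1 q - modelOp _ d φ.1 q‖ ≤ _
        rw [modelOp_sub_modelOp, norm_smul, Real.norm_eq_abs, e]
        refine mul_le_mul ?_ (norm_projY_le _) (norm_nonneg _) (by positivity)
        have e3 : ((1 - (j / N : ℝ)) * m + (j / N : ℝ) * k q) -
            ((1 - ((j + 1 : ℕ) / N : ℝ)) * m + ((j + 1 : ℕ) / N : ℝ) * k q) = (m - k q) / N := by
          push_cast; field_simp; ring
        simp only at e3 ⊢
        rw [e3, abs_div, abs_of_pos hN0]
        gcongr
        refine (abs_sub _ _).trans ?_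
        linarith [hk.bound q]
      refine h2.trans ?_
      rw [norm_testLp]
      change _ ≤ 2 * M * C / N * ‖testLp T p (modelLin _ d φ)‖
      rw [norm_testLp]
      calc _ ≤ 2 * M / N * _ := mul_le_mul_of_nonneg_left h1 (by positivity)
        _ = _ := by simp only [modelLin, LinearMap.coe_mk, AddHom.coe_mk]; ring
  refine key N le_rfl k hk ?_
  ext q
  rw [div_self hN0.ne']
  ring

end APriori

/-! ### Duality -/

section Duality
variable {T d κ M : ℝ}

/-- The reflection `(s, t) ↦ (-s, t)` of the cylinder. -/
def reflect (q : ℝ × ℝ) : ℝ × ℝ := (-q.1, q.2)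

lemma reflect_reflect (q : ℝ × ℝ) : reflect (reflect q) = q := by simp [reflect]

lemma contDiff_reflect : ContDiff ℝ ∞ reflect := by unfold reflect; fun_prop

lemma measurePreserving_reflect (T : ℝ) :
    MeasurePreserving reflect (cylMeasure T) (cylMeasure T) := by
  rw [cylMeasure_eq_prod]
  exact (Measure.measurePreserving_neg volume).prod (MeasurePreserving.id _)

section
variable {F : Type*} [NormedAddCommGroup F] [NormedSpace ℝ F]

lemma IsCylMap.reflect {φ : ℝ × ℝ → F} (h : IsCylMap T φ) : IsCylMap T fun q => φ (reflect q) :=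
  ⟨h.smooth.comp contDiff_reflect, fun _ _ => h.periodic _ _⟩

lemma IsTestMap.reflect {φ : ℝ × ℝ → F} (h : IsTestMap T φ) : IsTestMap T fun q => φ (reflect q) :=
  ⟨h.toIsCylMap.reflect, h.supp.imp fun K hK s t hs => hK _ _ (by rwa [abs_neg])⟩

lemma pd_reflect {φ : ℝ × ℝ → F} (h : IsCylMap T φ) (v q : ℝ × ℝ) :
    pd v (fun q => φ (reflect q)) q = pd (reflect v) φ (reflect q) := by
  have hl : HasFDerivAt MorseBottTorus.reflect
      ((-ContinuousLinearMap.fst ℝ ℝ ℝ).prod (ContinuousLinearMap.snd ℝ ℝ ℝ)) q :=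
    (hasFDerivAt_fst.neg).prodMk hasFDerivAt_snd
  have := (h.differentiableAt (q := MorseBottTorus.reflect q)).hasFDerivAt.comp q hl
  exact congrArg (fun L : ℝ × ℝ →L[ℝ] F => L v) this.fderiv

omit [NormedSpace ℝ F] in
lemma eLpNorm_reflect {φ : ℝ × ℝ → F} {p : ℝ≥0∞} (h : AEStronglyMeasurable φ (cylMeasure T)) :
    eLpNorm (fun q => φ (reflect q)) p (cylMeasure T) = eLpNorm φ p (cylMeasure T) :=
  eLpNorm_comp_measurePreserving h (measurePreserving_reflect T)

end

lemma IsModelCoeff.reflect {δ : ℝ} {k : ℝ × ℝ → ℝ} (hk : IsModelCoeff T κ M δ k) :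
    IsModelCoeff T κ M δ fun q => k (reflect q) := by
  refine ⟨hk.toIsCylMap.reflect, fun q => hk.bound _, fun q e he => ?_, fun q => ?_,
    fun s => hk.mean (-s)⟩
  · rw [pd_reflect hk.toIsCylMap]
    rcases he with rfl | rfl
    · rw [show MorseBottTorus.reflect (1, 0) = -(1, 0) by simp [MorseBottTorus.reflect], pd, map_neg,
        abs_neg]
      exact hk.bound_pd _ _ (Or.inl rfl)
    · rw [show MorseBottTorus.reflect (0, 1) = (0, 1) by simp [MorseBottTorus.reflect]]
      exact hk.bound_pd _ _ (Or.inr rfl)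
  · rw [pd_reflect hk.toIsCylMap]
    rw [show MorseBottTorus.reflect (1, 0) = -(1, 0) by simp [MorseBottTorus.reflect], pd, map_neg,
        abs_neg]
    exact hk.slow _

/-- Integration by parts for the model operator. -/
lemma integral_modelOp_reflect (hT : 0 ≤ T) {k : ℝ × ℝ → ℝ} (hk : IsCylMap T k) {φ ψ : ℝ × ℝ → E4}
    (hφ : IsTestMap T φ) (hψ : IsTestMap T ψ) :
    ∫ q, inner ℝ (modelOp k d φ q) (ψ (reflect q)) ∂cylMeasure T =
      ∫ q, inner ℝ (φ q) (modelOp (fun q => k (reflect q)) d ψ (reflect q)) ∂cylMeasure T := by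
  have hinner : ∀ {φ χ : ℝ × ℝ → E4}, IsTestMap T φ → IsTestMap T χ →
      IsTestMap T fun q => inner ℝ (φ q) (χ q) := fun hφ hχ =>
    hφ.of_zero ⟨hφ.smooth.inner ℝ hχ.smooth, fun s t => by simp only [hφ.periodic, hχ.periodic]⟩
      fun q hq => by rw [hq, inner_zero_left]
  have hχ := hψ.reflect
  set χ : ℝ × ℝ → E4 := fun q => ψ (reflect q) with hχd
  have hJ : IsTestMap T fun q => stdJ (χ q) := hχ.comp stdJ.contDiff (map_zero _)
  have z1 := integral_pd hT (hinner hφ hχ) (1, 0)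
  have z2 := integral_pd hT (hinner hφ hJ) (0, 1)
  have i1 := ((hinner hφ hχ).pd (1, 0)).integrable
  have i2 := ((hinner hφ hJ).pd (0, 1)).integrable
  have i3 := (hinner hφ (hψ.modelOp hk.reflect d).reflect).integrable
  have key : ∀ q, inner ℝ (modelOp k d φ q) (χ q) =
      inner ℝ (φ q) (modelOp (fun q => k (reflect q)) d ψ (reflect q)) +
      (pd (1, 0) (fun q => inner ℝ (φ q) (χ q)) q -
        pd (0, 1) (fun q => inner ℝ (φ q) (stdJ (χ q))) q) := by
    intro q
    rw [pd_inner hφ.toIsCylMap hχ.toIsCylMap, pd_inner hφ.toIsCylMap hJ.toIsCylMap,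
      pd_clm hχ.toIsCylMap]
    simp only
    rw [hχd, pd_reflect hψ.toIsCylMap, pd_reflect hψ.toIsCylMap,
      show reflect (1, 0) = -(1, 0) by simp [reflect], show reflect (0, 1) = (0, 1) by simp [reflect]]
    have : pd (-(1, 0)) ψ (reflect q) = -pd (1, 0) ψ (reflect q) := by rw [pd, map_neg]; rfl
    rw [this]
    simp only [modelOp, inner_E4, sliceOp, PiLp.add_apply, PiLp.sub_apply, PiLp.smul_apply,
      PiLp.neg_apply, smul_eq_mul, stdJ_zero, stdJ_one, stdJ_two, stdJ_three, projY_zero, projY_one,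
      projY_two, projY_three, reflect_reflect]
    ring
  have i4 : Integrable (fun q => pd (1, 0) (fun q => inner ℝ (φ q) (χ q)) q -
      pd (0, 1) (fun q => inner ℝ (φ q) (stdJ (χ q))) q) (cylMeasure T) := i1.sub i2
  rw [integral_congr_ae (Filter.Eventually.of_forall key), integral_add i3 i4, integral_sub i1 i2, z1, z2,
    sub_zero, add_zero]

lemma exists_approx_reflect (hT : 0 < T) (hκ : 0 < κ) (hd0 : d ≠ 0)
    (hd : 4 * gapConst T κ M * d ^ 2 ≤ 1) {q : ℝ≥0∞} (hq1 : 1 ≤ q) (hq : q ≠ ⊤)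
    (hap : APrioriBound T κ M d q)
    {k : ℝ × ℝ → ℝ} (hk : IsModelCoeff T κ M (d ^ 2 / 4) k) {g : ℝ × ℝ → E4}
    (hg : MemLp g q (cylMeasure T)) {ε : ℝ} (hε : 0 < ε) : ∃ ψ : ℝ × ℝ → E4, IsTestMap T ψ ∧
      (eLpNorm (fun x => g x - modelOp (fun q => k (reflect q)) d ψ (reflect x)) q
        (cylMeasure T)).toReal < ε := by
  have : Fact (1 ≤ q) := ⟨hq1⟩
  have hg' : MemLp (fun x => g (reflect x)) q (cylMeasure T) :=
    hg.comp_measurePreserving (measurePreserving_reflect T)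
  obtain ⟨_, ⟨ψ, rfl⟩, hψ⟩ := Metric.mem_closure_iff.1
    (hap.denseRange hT hκ hd0 hd hq hk.reflect hg'.toLp) ε hε
  refine ⟨ψ.1, ψ.2, ?_⟩
  rw [dist_eq_norm, Lp.norm_def] at hψ
  have hm := (IsTestMap.modelOp hk.reflect.toIsCylMap ψ.2 d)
  have e : eLpNorm (fun x => g x - modelOp (fun q => k (reflect q)) d ψ.1 (reflect x)) q
      (cylMeasure T) = eLpNorm (fun x => g (reflect x) - modelOp (fun q => k (reflect q)) d ψ.1 x) q
      (cylMeasure T) := by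
    rw [← eLpNorm_reflect (φ := fun x => g x - modelOp (fun q => k (reflect q)) d ψ.1 (reflect x))
      (hg.1.sub hm.reflect.continuous.aestronglyMeasurable)]
    simp only [reflect_reflect]
  rw [e]
  refine lt_of_eq_of_lt (congrArg ENNReal.toReal (eLpNorm_congr_ae ?_)) hψ
  filter_upwards [Lp.coeFn_sub hg'.toLp (testLp T q (modelLin hk.reflect.toIsCylMap d ψ)),
    hg'.coeFn_toLp, (hm.memLp q).coeFn_toLp] with x h1 h2 h3
  refine Eq.trans ?_ h1.symm
  rw [Pi.sub_apply, h2]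
  exact congrArg _ h3.symm

/-- The duality map of the Lebesgue space. -/
def powerMap (p : ℝ) (φ : ℝ × ℝ → E4) (x : ℝ × ℝ) : E4 := ‖φ x‖ ^ (p - 2) • φ x

lemma norm_powerMap {p : ℝ} (hp : 1 < p) (φ : ℝ × ℝ → E4) (x : ℝ × ℝ) :
    ‖powerMap p φ x‖ = ‖φ x‖ ^ (p - 1) := by
  rw [powerMap, norm_smul, Real.norm_eq_abs, abs_of_nonneg (by positivity)]
  rcases (norm_nonneg (φ x)).eq_or_lt with h | h
  · rw [← h, mul_zero, Real.zero_rpow (by linarith)]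
  · rw [← Real.rpow_add_one h.ne']
    congr 1
    ring

lemma inner_powerMap {p : ℝ} (hp : 1 < p) (φ : ℝ × ℝ → E4) (x : ℝ × ℝ) :
    inner ℝ (φ x) (powerMap p φ x) = ‖φ x‖ ^ p := by
  rw [powerMap, inner_smul_right, real_inner_self_eq_norm_sq]
  rcases (norm_nonneg (φ x)).eq_or_lt with h | h
  · rw [← h, zero_pow two_ne_zero, mul_zero, Real.zero_rpow (by linarith)]
  · rw [← Real.rpow_natCast, ← Real.rpow_add h]
    congr 1
    push_cast
    ring

lemma aPrioriBound_of_conj (hT : 0 < T) (hκ : 0 < κ) (hd0 : d ≠ 0)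
    (hd : 4 * gapConst T κ M * d ^ 2 ≤ 1) {p q : ℝ≥0∞} [hpq : ENNReal.HolderConjugate p q]
    (hp1 : 1 < p) (hp : p ≠ ⊤) (hq1 : 1 ≤ q) (hq : q ≠ ⊤) (hap : APrioriBound T κ M d q) :
    APrioriBound T κ M d p := by
  obtain ⟨C, hC, h⟩ := id hap
  refine ⟨C, hC, fun k hk φ hφ => ?_⟩
  have hpr : 1 < p.toReal := by
    have := (ENNReal.toReal_lt_toReal ENNReal.one_ne_top hp).2 hp1
    simpa using this
  have hp0 : p ≠ 0 := (zero_lt_one.trans hp1).ne'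
  have hq0 : q ≠ 0 := (zero_lt_one.trans_le hq1).ne'
  have hconj : p.toReal.HolderConjugate q.toReal :=
    ENNReal.HolderConjugate.toReal_of_ne_top hp hq
  set N := (eLpNorm φ p (cylMeasure T)).toReal with hN
  set A := (eLpNorm (modelOp k d φ) p (cylMeasure T)).toReal with hA
  have hNn : 0 ≤ N := ENNReal.toReal_nonneg
  rcases hNn.eq_or_lt with hN0 | hN0
  · rw [← hN0]; positivity
  set g := powerMap p.toReal φ with hg
  have hpow : (∫ x, ‖φ x‖ ^ p.toReal ∂cylMeasure T) = N ^ p.toReal := by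
    have h1 := powNorm_eq_ofReal (by linarith : 0 < p.toReal) hφ
    have h2 := eLpNorm_eq_powNorm (T := T) hp0 hp φ
    have h3 : N ^ p.toReal = (powNorm T p.toReal φ).toReal := by
      rw [hN, h2, ENNReal.toReal_rpow, ← ENNReal.rpow_mul,
        one_div_mul_cancel (by linarith), ENNReal.rpow_one]
    rw [h3, h1, ENNReal.toReal_ofReal (integral_nonneg fun x => by positivity)]
  have hgn : eLpNorm g q (cylMeasure T) = powNorm T p.toReal φ ^ (1 / q.toReal) := by
    rw [eLpNorm_eq_powNorm hq0 hq, powNorm, powNorm]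
    congr 1
    refine lintegral_congr fun x => ?_
    rw [← ofReal_norm, ← ofReal_norm, norm_powerMap hpr,
      ENNReal.ofReal_rpow_of_nonneg (by positivity) hconj.symm.nonneg,
      ENNReal.ofReal_rpow_of_nonneg (by positivity) hconj.nonneg, ← Real.rpow_mul (norm_nonneg _),
      hconj.sub_one_mul_conj]
  have hgm : MemLp g q (cylMeasure T) := by
    refine ⟨?_, ?_⟩
    · have hc := hφ.continuous
      have hm : Measurable fun x => ‖φ x‖ ^ (p.toReal - 2) :=
        (hc.norm.measurable).pow_const _
      exact (hm.smul hc.measurable).aestronglyMeasurable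
    · rw [hgn]
      exact ENNReal.rpow_lt_top_of_nonneg (by positivity) (powNorm_lt_top (by linarith) hφ).ne
  have hgN : (eLpNorm g q (cylMeasure T)).toReal = N ^ (p.toReal - 1) := by
    have h2 := eLpNorm_eq_powNorm (T := T) hp0 hp φ
    rw [hgn, hN, h2, ENNReal.toReal_rpow, ← ENNReal.rpow_mul]
    congr 2
    have := hconj.inv_add_inv_eq_one
    have hp' : p.toReal ≠ 0 := by linarith
    rw [one_div, eq_sub_of_add_eq' this]
    field_simp
  have hmain : N ^ p.toReal ≤ A * (C * N ^ (p.toReal - 1)) := by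
    refine le_of_forall_pos_le_add fun ε hε => ?_
    set ε' := ε / (N + A * C + 1) with hε'
    have hA0 : 0 ≤ A := ENNReal.toReal_nonneg
    have hε'0 : 0 < ε' := by positivity
    obtain ⟨ψ, hψ, hψε⟩ := exists_approx_reflect hT hκ hd0 hd hq1 hq hap hk hgm hε'0
    have hm := (hψ.modelOp hk.reflect.toIsCylMap d)
    have hPψ := h _ hk.reflect ψ hψ
    have hdiff : MemLp (fun x => g x - modelOp (fun q => k (reflect q)) d ψ (reflect x)) q
        (cylMeasure T) := hgm.sub (hm.reflect.memLp q)
    have b1 := abs_integral_inner_le (p := q) (q := p) (hφ.memLp p) hdiff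
    have b2 := abs_integral_inner_le (p := q) (q := p) ((hφ.modelOp hk.toIsCylMap d).memLp p)
      (hψ.reflect.memLp q)
    have b3 := abs_integral_inner_le (p := q) (q := p) (hφ.memLp p) (hm.reflect.memLp q)
    rw [integral_modelOp_reflect hT.le hk.toIsCylMap hφ hψ,
      eLpNorm_reflect hψ.continuous.aestronglyMeasurable] at b2
    have b4 : (eLpNorm (modelOp (fun q => k (reflect q)) d ψ) q (cylMeasure T)).toReal ≤
        N ^ (p.toReal - 1) + ε' := by
      rw [← eLpNorm_reflect hm.continuous.aestronglyMeasurable, ← hgN]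
      refine le_trans ?_ (add_le_add_right hψε.le _)
      rw [← ENNReal.toReal_add hgm.2.ne hdiff.2.ne]
      refine ENNReal.toReal_mono (ENNReal.add_ne_top.2 ⟨hgm.2.ne, hdiff.2.ne⟩) ?_
      refine le_trans (le_of_eq ?_) (eLpNorm_sub_le hgm.1 hdiff.1 hq1)
      congr 1
      ext1 x
      simp
    have e1 : N ^ p.toReal = (∫ x, inner ℝ (φ x)
        (g x - modelOp (fun q => k (reflect q)) d ψ (reflect x)) ∂cylMeasure T) +
        ∫ x, inner ℝ (φ x) (modelOp (fun q => k (reflect q)) d ψ (reflect x)) ∂cylMeasure T := by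
      rw [← integral_add b1.1 b3.1, ← hpow]
      refine integral_congr_ae (Filter.Eventually.of_forall fun x => ?_)
      simp only
      rw [← inner_add_right, sub_add_cancel, hg, inner_powerMap hpr]
    have c1 := (le_abs_self _).trans b1.2
    have c2 := (le_abs_self _).trans b2.2
    have c3 : N * (eLpNorm (fun x => g x - modelOp (fun q => k (reflect q)) d ψ (reflect x)) q
        (cylMeasure T)).toReal ≤ N * ε' := mul_le_mul_of_nonneg_left hψε.le hN0.le
    have c4 : A * (eLpNorm ψ q (cylMeasure T)).toReal ≤ A * (C * (N ^ (p.toReal - 1) + ε')) :=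
      mul_le_mul_of_nonneg_left (hPψ.trans (mul_le_mul_of_nonneg_left b4 hC)) hA0
    have c5 : ε' * (N + A * C) ≤ ε := by
      rw [hε', div_mul_eq_mul_div, div_le_iff₀ (by positivity)]
      nlinarith
    rw [e1]
    linarith
  have hNp : N ^ p.toReal = N * N ^ (p.toReal - 1) := by
    rw [Real.rpow_sub_one hN0.ne']; field_simp
  rw [hNp] at hmain
  have hpos : 0 < N ^ (p.toReal - 1) := by positivity
  refine le_of_mul_le_mul_right ?_ hpos
  linarith

/-- The a priori estimate holds for all exponents. -/
lemma aPrioriBound (hT : 0 < T) (hκ : 0 < κ) (hd0 : d ≠ 0)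
    (hd : 4 * gapConst T κ M * d ^ 2 ≤ 1) {p : ℝ≥0∞} (hp1 : 1 < p) (hp : p ≠ ⊤) :
    APrioriBound T κ M d p := by
  by_cases h2 : 2 ≤ p
  · exact aPrioriBound_of_two_le hT hκ hd0 hd h2 hp
  · have hpr : 1 < p.toReal := by
      have := (ENNReal.toReal_lt_toReal ENNReal.one_ne_top hp).2 hp1
      simpa using this
    have hpr2 : p.toReal < 2 := by
      have := (ENNReal.toReal_lt_toReal hp ENNReal.ofNat_ne_top).2 (not_le.1 h2)
      simpa using this
    have hconj := Real.HolderConjugate.conjExponent hpr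
    have hq2 : 2 ≤ p.toReal.conjExponent := by
      rw [Real.conjExponent, le_div_iff₀ (by linarith)]; linarith
    have hE := ENNReal.HolderConjugate.of_toReal (p := p) (q := ENNReal.ofReal p.toReal.conjExponent)
      (by rwa [ENNReal.toReal_ofReal (by linarith)])
    have hq2' : 2 ≤ ENNReal.ofReal p.toReal.conjExponent := by
      rw [← ENNReal.ofReal_ofNat]; exact ENNReal.ofReal_le_ofReal hq2
    exact aPrioriBound_of_conj hT hκ hd0 hd hp1 hp (le_trans (by norm_num) hq2')
      ENNReal.ofReal_ne_top (aPrioriBound_of_two_le hT hκ hd0 hd hq2' ENNReal.ofReal_ne_top)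

/-- A weak solution of the adjoint model equation vanishes. -/
lemma ae_eq_zero_of_weak (hT : 0 < T) (hκ : 0 < κ) (hd0 : d ≠ 0)
    (hd : 4 * gapConst T κ M * d ^ 2 ≤ 1) {p : ℝ≥0∞} (hp1 : 1 < p) (hp : p ≠ ⊤)
    {k : ℝ × ℝ → ℝ} (hk : IsModelCoeff T κ M (d ^ 2 / 4) k) {u : ℝ × ℝ → E4}
    (hu : MemLp u p (cylMeasure T))
    (h : ∀ ψ, IsTestMap T ψ → ∫ x, inner ℝ
      (modelOp (fun q => k (reflect q)) d ψ (reflect x)) (u x) ∂cylMeasure T = 0) :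
    ∀ᵐ x ∂cylMeasure T, u x = 0 := by
  have hpr : 1 < p.toReal := by
    have := (ENNReal.toReal_lt_toReal ENNReal.one_ne_top hp).2 hp1
    simpa using this
  have hconj := Real.HolderConjugate.conjExponent hpr
  set q := ENNReal.ofReal p.toReal.conjExponent with hq
  have hE : ENNReal.HolderConjugate p q := ENNReal.HolderConjugate.of_toReal
    (by rwa [hq, ENNReal.toReal_ofReal hconj.symm.nonneg])
  have hq1 : 1 < q := by
    rw [hq, ← ENNReal.ofReal_one]
    exact (ENNReal.ofReal_lt_ofReal_iff (by linarith [hconj.symm.lt])).2 hconj.symm.lt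
  have hap := aPrioriBound hT hκ hd0 hd hq1 ENNReal.ofReal_ne_top
  have hpair : ∀ φ, IsTestMap T φ → ∫ x, inner ℝ (φ x) (u x) ∂cylMeasure T = 0 := by
    intro φ hφ
    set U := (eLpNorm u p (cylMeasure T)).toReal with hU
    have hU0 : 0 ≤ U := ENNReal.toReal_nonneg
    rw [← abs_nonpos_iff]
    refine le_of_forall_pos_le_add fun ε hε => ?_
    obtain ⟨ψ, hψ, hψε⟩ := exists_approx_reflect hT hκ hd0 hd hq1.le ENNReal.ofReal_ne_top hap hk
      (hφ.memLp q) (ε := ε / (U + 1)) (by positivity)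
    have hm := (hψ.modelOp hk.reflect.toIsCylMap d).reflect.memLp q
    have b1 := abs_integral_inner_le (p := p) (q := q) ((hφ.memLp q).sub hm) hu
    have b2 := abs_integral_inner_le (p := p) (q := q) hm hu
    have e : ∫ x, inner ℝ (φ x) (u x) ∂cylMeasure T = ∫ x, inner ℝ ((φ -
        fun x => modelOp (fun q => k (reflect q)) d ψ (reflect x)) x) (u x) ∂cylMeasure T := by
      rw [← add_zero (∫ x, inner ℝ ((φ - _) x) (u x) ∂cylMeasure T), ← h ψ hψ,
        ← integral_add b1.1 b2.1]
      refine integral_congr_ae (Filter.Eventually.of_forall fun x => ?_)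
      simp only
      rw [← inner_add_left, Pi.sub_apply, sub_add_cancel]
    rw [e]
    refine b1.2.trans ?_
    rw [zero_add]
    calc _ ≤ ε / (U + 1) * U := mul_le_mul_of_nonneg_right hψε.le hU0
      _ ≤ ε := by
        rw [div_mul_eq_mul_div, div_le_iff₀ (by positivity)]
        nlinarith
  refine ae_eq_zero_of_testFunctions hT (hu.locallyIntegrable hp1.le) fun ψ hψ => ?_
  have hi : Integrable (fun x => ψ x • u x) (cylMeasure T) := by
    have hψq := hψ.isTestMap.memLp q
    have : ENNReal.HolderTriple q p 1 := ENNReal.HolderTriple.symm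
    exact memLp_one_iff_integrable.1 (hu.smul hψq)
  refine ext_inner_left ℝ fun w => ?_
  rw [inner_zero_right, ← integral_inner hi, ← hpair _ (hψ.isTestMap.smul_const w)]
  refine integral_congr_ae (Filter.Eventually.of_forall fun x => ?_)
  simp only [inner_smul_left, inner_smul_right, RCLike.conj_to_real]

end Duality

/-! ### Structure of the weighted Sobolev spaces -/

section Weighted
variable {T : ℝ} {p : ℝ≥0∞} [Fact (1 ≤ p)] {d : ℝ} {k : ℕ}

lemma memLp_weighted_iff (hp : p ≠ ⊤) {u : ℝ × ℝ → E4}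
    (hu : AEStronglyMeasurable u (cylMeasure T)) :
    MemLp u p (weightedMeasure T p d) ↔
      MemLp (fun q => Real.exp (d * q.1) • u q) p (cylMeasure T) := by
  have hp0 : p ≠ 0 := (zero_lt_one.trans_le (Fact.out : 1 ≤ p)).ne'
  have hc : Continuous fun q : ℝ × ℝ => Real.exp (d * q.1) := by fun_prop
  constructor
  · intro h
    refine ⟨hc.aestronglyMeasurable.smul hu, ?_⟩
    rw [← eLpNorm_weighted T hp0 hp]
    exact h.2
  · intro h
    refine ⟨hu.mono_ac (weightedMeasure_absolutelyContinuous T p d), ?_⟩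
    rw [eLpNorm_weighted T hp0 hp]
    exact h.2

omit [Fact (1 ≤ p)] in
lemma aestronglyMeasurable_cyl (u : WeightedLp T p d) : AEStronglyMeasurable u (cylMeasure T) := by
  refine (Lp.aestronglyMeasurable u).mono_ac fun s hs => ?_
  have := ae_weighted_of (T := T) (p := p) (d := d) (P := fun q => q ∉ s)
    (by rw [ae_iff]; simpa using hs)
  rw [ae_iff] at this
  simpa using this

lemma memLp_exp_smul (hp : p ≠ ⊤) (u : WeightedLp T p d) :
    MemLp (fun q => Real.exp (d * q.1) • u q) p (cylMeasure T) :=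
  (memLp_weighted_iff hp (aestronglyMeasurable_cyl u)).1 (Lp.memLp u)

lemma norm_weightedLp (hp : p ≠ ⊤) (u : WeightedLp T p d) :
    ‖u‖ = (eLpNorm (fun q => Real.exp (d * q.1) • u q) p (cylMeasure T)).toReal := by
  rw [Lp.norm_def, eLpNorm_weighted T (zero_lt_one.trans_le (Fact.out : 1 ≤ p)).ne' hp]

/-- Multiplication of a test map by an exponential. -/
lemma IsTestMap.exp_smul {F : Type*} [NormedAddCommGroup F] [NormedSpace ℝ F] {φ : ℝ × ℝ → F}
    (h : IsTestMap T φ) (r : ℝ) : IsTestMap T fun q => Real.exp (r * q.1) • φ q :=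
  IsTestMap.smul (isCylMap_fst (w := fun s => Real.exp (r * s)) (by fun_prop)) h

lemma exists_norm_integral_le (hp : p ≠ ⊤) {ψ : ℝ × ℝ → ℝ} (hψ : IsTestMap T ψ) :
    ∃ C : ℝ, ∀ u : WeightedLp T p d, ‖∫ q, ψ q • u q ∂cylMeasure T‖ ≤ C * ‖u‖ := by
  set q := ENNReal.conjExponent p
  have hψ' := (hψ.exp_smul (-d)).memLp q
  have : ENNReal.HolderTriple q p 1 := ENNReal.HolderTriple.symm
  refine ⟨(eLpNorm (fun x => Real.exp (-d * x.1) • ψ x) q (cylMeasure T)).toReal, fun u => ?_⟩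
  have hu := memLp_exp_smul hp u
  rw [norm_weightedLp hp, ← ENNReal.toReal_mul]
  refine (norm_integral_le_lintegral_norm _).trans
    (ENNReal.toReal_mono (ENNReal.mul_ne_top hψ'.2.ne hu.2.ne) ?_)
  have := eLpNorm_smul_le_mul_eLpNorm (p := q) (q := p) (r := 1) hu.1 hψ'.1
  rw [eLpNorm_one_eq_lintegral_enorm] at this
  refine le_trans (le_of_eq (lintegral_congr fun x => ?_)) this
  rw [ofReal_norm]
  congr 1
  simp only [Pi.smul_apply', smul_smul, smul_eq_mul]
  rw [mul_right_comm, ← Real.exp_add]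
  simp

lemma continuous_integral_test (hp : p ≠ ⊤) {ψ : ℝ × ℝ → ℝ} (hψ : IsTestMap T ψ) :
    Continuous fun u : WeightedLp T p d => ∫ q, ψ q • u q ∂cylMeasure T := by
  obtain ⟨C, hC⟩ := exists_norm_integral_le (d := d) hp hψ
  let L : WeightedLp T p d →ₗ[ℝ] E4 :=
    { toFun := fun u => ∫ q, ψ q • u q ∂cylMeasure T
      map_add' := fun u v => by
        rw [← integral_add (integrable_test T p d hψ.isTestFunction u)
          (integrable_test T p d hψ.isTestFunction v)]
        refine integral_congr_ae ?_
        filter_upwards [ae_weighted_of (Lp.coeFn_add u v)] with q hq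
        rw [hq, Pi.add_apply, smul_add]
      map_smul' := fun c u => by
        rw [RingHom.id_apply, ← integral_smul]
        refine integral_congr_ae ?_
        filter_upwards [ae_weighted_of (Lp.coeFn_smul c u)] with q hq
        rw [hq, Pi.smul_apply, smul_comm] }
  exact (L.mkContinuous C hC).continuous

lemma weightedLp_eq_zero (hT : 0 < T) (hp : p ≠ ⊤) {u : WeightedLp T p d}
    (h : ∀ ψ, IsTestFunction T ψ → ∫ q, ψ q • u q ∂cylMeasure T = 0) : u = 0 := by
  have := ae_eq_zero_of_testFunctions hT ((memLp_exp_smul hp u).locallyIntegrable Fact.out)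
    fun ψ hψ => ?_
  · apply Lp.ext
    filter_upwards [(weightedMeasure_absolutelyContinuous T p d).ae_le this,
      Lp.coeFn_zero E4 p (weightedMeasure T p d)] with q h1 h2
    rw [h2]
    exact (smul_eq_zero.1 h1).resolve_left (Real.exp_pos _).ne'
  · rw [← h _ (hψ.isTestMap.exp_smul d).isTestFunction]
    refine integral_congr_ae (Filter.Eventually.of_forall fun q => ?_)
    simp only [smul_smul, smul_eq_mul, mul_comm]

lemma IsWeakDeriv.unique (hT : 0 < T) (hp : p ≠ ⊤) {e : ℝ × ℝ} {u w w' : WeightedLp T p d}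
    (h : IsWeakDeriv T e u w) (h' : IsWeakDeriv T e u w') : w = w' := by
  rw [← sub_eq_zero]
  refine weightedLp_eq_zero hT hp fun ψ hψ => ?_
  have h1 : ∫ q, ψ q • (w - w' : WeightedLp T p d) q ∂cylMeasure T =
      ∫ q, (ψ q • w q - ψ q • w' q) ∂cylMeasure T := by
    refine integral_congr_ae ?_
    filter_upwards [ae_weighted_of (Lp.coeFn_sub w w')] with q hq
    rw [hq, Pi.sub_apply, smul_sub]
  rw [h1, integral_sub (integrable_test T p d hψ w) (integrable_test T p d hψ w')]
  have a := h ψ hψ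
  have b := h' ψ hψ
  rw [a] at b
  rw [neg_inj.1 b, sub_self]

lemma isClosed_isWeakDeriv (hp : p ≠ ⊤) (e : ℝ × ℝ) :
    IsClosed {x : WeightedLp T p d × WeightedLp T p d | IsWeakDeriv T e x.1 x.2} := by
  have : {x : WeightedLp T p d × WeightedLp T p d | IsWeakDeriv T e x.1 x.2} =
      ⋂ (ψ : ℝ × ℝ → ℝ) (_ : IsTestFunction T ψ), {x | ∫ q, pd e ψ q • x.1 q ∂cylMeasure T =
        -∫ q, ψ q • x.2 q ∂cylMeasure T} := by
    ext x
    simp only [IsWeakDeriv, pd, mem_iInter, mem_ofPred_eq]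
  rw [this]
  refine isClosed_iInter fun ψ => isClosed_iInter fun hψ => isClosed_eq ?_ ?_
  · exact (continuous_integral_test hp (hψ.isTestMap.pd e)).comp continuous_fst
  · exact ((continuous_integral_test hp hψ.isTestMap).comp continuous_snd).neg

lemma completeSpace_sobolev (hp : p ≠ ⊤) : CompleteSpace (weightedSobolev T k p d) := by
  refine IsClosed.completeSpace_coe (hs := ?_)
  have hc : ∀ α : MultiIdx k, Continuous fun η : PiLp p fun _ : MultiIdx k => WeightedLp T p d =>
      η α := fun α => (PiLp.proj (𝕜 := ℝ) p (fun _ : MultiIdx k => WeightedLp T p d) α).continuous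
  have h1 : ∀ e (α β : MultiIdx k), IsClosed {η : PiLp p fun _ : MultiIdx k => WeightedLp T p d |
      IsWeakDeriv T e (η α) (η β)} := fun e α β =>
    (isClosed_isWeakDeriv hp e).preimage ((hc α).prodMk (hc β))
  have : (weightedSobolev T k p d : Set (PiLp p fun _ : MultiIdx k => WeightedLp T p d)) =
      ⋂ (α : MultiIdx k) (β : MultiIdx k),
        (⋂ (_ : (β.1.1 : ℕ) = α.1.1 + 1) (_ : (β.1.2 : ℕ) = α.1.2),
          {η | IsWeakDeriv T (1, 0) (η α) (η β)}) ∩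
        (⋂ (_ : (β.1.1 : ℕ) = α.1.1) (_ : (β.1.2 : ℕ) = α.1.2 + 1),
          {η | IsWeakDeriv T (0, 1) (η α) (η β)}) := by
    ext η
    simp only [mem_iInter, mem_inter_iff, mem_ofPred_eq]
    rfl
  rw [this]
  exact isClosed_iInter fun α => isClosed_iInter fun β =>
    (isClosed_iInter fun _ => isClosed_iInter fun _ => h1 _ _ _).inter
      (isClosed_iInter fun _ => isClosed_iInter fun _ => h1 _ _ _)

/-- A Sobolev section is determined by its underlying function. -/
lemma sobolev_ext_fst (hT : 0 < T) (hp : p ≠ ⊤) {η η' : weightedSobolev T k p d}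
    (h : sobolevComp (mkIdx 0 0 (by omega)) η = sobolevComp (mkIdx 0 0 (by omega)) η') :
    η = η' := by
  have key : ∀ n : ℕ, ∀ α : MultiIdx k, (α.1.1 : ℕ) + α.1.2 = n →
      sobolevComp α η = sobolevComp α η' := by
    intro n
    induction n with
    | zero =>
      intro α hα
      have : α = mkIdx 0 0 (by omega) := by ext <;> simp only <;> omega
      rw [this]
      exact h
    | succ n ih =>
      intro α hα
      have hα2 := α.2
      by_cases h1 : (α.1.1 : ℕ) = 0
      · set β : MultiIdx k := mkIdx 0 (α.1.2 - 1) (by omega) with hβ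
        have e1 := isWeakDeriv_snd η β α (by simp [hβ, h1]) (by simp only [hβ]; omega)
        have e2 := isWeakDeriv_snd η' β α (by simp [hβ, h1]) (by simp only [hβ]; omega)
        rw [ih β (by simp only [hβ]; omega)] at e1
        exact e1.unique hT hp e2
      · set β : MultiIdx k := mkIdx (α.1.1 - 1) α.1.2 (by omega) with hβ
        have e1 := isWeakDeriv_fst η β α (by simp only [hβ]; omega) (by simp [hβ])
        have e2 := isWeakDeriv_fst η' β α (by simp only [hβ]; omega) (by simp [hβ])
        rw [ih β (by simp only [hβ]; omega)] at e1
        exact e1.unique hT hp e2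
  exact sobolev_ext fun α => key _ α rfl

/-- Mixed weak derivatives commute. -/
lemma IsWeakDeriv.comm (hT : 0 < T) (hp : p ≠ ⊤) {e e' : ℝ × ℝ} {u v v' w w' : WeightedLp T p d}
    (h : IsWeakDeriv T e u v) (h' : IsWeakDeriv T e' u v') (hw : IsWeakDeriv T e' v w)
    (hw' : IsWeakDeriv T e v' w') : w = w' := by
  have key : IsWeakDeriv T e v' w := by
    intro ψ hψ
    have hψ' := hψ.isTestMap
    have a := h' _ (hψ'.pd e).isTestFunction
    have b := hw ψ hψ
    have c := h _ (hψ'.pd e').isTestFunction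
    change ∫ q, pd e' (pd e ψ) q • u q ∂cylMeasure T = -∫ q, pd e ψ q • v' q ∂cylMeasure T at a
    change ∫ q, pd e' ψ q • v q ∂cylMeasure T = _ at b
    change ∫ q, pd e (pd e' ψ) q • u q ∂cylMeasure T = -∫ q, pd e' ψ q • v q ∂cylMeasure T at c
    rw [pd_comm hψ'.toIsCylMap] at c
    change ∫ q, pd e ψ q • v' q ∂cylMeasure T = _
    rw [c] at a
    rw [← neg_inj.1 a, b]
  exact key.unique hT hp hw'

end Weighted

/-! ### Weak solutions of the model equation -/

section WeakSolution
variable {T : ℝ} {p : ℝ≥0∞} [Fact (1 ≤ p)] {d κ M : ℝ} {k : ℝ × ℝ → ℝ}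

lemma isTestMap_innerSL {ψ : ℝ × ℝ → E4} (hψ : IsTestMap T ψ) :
    IsTestMap T fun q => innerSL ℝ (ψ q) :=
  hψ.comp (innerSL ℝ).contDiff (map_zero _)

lemma integrable_inner_test {ψ : ℝ × ℝ → E4} (hψ : IsTestMap T ψ) (u : WeightedLp T p d) :
    Integrable (fun q => inner ℝ (ψ q) (u q)) (cylMeasure T) :=
  (pairing_eq_sum u (isTestMap_innerSL hψ)).1

lemma IsWeakDeriv.integral_inner {e : ℝ × ℝ} {u w : WeightedLp T p d} (h : IsWeakDeriv T e u w)
    {ψ : ℝ × ℝ → E4} (hψ : IsTestMap T ψ) :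
    ∫ q, inner ℝ (MorseBottTorus.pd e ψ q) (u q) ∂cylMeasure T =
      -∫ q, inner ℝ (ψ q) (w q) ∂cylMeasure T := by
  have := h.pairing (isTestMap_innerSL hψ)
  rw [pd_clm hψ.toIsCylMap (innerSL ℝ)] at this
  exact this

/-- The formal adjoint of the model operator. -/
def modelAdj (k : ℝ × ℝ → ℝ) (ψ : ℝ × ℝ → E4) (q : ℝ × ℝ) : E4 :=
  -pd (1, 0) ψ q + stdJ (pd (0, 1) ψ q) - k q • projY (ψ q)

lemma IsTestMap.modelAdj (hk : IsCylMap T k) {ψ : ℝ × ℝ → E4} (hψ : IsTestMap T ψ) :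
    IsTestMap T (modelAdj k ψ) :=
  (((hψ.pd (1, 0)).neg).add ((hψ.pd (0, 1)).comp stdJ.contDiff (map_zero _))).sub
    (IsTestMap.smul hk (hψ.comp projY.contDiff (map_zero _)))

lemma pd_modelAdj (hk : IsCylMap T k) {ψ : ℝ × ℝ → E4} (hψ : IsTestMap T ψ) (e q : ℝ × ℝ) :
    pd e (modelAdj k ψ) q = modelAdj k (pd e ψ) q - pd e k q • projY (ψ q) := by
  have h0 : IsTestMap T fun q => -pd (1, 0) ψ q := (hψ.pd (1, 0)).neg
  have h1 : IsTestMap T fun q => stdJ (pd (0, 1) ψ q) :=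
    (hψ.pd (0, 1)).comp stdJ.contDiff (map_zero _)
  have h2 : IsTestMap T fun q => projY (ψ q) := hψ.comp projY.contDiff (map_zero _)
  have h3 := IsTestMap.smul hk h2
  have hn : pd e (fun q => -pd (1, 0) ψ q) = fun q => -pd (1, 0) (pd e ψ) q := by
    have := pd_const_smul (hψ.pd (1, 0)).toIsCylMap (-1) e
    simpa only [neg_one_smul, pd_comm hψ.toIsCylMap e (1, 0)] using this
  change pd e (fun q => -pd (1, 0) ψ q + stdJ (pd (0, 1) ψ q) - k q • projY (ψ q)) q = _
  rw [pd_sub (h0.add h1).toIsCylMap h3.toIsCylMap, pd_add h0.toIsCylMap h1.toIsCylMap, hn,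
    pd_clm (hψ.pd (0, 1)).toIsCylMap, pd_smul hk h2.toIsCylMap, pd_clm hψ.toIsCylMap,
    pd_comm hψ.toIsCylMap e (0, 1)]
  simp only [modelAdj]
  abel

lemma inner_stdJ (v w : E4) : inner ℝ (stdJ v) w = -inner ℝ v (stdJ w) := by
  simp only [inner_E4, stdJ_zero, stdJ_one, stdJ_two, stdJ_three]
  ring

lemma inner_projY (v w : E4) : inner ℝ (projY v) w = inner ℝ v (projY w) := by
  simp [inner_E4]

/-- `u` solves the model equation with right hand side `g` in the weak sense. -/
def IsWeakSolution (T : ℝ) (k : ℝ × ℝ → ℝ) (u g : ℝ × ℝ → E4) : Prop :=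
  ∀ ψ : ℝ × ℝ → E4, IsTestMap T ψ → ∫ q, inner ℝ (modelAdj k ψ q) (u q) ∂cylMeasure T =
    ∫ q, inner ℝ (ψ q) (g q) ∂cylMeasure T

lemma isWeakSolution_of_weakDeriv (hk : IsCylMap T k) {u us ut g : WeightedLp T p d}
    (h1 : IsWeakDeriv T (1, 0) u us) (h2 : IsWeakDeriv T (0, 1) u ut)
    (hg : ∀ᵐ q ∂cylMeasure T, g q = us q + stdJ (ut q) - k q • projY (u q)) :
    IsWeakSolution T k u g := by
  intro ψ hψ
  have hJ : IsTestMap T fun q => stdJ (ψ q) := hψ.comp stdJ.contDiff (map_zero _)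
  have hY : IsTestMap T fun q => k q • projY (ψ q) :=
    IsTestMap.smul hk (hψ.comp projY.contDiff (map_zero _))
  have a1 := h1.integral_inner hψ
  have a2 := h2.integral_inner hJ
  rw [pd_clm hψ.toIsCylMap] at a2
  have i1 := integrable_inner_test (hψ.pd (1, 0)) u
  have i2 := integrable_inner_test ((hψ.pd (0, 1)).comp stdJ.contDiff (map_zero _)) u
  have i3 := integrable_inner_test hY u
  have j1 := integrable_inner_test hψ us
  have j2 := integrable_inner_test hJ ut
  have e1 : ∫ q, inner ℝ (modelAdj k ψ q) (u q) ∂cylMeasure T =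
      ∫ q, (-inner ℝ (pd (1, 0) ψ q) (u q) + inner ℝ (stdJ (pd (0, 1) ψ q)) (u q) -
        inner ℝ (k q • projY (ψ q)) (u q)) ∂cylMeasure T := by
    refine integral_congr_ae (Filter.Eventually.of_forall fun q => ?_)
    simp only [modelAdj, inner_sub_left, inner_add_left, inner_neg_left]
  have e2 : ∫ q, inner ℝ (ψ q) (g q) ∂cylMeasure T =
      ∫ q, (inner ℝ (ψ q) (us q) + -inner ℝ (stdJ (ψ q)) (ut q) -
        inner ℝ (k q • projY (ψ q)) (u q)) ∂cylMeasure T := by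
    refine integral_congr_ae ?_
    filter_upwards [hg] with q hq
    rw [hq, inner_sub_right, inner_add_right, inner_stdJ, inner_smul_left, inner_smul_right,
      inner_projY, neg_neg, RCLike.conj_to_real]
  have l1 : ∫ q, (-inner ℝ (pd (1, 0) ψ q) (u q) + inner ℝ (stdJ (pd (0, 1) ψ q)) (u q) -
        inner ℝ (k q • projY (ψ q)) (u q)) ∂cylMeasure T = _ := integral_sub (i1.neg.add i2) i3
  have l2 : ∫ q, (inner ℝ (ψ q) (us q) + -inner ℝ (stdJ (ψ q)) (ut q) -
        inner ℝ (k q • projY (ψ q)) (u q)) ∂cylMeasure T = _ := integral_sub (j1.add j2.neg) i3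
  rw [e1, e2, l1, l2]
  congr 1
  have l3 : ∫ q, (-inner ℝ (pd (1, 0) ψ q) (u q) + inner ℝ (stdJ (pd (0, 1) ψ q)) (u q))
    ∂cylMeasure T = _ := integral_add i1.neg i2
  have l4 : ∫ q, (inner ℝ (ψ q) (us q) + -inner ℝ (stdJ (ψ q)) (ut q))
    ∂cylMeasure T = _ := integral_add j1 j2.neg
  refine l3.trans (Eq.trans ?_ l4.symm)
  refine congrArg₂ (· + ·) ?_ ?_
  · exact (integral_neg _).trans (by rw [a1, neg_neg])
  · exact a2.trans (integral_neg _).symm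

lemma IsWeakSolution.deriv (hk : IsCylMap T k) {u w g g' r : WeightedLp T p d} {e : ℝ × ℝ}
    (h : IsWeakSolution T k u g) (hu : IsWeakDeriv T e u w) (hg : IsWeakDeriv T e g g')
    (hr : ∀ᵐ q ∂cylMeasure T, r q = g' q + MorseBottTorus.pd e k q • projY (u q)) :
    IsWeakSolution T k w r := by
  intro ψ hψ
  have hY : IsTestMap T fun q => MorseBottTorus.pd e k q • projY (ψ q) :=
    IsTestMap.smul (hk.pd e) (hψ.comp projY.contDiff (map_zero _))
  have a1 := hu.integral_inner (hψ.modelAdj hk)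
  have a2 := h _ (hψ.pd e)
  have a3 := hg.integral_inner hψ
  have i1 := integrable_inner_test ((hψ.pd e).modelAdj hk) u
  have i2 := integrable_inner_test hY u
  have i3 := integrable_inner_test hψ g'
  have e1 : ∫ q, inner ℝ (MorseBottTorus.pd e (modelAdj k ψ) q) (u q) ∂cylMeasure T =
      ∫ q, (inner ℝ (modelAdj k (MorseBottTorus.pd e ψ) q) (u q) -
        inner ℝ (MorseBottTorus.pd e k q • projY (ψ q)) (u q)) ∂cylMeasure T :=
    integral_congr_ae (Filter.Eventually.of_forall fun q => by
      simp only [pd_modelAdj hk hψ, inner_sub_left])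
  have e2 : ∫ q, inner ℝ (ψ q) (r q) ∂cylMeasure T = ∫ q, (inner ℝ (ψ q) (g' q) +
      inner ℝ (MorseBottTorus.pd e k q • projY (ψ q)) (u q)) ∂cylMeasure T := by
    refine integral_congr_ae ?_
    filter_upwards [hr] with q hq
    rw [hq, inner_add_right, inner_smul_left, inner_smul_right, inner_projY, RCLike.conj_to_real]
  rw [e1, integral_sub i1 i2, a2, a3] at a1
  rw [e2, integral_add i3 i2]
  linarith

lemma exp_smul_modelOp_reflect {ψ : ℝ × ℝ → E4} (hψ : IsTestMap T ψ) (q : ℝ × ℝ) :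
    Real.exp (d * q.1) • modelOp (fun q => k (reflect q)) d ψ (reflect q) =
      modelAdj k (fun q => Real.exp (d * q.1) • ψ (reflect q)) q := by
  have hd : ∀ s : ℝ, HasDerivAt (fun s => Real.exp (d * s)) (d * Real.exp (d * s)) s := fun s => by
    simpa [mul_comm] using ((hasDerivAt_id s).const_mul d).exp
  have hc : IsCylMap T fun q : ℝ × ℝ => Real.exp (d * q.1) :=
    isCylMap_fst (w := fun s => Real.exp (d * s)) (by fun_prop)
  simp only [modelAdj, modelOp, sliceOp]
  rw [pd_smul hc hψ.reflect.toIsCylMap, pd_smul hc hψ.reflect.toIsCylMap]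
  simp only
  rw [pd_fst (hd q.1), pd_fst (hd q.1), pd_reflect hψ.toIsCylMap, pd_reflect hψ.toIsCylMap,
    show reflect (1, 0) = -(1, 0) by simp [reflect], show reflect (0, 1) = (0, 1) by simp [reflect]]
  have : pd (-(1, 0)) ψ (reflect q) = -pd (1, 0) ψ (reflect q) := by rw [pd, map_neg]; rfl
  rw [this, reflect_reflect]
  simp only [map_smul, one_smul, zero_smul, add_zero]
  module

lemma IsWeakSolution.unique (hT : 0 < T) (hκ : 0 < κ) (hd0 : d ≠ 0)
    (hd : 4 * gapConst T κ M * d ^ 2 ≤ 1) (hp1 : 1 < p) (hp : p ≠ ⊤)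
    (hk : IsModelCoeff T κ M (d ^ 2 / 4) k) {u u' g : WeightedLp T p d}
    (h : IsWeakSolution T k u g) (h' : IsWeakSolution T k u' g) : u = u' := by
  rw [← sub_eq_zero]
  have := ae_eq_zero_of_weak hT hκ hd0 hd hp1 hp hk (memLp_exp_smul hp (u - u')) fun ψ hψ => ?_
  · apply Lp.ext
    filter_upwards [(weightedMeasure_absolutelyContinuous T p d).ae_le this,
      Lp.coeFn_zero E4 p (weightedMeasure T p d)] with q h1 h2
    rw [h2]
    exact (smul_eq_zero.1 h1).resolve_left (Real.exp_pos _).ne'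
  · have hχ : IsTestMap T fun q => Real.exp (d * q.1) • ψ (reflect q) := hψ.reflect.exp_smul d
    have hm := hχ.modelAdj hk.toIsCylMap
    have e : ∫ q, inner ℝ (modelOp (fun q => k (reflect q)) d ψ (reflect q))
        (Real.exp (d * q.1) • (u - u' : WeightedLp T p d) q) ∂cylMeasure T =
        ∫ q, (inner ℝ (modelAdj k (fun q => Real.exp (d * q.1) • ψ (reflect q)) q) (u q) -
          inner ℝ (modelAdj k (fun q => Real.exp (d * q.1) • ψ (reflect q)) q) (u' q))
          ∂cylMeasure T := by
      refine integral_congr_ae ?_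
      filter_upwards [ae_weighted_of (Lp.coeFn_sub u u')] with q hq
      rw [hq, ← inner_sub_right, ← exp_smul_modelOp_reflect hψ, inner_smul_left, inner_smul_right,
        Pi.sub_apply, RCLike.conj_to_real]
    rw [e, integral_sub (integrable_inner_test hm u) (integrable_inner_test hm u'), h _ hχ, h' _ hχ,
      sub_self]

end WeakSolution

/-! ### Solvability of the model equation -/

section Solver
variable {T : ℝ} {p : ℝ≥0∞} [Fact (1 ≤ p)] {d κ M : ℝ} {k : ℝ × ℝ → ℝ}

/-- The model operator from `W¹` to `L^p`. -/
lemma exists_modelLp (hk : IsCylMap T k) (hM : ∀ q, |k q| ≤ M) :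
    ∃ A : weightedSobolev T 1 p d →L[ℝ] WeightedLp T p d, ∀ η, ∀ᵐ q ∂cylMeasure T,
      A η q = sobolevComp (mkIdx 1 0 (by norm_num)) η q +
        stdJ (sobolevComp (mkIdx 0 1 (by norm_num)) η q) -
          k q • projY (sobolevComp (mkIdx 0 0 (by norm_num)) η q) := by
  obtain ⟨A₁, hA₁, -⟩ := exists_mulLp (T := T) (p := p) (d := d) (c := fun _ => stdJ)
    continuous_const (fun _ => le_rfl)
  obtain ⟨A₂, hA₂, -⟩ := exists_mulLp (T := T) (p := p) (d := d) (c := fun q => k q • projY)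
    (hk.continuous.smul continuous_const) (B := M * ‖projY‖) (fun q => by
      rw [norm_smul]; exact mul_le_mul_of_nonneg_right (hM q) (norm_nonneg _))
  refine ⟨sobolevComp (mkIdx 1 0 (by norm_num)) + A₁.comp (sobolevComp (mkIdx 0 1 (by norm_num))) -
    A₂.comp (sobolevComp (mkIdx 0 0 (by norm_num))), fun η => ?_⟩
  have e : ∀ (a b c : weightedSobolev T 1 p d →L[ℝ] WeightedLp T p d),
      (a + b - c) η = a η + b η - c η := fun a b c => rfl
  rw [e]
  filter_upwards [ae_weighted_of (Lp.coeFn_sub (sobolevComp (mkIdx 1 0 (by norm_num)) η +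
      A₁ (sobolevComp (mkIdx 0 1 (by norm_num)) η)) (A₂ (sobolevComp (mkIdx 0 0 (by norm_num)) η))),
    ae_weighted_of (Lp.coeFn_add (sobolevComp (mkIdx 1 0 (by norm_num)) η)
      (A₁ (sobolevComp (mkIdx 0 1 (by norm_num)) η))),
    ae_weighted_of (hA₁ (sobolevComp (mkIdx 0 1 (by norm_num)) η)),
    ae_weighted_of (hA₂ (sobolevComp (mkIdx 0 0 (by norm_num)) η))] with q h1 h2 h3 h4
  refine h1.trans ?_
  rw [Pi.sub_apply, h2, Pi.add_apply, h3, h4]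
  rfl

/-- Multiplication of test maps by `e^{-ds}`. -/
def twist (T d : ℝ) : testSpace T →ₗ[ℝ] testSpace T where
  toFun φ := ⟨fun q => Real.exp (-d * q.1) • φ.1 q, IsTestMap.exp_smul φ.2 (-d)⟩
  map_add' _ _ := Subtype.ext (funext fun _ => smul_add _ _ _)
  map_smul' c φ := Subtype.ext (funext fun q => smul_comm (Real.exp (-d * q.1)) c (φ.1 q))

lemma pd_twist (φ : testSpace T) (e q : ℝ × ℝ) :
    pd e (twist T d φ).1 q = Real.exp (-d * q.1) • (pd e φ.1 q - (e.1 * d) • φ.1 q) := by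
  have hd : HasDerivAt (fun s => Real.exp (-d * s)) (-d * Real.exp (-d * q.1)) q.1 := by
    simpa [mul_comm] using ((hasDerivAt_id q.1).const_mul (-d)).exp
  have := congrFun (pd_smul (isCylMap_fst (T := T) (w := fun s => Real.exp (-d * s)) (by fun_prop))
    (IsTestMap.toIsCylMap φ.2) e) q
  rw [pd_fst hd] at this
  refine Eq.trans this ?_
  module

omit [Fact (1 ≤ p)] in
lemma eLpNorm_pd_le (hT : 0 < T) (hp1 : 1 < p) (hp : p ≠ ⊤) (M d : ℝ) : ∃ K : ℝ, 0 ≤ K ∧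
    ∀ k : ℝ × ℝ → ℝ, IsCylMap T k → (∀ q, |k q| ≤ M) → ∀ φ : ℝ × ℝ → E4, IsTestMap T φ →
    ∀ e : ℝ × ℝ, e = (1, 0) ∨ e = (0, 1) → (eLpNorm (pd e φ) p (cylMeasure T)).toReal ≤
      K * ((eLpNorm (modelOp k d φ) p (cylMeasure T)).toReal +
        (eLpNorm φ p (cylMeasure T)).toReal) := by
  have hpr : 1 < p.toReal := by
    have := (ENNReal.toReal_lt_toReal ENNReal.one_ne_top hp).2 hp1
    simpa using this
  have hp0 : p ≠ 0 := (zero_lt_one.trans hp1).ne'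
  obtain ⟨K, hK, h⟩ := powNorm_pd_le_modelOp hpr M d
  refine ⟨(K ^ (1 / p.toReal)).toReal, ENNReal.toReal_nonneg, fun k hk hM φ hφ e he => ?_⟩
  have f1 := ((hφ.modelOp hk d).memLp p).2.ne
  have f2 := (hφ.memLp p).2.ne
  rw [← ENNReal.toReal_add f1 f2, ← ENNReal.toReal_mul]
  refine ENNReal.toReal_mono (by finiteness) ?_
  rw [eLpNorm_eq_powNorm hp0 hp, eLpNorm_eq_powNorm hp0 hp, eLpNorm_eq_powNorm hp0 hp]
  refine (ENNReal.rpow_le_rpow (h hT k hk hM φ hφ e he) (by positivity)).trans ?_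
  rw [ENNReal.mul_rpow_of_nonneg _ _ (by positivity)]
  gcongr
  exact ENNReal.rpow_add_le_add_rpow _ _ (by positivity) (by rw [div_le_one (by linarith)]; linarith)

lemma norm_sobolevComp_twist (hT : 0 ≤ T) (hp : p ≠ ⊤) (φ : testSpace T) (α : MultiIdx 1)
    {χ : ℝ × ℝ → E4}
    (h : ∀ q, pdIter α.1.1 α.1.2 (twist T d φ).1 q = Real.exp (-d * q.1) • χ q) :
    ‖sobolevComp α (toSobolev hT 1 p d (twist T d φ))‖ =
      (eLpNorm χ p (cylMeasure T)).toReal := by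
  rw [norm_weightedLp hp]
  congr 1
  refine eLpNorm_congr_ae ?_
  filter_upwards [ae_weighted_of (toSobolev_ae (p := p) (d := d) hT (twist T d φ) α)] with q hq
  rw [hq, h, smul_smul, ← Real.exp_add]
  simp

lemma norm_toSobolev_twist_le (hT : 0 < T) (hκ : 0 < κ) (hd0 : d ≠ 0)
    (hd : 4 * gapConst T κ M * d ^ 2 ≤ 1) (hp1 : 1 < p) (hp : p ≠ ⊤) :
    ∃ C : ℝ, 0 ≤ C ∧ ∀ k : ℝ × ℝ → ℝ, IsModelCoeff T κ M (d ^ 2 / 4) k → ∀ φ : testSpace T,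
      ‖toSobolev hT.le 1 p d (twist T d φ)‖ ≤
        C * (eLpNorm (modelOp k d φ.1) p (cylMeasure T)).toReal := by
  obtain ⟨C, hC, h⟩ := aPrioriBound (M := M) hT hκ hd0 hd hp1 hp
  obtain ⟨K, hK, hgrad⟩ := eLpNorm_pd_le hT hp1 hp M d
  refine ⟨piLpConst T p d 1 * (K * (1 + C) + (1 + |d|) * C), by
    have := piLpConst_nonneg (T := T) (p := p) (d := d) (k := 1); positivity, fun k hk φ => ?_⟩
  set N := (eLpNorm (modelOp k d φ.1) p (cylMeasure T)).toReal with hN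
  have hN0 : 0 ≤ N := ENNReal.toReal_nonneg
  have hφ : IsTestMap T φ.1 := φ.2
  have b0 := h k hk φ.1 hφ
  have bg : ∀ e : ℝ × ℝ, e = (1, 0) ∨ e = (0, 1) →
      (eLpNorm (pd e φ.1) p (cylMeasure T)).toReal ≤ K * (1 + C) * N := fun e he => by
    refine (hgrad k hk.toIsCylMap hk.bound φ.1 hφ e he).trans ?_
    rw [mul_assoc, add_mul, one_mul]
    exact mul_le_mul_of_nonneg_left (add_le_add_right b0 _) hK
  have hg0 : 0 ≤ K * (1 + C) * N := by positivity
  have hd0' : 0 ≤ |d| * C * N := by positivity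
  have hc0 : 0 ≤ C * N := by positivity
  rw [mul_assoc]
  refine norm_sobolev_le (by positivity) _ fun α => ?_
  have hα := α.2
  by_cases h1 : (α.1.1 : ℕ) = 1
  · have h2 : (α.1.2 : ℕ) = 0 := by omega
    rw [norm_sobolevComp_twist hT.le hp φ α (χ := fun q => pd (1, 0) φ.1 q - d • φ.1 q) fun q => by
      rw [h1, h2]
      change pd (1, 0) (twist T d φ).1 q = _
      rw [pd_twist, one_mul]]
    have hm1 := (hφ.pd (1, 0)).memLp (T := T) p
    have hm2 := (hφ.const_smul d).memLp p
    have e1 : (eLpNorm (fun q => pd (1, 0) φ.1 q - d • φ.1 q) p (cylMeasure T)).toReal ≤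
        (eLpNorm (pd (1, 0) φ.1) p (cylMeasure T)).toReal +
        |d| * (eLpNorm φ.1 p (cylMeasure T)).toReal := by
      have e2 : eLpNorm (fun q => d • φ.1 q) p (cylMeasure T) =
          ‖d‖ₑ * eLpNorm φ.1 p (cylMeasure T) := eLpNorm_const_smul d φ.1 p _
      rw [← Real.norm_eq_abs, ← toReal_enorm, ← ENNReal.toReal_mul, ← e2,
        ← ENNReal.toReal_add hm1.2.ne hm2.2.ne]
      exact ENNReal.toReal_mono (ENNReal.add_ne_top.2 ⟨hm1.2.ne, hm2.2.ne⟩)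
        (eLpNorm_sub_le hm1.1 hm2.1 hp1.le)
    have e3 := mul_le_mul_of_nonneg_left b0 (abs_nonneg d)
    have := bg (1, 0) (Or.inl rfl)
    linarith
  · by_cases h2 : (α.1.2 : ℕ) = 1
    · rw [norm_sobolevComp_twist hT.le hp φ α (χ := fun q => pd (0, 1) φ.1 q) fun q => by
        rw [h2, show (α.1.1 : ℕ) = 0 by omega]
        change pd (0, 1) (twist T d φ).1 q = _
        rw [pd_twist, zero_mul, zero_smul, sub_zero]]
      have := bg (0, 1) (Or.inr rfl)
      linarith
    · rw [norm_sobolevComp_twist hT.le hp φ α (χ := fun q => φ.1 q) fun q => by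
        rw [show (α.1.2 : ℕ) = 0 by omega, show (α.1.1 : ℕ) = 0 by omega]
        change (twist T d φ).1 q = _
        rfl]
      linarith

lemma exp_smul_modelLp_twist (hT : 0 < T) {A : weightedSobolev T 1 p d →L[ℝ] WeightedLp T p d}
    (hA : ∀ η, ∀ᵐ q ∂cylMeasure T, A η q = sobolevComp (mkIdx 1 0 (by norm_num)) η q +
      stdJ (sobolevComp (mkIdx 0 1 (by norm_num)) η q) -
        k q • projY (sobolevComp (mkIdx 0 0 (by norm_num)) η q)) (φ : testSpace T) :
    ∀ᵐ q ∂cylMeasure T,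
      Real.exp (d * q.1) • A (toSobolev hT.le 1 p d (twist T d φ)) q = modelOp k d φ.1 q := by
  filter_upwards [hA (toSobolev hT.le 1 p d (twist T d φ)),
    ae_weighted_of (toSobolev_ae (p := p) (d := d) (k := 1) hT.le (twist T d φ)
      (mkIdx 1 0 (by norm_num))),
    ae_weighted_of (toSobolev_ae (p := p) (d := d) (k := 1) hT.le (twist T d φ)
      (mkIdx 0 1 (by norm_num))),
    ae_weighted_of (toSobolev_ae (p := p) (d := d) (k := 1) hT.le (twist T d φ)
      (mkIdx 0 0 (by norm_num)))] with q h1 h2 h3 h4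
  change _ = pd (1, 0) (twist T d φ).1 q at h2
  change _ = pd (0, 1) (twist T d φ).1 q at h3
  change _ = Real.exp (-d * q.1) • φ.1 q at h4
  rw [pd_twist] at h2 h3
  rw [h1, h2, h3, h4]
  have e : Real.exp (d * q.1) * Real.exp (-d * q.1) = 1 := by rw [← Real.exp_add]; simp
  simp only [map_smul, one_mul, zero_mul, zero_smul, sub_zero, smul_sub, smul_add, smul_smul, e,
    one_smul, modelOp, sliceOp]
  have e1 : Real.exp (d * q.1) * (Real.exp (-d * q.1) * d) = d := by rw [← mul_assoc, e, one_mul]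
  have e2 : Real.exp (d * q.1) * (k q * Real.exp (-d * q.1)) = k q := by
    rw [mul_left_comm, e, mul_one]
  rw [e1, e2]
  abel

/-- The model equation can be solved in `W¹`. -/
lemma exists_modelLp_eq (hT : 0 < T) (hκ : 0 < κ) (hd0 : d ≠ 0)
    (hd : 4 * gapConst T κ M * d ^ 2 ≤ 1) (hp1 : 1 < p) (hp : p ≠ ⊤) :
    ∃ C : ℝ, 0 ≤ C ∧ ∀ k : ℝ × ℝ → ℝ, IsModelCoeff T κ M (d ^ 2 / 4) k → ∀ f : WeightedLp T p d,
      ∃ η : weightedSobolev T 1 p d, ‖η‖ ≤ C * ‖f‖ ∧ ∀ᵐ q ∂cylMeasure T,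
        f q = sobolevComp (mkIdx 1 0 (by norm_num)) η q +
          stdJ (sobolevComp (mkIdx 0 1 (by norm_num)) η q) -
            k q • projY (sobolevComp (mkIdx 0 0 (by norm_num)) η q) := by
  obtain ⟨C, hC, hC'⟩ := norm_toSobolev_twist_le (M := M) hT hκ hd0 hd hp1 hp
  refine ⟨C, hC, fun k hk f => ?_⟩
  obtain ⟨A, hA⟩ := exists_modelLp (p := p) (d := d) hk.toIsCylMap hk.bound
  have : CompleteSpace (weightedSobolev T 1 p d) := completeSpace_sobolev hp
  set ι := (toSobolev hT.le 1 p d).comp (twist T d) with hι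
  set B : testSpace T →ₗ[ℝ] WeightedLp T p d := A.toLinearMap.comp ι with hB
  have hBφ : ∀ φ, ∀ᵐ q ∂cylMeasure T, Real.exp (d * q.1) • B φ q = modelOp k d φ.1 q :=
    exp_smul_modelLp_twist hT hA
  have hBn : ∀ φ, ‖ι φ‖ ≤ C * ‖B φ‖ := fun φ => by
    refine (hC' k hk φ).trans_eq ?_
    rw [norm_weightedLp hp]
    congr 2
    exact eLpNorm_congr_ae ((hBφ φ).mono fun q hq => hq.symm)
  have hBd : DenseRange B := by
    intro g
    rw [Metric.mem_closure_iff]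
    intro ε hε
    have hg := memLp_exp_smul hp g
    obtain ⟨_, ⟨φ, rfl⟩, hφ⟩ := Metric.mem_closure_iff.1
      ((aPrioriBound hT hκ hd0 hd hp1 hp).denseRange hT hκ hd0 hd hp hk hg.toLp) ε hε
    refine ⟨_, ⟨φ, rfl⟩, ?_⟩
    rw [dist_eq_norm, Lp.norm_def] at hφ
    rw [dist_eq_norm, norm_weightedLp hp]
    refine lt_of_eq_of_lt (congrArg ENNReal.toReal (eLpNorm_congr_ae ?_)) hφ
    filter_upwards [Lp.coeFn_sub hg.toLp (testLp T p (modelLin hk.toIsCylMap d φ)), hg.coeFn_toLp,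
      ((IsTestMap.modelOp hk.toIsCylMap φ.2 d).memLp p).coeFn_toLp, hBφ φ,
      ae_weighted_of (Lp.coeFn_sub g (B φ))] with q h1 h2 h3 h4 h5
    refine Eq.trans ?_ h1.symm
    rw [h5, Pi.sub_apply, Pi.sub_apply, smul_sub, h2, h4]
    exact congrArg _ h3.symm
  set Q := ι.extendOfNorm B with hQ
  have hQB : ∀ φ, Q (B φ) = ι φ := ι.extendOfNorm_eq hBd ⟨C, hBn⟩
  have hAQ : A (Q f) = f := congrFun (hBd.equalizer (A.continuous.comp Q.continuous) continuous_id
    (funext fun φ => by simp only [Function.comp_apply, hQB, id_eq]; rfl)) f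
  refine ⟨Q f, ι.norm_extendOfNorm_apply_le hBd C hBn f, ?_⟩
  have := hA (Q f)
  rwa [hAQ] at this

end Solver

/-! ### First order operators from `W²` to `W¹` -/

section FirstOrder
variable {T : ℝ} {p : ℝ≥0∞} [Fact (1 ≤ p)] {d κ M : ℝ}

lemma isCoeff_const (A : E4 →L[ℝ] E4) : IsCoeff T ‖A‖ fun _ => A where
  toIsCylMap := isCylMap_const A
  bound _ := le_rfl
  bound_pd q e _ := by simp [pd]

lemma IsCoeff.mono {B B' : ℝ} {c : ℝ × ℝ → E4 →L[ℝ] E4} (hc : IsCoeff T B c) (hB : B ≤ B') :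
    IsCoeff T B' c :=
  ⟨hc.toIsCylMap, fun q => (hc.bound q).trans hB, fun q e he => (hc.bound_pd q e he).trans hB⟩

lemma IsCylMap.isCoeff_smul {k : ℝ × ℝ → ℝ} (hk : IsCylMap T k) {B : ℝ} (h0 : ∀ q, |k q| ≤ B)
    (h1 : ∀ q e, e = ((1 : ℝ), (0 : ℝ)) ∨ e = (0, 1) → |MorseBottTorus.pd e k q| ≤ B)
    (A : E4 →L[ℝ] E4) : IsCoeff T (B * ‖A‖) fun q => k q • A where
  toIsCylMap := hk.smul (isCylMap_const A)
  bound q := by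
    rw [norm_smul]
    exact mul_le_mul_of_nonneg_right (h0 q) (norm_nonneg _)
  bound_pd q e he := by
    rw [pd_smul hk (isCylMap_const A)]
    have : MorseBottTorus.pd e (fun _ : ℝ × ℝ => A) q = 0 := by simp [MorseBottTorus.pd]
    simp only [this, smul_zero, zero_add, norm_smul]
    exact mul_le_mul_of_nonneg_right (h1 q e he) (norm_nonneg _)

/-- The operator `c₁ ∂_t + c₀` from `W²` to `W¹`. -/
lemma exists_firstOrderOp (T : ℝ) (p : ℝ≥0∞) [Fact (1 ≤ p)] (d : ℝ) : ∃ K : ℝ, 0 ≤ K ∧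
    ∀ (B : ℝ) (c₁ c₀ : ℝ × ℝ → E4 →L[ℝ] E4), IsCoeff T B c₁ → IsCoeff T B c₀ →
      ∃ E : weightedSobolev T 2 p d →L[ℝ] weightedSobolev T 1 p d,
        (∀ η, ∀ᵐ q ∂cylMeasure T, sobolevComp (mkIdx 0 0 (by norm_num)) (E η) q =
          c₁ q (sobolevComp (mkIdx 0 1 (by norm_num)) η q) +
            c₀ q (sobolevComp (mkIdx 0 0 (by norm_num)) η q)) ∧ ‖E‖ ≤ K * B := by
  obtain ⟨S₁, hS₁, n₁⟩ := exists_shiftOp T p d 0 1 (by norm_num)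
  obtain ⟨S₀, hS₀, n₀⟩ := exists_shiftOp T p d 0 0 (by norm_num)
  have hP := piLpConst_nonneg (T := T) (p := p) (d := d) (k := 1)
  refine ⟨piLpConst T p d 1 * 2 * piLpConst T p d 1 * 2, by positivity,
    fun B c₁ c₀ h₁ h₀ => ?_⟩
  have hB : 0 ≤ B := (norm_nonneg _).trans (h₁.bound 0)
  obtain ⟨A₁, hA₁, -, -, m₁⟩ := exists_mulOp (p := p) (d := d) h₁
  obtain ⟨A₀, hA₀, -, -, m₀⟩ := exists_mulOp (p := p) (d := d) h₀
  refine ⟨A₁.comp S₁ + A₀.comp S₀, fun η => ?_, ?_⟩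
  · have e1 : sobolevComp (mkIdx 0 0 (by norm_num)) (S₁ η) =
      sobolevComp (mkIdx 0 1 (by norm_num)) η := hS₁ η (mkIdx 0 0 (by norm_num))
    have e0 : sobolevComp (mkIdx 0 0 (by norm_num)) (S₀ η) =
      sobolevComp (mkIdx 0 0 (by norm_num)) η := hS₀ η (mkIdx 0 0 (by norm_num))
    have b1 := hA₁ (S₁ η)
    have b0 := hA₀ (S₀ η)
    rw [e1] at b1
    rw [e0] at b0
    have e : sobolevComp (mkIdx 0 0 (by norm_num)) ((A₁.comp S₁ + A₀.comp S₀) η) =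
      sobolevComp (mkIdx 0 0 (by norm_num)) (A₁ (S₁ η)) +
        sobolevComp (mkIdx 0 0 (by norm_num)) (A₀ (S₀ η)) := map_add _ _ _
    rw [e]
    filter_upwards [ae_weighted_of b1, ae_weighted_of b0, ae_weighted_of (Lp.coeFn_add
      (sobolevComp (mkIdx 0 0 (by norm_num)) (A₁ (S₁ η)))
      (sobolevComp (mkIdx 0 0 (by norm_num)) (A₀ (S₀ η))))] with q q1 q0 qe
    rw [qe, Pi.add_apply, q1, q0]
  · refine (norm_add_le (A₁.comp S₁) (A₀.comp S₀)).trans ?_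
    have c1 := (A₁.opNorm_comp_le S₁).trans (mul_le_mul m₁ n₁ S₁.opNorm_nonneg (by positivity))
    have c0 := (A₀.opNorm_comp_le S₀).trans (mul_le_mul m₀ n₀ S₀.opNorm_nonneg (by positivity))
    linarith

/-- The model operator from `W²` to `W¹`. -/
lemma exists_modelOp {k : ℝ × ℝ → ℝ} {δ : ℝ} (hk : IsModelCoeff T κ M δ k) :
    ∃ D : weightedSobolev T 2 p d →L[ℝ] weightedSobolev T 1 p d,
      ∀ η, ∀ᵐ q ∂cylMeasure T, sobolevComp (mkIdx 0 0 (by norm_num)) (D η) q =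
        sobolevComp (mkIdx 1 0 (by norm_num)) η q +
          stdJ (sobolevComp (mkIdx 0 1 (by norm_num)) η q) -
            k q • projY (sobolevComp (mkIdx 0 0 (by norm_num)) η q) := by
  obtain ⟨S, hS, -⟩ := exists_shiftOp T p d 1 0 (by norm_num)
  obtain ⟨K, -, h⟩ := exists_firstOrderOp T p d
  obtain ⟨E, hE, -⟩ := h (max ‖stdJ‖ (M * ‖-projY‖)) (fun _ => stdJ) (fun q => k q • (-projY))
    ((isCoeff_const _).mono (le_max_left _ _))
    ((hk.toIsCylMap.isCoeff_smul hk.bound hk.bound_pd _).mono (le_max_right _ _))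
  refine ⟨S + E, fun η => ?_⟩
  have e1 : sobolevComp (mkIdx 0 0 (by norm_num)) (S η) =
    sobolevComp (mkIdx 1 0 (by norm_num)) η := hS η (mkIdx 0 0 (by norm_num))
  have e : sobolevComp (mkIdx 0 0 (by norm_num)) ((S + E) η) =
    sobolevComp (mkIdx 0 0 (by norm_num)) (S η) + sobolevComp (mkIdx 0 0 (by norm_num)) (E η) :=
    map_add _ _ _
  rw [e, e1]
  filter_upwards [hE η, ae_weighted_of (Lp.coeFn_add (sobolevComp (mkIdx 1 0 (by norm_num)) η)
    (sobolevComp (mkIdx 0 0 (by norm_num)) (E η)))] with q h1 h2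
  rw [h2, Pi.add_apply, h1]
  change _ + (_ + k q • (-projY _)) = _
  rw [smul_neg]
  abel

/-- A section is in `W²` if it and its first derivatives are in `W¹`. -/
lemma exists_sobolev_two (η η₁ η₂ : weightedSobolev T 1 p d)
    (h1 : sobolevComp (mkIdx 1 0 (by norm_num)) η = sobolevComp (mkIdx 0 0 (by norm_num)) η₁)
    (h2 : sobolevComp (mkIdx 0 1 (by norm_num)) η = sobolevComp (mkIdx 0 0 (by norm_num)) η₂)
    (h12 : sobolevComp (mkIdx 0 1 (by norm_num)) η₁ = sobolevComp (mkIdx 1 0 (by norm_num)) η₂)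
    {b : ℝ} (b0 : ‖η‖ ≤ b) (b1 : ‖η₁‖ ≤ b) (b2 : ‖η₂‖ ≤ b) :
    ∃ ξ : weightedSobolev T 2 p d,
      sobolevComp (mkIdx 0 0 (by norm_num)) ξ = sobolevComp (mkIdx 0 0 (by norm_num)) η ∧
      sobolevComp (mkIdx 1 0 (by norm_num)) ξ = sobolevComp (mkIdx 1 0 (by norm_num)) η ∧
      sobolevComp (mkIdx 0 1 (by norm_num)) ξ = sobolevComp (mkIdx 0 1 (by norm_num)) η ∧
      ‖ξ‖ ≤ piLpConst T p d 2 * b := by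
  set u : MultiIdx 2 → WeightedLp T p d := fun α =>
    if hi : (α.1.1 : ℕ) = 0 then
      if hj : (α.1.2 : ℕ) = 0 then sobolevComp (mkIdx 0 0 (by norm_num)) η
      else sobolevComp (mkIdx (k := 1) 0 (α.1.2 - 1) (by have := α.2; omega)) η₂
    else sobolevComp (mkIdx (k := 1) (α.1.1 - 1) α.1.2 (by have := α.2; omega)) η₁ with hu
  have u0 : ∀ α : MultiIdx 2, (α.1.1 : ℕ) = 0 → (α.1.2 : ℕ) = 0 →
      u α = sobolevComp (mkIdx 0 0 (by norm_num)) η := fun α hi hj => by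
    simp only [hu, hi, hj, dif_pos]
  have u2 : ∀ (α : MultiIdx 2) (β : MultiIdx 1), (α.1.1 : ℕ) = 0 → (β.1.1 : ℕ) = 0 →
      (α.1.2 : ℕ) = β.1.2 + 1 → u α = sobolevComp β η₂ := fun α β hi hi' hj => by
    have : β = mkIdx (k := 1) 0 (α.1.2 - 1) (by have := β.2; omega) := by
      ext <;> simp only <;> omega
    simp only [hu]
    rw [dif_pos hi, dif_neg (by omega)]
    exact congrArg (fun β => sobolevComp β η₂) this.symm
  have u1 : ∀ (α : MultiIdx 2) (β : MultiIdx 1), (α.1.1 : ℕ) = β.1.1 + 1 →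
      (α.1.2 : ℕ) = β.1.2 → u α = sobolevComp β η₁ := fun α β hi hj => by
    have : β = mkIdx (k := 1) (α.1.1 - 1) α.1.2 (by have := β.2; omega) := by
      ext <;> simp only <;> omega
    simp only [hu]
    rw [dif_neg (by omega)]
    exact congrArg (fun β => sobolevComp β η₁) this.symm
  clear_value u
  have hmem : WithLp.toLp p u ∈ weightedSobolev T 2 p d := by
    intro α β
    have hα := α.2
    have hβ := β.2
    refine ⟨fun hi hj => ?_, fun hi hj => ?_⟩
    · change IsWeakDeriv T (1, 0) (u α) (u β)
      rw [u1 β (mkIdx α.1.1 α.1.2 (by omega)) hi hj]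
      by_cases i0 : (α.1.1 : ℕ) = 0
      · by_cases j0 : (α.1.2 : ℕ) = 0
        · rw [u0 α i0 j0]
          have e : (mkIdx (k := 1) α.1.1 α.1.2 (by omega)) = mkIdx 0 0 (by norm_num) := by
            ext <;> simp only <;> omega
          rw [e, ← h1]
          exact isWeakDeriv_fst η _ _ rfl rfl
        · rw [u2 α (mkIdx 0 0 (by norm_num)) i0 rfl (by simp only; omega)]
          have e : (mkIdx (k := 1) α.1.1 α.1.2 (by omega)) = mkIdx 0 1 (by norm_num) := by
            ext <;> simp only <;> omega
          rw [e, h12]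
          exact isWeakDeriv_fst η₂ _ _ rfl rfl
      · rw [u1 α (mkIdx (α.1.1 - 1) α.1.2 (by omega)) (by simp only; omega) rfl]
        exact isWeakDeriv_fst η₁ _ _ (by simp only; omega) rfl
    · change IsWeakDeriv T (0, 1) (u α) (u β)
      by_cases i0 : (α.1.1 : ℕ) = 0
      · rw [u2 β (mkIdx 0 α.1.2 (by omega)) (by omega) rfl hj]
        by_cases j0 : (α.1.2 : ℕ) = 0
        · rw [u0 α i0 j0]
          have e : (mkIdx (k := 1) 0 α.1.2 (by omega)) = mkIdx 0 0 (by norm_num) := by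
            ext <;> simp only <;> omega
          rw [e, ← h2]
          exact isWeakDeriv_snd η _ _ rfl rfl
        · rw [u2 α (mkIdx 0 (α.1.2 - 1) (by omega)) i0 rfl (by simp only; omega)]
          exact isWeakDeriv_snd η₂ _ _ rfl (by simp only; omega)
      · rw [u1 α (mkIdx (α.1.1 - 1) α.1.2 (by omega)) (by simp only; omega) rfl,
          u1 β (mkIdx (α.1.1 - 1) β.1.2 (by omega)) (by simp only; omega) rfl]
        exact isWeakDeriv_snd η₁ _ _ rfl (by simp only; omega)
  have hb : ∀ α, ‖u α‖ ≤ b := fun α => by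
    have hα := α.2
    by_cases i0 : (α.1.1 : ℕ) = 0
    · by_cases j0 : (α.1.2 : ℕ) = 0
      · rw [u0 α i0 j0]
        exact (norm_sobolevComp_le _ _).trans b0
      · rw [u2 α (mkIdx 0 (α.1.2 - 1) (by omega)) i0 rfl (by simp only; omega)]
        exact (norm_sobolevComp_le _ _).trans b2
    · rw [u1 α (mkIdx (α.1.1 - 1) α.1.2 (by omega)) (by simp only; omega) rfl]
      exact (norm_sobolevComp_le _ _).trans b1
  have hc : ∀ α, sobolevComp α (⟨WithLp.toLp p u, hmem⟩ : weightedSobolev T 2 p d) = u α :=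
    fun α => by
      rw [sobolevComp]
      rfl
  refine ⟨⟨WithLp.toLp p u, hmem⟩, ?_, ?_, ?_, norm_sobolev_le ((norm_nonneg _).trans b0) _
    fun α => ?_⟩
  · rw [hc, u0 _ rfl rfl]
  · rw [hc, u1 (mkIdx 1 0 (by norm_num)) (mkIdx 0 0 (by norm_num)) rfl rfl, h1]
  · rw [hc, u2 (mkIdx 0 1 (by norm_num)) (mkIdx 0 0 (by norm_num)) rfl rfl rfl, h2]
  · rw [hc]
    exact hb α

/-- The model equation can be solved in `W²`. -/
lemma exists_modelOp_eq (hT : 0 < T) (hκ : 0 < κ) (hd0 : d ≠ 0)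
    (hd : 4 * gapConst T κ M * d ^ 2 ≤ 1) (hp1 : 1 < p) (hp : p ≠ ⊤) :
    ∃ C : ℝ, 0 ≤ C ∧ ∀ k : ℝ × ℝ → ℝ, IsModelCoeff T κ M (d ^ 2 / 4) k →
      ∀ f : weightedSobolev T 1 p d, ∃ ξ : weightedSobolev T 2 p d, ‖ξ‖ ≤ C * ‖f‖ ∧
        ∀ᵐ q ∂cylMeasure T, sobolevComp (mkIdx 0 0 (by norm_num)) f q =
          sobolevComp (mkIdx 1 0 (by norm_num)) ξ q +
            stdJ (sobolevComp (mkIdx 0 1 (by norm_num)) ξ q) -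
              k q • projY (sobolevComp (mkIdx 0 0 (by norm_num)) ξ q) := by
  obtain ⟨C, hC, hsolve⟩ := exists_modelLp_eq (M := M) hT hκ hd0 hd hp1 hp
  refine ⟨piLpConst T p d 2 * (C * (1 + |M| * ‖projY‖ * C) + C), by
    have := piLpConst_nonneg (T := T) (p := p) (d := d) (k := 2); positivity, fun k hk f => ?_⟩
  have hM : 0 ≤ M := (abs_nonneg _).trans (hk.bound 0)
  obtain ⟨η, hη, eη⟩ := hsolve k hk (sobolevComp (mkIdx 0 0 (by norm_num)) f)
  have hηf : ‖η‖ ≤ C * ‖f‖ := hη.trans (mul_le_mul_of_nonneg_left (norm_sobolevComp_le _ _) hC)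
  have wη := isWeakSolution_of_weakDeriv hk.toIsCylMap
    (isWeakDeriv_fst η (mkIdx 0 0 (by norm_num)) (mkIdx 1 0 (by norm_num)) rfl rfl)
    (isWeakDeriv_snd η (mkIdx 0 0 (by norm_num)) (mkIdx 0 1 (by norm_num)) rfl rfl) eη
  have step : ∀ (e : ℝ × ℝ), e = (1, 0) ∨ e = (0, 1) → ∀ α : MultiIdx 1,
      IsWeakDeriv T e (sobolevComp (mkIdx 0 0 (by norm_num)) η) (sobolevComp α η) →
      IsWeakDeriv T e (sobolevComp (mkIdx 0 0 (by norm_num)) f) (sobolevComp α f) →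
      ∃ ζ : weightedSobolev T 1 p d,
        sobolevComp α η = sobolevComp (mkIdx 0 0 (by norm_num)) ζ ∧
        ‖ζ‖ ≤ C * (1 + |M| * ‖projY‖ * C) * ‖f‖ := by
    intro e he α hα hf
    obtain ⟨A, hA, hAn⟩ := exists_mulLp (T := T) (p := p) (d := d)
      (c := fun q => pd e k q • projY) ((hk.toIsCylMap.pd e).continuous.smul continuous_const)
      (B := |M| * ‖projY‖) (fun q => by
        rw [norm_smul]
        exact mul_le_mul_of_nonneg_right ((hk.bound_pd q e he).trans (le_abs_self _))
          (norm_nonneg _))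
    obtain ⟨ζ, hζ, eζ⟩ := hsolve k hk
      (sobolevComp α f + A (sobolevComp (mkIdx 0 0 (by norm_num)) η))
    have wζ := isWeakSolution_of_weakDeriv hk.toIsCylMap
      (isWeakDeriv_fst ζ (mkIdx 0 0 (by norm_num)) (mkIdx 1 0 (by norm_num)) rfl rfl)
      (isWeakDeriv_snd ζ (mkIdx 0 0 (by norm_num)) (mkIdx 0 1 (by norm_num)) rfl rfl) eζ
    have wα := wη.deriv hk.toIsCylMap (r := sobolevComp α f +
      A (sobolevComp (mkIdx 0 0 (by norm_num)) η)) hα hf (by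
        filter_upwards [ae_weighted_of (hA (sobolevComp (mkIdx 0 0 (by norm_num)) η)),
          ae_weighted_of (Lp.coeFn_add (sobolevComp α f)
            (A (sobolevComp (mkIdx 0 0 (by norm_num)) η)))] with q h1 h2
        rw [h2, Pi.add_apply, h1]
        rfl)
    refine ⟨ζ, wα.unique hT hκ hd0 hd hp1 hp hk wζ, hζ.trans ?_⟩
    rw [mul_assoc]
    refine mul_le_mul_of_nonneg_left ?_ hC
    refine (norm_add_le _ _).trans ?_
    have a1 := norm_sobolevComp_le α f
    have a2 : ‖A (sobolevComp (mkIdx 0 0 (by norm_num)) η)‖ ≤ |M| * ‖projY‖ * (C * ‖f‖) :=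
      (A.le_of_opNorm_le hAn _).trans (mul_le_mul_of_nonneg_left
        ((norm_sobolevComp_le _ _).trans hηf) (by positivity))
    linarith
  have df1 := isWeakDeriv_fst η (mkIdx 0 0 (by norm_num)) (mkIdx 1 0 (by norm_num)) rfl rfl
  have df2 := isWeakDeriv_snd η (mkIdx 0 0 (by norm_num)) (mkIdx 0 1 (by norm_num)) rfl rfl
  obtain ⟨η₁, e1, n1⟩ := step (1, 0) (Or.inl rfl) (mkIdx 1 0 (by norm_num)) df1
    (isWeakDeriv_fst f (mkIdx 0 0 (by norm_num)) (mkIdx 1 0 (by norm_num)) rfl rfl)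
  obtain ⟨η₂, e2, n2⟩ := step (0, 1) (Or.inr rfl) (mkIdx 0 1 (by norm_num)) df2
    (isWeakDeriv_snd f (mkIdx 0 0 (by norm_num)) (mkIdx 0 1 (by norm_num)) rfl rfl)
  have d12 := isWeakDeriv_snd η₁ (mkIdx 0 0 (by norm_num)) (mkIdx 0 1 (by norm_num)) rfl rfl
  have d21 := isWeakDeriv_fst η₂ (mkIdx 0 0 (by norm_num)) (mkIdx 1 0 (by norm_num)) rfl rfl
  rw [← e1] at d12
  rw [← e2] at d21
  have e12 := df1.comm hT hp df2 d12 d21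
  have hpos : 0 ≤ C * (1 + |M| * ‖projY‖ * C) * ‖f‖ := by positivity
  have hpos' : 0 ≤ C * ‖f‖ := by positivity
  obtain ⟨ξ, x0, x1, x2, hξ⟩ := exists_sobolev_two η η₁ η₂ e1 e2 e12
    (b := (C * (1 + |M| * ‖projY‖ * C) + C) * ‖f‖) (by linarith) (by linarith) (by linarith)
  refine ⟨ξ, by rwa [mul_assoc], ?_⟩
  rw [x0, x1, x2]
  exact eη

/-- The model operator from `W²` to `W¹` has a bounded inverse, uniformly in the coefficient. -/
lemma exists_modelOp_inverse (hT : 0 < T) (hκ : 0 < κ) (hd0 : d ≠ 0)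
    (hd : 4 * gapConst T κ M * d ^ 2 ≤ 1) (hp1 : 1 < p) (hp : p ≠ ⊤) :
    ∃ C : ℝ, 0 ≤ C ∧ ∀ k : ℝ × ℝ → ℝ, IsModelCoeff T κ M (d ^ 2 / 4) k →
      ∃ D : weightedSobolev T 2 p d →L[ℝ] weightedSobolev T 1 p d,
        (∀ η, ∀ᵐ q ∂cylMeasure T, sobolevComp (mkIdx 0 0 (by norm_num)) (D η) q =
          sobolevComp (mkIdx 1 0 (by norm_num)) η q +
            stdJ (sobolevComp (mkIdx 0 1 (by norm_num)) η q) -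
              k q • projY (sobolevComp (mkIdx 0 0 (by norm_num)) η q)) ∧
        ∃ Q : weightedSobolev T 1 p d →L[ℝ] weightedSobolev T 2 p d,
          D.comp Q = ContinuousLinearMap.id ℝ _ ∧ Q.comp D = ContinuousLinearMap.id ℝ _ ∧
          ‖Q‖ ≤ C := by
  obtain ⟨C, hC, hsolve⟩ := exists_modelOp_eq (M := M) hT hκ hd0 hd hp1 hp
  refine ⟨C, hC, fun k hk => ?_⟩
  obtain ⟨D, hD⟩ := exists_modelOp (p := p) (d := d) hk
  refine ⟨D, hD, ?_⟩
  have hsurj : ∀ f, ∃ ξ, D ξ = f ∧ ‖ξ‖ ≤ C * ‖f‖ := fun f => by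
    obtain ⟨ξ, hξ, e⟩ := hsolve k hk f
    refine ⟨ξ, sobolev_ext_fst hT hp (Lp.ext ?_), hξ⟩
    refine (weightedMeasure_absolutelyContinuous T p d).ae_le ?_
    filter_upwards [hD ξ, e] with q h1 h2
    exact h1.trans h2.symm
  have hinj : Function.Injective D := fun ξ ξ' h => by
    have w := isWeakSolution_of_weakDeriv hk.toIsCylMap
      (isWeakDeriv_fst ξ (mkIdx 0 0 (by norm_num)) (mkIdx 1 0 (by norm_num)) rfl rfl)
      (isWeakDeriv_snd ξ (mkIdx 0 0 (by norm_num)) (mkIdx 0 1 (by norm_num)) rfl rfl) (hD ξ)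
    have w' := isWeakSolution_of_weakDeriv hk.toIsCylMap
      (isWeakDeriv_fst ξ' (mkIdx 0 0 (by norm_num)) (mkIdx 1 0 (by norm_num)) rfl rfl)
      (isWeakDeriv_snd ξ' (mkIdx 0 0 (by norm_num)) (mkIdx 0 1 (by norm_num)) rfl rfl) (hD ξ')
    rw [h] at w
    exact sobolev_ext_fst hT hp (w.unique hT hκ hd0 hd hp1 hp hk w')
  set e := LinearEquiv.ofBijective D.toLinearMap ⟨hinj, fun f => (hsurj f).imp fun _ h => h.1⟩
    with he
  have hDe : ∀ f, D (e.symm f) = f := fun f => e.apply_symm_apply f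
  have hn : ∀ f, ‖e.symm f‖ ≤ C * ‖f‖ := fun f => by
    obtain ⟨ξ, h1, h2⟩ := hsurj f
    rwa [hinj ((hDe f).trans h1.symm)]
  exact ⟨e.symm.toLinearMap.mkContinuous C hn, ContinuousLinearMap.ext hDe,
    ContinuousLinearMap.ext fun ξ => e.symm_apply_apply ξ, LinearMap.mkContinuous_norm_le _ hC _⟩

end FirstOrder

/-- A small perturbation of an invertible operator is invertible. -/
lemma exists_inverse_add {E F : Type*} [NormedAddCommGroup E] [NormedSpace ℝ E] [CompleteSpace E]
    [NormedAddCommGroup F] [NormedSpace ℝ F] {D P : E →L[ℝ] F} {Q : F →L[ℝ] E}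
    (h1 : D.comp Q = ContinuousLinearMap.id ℝ _) (h2 : Q.comp D = ContinuousLinearMap.id ℝ _)
    {C : ℝ} (hC : ‖Q‖ ≤ C) (hP : C * ‖P‖ ≤ 1 / 2) :
    ∃ R : F →L[ℝ] E, (D + P).comp R = ContinuousLinearMap.id ℝ _ ∧
      R.comp (D + P) = ContinuousLinearMap.id ℝ _ ∧ ‖R‖ ≤ 2 * C := by
  have hQP : ‖-(Q.comp P)‖ ≤ 1 / 2 := by
    rw [norm_neg]
    exact (Q.opNorm_comp_le P).trans ((mul_le_mul_of_nonneg_right hC (norm_nonneg _)).trans hP)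
  have hlt : ‖-(Q.comp P)‖ < 1 := hQP.trans_lt (by norm_num)
  set u : (E →L[ℝ] E)ˣ := Units.oneSub (-(Q.comp P)) hlt with hu
  have hu1 : (u : E →L[ℝ] E) = ContinuousLinearMap.id ℝ E + Q.comp P := by
    rw [hu, Units.val_oneSub, sub_neg_eq_add]; rfl
  have hQD : Q.comp (D + P) = u := by rw [ContinuousLinearMap.comp_add, h2, hu1]
  have hDu : D.comp (u : E →L[ℝ] E) = D + P := by
    rw [← hQD, ← ContinuousLinearMap.comp_assoc, h1, ContinuousLinearMap.id_comp]
  set v : E →L[ℝ] E := ((u⁻¹ : (E →L[ℝ] E)ˣ) : E →L[ℝ] E) with hv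
  have huv : (u : E →L[ℝ] E).comp v = ContinuousLinearMap.id ℝ E := u.mul_inv
  have hvu : v.comp (u : E →L[ℝ] E) = ContinuousLinearMap.id ℝ E := u.inv_mul
  refine ⟨v.comp Q, ?_, ?_, ?_⟩
  · rw [← hDu, ContinuousLinearMap.comp_assoc, ← ContinuousLinearMap.comp_assoc _ v, huv,
      ContinuousLinearMap.id_comp, h1]
  · rw [ContinuousLinearMap.comp_assoc, hQD, hvu]
  · have hvn : ∀ x, ‖v x‖ ≤ 2 * ‖x‖ := fun x => by
      have e1 : v x + Q (P (v x)) = x := by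
        have := congrArg (fun L : E →L[ℝ] E => L x) huv
        rw [hu1] at this
        exact this
      have e2 : ‖Q (P (v x))‖ ≤ 1 / 2 * ‖v x‖ := by
        rw [norm_neg] at hQP
        exact (Q.comp P).le_of_opNorm_le hQP (v x)
      have e3 : ‖v x‖ ≤ ‖x‖ + ‖Q (P (v x))‖ := by
        have := norm_sub_le x (Q (P (v x)))
        rwa [← eq_sub_of_add_eq e1] at this
      linarith
    refine ContinuousLinearMap.opNorm_le_bound _ (by linarith [(norm_nonneg Q).trans hC])
      fun x => ?_
    have := Q.le_of_opNorm_le hC x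
    have := hvn (Q x)
    change ‖v (Q x)‖ ≤ _
    linarith

/-! ### Reeb vector fields -/

@[simp] lemma dirA_apply (i : Fin 4) : dirA i = if i = 0 then 1 else 0 := by
  simp [dirA]
@[simp] lemma dirZ_apply (i : Fin 4) : dirZ i = if i = 1 then 1 else 0 := by
  simp [dirZ]
@[simp] lemma dirX_apply (i : Fin 4) : dirX i = if i = 2 then 1 else 0 := by
  simp [dirX]
@[simp] lemma dirY_apply (i : Fin 4) : dirY i = if i = 3 then 1 else 0 := by
  simp [dirY]

lemma eq_sum_dir (v : E4) : v = v 0 • dirA + v 1 • dirZ + v 2 • dirX + v 3 • dirY := by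
  ext i
  fin_cases i <;> simp

lemma isOpen_nbhd (ε : ℝ) : IsOpen (nbhd ε) := by
  refine isOpen_lt (Continuous.abs ?_) continuous_const
  exact (coordForm 3).continuous

lemma hasFDerivAt_coord (i : Fin 4) (q : E4) : HasFDerivAt (fun q : E4 => q i) (coordForm i) q :=
  (coordForm i).hasFDerivAt

lemma stdForm_apply (q w : E4) : stdForm q w = w 1 - q 3 * w 2 := by simp [stdForm]

lemma hasFDerivAt_stdForm (q : E4) :
    HasFDerivAt stdForm (-(coordForm 3).smulRight (coordForm 2)) q := by
  have := ((hasFDerivAt_coord 3 q).smul_const (coordForm 2)).const_sub (coordForm 1)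
  exact this

lemma extDer_smul_stdForm {H : E4 → ℝ} {H' : E4 →L[ℝ] ℝ} {q : E4} (hH : HasFDerivAt H H' q)
    (v w : E4) : extDer (fun q => H q • stdForm q) q v w =
      H' v * stdForm q w - H' w * stdForm q v + H q * (v 2 * w 3 - v 3 * w 2) := by
  have := (hH.fun_smul (hasFDerivAt_stdForm q)).fderiv
  rw [extDer, this]
  simp [ContinuousLinearMap.smulRight_apply]
  ring

lemma IsReebVector.eq {H : E4 → ℝ} {H' : E4 →L[ℝ] ℝ} {q v : E4} (hH : HasFDerivAt H H' q)
    (hq : H q ≠ 0) (hv : IsReebVector (fun q => H q • stdForm q) q v) :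
    v = (1 / H q + q 3 * (H' dirY / H q ^ 2)) • dirZ + (H' dirY / H q ^ 2) • dirX -
      ((H' dirX + q 3 * H' dirZ) / H q ^ 2) • dirY := by
  obtain ⟨h0, h1, h2⟩ := hv
  have e1 : stdForm q v = 1 / H q := by
    rw [eq_div_iff hq, mul_comm]
    exact h1
  have eY := h2 dirY
  have eX := h2 (dirX + q 3 • dirZ)
  rw [extDer_smul_stdForm hH, e1, stdForm_apply] at eY eX
  simp at eY eX
  have hx : v 2 = H' dirY / H q ^ 2 := by
    field_simp at eY ⊢
    linarith
  have hy : v 3 = -((H' dirX + q 3 * H' dirZ) / H q ^ 2) := by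
    field_simp at eX ⊢
    linarith
  rw [stdForm_apply, hx] at e1
  rw [eq_sum_dir v, h0, hx, hy, show v 1 = 1 / H q + q 3 * (H' dirY / H q ^ 2) by linarith]
  module

section Profile
variable {T ε : ℝ} {h : ℝ × ℝ × ℝ → ℝ}

/-- The linear map `(a, z, x, y) ↦ (x, y, z)`. -/
def toProfile : E4 →L[ℝ] ℝ × ℝ × ℝ := (coordForm 2).prod ((coordForm 3).prod (coordForm 1))

/-- The conformal factor as a function on `ℝ⁴`. -/
def profile (h : ℝ × ℝ × ℝ → ℝ) (q : E4) : ℝ := h (q 2, q 3, q 1)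

lemma IsMorseBottNormalForm.contDiffOn_profile (hh : IsMorseBottNormalForm T ε h) :
    ContDiffOn ℝ ∞ (profile h) (nbhd ε) :=
  hh.smooth.comp (f := toProfile) toProfile.contDiff.contDiffOn fun _ hq => hq

lemma IsMorseBottNormalForm.contDiffAt_profile (hh : IsMorseBottNormalForm T ε h) {q : E4}
    (hq : q ∈ nbhd ε) : ContDiffAt ℝ ∞ (profile h) q :=
  hh.contDiffOn_profile.contDiffAt ((isOpen_nbhd ε).mem_nhds hq)

lemma IsMorseBottNormalForm.profile_pos (hh : IsMorseBottNormalForm T ε h) {q : E4}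
    (hq : q ∈ nbhd ε) : 0 < profile h q := hh.pos _ _ _ hq

lemma mem_nbhd (hε : 0 < ε) {q : E4} (hq : q 3 = 0) : q ∈ nbhd ε := by
  change |q 3| < ε
  rwa [hq, abs_zero]

lemma IsMorseBottNormalForm.profile_eq_one (hh : IsMorseBottNormalForm T ε h) {q : E4}
    (hq : q 3 = 0) : profile h q = 1 := by
  rw [profile, hq]
  exact hh.eq_one _ _

lemma IsMorseBottNormalForm.fderiv_profile (hh : IsMorseBottNormalForm T ε h) (hε : 0 < ε) {q : E4}
    (hq : q 3 = 0) : fderiv ℝ (profile h) q = 0 := by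
  have hd : DifferentiableAt ℝ h (toProfile q) := by
    refine (hh.smooth.contDiffAt ?_).differentiableAt (by simp)
    refine IsOpen.mem_nhds (isOpen_lt (by fun_prop) continuous_const) ?_
    change |q 3| < ε
    rwa [hq, abs_zero]
  have := (hd.hasFDerivAt.comp q toProfile.hasFDerivAt).fderiv
  have e : fderiv ℝ h (toProfile q) = 0 := by
    have : toProfile q = (q 2, 0, q 1) := by rw [← hq]; rfl
    rw [this]
    exact hh.deriv_eq_zero _ _
  rw [e, ContinuousLinearMap.zero_comp] at this
  exact this

/-- The Hessian of the conformal factor in the normal direction. -/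
def normalHess (h : ℝ × ℝ × ℝ → ℝ) (q : E4) : ℝ :=
  fderiv ℝ (fderiv ℝ (profile h)) q dirY dirY

lemma IsMorseBottNormalForm.hess_tangent (hh : IsMorseBottNormalForm T ε h) (hε : 0 < ε) {q : E4}
    (hq : q 3 = 0) {u : E4} (hu : u 3 = 0) : fderiv ℝ (fderiv ℝ (profile h)) q u = 0 := by
  have hd : DifferentiableAt ℝ (fderiv ℝ (profile h)) q :=
    ((hh.contDiffAt_profile (mem_nbhd hε hq)).fderiv_right (m := ∞) le_rfl).differentiableAt (by simp)
  have h1 : HasDerivAt (fun r : ℝ => q + r • u) u 0 := by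
    simpa using ((hasDerivAt_id (0 : ℝ)).smul_const u).const_add q
  have h2 : HasFDerivAt (fderiv ℝ (profile h)) (fderiv ℝ (fderiv ℝ (profile h)) q)
      (q + (0 : ℝ) • u) := by simpa using hd.hasFDerivAt
  have h3 := h2.comp_hasDerivAt (0 : ℝ) h1
  have h4 : (fderiv ℝ (profile h) ∘ fun r : ℝ => q + r • u) = fun _ => 0 := by
    funext r
    exact hh.fderiv_profile hε (by simp [hq, hu])
  rw [h4] at h3
  exact h3.unique (hasDerivAt_const _ _)

lemma IsMorseBottNormalForm.hess_eq (hh : IsMorseBottNormalForm T ε h) (hε : 0 < ε) {q : E4}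
    (hq : q 3 = 0) (u v : E4) :
    fderiv ℝ (fderiv ℝ (profile h)) q u v = normalHess h q * u 3 * v 3 := by
  have hsymm : IsSymmSndFDerivAt ℝ (profile h) q :=
    (hh.contDiffAt_profile (mem_nbhd hε hq)).isSymmSndFDerivAt (by
      simp only [minSmoothness_of_isRCLikeNormedField]; exact ENat.LEInfty.out)
  set A := fderiv ℝ (fderiv ℝ (profile h)) q with hA
  have key : ∀ u : E4, A u = u 3 • A dirY := fun u => by
    have : A (u - u 3 • dirY) = 0 := hh.hess_tangent hε hq (by simp)
    rwa [map_sub, map_smul, sub_eq_zero] at this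
  rw [key u]
  change u 3 * A dirY v = _
  rw [hsymm.eq dirY v]
  change u 3 * A v dirY = A dirY dirY * _ * _
  rw [key v]
  change u 3 * (v 3 * A dirY dirY) = _
  ring

/-- A Reeb vector field along the torus. -/
lemma IsMorseBottNormalForm.reeb_torus (hh : IsMorseBottNormalForm T ε h) (hε : 0 < ε)
    {R : E4 → E4} (hR : ∀ q ∈ nbhd ε, IsReebVector (contactForm h) q (R q)) {q : E4}
    (hq : q 3 = 0) :
    R q = dirZ ∧ HasFDerivAt R (normalHess h q • (coordForm 3).smulRight dirX) q := by
  have hqn := mem_nbhd hε hq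
  have hRq : ∀ q ∈ nbhd ε, R q = (1 / profile h q + q 3 * (fderiv ℝ (profile h) q dirY /
      profile h q ^ 2)) • dirZ + (fderiv ℝ (profile h) q dirY / profile h q ^ 2) • dirX -
      ((fderiv ℝ (profile h) q dirX + q 3 * fderiv ℝ (profile h) q dirZ) /
        profile h q ^ 2) • dirY := fun q hq =>
    IsReebVector.eq ((hh.contDiffAt_profile hq).differentiableAt (by simp)).hasFDerivAt
      (hh.profile_pos hq).ne' (hR q hq)
  have d0 := hh.fderiv_profile hε hq
  have h1 := hh.profile_eq_one hq
  refine ⟨?_, ?_⟩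
  · rw [hRq q hqn, d0, h1]
    simp
  have hP : HasFDerivAt (profile h) (0 : E4 →L[ℝ] ℝ) q := by
    rw [← d0]
    exact ((hh.contDiffAt_profile hqn).differentiableAt (by simp)).hasFDerivAt
  have hd : DifferentiableAt ℝ (fderiv ℝ (profile h)) q :=
    ((hh.contDiffAt_profile hqn).fderiv_right (m := ∞) le_rfl).differentiableAt
      (by simp)
  have hΦ : ∀ v : E4, HasFDerivAt (fun q => fderiv ℝ (profile h) q v)
      ((normalHess h q * v 3) • coordForm 3 : E4 →L[ℝ] ℝ) q := fun v => by
    refine (HasFDerivAt.clm_apply (c := fderiv ℝ (profile h)) (u := fun _ => v) hd.hasFDerivAt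
      (hasFDerivAt_const v q)).congr_fderiv ?_
    ext u
    simp [hh.hess_eq hε hq]
    ring
  have hinv : HasFDerivAt (fun q => (profile h q)⁻¹) (0 : E4 →L[ℝ] ℝ) q := by
    have := (hasDerivAt_inv (x := profile h q) (by rw [h1]; simp)).comp_hasFDerivAt q hP
    rw [smul_zero] at this
    exact this
  have h3 := hasFDerivAt_coord 3 q
  have hi2 := hinv.mul hinv
  have A := (hΦ dirY).mul hi2
  have B := ((hΦ dirX).add (h3.mul (hΦ dirZ))).mul hi2
  have C := ((hinv.add (h3.mul A)).smul_const dirZ).add (A.smul_const dirX)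
  have := C.sub (B.smul_const dirY)
  refine (this.congr_of_eventuallyEq ?_).congr_fderiv ?_
  · filter_upwards [(isOpen_nbhd ε).mem_nhds hqn] with q hq
    rw [hRq q hq]
    simp only [Pi.add_apply, Pi.mul_apply, div_eq_mul_inv, one_mul, pow_two, mul_inv]
    rfl
  · ext u i
    simp [h1, d0, hq]

end Profile

/-! ### Compatible almost complex structures along the torus -/

section Structures
variable {T ε δ ε' : ℝ} {h : ℝ × ℝ × ℝ → ℝ} {f g : ℝ → ℝ} {J Jδ : E4 → E4 →L[ℝ] E4} {q : E4}

lemma IsCompatibleACS.differentiableAt {α : E4 → E4 →L[ℝ] ℝ} (hJ : IsCompatibleACS T ε α J)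
    (hq : q ∈ nbhd ε) : DifferentiableAt ℝ J q :=
  (hJ.smooth.contDiffAt ((isOpen_nbhd ε).mem_nhds hq)).differentiableAt (by simp)

lemma IsCompatibleACS.dirZ_torus (hh : IsMorseBottNormalForm T ε h) (hε : 0 < ε)
    (hJ : IsCompatibleACS T ε (contactForm h) J) (hJX : ∀ q : E4, q 3 = 0 → J q dirX = dirY)
    (hq : q 3 = 0) : J q dirZ = -dirA ∧
      HasFDerivAt (fun q => J q dirZ) (-(normalHess h q • projY)) q := by
  have hqn := mem_nbhd hε hq
  obtain ⟨hR, hR'⟩ := hh.reeb_torus hε hJ.reeb hq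
  have h1 := hh.profile_eq_one hq
  refine ⟨by rw [← hR, hJ.sq q hqn], ?_⟩
  have hP : HasFDerivAt (profile h) (0 : E4 →L[ℝ] ℝ) q := by
    rw [← hh.fderiv_profile hε hq]
    exact ((hh.contDiffAt_profile hqn).differentiableAt (by simp)).hasFDerivAt
  have a1 := (hP.fun_smul hR').const_sub dirZ
  have a2 := ((hJ.differentiableAt hqn).hasFDerivAt.clm_apply a1).sub (hP.smul_const dirA)
  refine (a2.congr_of_eventuallyEq ?_).congr_fderiv ?_
  · filter_upwards [(isOpen_nbhd ε).mem_nhds hqn] with q hq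
    simp only [Pi.sub_apply, map_sub, map_smul, hJ.sq q hq]
    module
  · ext1 u
    simp [h1, hR, hJX q hq, projY]

lemma hasFDerivAt_perturbed (hf : IsMorseOnCircle f) (hh : IsMorseBottNormalForm T ε h)
    (hg : ∀ y, |y| ≤ ε' → g y = 1) (hq : q ∈ nbhd ε) (hq' : |q 3| < ε') (δ : ℝ) :
    HasFDerivAt (fun q : E4 => Real.exp (δ * g (q 3) * f (q 2)) * profile h q)
      (Real.exp (δ * f (q 2)) • (fderiv ℝ (profile h) q +
        (profile h q * (δ * deriv f (q 2))) • coordForm 2)) q := by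
  have h1 : HasDerivAt (fun x => Real.exp (δ * f x))
      (Real.exp (δ * f (q 2)) * (δ * deriv f (q 2))) (q 2) :=
    ((hf.smooth.differentiable (by simp) _).hasDerivAt.const_mul δ).exp
  have h2 := h1.comp_hasFDerivAt q (hasFDerivAt_coord 2 q)
  have h3 := h2.mul ((hh.contDiffAt_profile hq).differentiableAt (by simp)).hasFDerivAt
  refine (h3.congr_of_eventuallyEq ?_).congr_fderiv ?_
  · have : IsOpen {q : E4 | |q 3| < ε'} := isOpen_nbhd ε'
    filter_upwards [this.mem_nhds hq'] with q hq
    rw [hg _ (le_of_lt hq), mul_one]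
    rfl
  · ext1 u
    simp
    ring

lemma perturbedForm_eq (h : ℝ × ℝ × ℝ → ℝ) (f g : ℝ → ℝ) (δ : ℝ) : perturbedForm h f g δ =
    fun q => (Real.exp (δ * g (q 3) * f (q 2)) * profile h q) • stdForm q := by
  funext q
  exact smul_smul _ _ _

lemma IsReebVector.perturbed (hf : IsMorseOnCircle f) (hh : IsMorseBottNormalForm T ε h)
    (hg : ∀ y, |y| ≤ ε' → g y = 1) (hq : q ∈ nbhd ε) (hq' : |q 3| < ε') {v w : E4}
    (hv : IsReebVector (contactForm h) q v) (hw : IsReebVector (perturbedForm h f g δ) q w) :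
    (Real.exp (δ * f (q 2)) * profile h q) • w =
      profile h q • v - (δ * deriv f (q 2)) • dirY := by
  have hpos := hh.profile_pos hq
  have hE := Real.exp_pos (δ * f (q 2))
  have e1 := IsReebVector.eq ((hh.contDiffAt_profile hq).differentiableAt (by simp)).hasFDerivAt
    hpos.ne' hv
  rw [perturbedForm_eq] at hw
  have e2 := IsReebVector.eq (hasFDerivAt_perturbed hf hh hg hq hq' δ) (by positivity) hw
  rw [hg _ hq'.le, mul_one] at e2
  rw [e1, e2]
  ext i
  fin_cases i <;> simp <;> field_simp
  ring

lemma IsCompatibleACS.perturbed_dirZ (hf : IsMorseOnCircle f) (hh : IsMorseBottNormalForm T ε h)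
    (hJ : IsCompatibleACS T ε (contactForm h) J)
    (hJδ : IsCompatibleACS T ε (perturbedForm h f g δ) Jδ)
    (hJJ : ∀ q ∈ nbhd ε, ∀ w, InContactPlane (contactForm h) q w → Jδ q w = J q w)
    (hg : ∀ y, |y| ≤ ε' → g y = 1) (hq : q ∈ nbhd ε) (hq' : |q 3| < ε') :
    Jδ q dirZ = J q dirZ + (profile h q - Real.exp (δ * f (q 2)) * profile h q) • dirA +
      (δ * deriv f (q 2)) • J q dirY := by
  have hR := hJ.reeb q hq
  have e := hR.perturbed hf hh hg hq hq' (hJδ.reeb q hq)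
  set w : E4 := dirZ - profile h q • J q dirA + (δ * deriv f (q 2)) • dirY with hw
  have hplane : InContactPlane (contactForm h) q w := by
    have h1 : profile h q * stdForm q (J q dirA) = 1 := hR.2.1
    refine ⟨by simp [hw, hR.1], ?_⟩
    change profile h q * stdForm q w = 0
    rw [hw, map_add, map_sub, map_smul, smul_eq_mul, h1]
    simp [stdForm_apply]
  have h2 : dirZ = (Real.exp (δ * f (q 2)) * profile h q) • Jδ q dirA + w := by
    rw [e, hw]
    module
  have h3 := hJJ q hq w hplane
  have h4 : Jδ q dirZ = (Real.exp (δ * f (q 2)) * profile h q) • Jδ q (Jδ q dirA) + Jδ q w := by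
    rw [← map_smul, ← map_add, ← h2]
  rw [h4, hJδ.sq q hq, h3, hw, map_add, map_sub, map_smul, map_smul, hJ.sq q hq]
  module

/-- The zeroth order part of the deviation of the perturbed structure from the model. -/
def deviation₁ (f : ℝ → ℝ) (δ x : ℝ) : E4 →L[ℝ] E4 :=
  (coordForm 0).smulRight ((Real.exp (-(δ * f x)) - 1) • dirZ -
    (Real.exp (-(δ * f x)) * (δ * deriv f x)) • dirY) +
  (coordForm 1).smulRight ((1 - Real.exp (δ * f x)) • dirA - (δ * deriv f x) • dirX)

/-- The derivative part of the deviation of the perturbed structure from the model. -/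
def deviation₀ (f : ℝ → ℝ) (J : E4 → E4 →L[ℝ] E4) (δ : ℝ) (q : E4) : E4 →L[ℝ] E4 :=
  (δ * deriv f (q 2)) • (fderiv ℝ J q).flip dirY -
    (coordForm 2).smulRight ((Real.exp (δ * f (q 2)) * (δ * deriv f (q 2))) • dirA +
      (δ * deriv (deriv f) (q 2)) • dirX)

lemma IsCompatibleACS.perturbed_torus (hf : IsMorseOnCircle f) (hh : IsMorseBottNormalForm T ε h)
    (hε : 0 < ε) (hJ : IsCompatibleACS T ε (contactForm h) J)
    (hJX : ∀ q : E4, q 3 = 0 → J q dirX = dirY)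
    (hJδ : IsCompatibleACS T ε (perturbedForm h f g δ) Jδ)
    (hJJ : ∀ q ∈ nbhd ε, ∀ w, InContactPlane (contactForm h) q w → Jδ q w = J q w)
    (hg : ∀ y, |y| ≤ ε' → g y = 1) (hε' : 0 < ε') (hq : q 3 = 0) :
    Jδ q = stdJ + deviation₁ f δ (q 2) ∧
      ∀ η, fderiv ℝ Jδ q η dirZ = -(normalHess h q • projY η) + deviation₀ f J δ q η := by
  have hqn := mem_nbhd hε hq
  have hq' : |q 3| < ε' := by rwa [hq, abs_zero]
  have hJY : J q dirY = -dirX := by rw [← hJX q hq, hJ.sq q hqn]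
  obtain ⟨hZ, hZ'⟩ := hJ.dirZ_torus hh hε hJX hq
  have h1 := hh.profile_eq_one hq
  have hX : Jδ q dirX = dirY := by
    rw [hJJ q hqn dirX ⟨by simp, by simp [contactForm, stdForm_apply, hq]⟩, hJX q hq]
  have hY : Jδ q dirY = -dirX := by
    rw [hJJ q hqn dirY ⟨by simp, by simp [contactForm, stdForm_apply]⟩, hJY]
  have hz := hJ.perturbed_dirZ hf hh hJδ hJJ hg hqn hq'
  rw [hZ, h1, hJY] at hz
  have ha : Jδ q dirA = Real.exp (-(δ * f (q 2))) • (dirZ - (δ * deriv f (q 2)) • dirY) := by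
    have := (hJ.reeb q hqn).perturbed hf hh hg hqn hq' (hJδ.reeb q hqn)
    rw [h1, (hh.reeb_torus hε hJ.reeb hq).1, mul_one, one_smul] at this
    rw [← this, smul_smul, ← Real.exp_add]
    simp
  refine ⟨?_, fun η => ?_⟩
  · ext1 w
    rw [eq_sum_dir w]
    simp only [map_add, map_smul, ha, hz, hX, hY]
    ext i
    fin_cases i <;> simp [deviation₁] <;> ring
  · have hP : HasFDerivAt (profile h) (0 : E4 →L[ℝ] ℝ) q := by
      rw [← hh.fderiv_profile hε hq]
      exact ((hh.contDiffAt_profile hqn).differentiableAt (by simp)).hasFDerivAt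
    have b1 : HasFDerivAt (fun q : E4 => Real.exp (δ * f (q 2)))
        ((Real.exp (δ * f (q 2)) * (δ * deriv f (q 2))) • coordForm 2 : E4 →L[ℝ] ℝ) q :=
      HasDerivAt.comp_hasFDerivAt (f := fun q : E4 => q 2) q
        (((hf.smooth.differentiable (by simp) _).hasDerivAt.const_mul δ).exp) (hasFDerivAt_coord 2 q)
    have hf' : ContDiff ℝ ∞ (deriv f) := (contDiff_infty_iff_deriv.1 hf.smooth).2
    have b2 : HasFDerivAt (fun q : E4 => δ * deriv f (q 2))
        ((δ * deriv (deriv f) (q 2)) • coordForm 2 : E4 →L[ℝ] ℝ) q :=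
      HasDerivAt.comp_hasFDerivAt (f := fun q : E4 => q 2) q
        ((hf'.differentiable (by simp) _).hasDerivAt.const_mul δ) (hasFDerivAt_coord 2 q)
    have b3 : HasFDerivAt (fun q => J q dirY) ((fderiv ℝ J q).flip dirY) q := by
      refine ((hJ.differentiableAt hqn).hasFDerivAt.clm_apply
        (hasFDerivAt_const dirY q)).congr_fderiv ?_
      ext1 u
      simp
    have b4 : HasFDerivAt (fun q => Jδ q dirZ) ((fderiv ℝ Jδ q).flip dirZ) q := by
      refine ((hJδ.differentiableAt hqn).hasFDerivAt.clm_apply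
        (hasFDerivAt_const dirZ q)).congr_fderiv ?_
      ext1 u
      simp
    have b5 := (hZ'.add ((hP.sub (b1.mul hP)).smul_const dirA)).add (b2.fun_smul b3)
    have b6 := b4.unique (b5.congr_of_eventuallyEq (by
      have : IsOpen {q : E4 | |q 3| < ε'} := isOpen_nbhd ε'
      filter_upwards [(isOpen_nbhd ε).mem_nhds hqn, this.mem_nhds hq'] with q hq hq'
      exact hJ.perturbed_dirZ hf hh hJδ hJJ hg hq hq'))
    have b7 := congrArg (fun L : E4 →L[ℝ] E4 => L η) b6
    refine Eq.trans b7 ?_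
    simp [h1, hJY, deviation₀]
    module

end Structures

/-! ### Families of functions on the torus -/

section Families
variable {F : Type*} [NormedAddCommGroup F] [NormedSpace ℝ F] {T : ℝ}

/-- A smooth family, with a real parameter, of functions on `ℝ/ℤ × ℝ/Tℤ`. -/
structure IsTorusFamily (T : ℝ) (G : ℝ × ℝ × ℝ → F) : Prop where
  smooth : ContDiff ℝ ∞ G
  periodic_x : ∀ δ x z, G (δ, x + 1, z) = G (δ, x, z)
  periodic_z : ∀ δ x z, G (δ, x, z + T) = G (δ, x, z)

omit [NormedAddCommGroup F] [NormedSpace ℝ F] in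
lemma exists_torus_rep (hT : 0 < T) {H : ℝ → ℝ → F} (h1 : ∀ x z, H (x + 1) z = H x z)
    (h2 : ∀ x z, H x (z + T) = H x z) (x z : ℝ) :
    ∃ x' ∈ Icc (0 : ℝ) 1, ∃ z' ∈ Icc 0 T, H x z = H x' z' := by
  obtain ⟨x', hx', e1⟩ := Function.Periodic.exists_mem_Ico₀ (f := fun x => H x z) (c := 1)
    (fun x => h1 x z) one_pos x
  obtain ⟨z', hz', e2⟩ := Function.Periodic.exists_mem_Ico₀ (f := fun z => H x' z) (c := T)
    (fun z => h2 x' z) hT z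
  exact ⟨x', Ico_subset_Icc_self hx', z', Ico_subset_Icc_self hz', e1.trans e2⟩

variable {G : ℝ × ℝ × ℝ → F}

lemma IsTorusFamily.exists_bound (hG : IsTorusFamily T G) (hT : 0 < T) :
    ∃ B : ℝ, 0 ≤ B ∧ ∀ δ ∈ Icc (0 : ℝ) 1, ∀ x z, ‖G (δ, x, z)‖ ≤ B := by
  obtain ⟨B, hB⟩ := (isCompact_Icc.prod (isCompact_Icc.prod isCompact_Icc) :
    IsCompact (Icc (0 : ℝ) 1 ×ˢ Icc (0 : ℝ) 1 ×ˢ Icc (0 : ℝ) T)).exists_bound_of_continuousOn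
    hG.smooth.continuous.continuousOn
  refine ⟨max B 0, le_max_right _ _, fun δ hδ x z => ?_⟩
  obtain ⟨x', hx', z', hz', e⟩ := exists_torus_rep (H := fun x z => G (δ, x, z)) hT
    (fun x z => hG.periodic_x δ x z) (fun x z => hG.periodic_z δ x z) x z
  change G (δ, x, z) = G (δ, x', z') at e
  rw [e]
  exact (hB _ ⟨hδ, hx', hz'⟩).trans (le_max_left _ _)

lemma IsTorusFamily.fderiv_apply (hG : IsTorusFamily T G) (u : ℝ × ℝ × ℝ) :
    IsTorusFamily T fun r => fderiv ℝ G r u where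
  smooth := (hG.smooth.fderiv_right (m := ∞) le_rfl).clm_apply contDiff_const
  periodic_x δ x z := by
    have h : (fun r : ℝ × ℝ × ℝ => G (r + (0, 1, 0))) = G := by
      funext ⟨a, b, c⟩
      simpa using hG.periodic_x a b c
    have := fderiv_comp_add_right (𝕜 := ℝ) (f := G) (x := (δ, x, z)) (0, 1, 0)
    rw [h] at this
    rw [this]
    simp
  periodic_z δ x z := by
    have h : (fun r : ℝ × ℝ × ℝ => G (r + (0, 0, T))) = G := by
      funext ⟨a, b, c⟩
      simpa using hG.periodic_z a b c
    have := fderiv_comp_add_right (𝕜 := ℝ) (f := G) (x := (δ, x, z)) (0, 0, T)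
    rw [h] at this
    rw [this]
    simp

lemma IsTorusFamily.exists_linear_bound (hG : IsTorusFamily T G) (hT : 0 < T)
    (h0 : ∀ x z, G (0, x, z) = 0) :
    ∃ B : ℝ, 0 ≤ B ∧ ∀ δ ∈ Icc (0 : ℝ) 1, ∀ x z, ‖G (δ, x, z)‖ ≤ B * δ := by
  obtain ⟨B, hB0, hB⟩ := (hG.fderiv_apply (1, 0, 0)).exists_bound hT
  refine ⟨B, hB0, fun δ hδ x z => ?_⟩
  have hd : ∀ τ : ℝ, HasDerivAt (fun τ => G (τ, x, z)) (fderiv ℝ G (τ, x, z) (1, 0, 0)) τ :=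
    fun τ => HasFDerivAt.comp_hasDerivAt τ
      ((hG.smooth.differentiable (by simp)).differentiableAt.hasFDerivAt)
      ((hasDerivAt_id τ).prodMk ((hasDerivAt_const τ x).prodMk (hasDerivAt_const τ z)))
  have := (convex_Icc (0 : ℝ) 1).norm_image_sub_le_of_norm_hasDerivWithin_le
    (f := fun τ => G (τ, x, z)) (fun τ _ => (hd τ).hasDerivWithinAt) (fun τ hτ => hB τ hτ x z)
    (left_mem_Icc.2 zero_le_one) hδ
  simp only [h0, sub_zero, Real.norm_eq_abs, abs_of_nonneg hδ.1] at this
  exact this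

lemma IsTorusFamily.isCylMap (hG : IsTorusFamily T G) {x : ℝ → ℝ} (hx : ContDiff ℝ ∞ x)
    (δ c : ℝ) : IsCylMap T fun q : ℝ × ℝ => G (δ, x q.1, q.2 + c) := by
  refine ⟨hG.smooth.comp (by fun_prop), fun s t => ?_⟩
  change G (δ, x s, t + T + c) = _
  rw [add_right_comm]
  exact hG.periodic_z _ _ _

lemma IsTorusFamily.pd_eq (hG : IsTorusFamily T G) {x : ℝ → ℝ} (hx : ContDiff ℝ ∞ x)
    (δ c : ℝ) (e q : ℝ × ℝ) : pd e (fun q : ℝ × ℝ => G (δ, x q.1, q.2 + c)) q =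
      (e.1 * deriv x q.1) • fderiv ℝ G (δ, x q.1, q.2 + c) (0, 1, 0) +
        e.2 • fderiv ℝ G (δ, x q.1, q.2 + c) (0, 0, 1) := by
  have h1 : HasFDerivAt (fun q : ℝ × ℝ => x q.1)
      (deriv x q.1 • ContinuousLinearMap.fst ℝ ℝ ℝ) q :=
    HasDerivAt.comp_hasFDerivAt (f := fun q : ℝ × ℝ => q.1) q
      (hx.differentiable (by simp) _).hasDerivAt hasFDerivAt_fst
  have h2 : HasFDerivAt (fun q : ℝ × ℝ => q.2 + c) (ContinuousLinearMap.snd ℝ ℝ ℝ) q :=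
    hasFDerivAt_snd.add_const c
  have h3 := HasFDerivAt.comp (f := fun q : ℝ × ℝ => (δ, x q.1, q.2 + c)) q
    ((hG.smooth.differentiable (by simp)).differentiableAt.hasFDerivAt)
    ((hasFDerivAt_const δ q).prodMk (h1.prodMk h2))
  have h4 := congrArg (fun L : ℝ × ℝ →L[ℝ] F => L e) h3.fderiv
  refine Eq.trans h4 ?_
  rw [← map_smul, ← map_smul, ← map_add]
  simp [mul_comm]

lemma IsTorusFamily.norm_pd_fst (hG : IsTorusFamily T G) {x : ℝ → ℝ} (hx : ContDiff ℝ ∞ x)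
    (δ c : ℝ) (q : ℝ × ℝ) : ‖pd (1, 0) (fun q : ℝ × ℝ => G (δ, x q.1, q.2 + c)) q‖ =
      |deriv x q.1| * ‖fderiv ℝ G (δ, x q.1, q.2 + c) (0, 1, 0)‖ := by
  rw [hG.pd_eq hx, one_mul, zero_smul, add_zero, norm_smul, Real.norm_eq_abs]

lemma IsTorusFamily.norm_pd_snd (hG : IsTorusFamily T G) {x : ℝ → ℝ} (hx : ContDiff ℝ ∞ x)
    (δ c : ℝ) (q : ℝ × ℝ) : ‖pd (0, 1) (fun q : ℝ × ℝ => G (δ, x q.1, q.2 + c)) q‖ =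
      ‖fderiv ℝ G (δ, x q.1, q.2 + c) (0, 0, 1)‖ := by
  rw [hG.pd_eq hx, zero_mul, zero_smul, one_smul, zero_add]

lemma IsTorusFamily.exists_bound_cyl (hG : IsTorusFamily T G) (hT : 0 < T) :
    ∃ B : ℝ, 0 ≤ B ∧ ∀ δ ∈ Icc (0 : ℝ) 1, ∀ x : ℝ → ℝ, ContDiff ℝ ∞ x →
      ∀ c : ℝ, ∀ q : ℝ × ℝ, ‖G (δ, x q.1, q.2 + c)‖ ≤ B ∧
        ‖pd (1, 0) (fun q : ℝ × ℝ => G (δ, x q.1, q.2 + c)) q‖ ≤ B * |deriv x q.1| ∧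
        ‖pd (0, 1) (fun q : ℝ × ℝ => G (δ, x q.1, q.2 + c)) q‖ ≤ B := by
  obtain ⟨B₀, p₀, h₀⟩ := hG.exists_bound hT
  obtain ⟨B₁, p₁, h₁⟩ := (hG.fderiv_apply (0, 1, 0)).exists_bound hT
  obtain ⟨B₂, p₂, h₂⟩ := (hG.fderiv_apply (0, 0, 1)).exists_bound hT
  refine ⟨B₀ + B₁ + B₂, by positivity, fun δ hδ x hx c q => ⟨?_, ?_, ?_⟩⟩
  · linarith [h₀ δ hδ (x q.1) (q.2 + c)]
  · rw [hG.norm_pd_fst hx, mul_comm]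
    refine mul_le_mul_of_nonneg_right ?_ (abs_nonneg _)
    linarith [h₁ δ hδ (x q.1) (q.2 + c)]
  · rw [hG.norm_pd_snd hx]
    linarith [h₂ δ hδ (x q.1) (q.2 + c)]

lemma IsTorusFamily.exists_isCoeff {G : ℝ × ℝ × ℝ → E4 →L[ℝ] E4} (hG : IsTorusFamily T G)
    (hT : 0 < T) (h0 : ∀ x z, G (0, x, z) = 0) :
    ∃ B : ℝ, 0 ≤ B ∧ ∀ δ ∈ Icc (0 : ℝ) 1, ∀ x : ℝ → ℝ, ContDiff ℝ ∞ x →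
      (∀ s, |deriv x s| ≤ 1) → ∀ c : ℝ,
        IsCoeff T (B * δ) fun q : ℝ × ℝ => G (δ, x q.1, q.2 + c) := by
  have hzero : ∀ u : ℝ × ℝ, ∀ x z, fderiv ℝ G (0, x, z) (0, u) = 0 := fun u x z => by
    have h1 : HasDerivAt (fun r : ℝ => ((0 : ℝ), (x, z) + r • u)) (0, u) 0 := by
      refine (hasDerivAt_const _ _).prodMk ?_
      simpa using ((hasDerivAt_id (0 : ℝ)).smul_const u).const_add (x, z)
    have h2 : HasFDerivAt G (fderiv ℝ G (0, x, z)) ((0 : ℝ), (x, z) + (0 : ℝ) • u) := by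
      rw [zero_smul, add_zero]
      exact (hG.smooth.differentiable (by simp)).differentiableAt.hasFDerivAt
    have h3 := h2.comp_hasDerivAt (0 : ℝ) h1
    have h4 : (G ∘ fun r : ℝ => ((0 : ℝ), (x, z) + r • u)) = fun _ => 0 :=
      funext fun r => h0 _ _
    rw [h4] at h3
    exact h3.unique (hasDerivAt_const _ _)
  obtain ⟨B₀, p₀, h₀⟩ := hG.exists_linear_bound hT h0
  obtain ⟨B₁, p₁, h₁⟩ := (hG.fderiv_apply (0, 1, 0)).exists_linear_bound hT (hzero _)
  obtain ⟨B₂, p₂, h₂⟩ := (hG.fderiv_apply (0, 0, 1)).exists_linear_bound hT (hzero _)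
  refine ⟨B₀ + B₁ + B₂, by positivity, fun δ hδ x hx hx' c => ⟨hG.isCylMap hx δ c, fun q => ?_,
    fun q e he => ?_⟩⟩
  · have := mul_nonneg p₁ hδ.1
    have := mul_nonneg p₂ hδ.1
    linarith [h₀ δ hδ (x q.1) (q.2 + c)]
  · have := mul_nonneg p₁ hδ.1
    have := mul_nonneg p₂ hδ.1
    have := mul_nonneg p₀ hδ.1
    rcases he with rfl | rfl
    · rw [hG.norm_pd_fst hx]
      have := mul_le_of_le_one_left (norm_nonneg (fderiv ℝ G (δ, x q.1, q.2 + c) (0, 1, 0)))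
        (hx' q.1)
      linarith [h₁ δ hδ (x q.1) (q.2 + c)]
    · rw [hG.norm_pd_snd hx]
      linarith [h₂ δ hδ (x q.1) (q.2 + c)]

end Families

/-! ### Gradient trajectories -/

lemma IsMorseOnCircle.deriv_periodic {f : ℝ → ℝ} (hf : IsMorseOnCircle f) (x : ℝ) :
    deriv f (x + 1) = deriv f x := by
  rw [← deriv_comp_add_const]
  exact congrArg (fun f => deriv f x) (funext hf.periodic)

lemma IsMorseOnCircle.contDiff_deriv {f : ℝ → ℝ} (hf : IsMorseOnCircle f) :
    ContDiff ℝ ∞ (deriv f) := (contDiff_infty_iff_deriv.1 hf.smooth).2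

lemma IsMorseOnCircle.deriv_deriv_periodic {f : ℝ → ℝ} (hf : IsMorseOnCircle f) (x : ℝ) :
    deriv (deriv f) (x + 1) = deriv (deriv f) x := by
  rw [← deriv_comp_add_const]
  exact congrArg (fun f => deriv f x) (funext hf.deriv_periodic)

lemma IsMorseOnCircle.exists_bound_deriv {f : ℝ → ℝ} (hf : IsMorseOnCircle f) :
    ∃ B : ℝ, 0 ≤ B ∧ ∀ x, |deriv f x| ≤ B := by
  obtain ⟨B, hB⟩ := (isCompact_Icc : IsCompact (Icc (0 : ℝ) 1)).exists_bound_of_continuousOn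
    hf.contDiff_deriv.continuous.continuousOn
  refine ⟨max B 0, le_max_right _ _, fun x => ?_⟩
  obtain ⟨y, hy, e⟩ := Function.Periodic.exists_mem_Ico₀ (f := deriv f) (c := 1)
    hf.deriv_periodic one_pos x
  rw [e]
  exact (hB y (Ico_subset_Icc_self hy)).trans (le_max_left _ _)

lemma contDiff_of_autonomous {φ x : ℝ → ℝ} (hφ : ContDiff ℝ ∞ φ)
    (hx : ∀ s, HasDerivAt x (φ (x s)) s) : ContDiff ℝ ∞ x := by
  have hd : deriv x = fun s => φ (x s) := funext fun s => (hx s).deriv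
  refine contDiff_infty.2 fun n => ?_
  induction n with
  | zero => exact contDiff_zero.2 (continuous_iff_continuousAt.2 fun s => (hx s).continuousAt)
  | succ n ih =>
    rw [Nat.cast_succ, contDiff_succ_iff_deriv]
    refine ⟨fun s => (hx s).differentiableAt, by simp, ?_⟩
    rw [hd]
    exact (hφ.of_le (by exact_mod_cast le_top)).comp ih

/-! ### Geometric data along gradient cylinders -/

lemma fderiv_translate {F : Type*} [NormedAddCommGroup F] [NormedSpace ℝ F] {Φ : E4 → F}
    {U : Set E4} (hU : IsOpen U) {u q : E4} (h : ∀ q ∈ U, Φ (q + u) = Φ q) (hq : q ∈ U) :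
    fderiv ℝ Φ (q + u) = fderiv ℝ Φ q := by
  rw [← fderiv_comp_add_right]
  refine Filter.EventuallyEq.fderiv_eq ?_
  filter_upwards [hU.mem_nhds hq] with q hq using h q hq

/-- The point of the torus with coordinates `x` and `z`. -/
def torusPt (x z : ℝ) : E4 := z • dirZ + x • dirX

lemma torusPt_three (x z : ℝ) : torusPt x z 3 = 0 := by simp [torusPt]

lemma torusPt_two (x z : ℝ) : torusPt x z 2 = x := by simp [torusPt]

lemma torusPt_add_x (x z : ℝ) : torusPt (x + 1) z = torusPt x z + dirX := by
  simp only [torusPt]; module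

lemma torusPt_add_z (T x z : ℝ) : torusPt x (z + T) = torusPt x z + T • dirZ := by
  simp only [torusPt]; module

lemma contDiff_torusPt : ContDiff ℝ ∞ fun r : ℝ × ℝ × ℝ => torusPt r.2.1 r.2.2 := by
  unfold torusPt
  fun_prop

section Data
variable {T ε δ : ℝ} {h : ℝ × ℝ × ℝ → ℝ} {f : ℝ → ℝ} {J : E4 → E4 →L[ℝ] E4}

lemma contDiff_comp_torusPt {F : Type*} [NormedAddCommGroup F] [NormedSpace ℝ F] {Φ : E4 → F}
    (hε : 0 < ε) (hΦ : ContDiffOn ℝ ∞ Φ (nbhd ε)) :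
    ContDiff ℝ ∞ fun r : ℝ × ℝ × ℝ => Φ (torusPt r.2.1 r.2.2) :=
  hΦ.comp_contDiff contDiff_torusPt fun _ => mem_nbhd hε (torusPt_three _ _)

lemma normalHess_translate {u : E4} (hu : ∀ q, profile h (q + u) = profile h q) (q : E4) :
    normalHess h (q + u) = normalHess h q := by
  have h1 : ∀ q, fderiv ℝ (profile h) (q + u) = fderiv ℝ (profile h) q := fun q =>
    fderiv_translate isOpen_univ (fun q _ => hu q) (mem_univ q)
  rw [normalHess, fderiv_translate isOpen_univ (fun q _ => h1 q) (mem_univ q), normalHess]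

lemma normalHess_add_dirA (a : ℝ) (q : E4) : normalHess h (q + a • dirA) = normalHess h q :=
  normalHess_translate (fun q => by simp [profile]) q

lemma IsMorseBottNormalForm.torusFamily (hh : IsMorseBottNormalForm T ε h) (hε : 0 < ε) :
    IsTorusFamily T fun r : ℝ × ℝ × ℝ => normalHess h (torusPt r.2.1 r.2.2) where
  smooth := by
    have h1 : ContDiffOn ℝ ∞ (fderiv ℝ (fderiv ℝ (profile h))) (nbhd ε) :=
      (hh.contDiffOn_profile.fderiv_of_isOpen (m := ∞) (isOpen_nbhd ε) le_rfl).fderiv_of_isOpen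
        (isOpen_nbhd ε) le_rfl
    exact ((contDiff_comp_torusPt hε h1).clm_apply contDiff_const).clm_apply contDiff_const
  periodic_x δ x z := by
    rw [torusPt_add_x]
    exact normalHess_translate (fun q => by simpa [profile] using hh.periodic_x _ _ _) _
  periodic_z δ x z := by
    rw [torusPt_add_z]
    exact normalHess_translate (fun q => by simpa [profile] using hh.periodic_z _ _ _) _

lemma IsMorseBottNormalForm.integral_ne_zero (hh : IsMorseBottNormalForm T ε h) (hε : 0 < ε)
    (x : ℝ) : ∫ t in (0 : ℝ)..T, normalHess h (torusPt x t) ≠ 0 := by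
  intro h0
  obtain ⟨R, hR, hmb⟩ := hh.morseBott
  have hc : Continuous fun t => normalHess h (torusPt x t) :=
    (hh.torusFamily hε).smooth.continuous.comp (f := fun t : ℝ => ((0 : ℝ), x, t)) (by fun_prop)
  have := hmb x (fun t => (∫ τ in (0 : ℝ)..t, normalHess h (torusPt x τ)) • dirX + dirY)
    (fun t => by simp) (fun t => ?_) (by simp [h0])
  · simp at this
  · have h1 := ((hc.integral_hasStrictDerivAt 0 t).hasDerivAt.smul_const dirX).add_const dirY
    refine h1.congr_deriv ?_
    have := (hh.reeb_torus hε hR (torusPt_three x t)).2.fderiv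
    rw [torusPt] at this
    rw [this]
    simp [torusPt]

lemma IsMorseBottNormalForm.exists_mean_bound (hh : IsMorseBottNormalForm T ε h)
    (hε : 0 < ε) : ∃ κ : ℝ, 0 < κ ∧ ∀ x c : ℝ,
      κ ≤ |∫ t in (0 : ℝ)..T, normalHess h (torusPt x (t + c))| := by
  have hG := hh.torusFamily hε
  have hc : Continuous fun x => |∫ t in (0 : ℝ)..T, normalHess h (torusPt x t)| := by
    refine continuous_abs.comp (intervalIntegral.continuous_parametric_intervalIntegral_of_continuous'
      ?_ 0 T)
    exact hG.smooth.continuous.comp (f := fun r : ℝ × ℝ => ((0 : ℝ), r.1, r.2)) (by fun_prop)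
  obtain ⟨x₀, -, hx₀⟩ := (isCompact_Icc : IsCompact (Icc (0 : ℝ) 1)).exists_isMinOn
    ⟨0, left_mem_Icc.2 zero_le_one⟩ hc.continuousOn
  refine ⟨_, abs_pos.2 (hh.integral_ne_zero hε x₀), fun x c => ?_⟩
  have h1 : ∫ t in (0 : ℝ)..T, normalHess h (torusPt x (t + c)) =
      ∫ t in (0 : ℝ)..T, normalHess h (torusPt x t) := by
    have hp : Function.Periodic (fun t => normalHess h (torusPt x t)) T :=
      fun t => hG.periodic_z 0 x t
    rw [intervalIntegral.integral_comp_add_right (fun t => normalHess h (torusPt x t)), zero_add,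
      add_comm T c]
    simpa using hp.intervalIntegral_add_eq c 0
  rw [h1]
  obtain ⟨y, hy, e⟩ := Function.Periodic.exists_mem_Ico₀
    (f := fun x => |∫ t in (0 : ℝ)..T, normalHess h (torusPt x t)|) (c := 1)
    (fun x => by simp only [fun t => hG.periodic_x 0 x t]) one_pos x
  rw [e]
  exact hx₀ (Ico_subset_Icc_self hy)

lemma isTorusFamily_deviation₁ (hf : IsMorseOnCircle f) :
    IsTorusFamily T fun r : ℝ × ℝ × ℝ => deviation₁ f r.1 r.2.1 where
  smooth := by
    have h1 : ContDiff ℝ ∞ fun r : ℝ × ℝ × ℝ => f r.2.1 := hf.smooth.comp (by fun_prop)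
    have h2 : ContDiff ℝ ∞ fun r : ℝ × ℝ × ℝ => deriv f r.2.1 :=
      hf.contDiff_deriv.comp (by fun_prop)
    unfold deviation₁
    have h3 : ContDiff ℝ ∞ fun r : ℝ × ℝ × ℝ => r.1 * f r.2.1 := contDiff_fst.mul h1
    have h4 : ContDiff ℝ ∞ fun r : ℝ × ℝ × ℝ => r.1 * deriv f r.2.1 := contDiff_fst.mul h2
    refine ContDiff.add (ContDiff.smulRight contDiff_const ?_)
      (ContDiff.smulRight contDiff_const ?_)
    · exact ((h3.neg.exp.sub contDiff_const).smul contDiff_const).sub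
        ((h3.neg.exp.mul h4).smul contDiff_const)
    · exact ((contDiff_const.sub h3.exp).smul contDiff_const).sub (h4.smul contDiff_const)
  periodic_x δ x z := by simp only [deviation₁, hf.periodic, hf.deriv_periodic]
  periodic_z δ x z := rfl

lemma isTorusFamily_deviation₀ (hε : 0 < ε) (hf : IsMorseOnCircle f)
    {α : E4 → E4 →L[ℝ] ℝ} (hJ : IsCompatibleACS T ε α J) :
    IsTorusFamily T fun r : ℝ × ℝ × ℝ => deviation₀ f J r.1 (torusPt r.2.1 r.2.2) where
  smooth := by
    have h1 : ContDiff ℝ ∞ fun r : ℝ × ℝ × ℝ => f r.2.1 := hf.smooth.comp (by fun_prop)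
    have h2 : ContDiff ℝ ∞ fun r : ℝ × ℝ × ℝ => deriv f r.2.1 :=
      hf.contDiff_deriv.comp (by fun_prop)
    have h3 : ContDiff ℝ ∞ fun r : ℝ × ℝ × ℝ => deriv (deriv f) r.2.1 :=
      (contDiff_infty_iff_deriv.1 hf.contDiff_deriv).2.comp (by fun_prop)
    have h4 := contDiff_comp_torusPt hε
      (hJ.smooth.fderiv_of_isOpen (m := ∞) (isOpen_nbhd ε) le_rfl)
    have h5 : ContDiff ℝ ∞ fun r : ℝ × ℝ × ℝ => (fderiv ℝ J (torusPt r.2.1 r.2.2)).flip dirY :=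
      ((ContinuousLinearMap.flipₗᵢ ℝ E4 E4 E4).contDiff.comp h4).clm_apply contDiff_const
    unfold deviation₀
    simp only [torusPt_two]
    have h6 : ContDiff ℝ ∞ fun r : ℝ × ℝ × ℝ => r.1 * f r.2.1 := contDiff_fst.mul h1
    have h7 : ContDiff ℝ ∞ fun r : ℝ × ℝ × ℝ => r.1 * deriv f r.2.1 := contDiff_fst.mul h2
    exact (h7.smul h5).sub (ContDiff.smulRight contDiff_const
      (((h6.exp.mul h7).smul contDiff_const).add ((contDiff_fst.mul h3).smul contDiff_const)))
  periodic_x δ x z := by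
    simp only [deviation₀, torusPt_two, hf.periodic, hf.deriv_periodic, hf.deriv_deriv_periodic]
    rw [torusPt_add_x, fderiv_translate (isOpen_nbhd ε) hJ.periodic_x
      (mem_nbhd hε (torusPt_three x z))]
  periodic_z δ x z := by
    simp only [deviation₀, torusPt_two]
    rw [torusPt_add_z, fderiv_translate (isOpen_nbhd ε) hJ.periodic_z
      (mem_nbhd hε (torusPt_three x z))]

lemma deviation₁_zero (x : ℝ) : deviation₁ f 0 x = 0 := by
  ext w i
  simp [deviation₁]

lemma deviation₀_zero (q : E4) : deviation₀ f J 0 q = 0 := by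
  ext w i
  simp [deviation₀]

lemma deviation₀_add_dirA (hε : 0 < ε) {α : E4 → E4 →L[ℝ] ℝ} (hJ : IsCompatibleACS T ε α J)
    (a : ℝ) {q : E4} (hq : q 3 = 0) : deviation₀ f J δ (q + a • dirA) = deviation₀ f J δ q := by
  rw [deviation₀, fderiv_translate (isOpen_nbhd ε) (fun q hq => hJ.invariant q hq a)
    (mem_nbhd hε hq), deviation₀]
  simp

end Data

/-! ### The linearized operator along a gradient cylinder -/

lemma isFredholm_of_inverse {E F : Type*} [NormedAddCommGroup E] [NormedSpace ℝ E]
    [NormedAddCommGroup F] [NormedSpace ℝ F] {D : E →L[ℝ] F} {Q : F →L[ℝ] E}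
    (h1 : D.comp Q = ContinuousLinearMap.id ℝ _) (h2 : Q.comp D = ContinuousLinearMap.id ℝ _) :
    D.IsFredholm ∧ fredholmIndex D = 0 := by
  have e1 : ∀ f, D (Q f) = f := fun f => congrArg (fun L : F →L[ℝ] F => L f) h1
  have e2 : ∀ x, Q (D x) = x := fun x => congrArg (fun L : E →L[ℝ] E => L x) h2
  constructor
  · have := (LinearEquiv.ofLinearMap D.toLinearMap Q.toLinearMap (LinearMap.ext e1)
      (LinearMap.ext e2)).isQuasiInverse
    exact ContinuousLinearMap.IsFredholm.of_isQuasiInverse (v := Q) this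
  · have hker : D.ker = ⊥ := LinearMap.ker_eq_bot.2 (Function.LeftInverse.injective e2)
    have hrange : D.range = ⊤ := LinearMap.range_eq_top.2 (Function.RightInverse.surjective e1)
    rw [fredholmIndex, hker, hrange, finrank_bot]
    have : Subsingleton (F ⧸ (⊤ : Submodule ℝ F)) :=
      Submodule.Quotient.subsingleton_iff.2 rfl
    rw [Module.finrank_zero_of_subsingleton]
    rfl

section Main
variable {T ε : ℝ} {h : ℝ × ℝ × ℝ → ℝ}

lemma IsMorseBottNormalForm.exists_isModelCoeff (hh : IsMorseBottNormalForm T ε h) (hT : 0 < T)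
    (hε : 0 < ε) : ∃ κ M : ℝ, 0 < κ ∧ 0 ≤ M ∧ ∀ (x : ℝ → ℝ) (c r : ℝ), ContDiff ℝ ∞ x → r ≤ 1 →
      (∀ s, |deriv x s| ≤ r) →
      IsModelCoeff T κ M (M * r) fun q : ℝ × ℝ => normalHess h (torusPt (x q.1) (q.2 + c)) := by
  obtain ⟨κ, hκ, hmean⟩ := hh.exists_mean_bound hε
  have hG := hh.torusFamily hε
  obtain ⟨M, hM, hb⟩ := hG.exists_bound_cyl hT
  refine ⟨κ, M, hκ, hM, fun x c r hx hr hxr => ?_⟩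
  set k : ℝ × ℝ → ℝ := fun q => normalHess h (torusPt (x q.1) (q.2 + c)) with hk
  have hkc : IsCylMap T k := hG.isCylMap hx 0 c
  have hb' : ∀ q : ℝ × ℝ, ‖k q‖ ≤ M ∧ ‖pd (1, 0) k q‖ ≤ M * |deriv x q.1| ∧ ‖pd (0, 1) k q‖ ≤ M :=
    hb 0 (left_mem_Icc.2 zero_le_one) x hx c
  have hm : ∀ s, κ ≤ |∫ t in (0 : ℝ)..T, k (s, t)| := fun s => hmean (x s) c
  clear_value k
  have h1 : ∀ q : ℝ × ℝ, |pd (1, 0) k q| ≤ M * r := fun q =>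
    (hb' q).2.1.trans (mul_le_mul_of_nonneg_left (hxr _) hM)
  refine ⟨hkc, fun q => (hb' q).1, fun q e he => ?_, h1, hm⟩
  rcases he with rfl | rfl
  · exact (h1 q).trans (mul_le_of_le_one_right hM hr)
  · exact (hb' q).2.2

/-- Along the torus, the linearized operator is the model operator up to the deviation terms. -/
lemma linearizedAt_gradientCylinder {f g : ℝ → ℝ} {δ ε' : ℝ} {J Jδ : E4 → E4 →L[ℝ] E4}
    (hf : IsMorseOnCircle f) (hh : IsMorseBottNormalForm T ε h)
    (hε : 0 < ε) (hJ : IsCompatibleACS T ε (contactForm h) J)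
    (hJX : ∀ q : E4, q 3 = 0 → J q dirX = dirY)
    (hJδ : IsCompatibleACS T ε (perturbedForm h f g δ) Jδ)
    (hJJ : ∀ q ∈ nbhd ε, ∀ w, InContactPlane (contactForm h) q w → Jδ q w = J q w)
    (hg : ∀ y, |y| ≤ ε' → g y = 1) (hε' : 0 < ε') {v : ℝ → ℝ → E4} {a x : ℝ → ℝ} {c : ℝ}
    (hv : ∀ s t, v s t = !₂[a s, t + c, x s, 0]) (s t : ℝ) (η ηs ηt : E4) :
    linearizedAt Jδ v s t η ηs ηt =
      ηs + stdJ ηt - normalHess h (torusPt (x s) (t + c)) • projY η +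
        (deviation₁ f δ (x s) ηt + deviation₀ f J δ (torusPt (x s) (t + c)) η) := by
  have hpt : ∀ s t, v s t = torusPt (x s) (t + c) + a s • dirA := fun s t => by
    rw [hv]
    ext i
    fin_cases i <;> simp [torusPt]
  have hder : deriv (fun τ => v s τ) t = dirZ := by
    have : HasDerivAt (fun τ => (τ + c) • dirZ + x s • dirX + a s • dirA) dirZ t := by
      simpa using ((((hasDerivAt_id t).add_const c).smul_const dirZ).add_const (x s • dirX)).add_const
        (a s • dirA)
    rw [show (fun τ => v s τ) = fun τ => (τ + c) • dirZ + x s • dirX + a s • dirA from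
      funext fun τ => hpt s τ]
    exact this.deriv
  have h3 : (torusPt (x s) (t + c) + a s • dirA) 3 = 0 := by simp [torusPt]
  have h2 : (torusPt (x s) (t + c) + a s • dirA) 2 = x s := by simp [torusPt]
  obtain ⟨e1, e2⟩ := hJ.perturbed_torus hf hh hε hJX hJδ hJJ hg hε' h3
  rw [linearizedAt, hder, hpt, e2, e1, h2, normalHess_add_dirA,
    deviation₀_add_dirA hε hJ _ (torusPt_three _ _)]
  change ηs + (stdJ ηt + deviation₁ f δ (x s) ηt) + _ = _
  abel

set_option maxHeartbeats 1000000 in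
theorem exists_linearizedOperator_inverse (hT : 0 < T) (hε : 0 < ε)
    (hh : IsMorseBottNormalForm T ε h) :
    ∃ d₀ : ℝ, 0 < d₀ ∧ ∀ (f g : ℝ → ℝ) (J : E4 → E4 →L[ℝ] E4),
      IsMorseOnCircle f → IsBump ε g →
      IsCompatibleACS T ε (contactForm h) J →
      (∀ q : E4, q 3 = 0 → J q dirX = dirY) →
      ∀ (p : ℝ≥0∞) [Fact (1 ≤ p)], 1 < p → p ≠ ⊤ →
      ∀ d : ℝ, 0 < |d| → |d| < d₀ →
      ∃ δ₀ : ℝ, 0 < δ₀ ∧ ∃ C : ℝ, 0 < C ∧ ∀ δ : ℝ, 0 < δ → δ < δ₀ →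
        ∀ Jδ : E4 → E4 →L[ℝ] E4,
          IsCompatibleACS T ε (perturbedForm h f g δ) Jδ →
          (∀ q ∈ nbhd ε, ∀ w, InContactPlane (contactForm h) q w → Jδ q w = J q w) →
          ∀ v : ℝ → ℝ → E4, IsGradientCylinder f δ v →
            ∃ D : weightedSobolev T 2 p d →L[ℝ] weightedSobolev T 1 p d,
              IsLinearizedOperator Jδ v D ∧
              ∃ Q : weightedSobolev T 1 p d →L[ℝ] weightedSobolev T 2 p d,
                D.comp Q = ContinuousLinearMap.id ℝ _ ∧
                Q.comp D = ContinuousLinearMap.id ℝ _ ∧ ‖Q‖ ≤ C := by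
  obtain ⟨κ, M, hκ, hM, hk⟩ := hh.exists_isModelCoeff hT hε
  set Γ := gapConst T κ M with hΓ
  have hΓ0 := abs_nonneg Γ
  refine ⟨1 / (2 * (|Γ| + 1)), by positivity, fun f g J hf hg hJ hJX p _ hp1 hp d hd0 hd => ?_⟩
  obtain ⟨-, ε', hε', -, hg1, -⟩ := hg
  have hdne : d ≠ 0 := abs_pos.1 hd0
  have hgap : 4 * Γ * d ^ 2 ≤ 1 := by
    rw [lt_div_iff₀ (by positivity)] at hd
    have h1 : (|d| * (2 * (|Γ| + 1))) ^ 2 ≤ 1 := pow_le_one₀ (by positivity) hd.le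
    have h2 : (|d| * (2 * (|Γ| + 1))) ^ 2 = 4 * (|Γ| + 1) ^ 2 * d ^ 2 := by
      rw [mul_pow, sq_abs]; ring
    have h3 : 4 * Γ * d ^ 2 ≤ 4 * (|Γ| + 1) ^ 2 * d ^ 2 := by
      refine mul_le_mul_of_nonneg_right ?_ (sq_nonneg d)
      nlinarith [le_abs_self Γ]
    linarith
  obtain ⟨C, hC, hinv⟩ := exists_modelOp_inverse (M := M) hT hκ hdne hgap hp1 hp
  obtain ⟨K, hK, hop⟩ := exists_firstOrderOp T p d
  obtain ⟨B₁, hB₁, hc₁⟩ := (isTorusFamily_deviation₁ (T := T) hf).exists_isCoeff hT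
    fun _ _ => deviation₁_zero _
  obtain ⟨B₀, hB₀, hc₀⟩ := (isTorusFamily_deviation₀ hε hf hJ).exists_isCoeff hT
    fun _ _ => deviation₀_zero _
  obtain ⟨L, hL, hfL⟩ := hf.exists_bound_deriv
  have hd2 : 0 < d ^ 2 := by positivity
  set S := 1 + L + 4 * (M * L) / d ^ 2 + 2 * (C * (K * (B₁ + B₀))) with hS
  have hS0 : 0 < S := by positivity
  refine ⟨1 / S, by positivity, 2 * C + 1, by positivity, fun δ hδ hδ' Jδ hJδ hJJ v hv => ?_⟩
  obtain ⟨a, x, c, -, -, hx, hv⟩ := hv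
  have hδS : δ * S ≤ 1 := by
    rw [lt_div_iff₀ hS0] at hδ'
    exact hδ'.le
  have n1 : 0 ≤ δ * L := by positivity
  have n2 : 0 ≤ δ * (4 * (M * L) / d ^ 2) := by positivity
  have n3 : 0 ≤ δ * (2 * (C * (K * (B₁ + B₀)))) := by positivity
  have hδS' : δ + δ * L + δ * (4 * (M * L) / d ^ 2) + δ * (2 * (C * (K * (B₁ + B₀)))) ≤ 1 := by
    rw [hS] at hδS
    linarith
  have hδ1 : δ ∈ Icc (0 : ℝ) 1 := ⟨hδ.le, by linarith⟩
  have hxs : ContDiff ℝ ∞ x := contDiff_of_autonomous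
    (φ := fun x => δ * deriv f x) (contDiff_const.mul hf.contDiff_deriv) hx
  have hx' : ∀ s, |deriv x s| ≤ δ * L := fun s => by
    rw [(hx s).deriv, abs_mul, abs_of_pos hδ]
    exact mul_le_mul_of_nonneg_left (hfL _) hδ.le
  have hx1 : ∀ s, |deriv x s| ≤ 1 := fun s => (hx' s).trans (by linarith)
  have hslow : M * (δ * L) ≤ d ^ 2 / 4 := by
    have : δ * (4 * (M * L) / d ^ 2) ≤ 1 := by linarith
    rw [← mul_div_assoc, div_le_one hd2] at this
    linarith
  have hkx := hk x c (δ * L) hxs (by linarith) hx'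
  obtain ⟨D₀, hD₀, Q₀, i1, i2, hQ₀⟩ := hinv _
    ⟨hkx.toIsCylMap, hkx.bound, hkx.bound_pd, fun q => (hkx.slow q).trans hslow, hkx.mean⟩
  obtain ⟨P, hP, hPn⟩ := hop ((B₁ + B₀) * δ) (fun q => deviation₁ f δ (x q.1))
    (fun q => deviation₀ f J δ (torusPt (x q.1) (q.2 + c)))
    ((hc₁ δ hδ1 x hxs hx1 c).mono (mul_le_mul_of_nonneg_right (by linarith) hδ.le))
    ((hc₀ δ hδ1 x hxs hx1 c).mono (mul_le_mul_of_nonneg_right (by linarith) hδ.le))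
  have hsmall : C * ‖P‖ ≤ 1 / 2 := by
    refine (mul_le_mul_of_nonneg_left hPn hC).trans ?_
    linarith
  have : CompleteSpace (weightedSobolev T 2 p d) := completeSpace_sobolev hp
  obtain ⟨Q, j1, j2, hQ⟩ := exists_inverse_add i1 i2 hQ₀ hsmall
  refine ⟨D₀ + P, fun η => ?_, Q, j1, j2, hQ.trans (by linarith)⟩
  have e : sobolevComp (mkIdx 0 0 (by norm_num)) ((D₀ + P) η) =
    sobolevComp (mkIdx 0 0 (by norm_num)) (D₀ η) + sobolevComp (mkIdx 0 0 (by norm_num)) (P η) :=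
    map_add _ _ _
  simp only [partialDeriv_eq]
  rw [e]
  filter_upwards [hD₀ η, hP η, ae_weighted_of (Lp.coeFn_add
    (sobolevComp (mkIdx 0 0 (by norm_num)) (D₀ η))
    (sobolevComp (mkIdx 0 0 (by norm_num)) (P η)))] with q h1 h2 h3
  rw [h3, Pi.add_apply, h1, h2]
  exact (linearizedAt_gradientCylinder hf hh hε hJ hJX hJδ hJJ hg1 hε' hv _ _ _ _ _).symm

end Main

end MorseBottTorus

end

theorem mainTheorem5 (T ε : ℝ) (hT : 0 < T) (hε : 0 < ε) (h : ℝ × ℝ × ℝ → ℝ)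
    (hh : IsMorseBottNormalForm T ε h) :
    ∃ d₀ : ℝ, 0 < d₀ ∧ ∀ (f g : ℝ → ℝ) (J : E4 → E4 →L[ℝ] E4),
      IsMorseOnCircle f → IsBump ε g →
      IsCompatibleACS T ε (contactForm h) J →
      (∀ q : E4, q 3 = 0 → J q dirX = dirY) →
      ∀ (p : ℝ≥0∞) [Fact (1 ≤ p)], 1 < p → p ≠ ⊤ →
      ∀ d : ℝ, 0 < |d| → |d| < d₀ →
      ∃ δ₀ : ℝ, 0 < δ₀ ∧ ∃ C : ℝ, 0 < C ∧ ∀ δ : ℝ, 0 < δ → δ < δ₀ →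
        ∀ Jδ : E4 → E4 →L[ℝ] E4,
          IsCompatibleACS T ε (perturbedForm h f g δ) Jδ →
          (∀ q ∈ nbhd ε, ∀ w, InContactPlane (contactForm h) q w → Jδ q w = J q w) →
          ∀ v : ℝ → ℝ → E4, IsGradientCylinder f δ v →
            ∃ D : weightedSobolev T 2 p d →L[ℝ] weightedSobolev T 1 p d,
              IsLinearizedOperator Jδ v D ∧ D.IsFredholm ∧ fredholmIndex D = 0 ∧
              ∃ Q : weightedSobolev T 1 p d →L[ℝ] weightedSobolev T 2 p d,
                D.comp Q = ContinuousLinearMap.id ℝ _ ∧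
                Q.comp D = ContinuousLinearMap.id ℝ _ ∧ ‖Q‖ ≤ C := by
  obtain ⟨d₀, hd₀, H⟩ := exists_linearizedOperator_inverse hT hε hh
  refine ⟨d₀, hd₀, fun f g J hf hg hJ hJX p _ hp1 hp d hd0 hd => ?_⟩
  obtain ⟨δ₀, hδ₀, C, hC, H'⟩ := H f g J hf hg hJ hJX p hp1 hp d hd0 hd
  refine ⟨δ₀, hδ₀, C, hC, fun δ hδ hδ' Jδ hJδ hJJ v hv => ?_⟩
  obtain ⟨D, hD, Q, h1, h2, hQ⟩ := H' δ hδ hδ' Jδ hJδ hJJ v hv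
  exact ⟨D, hD, (isFredholm_of_inverse h1 h2).1, (isFredholm_of_inverse h1 h2).2, Q, h1, h2, hQ⟩
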